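/- **Setting.** Work on $\mathbb R^2$, with $\widehat g(\xi)=\int_{\mathbb R^2}e^{-ix\cdot\xi}g(x)\,dx$, $\langle y\rangle=(1+|y|^2)^{1/2}$ and $m(D)g=\mathcal F^{-1}(m\,\widehat g)$. Let $n\ge 1000$ be a real number, $k=n/100$, $\delta_0=1/100$. Let $\lambda\in\mathbb R$ and let $\rho\in C_0^\infty(B(0,2))$ be real-valued with $\rho(\xi)=1$ for $|\xi|\le1$. Consider solutions of $$-i\partial_tu+\sqrt{1-\Delta}\,u=\lambda\big(|x|^{-1}*|u|^2\big)u .$$ For $T>0$ put $$\|u\|_{\Sigma_T}=\sup_{t\in[0,T]}\Big[\langle t\rangle^{-\delta_0}\big(\|u(t)\|_{H^n}+\|x\,e^{it\langle D\rangle}u(t)\|_{H^2}\big)+\langle t\rangle^{-2\delta_0}\|(x\otimes x)\,e^{it\langle D\rangle}u(t)\|_{H^2}+\|u(t)\|_S\Big],$$ where $\|g\|_S=\|\langle\xi\rangle^k\widehat g\|_{L^\infty_\xi}$. Say that $u$ satisfies the a priori assumption on $[0,T]$ with size $\varepsilon_1>0$ and constant $A>0$ if $u\in C([0,T],H^n)$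 solves the equation on $[0,T]$ and $\|u\|_{\Sigma_T}\le A\varepsilon_1$. Define the phase correction and the corrected profile $$B(t,\xi)=\frac{\lambda}{(2\pi)^2}\int_0^t\int_{\mathbb R^2}\Big|\frac{\xi}{\langle\xi\rangle}-\frac{\sigma}{\langle\sigma\rangle}\Big|^{-1}|\widehat u(s,\sigma)|^2\,d\sigma\,\frac{\rho(s^{-2/n}\xi)}{\langle s\rangle}\,ds,\qquad \mathsf v(t,\xi)=e^{-iB(t,\xi)}e^{it\langle\xi\rangle}\widehat u(t,\xi).$$ **Proposition 4.1.** For every such $n$ there is $0<\delta\le\frac1{100}$ such that for all $\rho,\lambda$ as above and all $A>0$ there is a constant $C>0$, depending only on $n,\rho,\lambda,A$, with the following properties. (i) For all $T>0$, all $\varepsilon_1>0$ and every $u$ satisfying the a priori assumption on $[0,T]$ with size $\varepsilon_1$ and constant $A$, $$\big\|\langle\xi\rangle^k\big(\mathsf v(t_2,\xi)-\mathsf v(t_1,\xi)\big)\big\|_{L^\infty_\xi}\le C\varepsilon_1^3\langle t_1\rangle^{-\delta}\qquad\text{for all }0\le t_1\le t_2\le T,$$ and the scattering norm stays bounded: $$\|u(t)\|_S\le\|u(0)\|_S+C\varepsilon_1^3\qquad\text{for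 all }t\in[0,T].$$ (ii) If $u$ is defined on $[0,\infty)$ and, for some $\varepsilon_1>0$, satisfies the a priori assumption with size $\varepsilon_1$ and constant $A$ on $[0,T]$ for every $T>0$, then $\mathsf v(t,\cdot)$ is Cauchy as $t\to\infty$ in the norm $\|\langle\xi\rangle^k\,\cdot\,\|_{L^\infty_\xi}$. -/

import Mathlib

open MeasureTheory Filter Topology

open scoped ENNReal FourierTransform ContDiff

noncomputable section

namespace SemiRelHartree

/-- The Euclidean plane. -/
abbrev Plane : Type := EuclideanSpace ℝ (Fin 2)

/-- Complex-valued square integrable functions on the plane. -/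
abbrev L2 : Type := Lp ℂ 2 (volume : Measure Plane)

/-- The Japanese bracket `(1 + r ^ 2) ^ (1 / 2)` of a real number. -/
def bracket (r : ℝ) : ℝ := Real.sqrt (1 + r ^ 2)

/-- The Japanese bracket of a point of the plane. -/
def jb (x : Plane) : ℝ := bracket ‖x‖

/-- The Fourier transform with the normalization `∫ exp (-i x ⬝ ξ) g x dx`, extended to `L²`.
Mathlib's transform uses `exp (-2 π i x ⬝ w)`, hence the evaluation at `ξ / (2 π)`. It is defined
up to a null set, like `g` itself. -/
def hat (g : L2) (ξ : Plane) : ℂ := (𝓕 g : L2) ((2 * Real.pi)⁻¹ • ξ)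

open scoped Classical in
/-- The Fourier multiplier `m(D)`, whose transform is `m ξ * hat g ξ`, on its maximal domain in
`L²` (and `0` off that domain). In Mathlib's frequency variable `w` one has `ξ = 2 π w`. -/
def fourierMul (m : Plane → ℂ) (g : L2) : L2 :=
  if h : MemLp (fun w : Plane => m ((2 * Real.pi) • w) * (𝓕 g : L2) w) 2 volume then
    𝓕⁻ (h.toLp _)
  else 0

/-- The operator `⟨D⟩ = √(1 - Δ)`; its domain is `H¹`. -/
def japD (g : L2) : L2 := fourierMul (fun ξ => (jb ξ : ℂ)) g

/-- The unitary operator `exp (i t ⟨D⟩)`. -/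
def propagator (t : ℝ) (g : L2) : L2 :=
  fourierMul (fun ξ => Complex.exp (Complex.I * t * jb ξ)) g

/-- The norm of the Sobolev space `H ^ s`, that is, the `L²` norm of `⟨D⟩ ^ s g`, computed on the
Fourier side by Plancherel's identity; it is `∞` when `g` is not in `H ^ s`. -/
def sobolevNorm (s : ℝ) (g : L2) : ℝ≥0∞ :=
  ENNReal.ofReal ((2 * Real.pi)⁻¹) *
    eLpNorm (fun ξ : Plane => ((jb ξ ^ s : ℝ) : ℂ) * hat g ξ) 2 volume

open scoped Classical in
/-- The norm in `H ^ s` of the product `w g` for a real weight `w`; it is `∞` when this product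
is not in `L²`. -/
def weightedSobolevNorm (w : Plane → ℝ) (s : ℝ) (g : L2) : ℝ≥0∞ :=
  if h : MemLp (fun x : Plane => (w x : ℂ) * g x) 2 volume then sobolevNorm s (h.toLp _) else ⊤

/-- The norm in `H ^ s` of the vector-valued function `x g`. -/
def firstMomentNorm (s : ℝ) (g : L2) : ℝ≥0∞ :=
  (∑ i : Fin 2, weightedSobolevNorm (fun x => x i) s g ^ 2) ^ (1 / 2 : ℝ)

/-- The norm in `H ^ s` of the matrix-valued function `(x ⊗ x) g`. -/
def secondMomentNorm (s : ℝ) (g : L2) : ℝ≥0∞ :=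
  (∑ i : Fin 2, ∑ j : Fin 2, weightedSobolevNorm (fun x => x i * x j) s g ^ 2) ^ (1 / 2 : ℝ)

/-- The norm `E₁` at time `t`. -/
def normE1 (n t : ℝ) (g : L2) : ℝ≥0∞ := sobolevNorm n g + firstMomentNorm 2 (propagator t g)

/-- The norm `E₂` at time `t`. -/
def normE2 (t : ℝ) (g : L2) : ℝ≥0∞ := secondMomentNorm 2 (propagator t g)

/-- The weighted sup norm (essential supremum) of `⟨ξ⟩ ^ k F`. -/
def weightedSup (k : ℝ) (F : Plane → ℂ) : ℝ≥0∞ :=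
  eLpNorm (fun ξ : Plane => ((jb ξ ^ k : ℝ) : ℂ) * F ξ) ⊤ volume

/-- The scattering norm, the weighted sup norm of the Fourier transform. -/
def normS (k : ℝ) (g : L2) : ℝ≥0∞ := weightedSup k (hat g)

/-- The norm `Σ_T` for regularity index `n`, weight index `n / 100` and growth exponent
`1 / 100`. -/
def normSigma (n T : ℝ) (u : ℝ → L2) : ℝ≥0∞ :=
  ⨆ t ∈ Set.Icc (0 : ℝ) T,
    (ENNReal.ofReal (bracket t ^ (-(1 / 100) : ℝ)) * normE1 n t (u t) +
      ENNReal.ofReal (bracket t ^ (-(2 * (1 / 100)) : ℝ)) * normE2 t (u t) +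
      normS (n / 100) (u t))

/-- The Hartree potential `|x|⁻¹ * |g|²` (a convolution). -/
def hartreePotential (g : L2) (x : Plane) : ℝ := ∫ y : Plane, ‖x - y‖⁻¹ * ‖g y‖ ^ 2

open scoped Classical in
/-- The nonlinearity `(|x|⁻¹ * |g|²) g`, as an element of `L²` (and `0` if it is not in `L²`,
which does not happen for `g` in `H²`). -/
def hartree (g : L2) : L2 :=
  if h : MemLp (fun x : Plane => (hartreePotential g x : ℂ) * g x) 2 volume then h.toLp _ else 0

/-- `u ∈ C([0, T], H ^ n)`. -/
def ContinuousInSobolev (n T : ℝ) (u : ℝ → L2) : Prop :=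
  (∀ t ∈ Set.Icc (0 : ℝ) T, sobolevNorm n (u t) < ⊤) ∧
    ∀ t ∈ Set.Icc (0 : ℝ) T,
      Tendsto (fun s => sobolevNorm n (u s - u t)) (𝓝[Set.Icc 0 T] t) (𝓝 0)

/-- `u` solves `-i ∂ₜ u + ⟨D⟩ u = lam (|x|⁻¹ * |u|²) u` on `[0, T]`, the time derivative being
taken in `L²` (one-sided at the end points). -/
def SolvesHartree (lam T : ℝ) (u : ℝ → L2) : Prop :=
  ∀ t ∈ Set.Icc (0 : ℝ) T, ∃ u' : L2, HasDerivWithinAt u u' (Set.Icc 0 T) t ∧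
    -(Complex.I • u') + japD (u t) = (lam : ℂ) • hartree (u t)

/-- A solution `u ∈ C([0, T], H ^ n)` obeying the a priori bound `‖u‖_{Σ_T} ≤ A ε`. -/
structure APriori (n lam A ε T : ℝ) (u : ℝ → L2) : Prop where
  continuous : ContinuousInSobolev n T u
  solves : SolvesHartree lam T u
  bound : normSigma n T u ≤ ENNReal.ofReal (A * ε)

/-- A bump function: smooth, supported in `B(0, 2)`, equal to `1` on the closed unit disc. -/
structure IsBump (ρ : Plane → ℝ) : Prop where
  smooth : ContDiff ℝ ∞ ρ
  support : tsupport ρ ⊆ Metric.ball 0 2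
  eq_one : ∀ ξ : Plane, ‖ξ‖ ≤ 1 → ρ ξ = 1

/-- The phase correction `B(t, ξ)`. -/
def phase (n lam : ℝ) (ρ : Plane → ℝ) (u : ℝ → L2) (t : ℝ) (ξ : Plane) : ℝ :=
  lam / (2 * Real.pi) ^ 2 *
    ∫ s in (0 : ℝ)..t,
      (∫ σ : Plane, ‖(jb ξ)⁻¹ • ξ - (jb σ)⁻¹ • σ‖⁻¹ * ‖hat (u s) σ‖ ^ 2) *
        (ρ (s ^ (-(2 / n)) • ξ) / bracket s)

/-- The corrected profile `exp (-i B(t, ξ)) exp (i t ⟨ξ⟩) û(t, ξ)`. -/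
def profile (n lam : ℝ) (ρ : Plane → ℝ) (u : ℝ → L2) (t : ℝ) (ξ : Plane) : ℂ :=
  Complex.exp (-(Complex.I * phase n lam ρ u t ξ)) * Complex.exp (Complex.I * t * jb ξ) *
    hat (u t) ξ

end SemiRelHartree

end

namespace SemiRelHartree

/-! ### Japanese brackets -/

/-! Put F(t,ξ) = e^{it⟨ξ⟩} û(t,ξ). The equation reads ∂ₜF = iλ e^{it⟨ξ⟩} N̂, where N is the Hartree
term. Up to an error integrable in time in the weighted sup norm, e^{it⟨ξ⟩} N̂ is a real multiple of
F, of size 1/t, and that multiple is λ⁻¹ ∂ₜB. Multiplication by e^{-iB} removes it, so the corrected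
profile has time derivative O(ε₁³ (1+t)^{-101/100} ⟨ξ⟩^{-k}), and integration in time gives the rate
with δ = 1/100.

Leading term. The Coulomb kernel is a superposition of Gaussians, 1/r = π^{-1/2} ∫ τ^{-1/2} e^{-τr²}
dτ (`subordination`). On the Fourier side (`hat_hartree`) the Gaussian of parameter τ averages
û(ξ-η) times the transform `corr` of |u|² against a density `gam τ` of width √τ in the momentum
transfer η. For small η the phases t(⟨ξ⟩-⟨ξ-η⟩) and t(⟨σ+η⟩-⟨σ⟩) are close to tη·v(ξ) and tη·v(σ),
with v = ξ/⟨ξ⟩ the group velocity. The Gaussian average then equals e^{-τt²|v(ξ)-v(σ)|²}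
(`quad_eq`), and integrating in τ rebuilds t⁻¹|v(ξ)-v(σ)|⁻¹ (`coul_subordination`).

Errors. The scales are split at τ = t^{-8/5}. Below it, Taylor expansion of the bracket and Hölder
continuity of F control the freezing of phases and profiles (`freeze`, `defect_small`). Above it,
the nonlinearity and its model are small separately (`defect_large`). For the nonlinearity this is
non-stationary phase: the bracket is strictly convex, so two integrations by parts in the direction
of η give `corr` decay (t|η|)^{-2} up to small powers of t (`corr_decay`). Frequencies above
t^{2/n}, where convexity degenerates and the weight is costly, are handled by the H^n bound, through
the pointwise decay ⟨ξ⟩^{-n/3} of F (`pointwise`). The total error is t^{-105/100} (`leading`);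
`resonance` then replaces 1/t by the truncated factor ρ/⟨t⟩ and includes small times.

Regularity of F. The second moment of e^{it⟨D⟩}u makes F Hölder continuous and an L² limit of
Schwartz functions with two derivatives bounded in L², with slowly growing norms (`APriori.prof`).

From L² to sup norms. The equation holds only in L², so the corrected profile is paired with bounded
test functions of bounded support, the pairing is differentiated in time (`exists_deriv_weak`), and
duality returns an almost everywhere bound (`ae_norm_le_of_dual`). The scattering norm is controlled
because the corrected profile and û have equal modulus, and the Cauchy property because the rate
tends to zero. -/

lemma bracket_sq (r : ℝ) : bracket r ^ 2 = 1 + r ^ 2 := Real.sq_sqrt (by positivity)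

lemma one_le_bracket (r : ℝ) : 1 ≤ bracket r := by
  unfold bracket; rw [Real.one_le_sqrt]; nlinarith [sq_nonneg r]

lemma bracket_pos (r : ℝ) : 0 < bracket r := lt_of_lt_of_le one_pos (one_le_bracket r)

lemma bracket_le_one_add {r : ℝ} (hr : 0 ≤ r) : bracket r ≤ 1 + r := by
  unfold bracket; exact Real.sqrt_le_iff.2 ⟨by positivity, by nlinarith⟩

lemma le_bracket (r : ℝ) : r ≤ bracket r := by
  unfold bracket; exact Real.le_sqrt_of_sq_le (by linarith)

lemma continuous_bracket : Continuous bracket := by unfold bracket; fun_prop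

lemma one_le_jb (x : Plane) : 1 ≤ jb x := one_le_bracket _

lemma jb_pos (x : Plane) : 0 < jb x := bracket_pos _

lemma jb_ne (x : Plane) : jb x ≠ 0 := (jb_pos x).ne'

lemma jb_sq (x : Plane) : jb x ^ 2 = 1 + ‖x‖ ^ 2 := bracket_sq _

lemma norm_le_jb (x : Plane) : ‖x‖ ≤ jb x := le_bracket _

lemma jb_le_one_add (x : Plane) : jb x ≤ 1 + ‖x‖ := bracket_le_one_add (norm_nonneg _)

lemma continuous_jb : Continuous jb := by
  unfold jb; exact continuous_bracket.comp continuous_norm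

lemma jb_sub_comm (x y : Plane) : jb (x - y) = jb (y - x) := by simp [jb, norm_sub_rev]

/-- Peetre-type inequality. It lets a weight in ξ be shared between the factors of a convolution. -/
lemma jb_add_le (x y : Plane) : jb (x + y) ≤ 2 * jb x * jb y := by
  have h : ‖x + y‖ ≤ ‖x‖ + ‖y‖ := norm_add_le x y
  have h0 := norm_nonneg (x + y)
  have hx := jb_sq x
  have hy := jb_sq y
  have hp := mul_pos (jb_pos x) (jb_pos y)
  refine le_of_sq_le_sq ?_ (by nlinarith) |>.trans_eq rfl
  have : (2 * jb x * jb y) ^ 2 = 4 * (1 + ‖x‖ ^ 2) * (1 + ‖y‖ ^ 2) := by rw [← hx, ← hy]; ring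
  rw [this, jb_sq]
  have : ‖x + y‖ ^ 2 ≤ (‖x‖ + ‖y‖) ^ 2 := pow_le_pow_left₀ h0 h 2
  nlinarith [sq_nonneg (‖x‖ - ‖y‖), mul_nonneg (sq_nonneg ‖x‖) (sq_nonneg ‖y‖)]

lemma jb_le_mul_sub (x y : Plane) : jb x ≤ 2 * jb y * jb (x - y) := by
  have := jb_add_le y (x - y); simpa using this

lemma jb_rpow_le {s : ℝ} (hs : 0 ≤ s) (x y : Plane) :
    jb x ^ s ≤ 2 ^ s * jb y ^ s * jb (x - y) ^ s := by
  have h2 := Real.rpow_le_rpow (jb_pos x).le (jb_le_mul_sub x y) hs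
  rwa [Real.mul_rpow (by have := jb_pos y; positivity) (jb_pos _).le,
    Real.mul_rpow zero_le_two (jb_pos _).le] at h2

lemma jb_rpow_le' {s : ℝ} (hs : 0 ≤ s) (x y : Plane) :
    jb y ^ s ≤ 2 ^ s * jb (x + y) ^ s * jb x ^ s := by
  have := jb_rpow_le hs y (x + y)
  rwa [jb_sub_comm, add_sub_cancel_right] at this

lemma one_le_jb_rpow {s : ℝ} (hs : 0 ≤ s) (x : Plane) : 1 ≤ jb x ^ s :=
  Real.one_le_rpow (one_le_jb x) hs

lemma jb_rpow_le_one {s : ℝ} (hs : s ≤ 0) (x : Plane) : jb x ^ s ≤ 1 :=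
  Real.rpow_le_one_of_one_le_of_nonpos (one_le_jb x) hs

lemma jb_rpow_pos (s : ℝ) (x : Plane) : 0 < jb x ^ s := Real.rpow_pos_of_pos (jb_pos x) _

lemma continuous_jb_rpow (s : ℝ) : Continuous (fun x => jb x ^ s) :=
  continuous_jb.rpow_const fun x => Or.inl (jb_ne x)

lemma jb_rpow_mono {s r : ℝ} (h : s ≤ r) (x : Plane) : jb x ^ s ≤ jb x ^ r :=
  Real.rpow_le_rpow_of_exponent_le (one_le_jb x) h

lemma integrable_jb_rpow {s : ℝ} (hs : s < -2) : Integrable (fun x : Plane => jb x ^ s) := by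
  have := integrable_rpow_neg_one_add_norm_sq (E := Plane) (μ := volume) (r := -s)
    (by simp; linarith)
  refine this.congr (ae_of_all _ fun x => ?_)
  simp only [jb, bracket]
  rw [Real.sqrt_eq_rpow, ← Real.rpow_mul (by positivity)]
  congr 1; ring

/-- The integral of `⟨x⟩ ^ (-3)`. -/
noncomputable def jbMass : ℝ := ∫ x : Plane, jb x ^ (-3 : ℝ)

lemma jbMass_nonneg : 0 ≤ jbMass := integral_nonneg fun x => (jb_rpow_pos _ x).le

lemma integrable_jb3 : Integrable (fun x : Plane => jb x ^ (-3 : ℝ)) :=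
  integrable_jb_rpow (by norm_num)

/-! ### The Gaussian kernel -/

/-- The probability density whose characteristic function is `exp (-τ |x|²)`. -/
noncomputable def gam (τ : ℝ) (η : Plane) : ℝ := (4 * Real.pi * τ)⁻¹ * Real.exp (-(4 * τ)⁻¹ * ‖η‖ ^ 2)

lemma gam_nonneg {τ : ℝ} (hτ : 0 < τ) (η : Plane) : 0 ≤ gam τ η := by
  unfold gam; positivity

lemma continuous_gam (τ : ℝ) : Continuous (gam τ) := by unfold gam; fun_prop

lemma measurable_gam : Measurable (fun p : ℝ × Plane => gam p.1 p.2) := by unfold gam; fun_prop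

lemma norm_addHaar_plane {f : ℝ → ℝ} :
    Integrable (fun x : Plane => f ‖x‖) ↔ IntegrableOn (fun y : ℝ => y * f y) (Set.Ioi 0) := by
  rw [integrable_fun_norm_addHaar]; simp

/-- In polar coordinates the power becomes r^{p+1}, integrable at the origin exactly when p > -2.
The exponent -7/4 used later lies inside this range. -/
lemma integrable_gam_one_rpow {p : ℝ} (hp : -2 < p) :
    Integrable (fun η : Plane => gam 1 η * ‖η‖ ^ p) := by
  have := (norm_addHaar_plane (f := fun r => (4 * Real.pi * 1)⁻¹ *
    Real.exp (-(4 * 1)⁻¹ * r ^ 2) * r ^ p)).2 ?_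
  · exact this
  have h := (integrableOn_rpow_mul_exp_neg_mul_sq (b := (4 * 1 : ℝ)⁻¹) (by norm_num)
    (s := p + 1) (by linarith)).const_mul (4 * Real.pi * 1)⁻¹
  refine IntegrableOn.congr_fun (f := fun x : ℝ => (4 * Real.pi * 1)⁻¹ *
    (x ^ (p + 1) * Real.exp (-(4 * 1)⁻¹ * x ^ 2))) h (fun y hy => ?_) measurableSet_Ioi
  have hy : (0 : ℝ) < y := hy
  simp only
  rw [Real.rpow_add hy, Real.rpow_one]; ring

/-- Moments of the standard Gaussian kernel. -/
noncomputable def gamMoment (p : ℝ) : ℝ := ∫ η : Plane, gam 1 η * ‖η‖ ^ p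

lemma gamMoment_nonneg (p : ℝ) : 0 ≤ gamMoment p :=
  integral_nonneg fun η => mul_nonneg (gam_nonneg one_pos η) (by positivity)

/-- Self-similarity reduces every moment to τ = 1; the moment of order p then scales as τ^{p/2}. -/
lemma gam_scale {τ : ℝ} (hτ : 0 < τ) (η : Plane) :
    gam τ (√τ • η) = τ⁻¹ * gam 1 η := by
  unfold gam
  rw [norm_smul, mul_pow, Real.norm_eq_abs, sq_abs, Real.sq_sqrt hτ.le]
  rw [show -(4 * τ)⁻¹ * (τ * ‖η‖ ^ 2) = -(4 * 1)⁻¹ * ‖η‖ ^ 2 by field_simp]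
  field_simp

lemma integrable_gam_rpow {τ p : ℝ} (hτ : 0 < τ) (hp : -2 < p) :
    Integrable (fun η : Plane => gam τ η * ‖η‖ ^ p) := by
  rw [← integrable_comp_smul_iff volume _ (Real.sqrt_pos.2 hτ).ne']
  have := (integrable_gam_one_rpow hp).const_mul (τ⁻¹ * √τ ^ p)
  refine this.congr (ae_of_all _ fun η => ?_)
  simp only
  rw [gam_scale hτ, norm_smul, Real.norm_eq_abs, abs_of_nonneg (Real.sqrt_nonneg _),
    Real.mul_rpow (Real.sqrt_nonneg _) (norm_nonneg _)]
  ring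

lemma integral_gam_rpow {τ p : ℝ} (hτ : 0 < τ) :
    ∫ η : Plane, gam τ η * ‖η‖ ^ p = gamMoment p * τ ^ (p / 2) := by
  have h := Measure.integral_comp_smul (volume : Measure Plane)
    (fun η : Plane => gam τ η * ‖η‖ ^ p) (√τ)
  have h2 : ∫ η : Plane, gam τ (√τ • η) * ‖√τ • η‖ ^ p = τ⁻¹ * √τ ^ p * gamMoment p := by
    rw [gamMoment, ← integral_const_mul]
    congr 1 with η
    rw [gam_scale hτ, norm_smul, Real.norm_eq_abs, abs_of_nonneg (Real.sqrt_nonneg _),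
      Real.mul_rpow (Real.sqrt_nonneg _) (norm_nonneg _)]
    ring
  rw [h2] at h
  simp only [finrank_euclideanSpace, Fintype.card_fin, Real.sq_sqrt hτ.le, abs_inv, abs_of_pos hτ,
    smul_eq_mul] at h
  have h3 := mul_left_cancel₀ (inv_ne_zero hτ.ne') ((mul_assoc _ _ _).symm.trans h)
  rw [← h3, Real.sqrt_eq_rpow, ← Real.rpow_mul hτ.le, mul_comm]
  congr 2; ring

lemma integrable_gam {τ : ℝ} (hτ : 0 < τ) : Integrable (gam τ) := by
  have := integrable_gam_rpow hτ (p := 0) (by norm_num)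
  simpa using this

lemma integral_gam {τ : ℝ} (hτ : 0 < τ) : ∫ η : Plane, gam τ η = 1 := by
  unfold gam
  rw [integral_const_mul]
  have := GaussianFourier.integral_rexp_neg_mul_sq_norm (V := Plane) (b := (4 * τ)⁻¹)
    (by positivity)
  rw [this]
  simp
  field_simp

/-- Once the phases are linear in η, this turns the average over η into a Gaussian in the difference
of velocities. -/
lemma integral_gam_cexp {τ : ℝ} (hτ : 0 < τ) (x : Plane) :
    ∫ η : Plane, (gam τ η : ℂ) * Complex.exp (Complex.I * inner ℝ η x) =
      Real.exp (-τ * ‖x‖ ^ 2) := by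
  have h := GaussianFourier.integral_cexp_neg_mul_sq_norm_add (V := Plane) (b := ((4 * τ)⁻¹ : ℝ))
    (by rw [Complex.ofReal_re]; positivity) Complex.I x
  have e : ∀ η : Plane, (gam τ η : ℂ) * Complex.exp (Complex.I * inner ℝ η x) =
      ((4 * Real.pi * τ)⁻¹ : ℝ) *
      Complex.exp (-((4 * τ)⁻¹ : ℝ) * ‖η‖ ^ 2 + Complex.I * inner ℝ x η) := by
    intro η
    rw [Complex.exp_add, gam, real_inner_comm]
    push_cast; ring
  simp_rw [e]
  rw [integral_const_mul, h]
  simp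
  have hτ' : (τ : ℂ) ≠ 0 := by exact_mod_cast hτ.ne'
  have hpi : (Real.pi : ℂ) ≠ 0 := by exact_mod_cast Real.pi_ne_zero
  field_simp

lemma integral_gauss_cexp {τ : ℝ} (hτ : 0 < τ) (x η : Plane) :
    ∫ y : Plane, (Real.exp (-τ * ‖x - y‖ ^ 2) : ℂ) * Complex.exp (Complex.I * inner ℝ η y) =
      (2 * Real.pi) ^ 2 * gam τ η * Complex.exp (Complex.I * inner ℝ η x) := by
  have h := GaussianFourier.integral_cexp_neg_mul_sq_norm_add (V := Plane) (b := (τ : ℂ))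
    (by simpa using hτ) (-Complex.I) η
  have e : ∀ z : Plane, (Real.exp (-τ * ‖x - (x - z)‖ ^ 2) : ℂ) *
      Complex.exp (Complex.I * inner ℝ η (x - z)) = Complex.exp (Complex.I * inner ℝ η x) *
      Complex.exp (-τ * ‖z‖ ^ 2 + -Complex.I * inner ℝ η z) := by
    intro z
    rw [Complex.exp_add, inner_sub_right, sub_sub_cancel]
    push_cast
    rw [mul_sub, sub_eq_add_neg, Complex.exp_add, neg_mul Complex.I]
    ring
  rw [← integral_sub_left_eq_self _ volume x]
  simp_rw [e]
  rw [integral_const_mul, h]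
  simp [gam]
  have hτ' : (τ : ℂ) ≠ 0 := by exact_mod_cast hτ.ne'
  have hpi : (Real.pi : ℂ) ≠ 0 := by exact_mod_cast Real.pi_ne_zero
  rw [show -((τ : ℂ)⁻¹ * 4⁻¹ * ‖η‖ ^ 2) = -‖η‖ ^ 2 / (4 * τ) by field_simp]
  field_simp
  norm_num

/-- The value Γ(1/2) = √π. This is the identity behind the decomposition of the Coulomb kernel into
Gaussians. -/
lemma integral_rpow_exp {r : ℝ} (hr : 0 < r) :
    ∫ τ in Set.Ioi (0 : ℝ), τ ^ (-(1 / 2) : ℝ) * Real.exp (-τ * r ^ 2) = √Real.pi * r⁻¹ := by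
  have := Real.integral_rpow_mul_exp_neg_mul_Ioi (a := 1 / 2) (r := r ^ 2) (by norm_num)
    (by positivity)
  rw [Real.Gamma_one_half_eq] at this
  rw [← Real.sqrt_eq_rpow, Real.sqrt_div zero_le_one, Real.sqrt_sq hr.le, Real.sqrt_one,
    one_div r] at this
  rw [mul_comm, ← this]
  refine setIntegral_congr_fun measurableSet_Ioi fun τ _ => ?_
  norm_num
  left; ring

lemma integrableOn_rpow_exp {r : ℝ} (hr : 0 < r) :
    IntegrableOn (fun τ : ℝ => τ ^ (-(1 / 2) : ℝ) * Real.exp (-τ * r ^ 2)) (Set.Ioi 0) := by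
  have := integrableOn_rpow_mul_exp_neg_mul_rpow (s := -(1 / 2)) (p := 1) (b := r ^ 2)
    (by norm_num) one_pos (by positivity)
  refine this.congr_fun (fun τ _ => ?_) measurableSet_Ioi
  simp only [Real.rpow_one]
  rw [neg_mul, neg_mul, mul_comm τ]

/-! ### Agreement of the transform on `L²` with absolutely convergent integrals. -/

open scoped SchwartzMap LineDeriv

lemma continuous_innerL : Continuous fun p : Plane × Plane => (innerₗ Plane p.1) p.2 := by
  simpa using (continuous_inner (𝕜 := ℝ) (E := Plane))

/-- The transform on `L²` is compared with the integral through tempered distributions: tested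
against a smooth compactly supported `g`, both give the integral of `𝓕 g` times `f`. -/
lemma fourier_ae_eq (f : L2) (hf : Integrable f) :
    ((𝓕 f : L2) : Plane → ℂ) =ᵐ[volume] 𝓕 (f : Plane → ℂ) := by
  refine ae_eq_of_integral_contDiff_smul_eq ((Lp.memLp (𝓕 f : L2)).locallyIntegrable (by norm_num))
    ?_ fun g hg hgs => ?_
  · refine Continuous.locallyIntegrable ?_
    exact VectorFourier.fourierIntegral_continuous Real.continuous_fourierChar continuous_innerL hf
  · set G : 𝓢(Plane, ℂ) := HasCompactSupport.toSchwartzMap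
      (f := fun x => (g x : ℂ)) (by exact hgs.comp_left (g := fun r : ℝ => (r : ℂ)) (by simp))
      (Complex.ofRealCLM.contDiff.comp hg) with hG
    have hGx : ∀ x, G x = (g x : ℂ) := fun x => rfl
    have h1 := Lp.toTemperedDistribution_apply (𝓕 f : L2) G
    rw [← Lp.fourier_toTemperedDistribution_eq, TemperedDistribution.fourier_apply,
      Lp.toTemperedDistribution_apply] at h1
    have h2 := VectorFourier.integral_fourierIntegral_smul_eq_flip (L := innerₗ Plane) (μ := volume)
      (ν := volume)
      Real.continuous_fourierChar continuous_innerL G.integrable hf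
    simp only [flip_innerₗ] at h2
    have e : ∀ h : Plane → ℂ, ∫ x, g x • h x = ∫ x, G x • h x := by
      intro h; simp [hGx]
    rw [e, e, ← h1]
    exact h2

lemma fourierInv_ae_eq (f : L2) (hf : Integrable f) :
    ((𝓕⁻ f : L2) : Plane → ℂ) =ᵐ[volume] 𝓕⁻ (f : Plane → ℂ) := by
  refine ae_eq_of_integral_contDiff_smul_eq
    ((Lp.memLp (𝓕⁻ f : L2)).locallyIntegrable (by norm_num)) ?_ fun g hg hgs => ?_
  · refine Continuous.locallyIntegrable ?_
    have : 𝓕⁻ (f : Plane → ℂ) = fun x => 𝓕 (f : Plane → ℂ) (-x) := by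
      ext x; rw [Real.fourierInv_eq_fourier_neg]
    rw [this]
    exact (VectorFourier.fourierIntegral_continuous Real.continuous_fourierChar
      (L := innerₗ Plane) continuous_innerL hf).comp continuous_neg
  · set G : 𝓢(Plane, ℂ) := HasCompactSupport.toSchwartzMap
      (f := fun x => (g x : ℂ)) (by exact hgs.comp_left (g := fun r : ℝ => (r : ℂ)) (by simp))
      (Complex.ofRealCLM.contDiff.comp hg) with hG
    have hGx : ∀ x, G x = (g x : ℂ) := fun x => rfl
    have h1 := Lp.toTemperedDistribution_apply (𝓕⁻ f : L2) G
    rw [← Lp.fourierInv_toTemperedDistribution_eq, TemperedDistribution.fourierInv_apply,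
      Lp.toTemperedDistribution_apply] at h1
    have h2 := VectorFourier.integral_fourierIntegral_smul_eq_flip (L := innerₗ Plane) (μ := volume)
      (ν := volume)
      Real.continuous_fourierChar continuous_innerL G.integrable.comp_neg hf
    simp only [flip_innerₗ] at h2
    have e : ∀ h : Plane → ℂ, ∫ x, g x • h x = ∫ x, G x • h x := by
      intro h; simp [hGx]
    -- Reflecting the variable turns `𝓕⁻` into `𝓕`, so the self-adjointness of `𝓕` applies to the
    -- reflected test function.
    rw [e, e, ← h1, ← integral_neg_eq_self (fun x => G x • 𝓕⁻ (f : Plane → ℂ) x)]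
    have e3 : ∀ x, 𝓕⁻ (f : Plane → ℂ) (-x) = 𝓕 (f : Plane → ℂ) x := by
      intro x; rw [Real.fourierInv_eq_fourier_neg, neg_neg]
    simp_rw [e3]
    refine Eq.trans ?_ h2
    congr 1 with x
    congr 1
    rw [SchwartzMap.fourierInv_coe, Real.fourierInv_eq_fourier_comp_neg]
    rfl

/-- Dilations preserve null sets. This is needed because `hat` evaluates an almost everywhere class
at `ξ / (2 π)`. -/
lemma ae_comp_smul {c : ℝ} (hc : c ≠ 0) {p : Plane → Prop} (h : ∀ᵐ x : Plane, p x) :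
    ∀ᵐ x : Plane, p (c • x) := by
  have hq : Measure.QuasiMeasurePreserving (fun x : Plane => c • x) volume volume := by
    refine ⟨measurable_const_smul c, ?_⟩
    rw [Measure.map_addHaar_smul volume hc]
    exact Measure.smul_absolutelyContinuous
  exact hq.ae h

/-- The inverse Fourier transform in the normalization of `hat`. -/
noncomputable def ift (U : Plane → ℂ) (x : Plane) : ℂ :=
  ((2 * Real.pi) ^ 2 : ℂ)⁻¹ * ∫ ξ : Plane, Complex.exp (Complex.I * inner ℝ ξ x) * U ξ

lemma two_pi_ne : (2 * Real.pi) ≠ 0 := by positivity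

lemma fourierInv_comp_smul (U : Plane → ℂ) (x : Plane) :
    𝓕⁻ (fun w : Plane => U ((2 * Real.pi) • w)) x = ift U x := by
  rw [Real.fourierInv_eq']
  have h := Measure.integral_comp_smul (volume : Measure Plane)
    (fun ξ : Plane => Complex.exp (Complex.I * inner ℝ ξ x) * U ξ) (2 * Real.pi)
  rw [ift]
  simp only [finrank_euclideanSpace, Fintype.card_fin] at h
  rw [abs_of_pos (by positivity)] at h
  rw [show ((2 * Real.pi) ^ 2 : ℂ)⁻¹ = (((2 * Real.pi) ^ 2)⁻¹ : ℝ) by push_cast; rfl,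
    ← Complex.real_smul, ← h]
  congr 1 with w
  rw [real_inner_smul_left, smul_eq_mul, mul_comm Complex.I]

lemma hat_ae {g : L2} {U : Plane → ℂ} (h : hat g =ᵐ[volume] U) :
    ((𝓕 g : L2) : Plane → ℂ) =ᵐ[volume] fun w => U ((2 * Real.pi) • w) := by
  filter_upwards [ae_comp_smul two_pi_ne h] with w hw
  rw [← hw, hat, inv_smul_smul₀ two_pi_ne]

lemma integrable_comp_two_pi {U : Plane → ℂ} (hU : Integrable U) :
    Integrable (fun w : Plane => U ((2 * Real.pi) • w)) :=
  (integrable_comp_smul_iff volume U two_pi_ne).2 hU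

lemma eq_ift_of_hat {g : L2} {U : Plane → ℂ} (hU : Integrable U) (h : hat g =ᵐ[volume] U) :
    (g : Plane → ℂ) =ᵐ[volume] ift U := by
  have h1 := hat_ae h
  have h2 := fourierInv_ae_eq (𝓕 g) ((integrable_comp_two_pi hU).congr h1.symm)
  rw [FourierTransform.fourierInv_fourier_eq] at h2
  refine h2.trans (ae_of_all _ fun x => ?_)
  rw [← fourierInv_comp_smul, Real.fourierInv_eq, Real.fourierInv_eq]
  refine integral_congr_ae ?_
  filter_upwards [h1] with w hw
  rw [hw]

lemma memLp_comp_two_pi {U : Plane → ℂ} (hU : MemLp U 2) :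
    MemLp (fun w : Plane => U ((2 * Real.pi) • w)) 2 := by
  have hq : Measure.QuasiMeasurePreserving (fun x : Plane => (2 * Real.pi) • x) volume volume := by
    refine ⟨measurable_const_smul _, ?_⟩
    rw [Measure.map_addHaar_smul volume two_pi_ne]
    exact Measure.smul_absolutelyContinuous
  have hm := hU.1.comp_quasiMeasurePreserving hq
  refine (memLp_two_iff_integrable_sq_norm hm).2 ?_
  exact (integrable_comp_smul_iff volume (fun x => ‖U x‖ ^ 2) two_pi_ne).2
    ((memLp_two_iff_integrable_sq_norm hU.1).1 hU)

/-- Converse of `eq_ift_of_hat`. It is how the transform of the nonlinearity is read off once the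
nonlinearity is known to be an inverse integral. -/
lemma hat_of_eq_ift {g : L2} {H : Plane → ℂ} (hH : Integrable H) (hH2 : MemLp H 2)
    (h : (g : Plane → ℂ) =ᵐ[volume] ift H) : hat g =ᵐ[volume] H := by
  set W := (memLp_comp_two_pi hH2).toLp with hW
  have hWc := (memLp_comp_two_pi hH2).coeFn_toLp
  have h2 := fourierInv_ae_eq W ((integrable_comp_two_pi hH).congr hWc.symm)
  have h3 : (𝓕⁻ W : L2) = g := by
    refine Lp.ext (h2.trans (EventuallyEq.trans (ae_of_all _ fun x => ?_) h.symm))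
    rw [← fourierInv_comp_smul, Real.fourierInv_eq, Real.fourierInv_eq]
    refine integral_congr_ae ?_
    filter_upwards [hWc] with w hw
    rw [hw]
  have h4 : (𝓕 g : L2) = W := by rw [← h3, FourierTransform.fourier_fourierInv_eq]
  filter_upwards [ae_comp_smul (inv_ne_zero two_pi_ne) hWc] with ξ hξ
  rw [hat, h4, hξ, smul_inv_smul₀ two_pi_ne]

/-- The Fourier transform of an integrable function in the normalization of `hat`. -/
noncomputable def ft (f : Plane → ℂ) (ξ : Plane) : ℂ :=
  ∫ x : Plane, Complex.exp (-(Complex.I * inner ℝ x ξ)) * f x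

lemma hat_ae_eq_ft {g : L2} (hg : Integrable g) : hat g =ᵐ[volume] ft g := by
  filter_upwards [ae_comp_smul (inv_ne_zero two_pi_ne) (fourier_ae_eq g hg)] with ξ hξ
  rw [hat, hξ, Real.fourier_eq', ft]
  congr 1 with x
  rw [real_inner_smul_right, smul_eq_mul]
  congr 2
  have hpi : (Real.pi : ℂ) ≠ 0 := by exact_mod_cast Real.pi_ne_zero
  push_cast
  field_simp

/-! ### The Hartree nonlinearity on the Fourier side -/

/-- The transform of `|u|²` in terms of the transform `U` of `u`. -/
noncomputable def corr (U : Plane → ℂ) (η : Plane) : ℂ :=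
  ((2 * Real.pi) ^ 2 : ℂ)⁻¹ * ∫ σ : Plane, U (σ + η) * star (U σ)

/-- The transform of `(exp (-τ |x|²) * |u|²) u` in terms of the transform `U` of `u`. -/
noncomputable def tri (U : Plane → ℂ) (τ : ℝ) (ξ : Plane) : ℂ :=
  ∫ η : Plane, (gam τ η : ℂ) * corr U η * U (ξ - η)

/-- The transform of `(|x|⁻¹ * |u|²) u` in terms of the transform `U` of `u`. -/
noncomputable def hsym (U : Plane → ℂ) (ξ : Plane) : ℂ :=
  ((√Real.pi)⁻¹ : ℂ) * ∫ τ in Set.Ioi (0 : ℝ), ((τ ^ (-(1 / 2) : ℝ) : ℝ) : ℂ) * tri U τ ξ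

/-- The time-independent decay in `τ` of the Gaussian pieces. -/
noncomputable def beta (τ : ℝ) : ℝ := min 1 (τ ^ (-(7 / 8) : ℝ))

lemma beta_nonneg {τ : ℝ} (hτ : 0 < τ) : 0 ≤ beta τ := le_min zero_le_one (by positivity)

lemma measurable_beta : Measurable beta := by unfold beta; fun_prop

/-- Near 0 only τ^{-1/2} matters; at infinity the exponent is -1/2 - 7/8 = -11/8 < -1. -/
lemma integrableOn_beta :
    IntegrableOn (fun τ : ℝ => τ ^ (-(1 / 2) : ℝ) * beta τ) (Set.Ioi 0) := by
  rw [← Set.Ioc_union_Ioi_eq_Ioi zero_le_one]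
  refine IntegrableOn.union ?_ ?_
  · have h : IntegrableOn (fun τ : ℝ => τ ^ (-(1 / 2) : ℝ)) (Set.Ioc 0 1) :=
      (intervalIntegrable_iff_integrableOn_Ioc_of_le zero_le_one).1
        (intervalIntegral.intervalIntegrable_rpow' (by norm_num))
    refine Integrable.mono' h
      (((measurable_id.pow_const _).mul measurable_beta).aestronglyMeasurable) ?_
    refine (ae_restrict_iff' measurableSet_Ioc).2 (ae_of_all _ fun τ hτ => ?_)
    have h0 : 0 ≤ τ ^ (-(1 / 2) : ℝ) := Real.rpow_nonneg hτ.1.le _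
    rw [Real.norm_eq_abs, abs_of_nonneg (mul_nonneg h0 (beta_nonneg hτ.1))]
    exact mul_le_of_le_one_right h0 (min_le_left _ _)
  · have h : IntegrableOn (fun τ : ℝ => τ ^ (-(11 / 8) : ℝ)) (Set.Ioi 1) :=
      integrableOn_Ioi_rpow_of_lt (by norm_num) one_pos
    refine Integrable.mono' h
      (((measurable_id.pow_const _).mul measurable_beta).aestronglyMeasurable) ?_
    refine (ae_restrict_iff' measurableSet_Ioi).2 (ae_of_all _ fun τ hτ => ?_)
    have hτ0 : (0 : ℝ) < τ := one_pos.trans hτ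
    have h0 : 0 ≤ τ ^ (-(1 / 2) : ℝ) := Real.rpow_nonneg hτ0.le _
    rw [Real.norm_eq_abs, abs_of_nonneg (mul_nonneg h0 (beta_nonneg hτ0)),
      show (-(11 / 8) : ℝ) = -(1 / 2) + -(7 / 8) by norm_num, Real.rpow_add hτ0]
    exact mul_le_mul_of_nonneg_left (min_le_right _ _) h0

section

variable {U : Plane → ℂ} {a : ℝ}

lemma continuous_corr (hU : Continuous U) (hb : ∀ ξ, ‖U ξ‖ ≤ a * jb ξ ^ (-10 : ℝ)) :
    Continuous (corr U) := by
  have ha : 0 ≤ a := by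
    have := (norm_nonneg _).trans (hb 0)
    exact nonneg_of_mul_nonneg_left this (jb_rpow_pos _ _)
  unfold corr
  refine continuous_const.mul ?_
  refine continuous_of_dominated (bound := fun σ => a * (a * jb σ ^ (-10 : ℝ))) ?_ ?_ ?_ ?_
  · intro η
    exact Continuous.aestronglyMeasurable (by fun_prop)
  · intro η
    refine ae_of_all _ fun σ => ?_
    rw [norm_mul, norm_star]
    refine mul_le_mul ((hb _).trans ?_) (hb σ) (norm_nonneg _) ha
    exact mul_le_of_le_one_right ha (jb_rpow_le_one (by norm_num) _)
  · exact ((integrable_jb_rpow (by norm_num)).const_mul _).const_mul _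
  · refine ae_of_all _ fun σ => ?_
    fun_prop

lemma norm_corr_le_integral (η : Plane) :
    ‖corr U η‖ ≤ ∫ σ : Plane, ‖U (σ + η)‖ * ‖U σ‖ := by
  unfold corr
  rw [norm_mul]
  have h1 : ‖((2 * Real.pi) ^ 2 : ℂ)⁻¹‖ ≤ 1 := by
    rw [norm_inv, norm_pow, norm_mul, Complex.norm_real, Complex.norm_ofNat,
      Real.norm_of_nonneg Real.pi_pos.le]
    refine inv_le_one_of_one_le₀ ?_
    nlinarith [Real.pi_gt_three]
  refine (mul_le_of_le_one_left (norm_nonneg _) h1).trans ?_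
  refine (norm_integral_le_integral_norm _).trans (le_of_eq ?_)
  congr 1 with σ
  rw [norm_mul, norm_star]

/-- Of the ten powers of decay in σ, three are kept for integrability in σ and seven are traded, by
the Peetre inequality, for decay in η. -/
lemma pair_bound (hb : ∀ ξ, ‖U ξ‖ ≤ a * jb ξ ^ (-10 : ℝ)) (σ η : Plane) :
    ‖U (σ + η)‖ * ‖U σ‖ ≤ 2 ^ 7 * a ^ 2 * jb η ^ (-7 : ℝ) * jb σ ^ (-3 : ℝ) := by
  have ha : 0 ≤ a := by
    have := (norm_nonneg _).trans (hb 0)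
    exact nonneg_of_mul_nonneg_left this (jb_rpow_pos _ _)
  have h1 : ‖U (σ + η)‖ * ‖U σ‖ ≤ a * jb (σ + η) ^ (-7 : ℝ) * (a * jb σ ^ (-10 : ℝ)) := by
    refine mul_le_mul ((hb _).trans ?_) (hb _) (norm_nonneg _)
      (mul_nonneg ha (jb_rpow_pos _ _).le)
    exact mul_le_mul_of_nonneg_left (jb_rpow_mono (by norm_num) _) ha
  refine h1.trans ?_
  have h2 := jb_rpow_le' (s := 7) (by norm_num) σ η
  have e : jb σ ^ (-10 : ℝ) = jb σ ^ (-7 : ℝ) * jb σ ^ (-3 : ℝ) := by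
    rw [← Real.rpow_add (jb_pos _)]; norm_num
  have key : jb (σ + η) ^ (-7 : ℝ) * jb σ ^ (-7 : ℝ) ≤ 2 ^ 7 * jb η ^ (-7 : ℝ) := by
    rw [Real.rpow_neg (jb_pos _).le, Real.rpow_neg (jb_pos _).le, Real.rpow_neg (jb_pos _).le,
      ← mul_inv, ← div_eq_mul_inv]
    rw [inv_le_comm₀ (mul_pos (jb_rpow_pos _ _) (jb_rpow_pos _ _))
      (div_pos (by norm_num) (jb_rpow_pos _ _)), inv_div,
      div_le_iff₀ (by norm_num)]
    refine h2.trans (le_of_eq ?_)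
    norm_num; ring
  calc a * jb (σ + η) ^ (-7 : ℝ) * (a * jb σ ^ (-10 : ℝ))
      = a ^ 2 * jb σ ^ (-3 : ℝ) * (jb (σ + η) ^ (-7 : ℝ) * jb σ ^ (-7 : ℝ)) := by rw [e]; ring
    _ ≤ a ^ 2 * jb σ ^ (-3 : ℝ) * (2 ^ 7 * jb η ^ (-7 : ℝ)) :=
      mul_le_mul_of_nonneg_left key (mul_nonneg (sq_nonneg a) (jb_rpow_pos _ _).le)
    _ = _ := by ring

lemma norm_corr_le (hb : ∀ ξ, ‖U ξ‖ ≤ a * jb ξ ^ (-10 : ℝ)) (η : Plane) :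
    ‖corr U η‖ ≤ 2 ^ 7 * a ^ 2 * jbMass * jb η ^ (-7 : ℝ) := by
  refine (norm_corr_le_integral η).trans ?_
  have : ∫ σ : Plane, ‖U (σ + η)‖ * ‖U σ‖ ≤
      ∫ σ : Plane, 2 ^ 7 * a ^ 2 * jb η ^ (-7 : ℝ) * jb σ ^ (-3 : ℝ) := by
    refine integral_mono_of_nonneg (ae_of_all _ fun σ => by positivity)
      (integrable_jb3.const_mul _) (ae_of_all _ fun σ => pair_bound hb σ η)
  refine this.trans (le_of_eq ?_)
  rw [integral_const_mul, jbMass]; ring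

/-- Total mass one gives the bound for small τ; the moment of order -7/4, which scales as τ^{-7/8},
gives the bound for large τ. -/
lemma gam_int_le_beta {τ c : ℝ} (hτ : 0 < τ) (hc : 0 ≤ c) {w : Plane → ℝ}
    (h0 : ∀ η, 0 ≤ w η) (h : ∀ η, w η ≤ c * jb η ^ (-3 : ℝ)) :
    ∫ η : Plane, gam τ η * w η ≤ c * (1 + gamMoment (-(7 / 4))) * beta τ := by
  have hm := gamMoment_nonneg (-(7 / 4))
  have h1 : ∫ η : Plane, gam τ η * w η ≤ c := by
    calc ∫ η : Plane, gam τ η * w η ≤ ∫ η : Plane, gam τ η * c := by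
          refine integral_mono_of_nonneg (ae_of_all _ fun η => mul_nonneg (gam_nonneg hτ _) (h0 _))
            ((integrable_gam hτ).mul_const _) (ae_of_all _ fun η => ?_)
          refine mul_le_mul_of_nonneg_left ((h η).trans ?_) (gam_nonneg hτ _)
          exact mul_le_of_le_one_right hc (jb_rpow_le_one (by norm_num) _)
      _ = c := by rw [integral_mul_const, integral_gam hτ, one_mul]
  have h2 : ∫ η : Plane, gam τ η * w η ≤ c * gamMoment (-(7 / 4)) * τ ^ (-(7 / 8) : ℝ) := by
    calc ∫ η : Plane, gam τ η * w η ≤ ∫ η : Plane, c * (gam τ η * ‖η‖ ^ (-(7 / 4) : ℝ)) := by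
          refine integral_mono_of_nonneg (ae_of_all _ fun η => mul_nonneg (gam_nonneg hτ _) (h0 _))
            ((integrable_gam_rpow hτ (by norm_num)).const_mul _) ?_
          have : ∀ᵐ η : Plane, η ≠ 0 := by
            simp [ae_iff, measure_singleton]
          filter_upwards [this] with η hη
          have hη : 0 < ‖η‖ := norm_pos_iff.2 hη
          rw [mul_left_comm]
          refine mul_le_mul_of_nonneg_left ((h η).trans ?_) (gam_nonneg hτ _)
          refine mul_le_mul_of_nonneg_left ?_ hc
          calc jb η ^ (-3 : ℝ) ≤ jb η ^ (-(7 / 4) : ℝ) := jb_rpow_mono (by norm_num) _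
            _ ≤ ‖η‖ ^ (-(7 / 4) : ℝ) :=
              Real.rpow_le_rpow_of_nonpos hη (norm_le_jb _) (by norm_num)
      _ = _ := by rw [integral_const_mul, integral_gam_rpow hτ]; norm_num; ring
  have hb := beta_nonneg hτ
  rcases min_choice (1 : ℝ) (τ ^ (-(7 / 8) : ℝ)) with h' | h' <;> rw [beta, h']
  · nlinarith
  · refine h2.trans ?_
    have : 0 ≤ τ ^ (-(7 / 8) : ℝ) := by positivity
    nlinarith [mul_nonneg hc this]

/-- The weight ⟨ξ⟩^s is shared between `corr U η` and `U (ξ - η)`, which leaves only a scalar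
Gaussian average of `w`. -/
lemma norm_tri_le {τ s : ℝ} (hτ : 0 < τ) (hs : 0 ≤ s) (hU : ∀ ξ, ‖U ξ‖ ≤ a * jb ξ ^ (-s))
    {w : Plane → ℝ} (hw : ∀ η, jb η ^ s * ‖corr U η‖ ≤ w η)
    (hint : Integrable (fun η => gam τ η * w η)) (ξ : Plane) :
    jb ξ ^ s * ‖tri U τ ξ‖ ≤ 2 ^ s * a * ∫ η : Plane, gam τ η * w η := by
  have ha : 0 ≤ a := by
    have := (norm_nonneg _).trans (hU 0)
    exact nonneg_of_mul_nonneg_left this (jb_rpow_pos _ _)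
  have hx := (jb_rpow_pos s ξ).le
  calc jb ξ ^ s * ‖tri U τ ξ‖
      ≤ jb ξ ^ s * ∫ η : Plane, ‖(gam τ η : ℂ) * corr U η * U (ξ - η)‖ :=
        mul_le_mul_of_nonneg_left (norm_integral_le_integral_norm _) hx
    _ = ∫ η : Plane, jb ξ ^ s * ‖(gam τ η : ℂ) * corr U η * U (ξ - η)‖ := by
        rw [integral_const_mul]
    _ ≤ ∫ η : Plane, 2 ^ s * a * (gam τ η * w η) := by
        refine integral_mono_of_nonneg (ae_of_all _ fun η => mul_nonneg hx (norm_nonneg _))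
          (hint.const_mul _) (ae_of_all _ fun η => ?_)
        simp only
        rw [norm_mul, norm_mul, Complex.norm_real, Real.norm_of_nonneg (gam_nonneg hτ η)]
        have h1 := jb_rpow_le hs ξ η
        have h2 := hU (ξ - η)
        have hg := gam_nonneg hτ η
        have h3 : jb (ξ - η) ^ s * ‖U (ξ - η)‖ ≤ a := by
          rw [Real.rpow_neg (jb_pos _).le, ← div_eq_mul_inv, le_div_iff₀ (jb_rpow_pos _ _)] at h2
          linarith
        calc jb ξ ^ s * (gam τ η * ‖corr U η‖ * ‖U (ξ - η)‖)
            ≤ (2 ^ s * jb η ^ s * jb (ξ - η) ^ s) * (gam τ η * ‖corr U η‖ * ‖U (ξ - η)‖) :=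
              mul_le_mul_of_nonneg_right h1 (by positivity)
          _ = 2 ^ s * gam τ η * ((jb η ^ s * ‖corr U η‖) * (jb (ξ - η) ^ s * ‖U (ξ - η)‖)) := by
              ring
          _ ≤ 2 ^ s * gam τ η * (w η * a) := by
              refine mul_le_mul_of_nonneg_left ?_ (by positivity)
              exact mul_le_mul (hw η) h3 (mul_nonneg (jb_rpow_pos _ _).le (norm_nonneg _))
                (le_trans (mul_nonneg (jb_rpow_pos _ _).le (norm_nonneg _)) (hw η))
          _ = _ := by ring
    _ = _ := by rw [integral_const_mul]

end

section

variable {U : Plane → ℂ} {a : ℝ}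

lemma nonneg_of_bound {s : ℝ} (hb : ∀ ξ, ‖U ξ‖ ≤ a * jb ξ ^ s) : 0 ≤ a := by
  have := (norm_nonneg _).trans (hb 0)
  exact nonneg_of_mul_nonneg_left this (jb_rpow_pos _ _)

lemma bound_mono {s r : ℝ} (hb : ∀ ξ, ‖U ξ‖ ≤ a * jb ξ ^ s) (h : s ≤ r) :
    ∀ ξ, ‖U ξ‖ ≤ a * jb ξ ^ r := fun ξ =>
  (hb ξ).trans (mul_le_mul_of_nonneg_left (jb_rpow_mono h ξ) (nonneg_of_bound hb))

lemma integrable_of_bound {s : ℝ} (hs : s < -2) (hU : AEStronglyMeasurable U)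
    (hb : ∀ ξ, ‖U ξ‖ ≤ a * jb ξ ^ s) : Integrable U :=
  ((integrable_jb_rpow hs).const_mul a).mono' hU (ae_of_all _ hb)

lemma memLp_of_bound {s : ℝ} (hs : s < -2) (hU : AEStronglyMeasurable U)
    (hb : ∀ ξ, ‖U ξ‖ ≤ a * jb ξ ^ s) : MemLp U 2 := by
  refine (memLp_two_iff_integrable_sq_norm hU).2 ?_
  refine ((integrable_jb_rpow hs).const_mul (a ^ 2)).mono' (hU.norm.pow 2)
    (ae_of_all _ fun ξ => ?_)
  rw [Real.norm_of_nonneg (by positivity)]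
  have ha := nonneg_of_bound hb
  have h1 := jb_rpow_le_one (s := s) (by linarith) ξ
  have h0 := jb_rpow_pos s ξ
  calc ‖U ξ‖ ^ 2 ≤ (a * jb ξ ^ s) ^ 2 := pow_le_pow_left₀ (norm_nonneg _) (hb ξ) 2
    _ = a ^ 2 * (jb ξ ^ s * jb ξ ^ s) := by ring
    _ ≤ a ^ 2 * (jb ξ ^ s * 1) := by gcongr
    _ = _ := by ring

lemma norm_cexp_I_mul (r : ℝ) : ‖Complex.exp (Complex.I * r)‖ = 1 := by
  rw [mul_comm]; exact Complex.norm_exp_ofReal_mul_I r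

lemma integrable_pair (hU : Continuous U) (hb : ∀ ξ, ‖U ξ‖ ≤ a * jb ξ ^ (-10 : ℝ)) :
    Integrable (fun p : Plane × Plane => U (p.2 + p.1) * star (U p.2))
      (volume.prod volume) := by
  have h : Integrable (fun p : Plane × Plane =>
      (2 ^ 7 * a ^ 2 * jb p.1 ^ (-7 : ℝ)) * jb p.2 ^ (-3 : ℝ)) (volume.prod volume) :=
    ((integrable_jb_rpow (s := -7) (by norm_num)).const_mul _).mul_prod integrable_jb3
  refine h.mono' (Continuous.aestronglyMeasurable (by fun_prop)) (ae_of_all _ fun p => ?_)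
  rw [norm_mul, norm_star]
  exact pair_bound hb p.2 p.1

/-- By Fubini and the substitution ξ = σ + η, the double integral factors into an integral times its
conjugate. So `corr` is the transform of |u|². -/
lemma ift_corr (hU : Continuous U) (hb : ∀ ξ, ‖U ξ‖ ≤ a * jb ξ ^ (-10 : ℝ)) (y : Plane) :
    ∫ η : Plane, Complex.exp (Complex.I * inner ℝ η y) * corr U η =
      (2 * Real.pi) ^ 2 * ((‖ift U y‖ ^ 2 : ℝ) : ℂ) := by
  have e1 : ∀ η : Plane, Complex.exp (Complex.I * inner ℝ η y) * corr U η =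
      ((2 * Real.pi) ^ 2 : ℂ)⁻¹ *
        ∫ σ : Plane, Complex.exp (Complex.I * inner ℝ η y) * (U (σ + η) * star (U σ)) := by
    intro η; rw [corr, integral_const_mul]; ring
  simp_rw [e1]
  rw [integral_const_mul, integral_integral_swap]
  · have e2 : ∀ σ : Plane, ∫ η : Plane, Complex.exp (Complex.I * inner ℝ η y) *
        (U (σ + η) * star (U σ)) = star (Complex.exp (Complex.I * inner ℝ σ y) * U σ) *
          ∫ ξ : Plane, Complex.exp (Complex.I * inner ℝ ξ y) * U ξ := by
      intro σ
      rw [← integral_const_mul,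
        ← integral_add_left_eq_self (μ := volume) (fun ξ : Plane =>
          star (Complex.exp (Complex.I * inner ℝ σ y) * U σ) *
          (Complex.exp (Complex.I * inner ℝ ξ y) * U ξ)) σ]
      congr 1 with η
      rw [inner_add_left]
      have : star (Complex.exp (Complex.I * inner ℝ σ y)) =
          Complex.exp (-(Complex.I * inner ℝ σ y)) := by
        change (starRingEnd ℂ) _ = _
        rw [← Complex.exp_conj]; simp
      rw [star_mul', this]
      push_cast
      rw [mul_add, Complex.exp_add, Complex.exp_neg]
      have hne := Complex.exp_ne_zero (Complex.I * inner ℝ σ y)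
      field_simp
    simp_rw [e2]
    rw [integral_mul_const]
    have e3 : ∫ σ : Plane, star (Complex.exp (Complex.I * inner ℝ σ y) * U σ) =
        star (∫ σ : Plane, Complex.exp (Complex.I * inner ℝ σ y) * U σ) := by
      exact integral_conj
    rw [e3, ift]
    have e4 : ∀ z : ℂ, star z * z = ((‖z‖ ^ 2 : ℝ) : ℂ) := fun z => by
      have := Complex.conj_mul' z; push_cast; exact this
    rw [e4, norm_mul, norm_inv, norm_pow, norm_mul, Complex.norm_real, Complex.norm_ofNat,
      Real.norm_of_nonneg Real.pi_pos.le]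
    have hpi : (Real.pi : ℂ) ≠ 0 := by exact_mod_cast Real.pi_ne_zero
    push_cast
    field_simp
  · refine (integrable_pair hU hb).mono ?_ (ae_of_all _ fun p => ?_)
    · exact Continuous.aestronglyMeasurable (by unfold Function.uncurry; fun_prop)
    · simp only [Function.uncurry, norm_mul, norm_cexp_I_mul, one_mul]; rfl

lemma integrable_corr (hU : Continuous U) (hb : ∀ ξ, ‖U ξ‖ ≤ a * jb ξ ^ (-10 : ℝ)) :
    Integrable (corr U) :=
  integrable_of_bound (s := -7) (by norm_num) (continuous_corr hU hb).aestronglyMeasurable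
    (norm_corr_le hb)

/-- The Gaussian potentials in terms of the transform of `|u|²`. -/
lemma gauss_potential (hU : Continuous U) (hb : ∀ ξ, ‖U ξ‖ ≤ a * jb ξ ^ (-10 : ℝ)) {τ : ℝ}
    (hτ : 0 < τ) (x : Plane) :
    ((∫ y : Plane, Real.exp (-τ * ‖x - y‖ ^ 2) * ‖ift U y‖ ^ 2 : ℝ) : ℂ) =
      ∫ η : Plane, (gam τ η : ℂ) * corr U η * Complex.exp (Complex.I * inner ℝ η x) := by
  rw [← integral_complex_ofReal]
  have hpi : ((2 * Real.pi) ^ 2 : ℂ) ≠ 0 := pow_ne_zero _ (by exact_mod_cast two_pi_ne)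
  have e1 : ∀ y : Plane, ((Real.exp (-τ * ‖x - y‖ ^ 2) * ‖ift U y‖ ^ 2 : ℝ) : ℂ) =
      ((2 * Real.pi) ^ 2 : ℂ)⁻¹ * ∫ η : Plane, (Real.exp (-τ * ‖x - y‖ ^ 2) : ℂ) *
        (Complex.exp (Complex.I * inner ℝ η y) * corr U η) := by
    intro y
    rw [integral_const_mul, ift_corr hU hb, Complex.ofReal_mul]
    field_simp
  simp_rw [e1]
  rw [integral_const_mul, integral_integral_swap]
  · rw [← integral_const_mul]
    congr 1 with η
    have : ∀ y : Plane, (Real.exp (-τ * ‖x - y‖ ^ 2) : ℂ) *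
        (Complex.exp (Complex.I * inner ℝ η y) * corr U η) =
        (Real.exp (-τ * ‖x - y‖ ^ 2) : ℂ) * Complex.exp (Complex.I * inner ℝ η y) * corr U η :=
      fun y => by ring
    simp_rw [this]
    rw [integral_mul_const, integral_gauss_cexp hτ]
    field_simp
  · have h1 : Integrable (fun y : Plane => Real.exp (-τ * ‖x - y‖ ^ 2)) := by
      have h0 : Integrable (fun y : Plane => Real.exp (-τ * ‖y‖ ^ 2)) := by
        have := (GaussianFourier.integrable_cexp_neg_mul_sq_norm_add (V := Plane) (b := (τ : ℂ))
          (by simpa using hτ) 0 0).re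
        refine this.congr (ae_of_all _ fun y => ?_)
        simp only [zero_mul, add_zero]
        rw [show (-(τ : ℂ) * ‖y‖ ^ 2) = ((-τ * ‖y‖ ^ 2 : ℝ) : ℂ) by push_cast; ring]
        exact Complex.exp_ofReal_re _
      exact h0.comp_sub_left x
    have h2 : Integrable (fun p : Plane × Plane => Real.exp (-τ * ‖x - p.1‖ ^ 2) * ‖corr U p.2‖)
        (volume.prod volume) := h1.mul_prod (integrable_corr hU hb).norm
    have hc := continuous_corr hU hb
    refine h2.mono' (Continuous.aestronglyMeasurable (by unfold Function.uncurry; fun_prop))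
      (ae_of_all _ fun p => ?_)
    simp only [Function.uncurry, norm_mul, norm_cexp_I_mul, one_mul, Complex.norm_real,
      Real.norm_eq_abs, Real.abs_exp, le_refl]

/-- A convolution becomes a product: translating ξ by η detaches the potential from `U`. -/
lemma ift_tri (hU : Continuous U) (hb : ∀ ξ, ‖U ξ‖ ≤ a * jb ξ ^ (-10 : ℝ)) {τ : ℝ}
    (hτ : 0 < τ) (x : Plane) :
    ift (tri U τ) x =
      (∫ η : Plane, (gam τ η : ℂ) * corr U η * Complex.exp (Complex.I * inner ℝ η x)) *
        ift U x := by
  rw [ift, ift, mul_left_comm]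
  congr 1
  have e1 : ∀ ξ : Plane, Complex.exp (Complex.I * inner ℝ ξ x) * tri U τ ξ =
      ∫ η : Plane, Complex.exp (Complex.I * inner ℝ ξ x) *
        ((gam τ η : ℂ) * corr U η * U (ξ - η)) := by
    intro ξ; rw [tri, integral_const_mul]
  simp_rw [e1]
  rw [integral_integral_swap, ← integral_mul_const]
  · congr 1 with η
    rw [← integral_const_mul,
      ← integral_sub_right_eq_self (μ := volume) (fun ξ : Plane =>
        (gam τ η : ℂ) * corr U η * Complex.exp (Complex.I * inner ℝ η x) *
          (Complex.exp (Complex.I * inner ℝ ξ x) * U ξ)) η]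
    congr 1 with ξ
    rw [inner_sub_left]
    push_cast
    rw [mul_sub, Complex.exp_sub]
    have hne := Complex.exp_ne_zero (Complex.I * inner ℝ η x)
    field_simp
  · have h : Integrable (fun p : Plane × Plane =>
        (2 ^ 3 * a * jb p.1 ^ (-3 : ℝ)) * (gam τ p.2 * (2 ^ 7 * a ^ 2 * jbMass)))
        (volume.prod volume) :=
      (integrable_jb3.const_mul _).mul_prod ((integrable_gam hτ).mul_const _)
    have hc := continuous_corr hU hb
    have hg := continuous_gam τ
    refine h.mono' (Continuous.aestronglyMeasurable (by unfold Function.uncurry; fun_prop))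
      (ae_of_all _ fun p => ?_)
    obtain ⟨ξ, η⟩ := p
    simp only [Function.uncurry, norm_mul, norm_cexp_I_mul, one_mul, Complex.norm_real,
      Real.norm_of_nonneg (gam_nonneg hτ η)]
    have ha := nonneg_of_bound hb
    have h1 := norm_corr_le hb η
    have h2 : ‖U (ξ - η)‖ ≤ a * jb (ξ - η) ^ (-3 : ℝ) := bound_mono hb (by norm_num) _
    have h3 : jb η ^ (-7 : ℝ) * jb (ξ - η) ^ (-3 : ℝ) ≤ 2 ^ 3 * jb ξ ^ (-3 : ℝ) := by
      have h4 := jb_rpow_le (s := 3) (by norm_num) ξ η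
      have h5 : jb η ^ (-7 : ℝ) ≤ jb η ^ (-3 : ℝ) := jb_rpow_mono (by norm_num) _
      refine (mul_le_mul_of_nonneg_right h5 (jb_rpow_pos _ _).le).trans ?_
      rw [Real.rpow_neg (jb_pos _).le, Real.rpow_neg (jb_pos _).le, Real.rpow_neg (jb_pos _).le,
        ← mul_inv, ← div_eq_mul_inv]
      rw [inv_le_comm₀ (mul_pos (jb_rpow_pos _ _) (jb_rpow_pos _ _))
        (div_pos (by norm_num) (jb_rpow_pos _ _)), inv_div, div_le_iff₀ (by norm_num)]
      refine h4.trans (le_of_eq ?_)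
      norm_num; ring
    have hgn := gam_nonneg hτ η
    have hM := jbMass_nonneg
    calc gam τ η * ‖corr U η‖ * ‖U (ξ - η)‖
        ≤ gam τ η * (2 ^ 7 * a ^ 2 * jbMass * jb η ^ (-7 : ℝ)) * (a * jb (ξ - η) ^ (-3 : ℝ)) := by
          have := jb_rpow_pos (-7) η
          gcongr
      _ = gam τ η * (2 ^ 7 * a ^ 2 * jbMass) * a * (jb η ^ (-7 : ℝ) * jb (ξ - η) ^ (-3 : ℝ)) := by
          ring
      _ ≤ gam τ η * (2 ^ 7 * a ^ 2 * jbMass) * a * (2 ^ 3 * jb ξ ^ (-3 : ℝ)) := by gcongr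
      _ = _ := by ring

end

section

variable {U : Plane → ℂ} {a : ℝ}

/-- The constant in the elementary bound for `tri`. -/
noncomputable def triConst : ℝ := 2 ^ 10 * jbMass * (1 + gamMoment (-(7 / 4)))

lemma integrable_gam_mul_jb3 {τ : ℝ} (hτ : 0 < τ) (c : ℝ) :
    Integrable (fun η : Plane => gam τ η * (c * jb η ^ (-3 : ℝ))) := by
  refine ((integrable_gam hτ).mul_const |c|).mono'
    (Continuous.aestronglyMeasurable ((continuous_gam τ).mul
      (continuous_const.mul (continuous_jb_rpow _)))) (ae_of_all _ fun η => ?_)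
  rw [norm_mul, norm_mul, Real.norm_of_nonneg (gam_nonneg hτ η), Real.norm_eq_abs,
    Real.norm_of_nonneg (jb_rpow_pos _ _).le]
  exact mul_le_mul_of_nonneg_left
    (mul_le_of_le_one_right (abs_nonneg _) (jb_rpow_le_one (by norm_num) _)) (gam_nonneg hτ η)

lemma norm_tri_le_jb3 (hb : ∀ ξ, ‖U ξ‖ ≤ a * jb ξ ^ (-10 : ℝ)) {τ : ℝ} (hτ : 0 < τ) (ξ : Plane) :
    ‖tri U τ ξ‖ ≤ triConst * a ^ 3 * beta τ * jb ξ ^ (-3 : ℝ) := by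
  have ha := nonneg_of_bound hb
  have hM := jbMass_nonneg
  have h := norm_tri_le (s := 3) hτ (by norm_num) (bound_mono hb (by norm_num))
    (w := fun η => 2 ^ 7 * a ^ 2 * jbMass * jb η ^ (-3 : ℝ)) (fun η => ?_)
    (integrable_gam_mul_jb3 hτ _) ξ
  · have h2 := gam_int_le_beta hτ (c := 2 ^ 7 * a ^ 2 * jbMass) (by positivity)
      (w := fun η => 2 ^ 7 * a ^ 2 * jbMass * jb η ^ (-3 : ℝ))
      (fun η => mul_nonneg (by positivity) (jb_rpow_pos _ _).le) (fun η => le_rfl)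
    rw [Real.rpow_neg (jb_pos _).le, ← div_eq_mul_inv, le_div_iff₀ (jb_rpow_pos _ _), mul_comm]
    refine h.trans ((mul_le_mul_of_nonneg_left h2 (by positivity)).trans (le_of_eq ?_))
    rw [triConst]; norm_num; ring
  · have h1 := norm_corr_le hb η
    calc jb η ^ (3 : ℝ) * ‖corr U η‖
        ≤ jb η ^ (3 : ℝ) * (2 ^ 7 * a ^ 2 * jbMass * jb η ^ (-7 : ℝ)) :=
          mul_le_mul_of_nonneg_left h1 (jb_rpow_pos _ _).le
      _ = 2 ^ 7 * a ^ 2 * jbMass * (jb η ^ (3 : ℝ) * jb η ^ (-7 : ℝ)) := by ring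
      _ = 2 ^ 7 * a ^ 2 * jbMass * jb η ^ (-4 : ℝ) := by
          rw [← Real.rpow_add (jb_pos _)]; norm_num
      _ ≤ _ := mul_le_mul_of_nonneg_left (jb_rpow_mono (by norm_num) _) (by positivity)

lemma stronglyMeasurable_tri (hU : Continuous U) (hb : ∀ ξ, ‖U ξ‖ ≤ a * jb ξ ^ (-10 : ℝ)) :
    StronglyMeasurable (fun p : ℝ × Plane => tri U p.1 p.2) := by
  unfold tri
  have hc := continuous_corr hU hb
  refine StronglyMeasurable.integral_prod_right
    (f := fun (p : ℝ × Plane) η => (gam p.1 η : ℂ) * corr U η * U (p.2 - η)) ?_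
  refine Measurable.stronglyMeasurable ?_
  unfold Function.uncurry
  refine (Measurable.mul (Measurable.mul ?_ ?_) ?_)
  · exact Complex.measurable_ofReal.comp
      (measurable_gam.comp (measurable_fst.fst.prodMk measurable_snd))
  · exact hc.measurable.comp measurable_snd
  · exact hU.measurable.comp (measurable_fst.snd.sub measurable_snd)

lemma measurable_tri_right (hU : Continuous U) (hb : ∀ ξ, ‖U ξ‖ ≤ a * jb ξ ^ (-10 : ℝ))
    (ξ : Plane) : Measurable (fun τ : ℝ => tri U τ ξ) :=
  Measurable.of_uncurry_right (f := tri U) (stronglyMeasurable_tri hU hb).measurable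

lemma integrable_tri_tau (hU : Continuous U) (hb : ∀ ξ, ‖U ξ‖ ≤ a * jb ξ ^ (-10 : ℝ))
    (ξ : Plane) :
    IntegrableOn (fun τ : ℝ => ((τ ^ (-(1 / 2) : ℝ) : ℝ) : ℂ) * tri U τ ξ) (Set.Ioi 0) := by
  refine Integrable.mono' (integrableOn_beta.const_mul (triConst * a ^ 3 * jb ξ ^ (-3 : ℝ))) ?_ ?_
  · exact (Measurable.mul (Complex.measurable_ofReal.comp (measurable_id.pow_const _))
      (measurable_tri_right hU hb ξ)).aestronglyMeasurable
  · refine (ae_restrict_iff' measurableSet_Ioi).2 (ae_of_all _ fun τ hτ => ?_)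
    have hτ : (0 : ℝ) < τ := hτ
    have h0 : 0 ≤ τ ^ (-(1 / 2) : ℝ) := by positivity
    rw [norm_mul, Complex.norm_real, Real.norm_of_nonneg h0]
    refine (mul_le_mul_of_nonneg_left (norm_tri_le_jb3 hb hτ ξ) h0).trans (le_of_eq (by ring))

lemma integrable_tri_prod (hU : Continuous U) (hb : ∀ ξ, ‖U ξ‖ ≤ a * jb ξ ^ (-10 : ℝ)) :
    Integrable (fun p : Plane × ℝ => ((p.2 ^ (-(1 / 2) : ℝ) : ℝ) : ℂ) * tri U p.2 p.1)
      (volume.prod (volume.restrict (Set.Ioi 0))) := by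
  have h : Integrable (fun p : Plane × ℝ => (triConst * a ^ 3 * jb p.1 ^ (-3 : ℝ)) *
      (p.2 ^ (-(1 / 2) : ℝ) * beta p.2)) (volume.prod (volume.restrict (Set.Ioi 0))) :=
    (integrable_jb3.const_mul _).mul_prod integrableOn_beta
  refine h.mono' ?_ ?_
  · exact (Measurable.mul (Complex.measurable_ofReal.comp (measurable_snd.pow_const _))
      ((stronglyMeasurable_tri hU hb).measurable.comp measurable_swap)).aestronglyMeasurable
  · have : ∀ᵐ p : Plane × ℝ ∂(volume.prod (volume.restrict (Set.Ioi 0))), p.2 ∈ Set.Ioi (0 : ℝ) :=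
      Measure.quasiMeasurePreserving_snd.ae (ae_restrict_mem measurableSet_Ioi)
    filter_upwards [this] with p hp
    have hτ : (0 : ℝ) < p.2 := hp
    have h0 : 0 ≤ p.2 ^ (-(1 / 2) : ℝ) := by positivity
    rw [norm_mul, Complex.norm_real, Real.norm_of_nonneg h0]
    refine (mul_le_mul_of_nonneg_left (norm_tri_le_jb3 hb hτ p.1) h0).trans (le_of_eq (by ring))

lemma aestronglyMeasurable_hsym (hU : Continuous U) (hb : ∀ ξ, ‖U ξ‖ ≤ a * jb ξ ^ (-10 : ℝ)) :
    AEStronglyMeasurable (hsym U) :=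
  ((integrable_tri_prod hU hb).integral_prod_left).aestronglyMeasurable.const_mul _

/-- The integral of `τ ^ (-1 / 2) * beta τ`. -/
noncomputable def betaMass : ℝ := ∫ τ in Set.Ioi (0 : ℝ), τ ^ (-(1 / 2) : ℝ) * beta τ

lemma inv_sqrt_pi_le_one : (√Real.pi)⁻¹ ≤ 1 :=
  inv_le_one_of_one_le₀ (Real.one_le_sqrt.2 (by linarith [Real.pi_gt_three]))

lemma norm_inv_sqrt_pi_mul_le (z : ℂ) : ‖((√Real.pi)⁻¹ : ℂ) * z‖ ≤ ‖z‖ := by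
  rw [norm_mul, norm_inv, Complex.norm_real, Real.norm_of_nonneg (Real.sqrt_nonneg _)]
  exact mul_le_of_le_one_left (norm_nonneg _) inv_sqrt_pi_le_one

lemma norm_hsym_le (hb : ∀ ξ, ‖U ξ‖ ≤ a * jb ξ ^ (-10 : ℝ)) (ξ : Plane) :
    ‖hsym U ξ‖ ≤ triConst * a ^ 3 * betaMass * jb ξ ^ (-3 : ℝ) := by
  refine (norm_inv_sqrt_pi_mul_le _).trans ?_
  have : triConst * a ^ 3 * betaMass * jb ξ ^ (-3 : ℝ) = ∫ τ in Set.Ioi (0 : ℝ),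
      (triConst * a ^ 3 * jb ξ ^ (-3 : ℝ)) * (τ ^ (-(1 / 2) : ℝ) * beta τ) := by
    rw [integral_const_mul, betaMass]; ring
  rw [this]
  refine norm_integral_le_of_norm_le (integrableOn_beta.const_mul _) ?_
  refine (ae_restrict_iff' measurableSet_Ioi).2 (ae_of_all _ fun τ hτ => ?_)
  have hτ : (0 : ℝ) < τ := hτ
  have h0 : 0 ≤ τ ^ (-(1 / 2) : ℝ) := by positivity
  rw [norm_mul, Complex.norm_real, Real.norm_of_nonneg h0]
  refine (mul_le_mul_of_nonneg_left (norm_tri_le_jb3 hb hτ ξ) h0).trans (le_of_eq (by ring))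

lemma ift_hsym (hU : Continuous U) (hb : ∀ ξ, ‖U ξ‖ ≤ a * jb ξ ^ (-10 : ℝ)) (x : Plane) :
    ift (hsym U) x = ((√Real.pi)⁻¹ : ℂ) *
      ∫ τ in Set.Ioi (0 : ℝ), ((τ ^ (-(1 / 2) : ℝ) : ℝ) : ℂ) * ift (tri U τ) x := by
  have e1 : ∀ ξ : Plane, Complex.exp (Complex.I * inner ℝ ξ x) * hsym U ξ =
      ((√Real.pi)⁻¹ : ℂ) * ∫ τ in Set.Ioi (0 : ℝ), Complex.exp (Complex.I * inner ℝ ξ x) *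
        (((τ ^ (-(1 / 2) : ℝ) : ℝ) : ℂ) * tri U τ ξ) := by
    intro ξ; rw [hsym, integral_const_mul]; ring
  rw [ift]
  simp_rw [e1]
  rw [integral_const_mul, integral_integral_swap, mul_left_comm]
  · congr 1
    rw [← integral_const_mul]
    refine integral_congr_ae (ae_of_all _ fun τ => ?_)
    simp only
    rw [ift, mul_left_comm, ← integral_const_mul
      ((τ ^ (-(1 / 2) : ℝ) : ℝ) : ℂ)]
    refine congrArg _ (integral_congr_ae (ae_of_all (volume : Measure Plane) fun ξ => ?_))
    simp only
    ring
  · refine (integrable_tri_prod hU hb).mono ?_ (ae_of_all _ fun p => ?_)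
    · refine AEStronglyMeasurable.mul (Continuous.aestronglyMeasurable (by fun_prop))
        (integrable_tri_prod hU hb).aestronglyMeasurable
    · simp only [Function.uncurry, norm_mul, norm_cexp_I_mul, one_mul, le_refl]

/-- Split at distance one from `x`: inside, the singularity is integrable in the plane and `w` is
bounded; outside, the kernel is at most one and `w` is integrable. -/
lemma integrable_inv_norm_mul {w : Plane → ℝ} {c : ℝ} (hw : Integrable w) (hc : ∀ y, |w y| ≤ c)
    (x : Plane) : Integrable (fun y => ‖x - y‖⁻¹ * w y) := by
  have h1 : Integrable (fun y : Plane => (Metric.ball (0 : Plane) 1).indicator (fun z => ‖z‖⁻¹) y) := by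
    have := (norm_addHaar_plane (f := fun r => (Set.Iio (1 : ℝ)).indicator (fun r => r⁻¹) r)).2 ?_
    · refine this.congr (ae_of_all _ fun y => ?_)
      by_cases hy : ‖y‖ < 1 <;> simp [hy]
    · have h : IntegrableOn (fun _ : ℝ => (1 : ℝ)) (Set.Ioo 0 1) := by simp
      have h' : IntegrableOn ((Set.Ioo (0 : ℝ) 1).indicator (fun _ : ℝ => (1 : ℝ))) (Set.Ioi 0) :=
        ((integrable_indicator_iff measurableSet_Ioo).2 h).integrableOn
      refine h'.congr_fun (fun y hy => ?_) measurableSet_Ioi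
      have hy : (0 : ℝ) < y := hy
      by_cases h1 : y < 1 <;> simp [h1, hy, hy.ne']
  have hc0 : 0 ≤ c := (abs_nonneg _).trans (hc 0)
  have h2 : Integrable (fun y : Plane =>
      (Metric.ball (0 : Plane) 1).indicator (fun z => ‖z‖⁻¹) (x - y) * c + |w y|) :=
    ((h1.comp_sub_left x).mul_const c).add hw.abs
  refine h2.mono' ?_ (ae_of_all _ fun y => ?_)
  · exact ((measurable_const.sub measurable_id).norm.inv.aestronglyMeasurable).mul
      hw.aestronglyMeasurable
  · rw [norm_mul, norm_inv, norm_norm, Real.norm_eq_abs]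
    by_cases hy : ‖x - y‖ < 1
    · rw [Set.indicator_of_mem (by simpa using hy)]
      have := mul_le_mul_of_nonneg_left (hc y) (inv_nonneg.2 (norm_nonneg (x - y)))
      linarith [abs_nonneg (w y)]
    · rw [Set.indicator_of_notMem (by simpa using hy), zero_mul, zero_add]
      exact mul_le_of_le_one_left (abs_nonneg _) (inv_le_one_of_one_le₀ (not_lt.1 hy))

/-- Subordination of the Coulomb potential to Gaussians. -/
lemma subordination {w : Plane → ℝ} {c : ℝ} (hw : Integrable w) (hc : ∀ y, |w y| ≤ c)
    (x : Plane) : ∫ y : Plane, ‖x - y‖⁻¹ * w y = (√Real.pi)⁻¹ * ∫ τ in Set.Ioi (0 : ℝ),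
      τ ^ (-(1 / 2) : ℝ) * ∫ y : Plane, Real.exp (-τ * ‖x - y‖ ^ 2) * w y := by
  have hae : ∀ᵐ y : Plane, y ≠ x := by simp [ae_iff, measure_singleton]
  have hpos : ∀ y : Plane, y ≠ x → 0 < ‖x - y‖ := fun y hy =>
    norm_pos_iff.2 (sub_ne_zero.2 hy.symm)
  have e1 : ∫ y : Plane, ‖x - y‖⁻¹ * w y = ∫ y : Plane, (√Real.pi)⁻¹ *
      ∫ τ in Set.Ioi (0 : ℝ), τ ^ (-(1 / 2) : ℝ) * Real.exp (-τ * ‖x - y‖ ^ 2) * w y := by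
    refine integral_congr_ae ?_
    filter_upwards [hae] with y hy
    rw [integral_mul_const, integral_rpow_exp (hpos y hy)]
    have : √Real.pi ≠ 0 := (Real.sqrt_pos.2 Real.pi_pos).ne'
    field_simp
  rw [e1, integral_const_mul, integral_integral_swap]
  · congr 2 with τ
    rw [← integral_const_mul]
    congr 1 with y
    ring
  · have hm : AEStronglyMeasurable (Function.uncurry fun (y : Plane) (τ : ℝ) =>
        τ ^ (-(1 / 2) : ℝ) * Real.exp (-τ * ‖x - y‖ ^ 2) * w y)
        (volume.prod (volume.restrict (Set.Ioi 0))) := by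
      refine AEStronglyMeasurable.mul (Measurable.aestronglyMeasurable ?_)
        hw.aestronglyMeasurable.comp_fst
      fun_prop
    refine (integrable_prod_iff hm).2 ⟨?_, ?_⟩
    · filter_upwards [hae] with y hy
      exact Integrable.mul_const (integrableOn_rpow_exp (hpos y hy)) (w y)
    -- Integrating in τ first brings back the Coulomb kernel, whose integrability against `w` is
    -- known; this justifies Fubini.
    · have := ((integrable_inv_norm_mul hw hc x).norm.const_mul (√Real.pi))
      refine this.congr ?_
      filter_upwards [hae] with y hy
      have e : ∀ τ ∈ Set.Ioi (0 : ℝ), ‖Function.uncurry (fun (y : Plane) (τ : ℝ) =>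
        τ ^ (-(1 / 2) : ℝ) * Real.exp (-τ * ‖x - y‖ ^ 2) * w y) (y, τ)‖ =
          τ ^ (-(1 / 2) : ℝ) * Real.exp (-τ * ‖x - y‖ ^ 2) * |w y| := by
        intro τ hτ
        have hτ : (0 : ℝ) < τ := hτ
        simp only [Function.uncurry]
        rw [norm_mul, Real.norm_of_nonneg (by positivity), Real.norm_eq_abs]
      rw [setIntegral_congr_fun measurableSet_Ioi e, integral_mul_const,
        integral_rpow_exp (hpos y hy), norm_mul, norm_inv, norm_norm, Real.norm_eq_abs]
      ring

lemma norm_ift_le (x : Plane) : ‖ift U x‖ ≤ ∫ ξ, ‖U ξ‖ := by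
  unfold ift
  rw [norm_mul]
  have h1 : ‖((2 * Real.pi) ^ 2 : ℂ)⁻¹‖ ≤ 1 := by
    rw [norm_inv, norm_pow, norm_mul, Complex.norm_real, Complex.norm_ofNat,
      Real.norm_of_nonneg Real.pi_pos.le]
    refine inv_le_one_of_one_le₀ ?_
    nlinarith [Real.pi_gt_three]
  refine (mul_le_of_le_one_left (norm_nonneg _) h1).trans ?_
  refine (norm_integral_le_integral_norm _).trans (le_of_eq ?_)
  congr 1 with ξ
  rw [norm_mul, norm_cexp_I_mul, one_mul]

lemma memLp_ift {H : Plane → ℂ} (hH : Integrable H) (hH2 : MemLp H 2) :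
    MemLp (ift H) 2 := by
  set W := (memLp_comp_two_pi hH2).toLp with hW
  have hWc := (memLp_comp_two_pi hH2).coeFn_toLp
  have h2 := fourierInv_ae_eq W ((integrable_comp_two_pi hH).congr hWc.symm)
  refine (Lp.memLp (𝓕⁻ W : L2)).ae_eq (h2.trans (ae_of_all _ fun x => ?_))
  rw [← fourierInv_comp_smul, Real.fourierInv_eq, Real.fourierInv_eq]
  refine integral_congr_ae ?_
  filter_upwards [hWc] with w hw
  rw [hw]

/-- The Fourier transform of the Hartree nonlinearity. -/
theorem hat_hartree {g : L2} (hU : Continuous U) (hb : ∀ ξ, ‖U ξ‖ ≤ a * jb ξ ^ (-10 : ℝ))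
    (hg : hat g =ᵐ[volume] U) : hat (hartree g) =ᵐ[volume] hsym U := by
  have hUi : Integrable U := integrable_of_bound (s := -10) (by norm_num) hU.aestronglyMeasurable hb
  have hgi := eq_ift_of_hat hUi hg
  have hbs := norm_hsym_le hb
  have hHi : Integrable (hsym U) :=
    integrable_of_bound (s := -3) (by norm_num) (aestronglyMeasurable_hsym hU hb) hbs
  have hH2 : MemLp (hsym U) 2 :=
    memLp_of_bound (s := -3) (by norm_num) (aestronglyMeasurable_hsym hU hb) hbs
  have hsq : Integrable (fun y => ‖ift U y‖ ^ 2) := by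
    have := (memLp_two_iff_integrable_sq_norm (Lp.aestronglyMeasurable g)).1 (Lp.memLp g)
    refine this.congr ?_
    filter_upwards [hgi] with y hy
    rw [hy]
  -- Proved Gaussian by Gaussian: each Gaussian potential times u is the inverse transform of the
  -- corresponding `tri`.
  have hpot : ∀ x, hartreePotential g x * ift U x = ift (hsym U) x := by
    intro x
    have h1 : hartreePotential g x = ∫ y : Plane, ‖x - y‖⁻¹ * ‖ift U y‖ ^ 2 := by
      unfold hartreePotential
      refine integral_congr_ae ?_
      filter_upwards [hgi] with y hy
      rw [hy]
    rw [h1, subordination hsq (c := (∫ ξ, ‖U ξ‖) ^ 2) (fun y => by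
        rw [abs_of_nonneg (by positivity)]
        exact pow_le_pow_left₀ (norm_nonneg _) (norm_ift_le y) 2), ift_hsym hU hb,
      Complex.ofReal_mul, ← integral_complex_ofReal, mul_assoc, Complex.ofReal_inv]
    congr 1
    rw [← integral_mul_const]
    refine setIntegral_congr_fun measurableSet_Ioi fun τ hτ => ?_
    beta_reduce
    rw [ift_tri hU hb hτ, Complex.ofReal_mul, gauss_potential hU hb hτ]
    ring
  have hae : (fun x : Plane => (hartreePotential g x : ℂ) * g x) =ᵐ[volume] ift (hsym U) := by
    filter_upwards [hgi] with x hx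
    rw [hx, hpot]
  have hmem : MemLp (fun x : Plane => (hartreePotential g x : ℂ) * g x) 2 :=
    (memLp_ift hHi hH2).ae_eq hae.symm
  have hh : hartree g = hmem.toLp _ := by rw [hartree, dif_pos hmem]
  rw [hh]
  exact hat_of_eq_ift hHi hH2 (hmem.coeFn_toLp.trans hae)

end

/-! ### Derivatives along a direction and integration by parts -/

/-- `f'` is the derivative of `f` in the direction `e`. -/
def LD {E : Type*} [NormedAddCommGroup E] [NormedSpace ℝ E] (e : Plane) (f f' : Plane → E) : Prop :=
  ∀ (σ : Plane) (s : ℝ), HasDerivAt (fun r : ℝ => f (σ + r • e)) (f' (σ + s • e)) s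

namespace LD

variable {E : Type*} [NormedAddCommGroup E] [NormedSpace ℝ E] {e : Plane}

lemma hasLineDerivAt {f f' : Plane → E} (h : LD e f f') (x : Plane) :
    HasLineDerivAt ℝ f (f' x) x e := by
  have := h x 0
  simpa [HasLineDerivAt] using this

lemma of_hasLineDerivAt {f f' : Plane → E} (h : ∀ x, HasLineDerivAt ℝ f (f' x) x e) :
    LD e f f' := by
  intro σ s
  have h1 : HasDerivAt (fun t : ℝ => f (σ + s • e + t • e)) (f' (σ + s • e)) 0 := h (σ + s • e)
  have h2 : HasDerivAt (fun r : ℝ => r - s) 1 s := (hasDerivAt_id s).sub_const s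
  have h3 := HasDerivAt.scomp (g₁ := fun t : ℝ => f (σ + s • e + t • e)) s
    (by simpa using h1) h2
  rw [one_smul] at h3
  refine h3.congr_of_eventuallyEq (Eventually.of_forall fun r => ?_)
  simp only [Function.comp]
  congr 1; module

lemma of_fderiv {f : Plane → E} (hf : Differentiable ℝ f) :
    LD e f (fun x => fderiv ℝ f x e) :=
  of_hasLineDerivAt fun x => (hf x).hasFDerivAt.hasLineDerivAt e

lemma add {f f' g g' : Plane → E} (hf : LD e f f') (hg : LD e g g') :
    LD e (fun x => f x + g x) (fun x => f' x + g' x) := fun σ s => (hf σ s).add (hg σ s)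

lemma sub {f f' g g' : Plane → E} (hf : LD e f f') (hg : LD e g g') :
    LD e (fun x => f x - g x) (fun x => f' x - g' x) := fun σ s => (hf σ s).sub (hg σ s)

lemma const_mul {𝔸 : Type*} [NormedRing 𝔸] [NormedAlgebra ℝ 𝔸] {f f' : Plane → 𝔸} (c : 𝔸)
    (hf : LD e f f') : LD e (fun x => c * f x) (fun x => c * f' x) :=
  fun σ s => (hf σ s).const_mul c

lemma mul {𝔸 : Type*} [NormedRing 𝔸] [NormedAlgebra ℝ 𝔸] {f f' g g' : Plane → 𝔸}
    (hf : LD e f f') (hg : LD e g g') :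
    LD e (fun x => f x * g x) (fun x => f' x * g x + f x * g' x) :=
  fun σ s => (hf σ s).mul (hg σ s)

lemma inv {f f' : Plane → ℝ} (hf : LD e f f') (h0 : ∀ x, f x ≠ 0) :
    LD e (fun x => (f x)⁻¹) (fun x => -f' x / f x ^ 2) :=
  fun σ s => (hf σ s).fun_inv (h0 _)

lemma div {f f' g g' : Plane → ℝ} (hf : LD e f f') (hg : LD e g g') (h0 : ∀ x, g x ≠ 0) :
    LD e (fun x => f x / g x) (fun x => (f' x * g x - f x * g' x) / g x ^ 2) :=
  fun σ s => (hf σ s).fun_div (hg σ s) (h0 _)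

lemma translate {f f' : Plane → E} (hf : LD e f f') (η : Plane) :
    LD e (fun x => f (x + η)) (fun x => f' (x + η)) := by
  intro σ s
  have := hf (σ + η) s
  have e1 : ∀ r : ℝ, σ + r • e + η = σ + η + r • e := fun r => by abel
  simp only [e1]; exact this

lemma ofReal {f f' : Plane → ℝ} (hf : LD e f f') :
    LD e (fun x => (f x : ℂ)) (fun x => (f' x : ℂ)) := fun σ s => (hf σ s).ofReal_comp

lemma star {f f' : Plane → ℂ} (hf : LD e f f') :
    LD e (fun x => star (f x)) (fun x => star (f' x)) := fun σ s => (hf σ s).star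

lemma congr_right {f f' g' : Plane → E} (hf : LD e f f') (h : ∀ x, f' x = g' x) : LD e f g' := by
  have : f' = g' := funext h
  rwa [this] at hf

lemma cexp_phase {P q : Plane → ℝ} (hP : LD e P q) (t : ℝ) :
    LD e (fun x => Complex.exp (-(Complex.I * t * P x)))
      (fun x => -(Complex.I * t * q x) * Complex.exp (-(Complex.I * t * P x))) := by
  intro σ s
  have h1 : HasDerivAt (fun r : ℝ => -(Complex.I * t * (P (σ + r • e) : ℂ)))
      (-(Complex.I * t * (q (σ + s • e) : ℂ))) s :=
    (((hP σ s).ofReal_comp).const_mul (Complex.I * t)).fun_neg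
  exact h1.cexp.congr_deriv (mul_comm _ _)

lemma ibp {f f' g g' : Plane → ℂ} (hf : LD e f f') (hg : LD e g g')
    (h1 : Integrable fun x => f' x * g x) (h2 : Integrable fun x => f x * g' x)
    (h3 : Integrable fun x => f x * g x) :
    ∫ x, f x * g' x = -∫ x, f' x * g x :=
  integral_bilinear_hasLineDerivAt_right_eq_neg_left_of_integrable
    (B := ContinuousLinearMap.mul ℝ ℂ) h1 h2 h3
    (fun x _ => hf.hasLineDerivAt x) (fun x _ => hg.hasLineDerivAt x)

lemma mean_value {f f' : Plane → ℝ} (hf : LD e f f') (σ : Plane) {r : ℝ} (hr : 0 < r) :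
    ∃ s ∈ Set.Ioo 0 r, f (σ + r • e) - f σ = r * f' (σ + s • e) := by
  obtain ⟨s, hs, h⟩ := exists_hasDerivAt_eq_slope (fun r : ℝ => f (σ + r • e))
    (fun s => f' (σ + s • e)) hr
    (fun s _ => (hf σ s).continuousAt.continuousWithinAt) (fun s _ => hf σ s)
  refine ⟨s, hs, ?_⟩
  simp only [zero_smul, add_zero, sub_zero] at h
  rw [h]; field_simp

end LD

/-- One integration by parts against an oscillating exponential. -/
lemma oscillatory_step {e : Plane} {P q m : Plane → ℝ} {Z Y : Plane → ℂ} {t : ℝ} (ht : 0 ≤ t)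
    (hP : LD e P q) (hPc : Continuous P) (hm : ∀ x, m x * q x = 1)
    (hY : LD e (fun x => (m x : ℂ) * Z x) Y)
    (hYi : Integrable Y) (hZi : Integrable Z) (hmZ : Integrable fun x => (m x : ℂ) * Z x) :
    t * ‖∫ x, Complex.exp (-(Complex.I * t * P x)) * Z x‖ =
      ‖∫ x, Complex.exp (-(Complex.I * t * P x)) * Y x‖ := by
  have hE : ∀ x, ‖Complex.exp (-(Complex.I * t * P x))‖ = 1 := fun x => by
    rw [show -(Complex.I * t * P x) = Complex.I * ((-(t * P x) : ℝ) : ℂ) by push_cast; ring]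
    exact norm_cexp_I_mul _
  have hEm : AEStronglyMeasurable (fun x : Plane => Complex.exp (-(Complex.I * t * P x))) :=
    Continuous.aestronglyMeasurable (by fun_prop)
  have hi : ∀ {W : Plane → ℂ}, Integrable W →
      Integrable fun x => Complex.exp (-(Complex.I * t * P x)) * W x := fun hW =>
    hW.mono (hEm.mul hW.aestronglyMeasurable) (ae_of_all _ fun x => by rw [norm_mul, hE, one_mul])
  -- Since m q = 1, differentiating the exponential against m Z returns -it times the original
  -- integrand.
  have e1 : ∀ x, -(Complex.I * t * q x) * Complex.exp (-(Complex.I * t * P x)) * ((m x : ℂ) * Z x) =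
      -(Complex.I * t) * (Complex.exp (-(Complex.I * t * P x)) * Z x) := by
    intro x
    have : (m x : ℂ) * q x = 1 := by exact_mod_cast hm x
    linear_combination (-(Complex.I * t) * Complex.exp (-(Complex.I * t * P x)) * Z x) * this
  have h := (hP.cexp_phase t).ibp hY (by
    simp_rw [e1]; exact (hi hZi).const_mul _) (hi hYi) (hi hmZ)
  rw [h]
  simp_rw [e1]
  rw [integral_const_mul, norm_neg, norm_mul, norm_neg, norm_mul, Complex.norm_I, one_mul,
    Complex.norm_real, Real.norm_of_nonneg ht]

/-- Bounds for the reciprocal of the derivative of a phase and its first two derivatives, and for a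
cutoff, on the region where they matter. -/
structure Amplitude (e : Plane) (q m m' m'' X X' X'' : Plane → ℝ) (μ r κ : ℝ) : Prop where
  mul_eq : ∀ x, m x * q x = 1
  dm : LD e m m'
  dm' : LD e m' m''
  dX : LD e X X'
  dX' : LD e X' X''
  cm : Continuous m
  cm' : Continuous m'
  cm'' : Continuous m''
  cX : Continuous X
  cX' : Continuous X'
  cX'' : Continuous X''
  bX : ∀ x, |X x| ≤ κ
  bX' : ∀ x, |X' x| ≤ κ
  bX'' : ∀ x, |X'' x| ≤ κ
  bm : ∀ x, (X x = 0 ∧ X' x = 0 ∧ X'' x = 0) ∨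
    (|m x| ≤ μ * r ∧ |m' x| ≤ 3 * μ ^ 2 * r ∧ |m'' x| ≤ 33 * μ ^ 3 * r)
  one_le : 1 ≤ μ
  r_nonneg : 0 ≤ r

/-- Two integrations by parts. -/
lemma oscillatory_bound {e : Plane} {P q m m' m'' X X' X'' : Plane → ℝ} {μ r κ t : ℝ}
    (h : Amplitude e q m m' m'' X X' X'' μ r κ) (ht : 0 ≤ t)
    (hP : LD e P q) (hPc : Continuous P) {Φ Φ' Φ'' : Plane → ℂ} (hΦ : LD e Φ Φ')
    (hΦ' : LD e Φ' Φ'') (i0 : Integrable Φ) (i1 : Integrable Φ') (i2 : Integrable Φ'') :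
    t ^ 2 * ‖∫ x, Complex.exp (-(Complex.I * t * P x)) * ((X x : ℂ) * Φ x)‖ ≤
      52 * μ ^ 4 * r ^ 2 * κ * ((∫ x, ‖Φ x‖) + (∫ x, ‖Φ' x‖) + ∫ x, ‖Φ'' x‖) := by
  have hκ : 0 ≤ κ := (abs_nonneg _).trans (h.bX 0)
  have hμ : 0 ≤ μ := zero_le_one.trans h.one_le
  have hμ1 := h.one_le
  have hr := h.r_nonneg
  have p1 : μ ≤ μ ^ 2 := by nlinarith
  have p2 : μ ^ 2 ≤ μ ^ 3 := by nlinarith [pow_nonneg hμ 2]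
  have p3 : μ ^ 3 ≤ μ ^ 4 := by nlinarith [pow_nonneg hμ 3]
  set c : Plane → ℝ := fun x => m x * X x with hc
  set c' : Plane → ℝ := fun x => m' x * X x + m x * X' x with hc'
  set c'' : Plane → ℝ := fun x => m'' x * X x + m' x * X' x + (m' x * X' x + m x * X'' x) with hc''
  have dc : LD e c c' := h.dm.mul h.dX
  have dc' : LD e c' c'' := (h.dm'.mul h.dX).add (h.dm.mul h.dX')
  have cc : Continuous c := h.cm.mul h.cX
  have cc' : Continuous c' := (h.cm'.mul h.cX).add (h.cm.mul h.cX')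
  have cc'' : Continuous c'' :=
    ((h.cm''.mul h.cX).add (h.cm'.mul h.cX')).add ((h.cm'.mul h.cX').add (h.cm.mul h.cX''))
  -- Where the cutoff and its two derivatives vanish all is zero; elsewhere the bounds on m, m', m''
  -- multiply out. The 40 is 33 + 3 + 3 + 1, from the four terms of c''.
  have key : ∀ x, |c x| ≤ μ * r * κ ∧ |c' x| ≤ 4 * μ ^ 2 * r * κ ∧
      |m x * c x| ≤ μ ^ 2 * r ^ 2 * κ ∧ |m x * c' x| ≤ 4 * μ ^ 3 * r ^ 2 * κ ∧
      |m' x * c x| ≤ 3 * μ ^ 3 * r ^ 2 * κ ∧ |m' x * c' x| ≤ 12 * μ ^ 4 * r ^ 2 * κ ∧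
      |m x * c'' x| ≤ 40 * μ ^ 4 * r ^ 2 * κ := by
    intro x
    rcases h.bm x with ⟨z0, z1, z2⟩ | ⟨b0, b1, b2⟩
    · simp only [hc, hc', hc'', z0, z1, z2, mul_zero, add_zero, abs_zero]
      refine ⟨?_, ?_, ?_, ?_, ?_, ?_, ?_⟩ <;> positivity
    · have x0 := h.bX x
      have x1 := h.bX' x
      have x2 := h.bX'' x
      have k0 : |c x| ≤ μ * r * κ := by
        simp only [hc, abs_mul]; gcongr
      have k1 : |c' x| ≤ 4 * μ ^ 2 * r * κ := by
        refine (abs_add_le _ _).trans ?_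
        rw [abs_mul, abs_mul]
        calc |m' x| * |X x| + |m x| * |X' x| ≤ 3 * μ ^ 2 * r * κ + μ ^ 2 * r * κ := by
              gcongr; exact b0.trans (by gcongr)
          _ = _ := by ring
      have k2 : |c'' x| ≤ 40 * μ ^ 3 * r * κ := by
        have e1 : |c'' x| ≤ |m'' x| * |X x| + |m' x| * |X' x| + (|m' x| * |X' x| + |m x| * |X'' x|) := by
          simp only [hc'']
          refine (abs_add_le _ _).trans (add_le_add ((abs_add_le _ _).trans ?_)
            ((abs_add_le _ _).trans ?_)) <;> simp only [abs_mul, le_refl]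
        refine e1.trans ?_
        calc _ ≤ 33 * μ ^ 3 * r * κ + 3 * μ ^ 3 * r * κ + (3 * μ ^ 3 * r * κ + μ ^ 3 * r * κ) := by
              gcongr
              · exact b1.trans (by gcongr)
              · exact b1.trans (by gcongr)
              · exact b0.trans (by gcongr; linarith)
          _ = _ := by ring
      refine ⟨k0, k1, ?_, ?_, ?_, ?_, ?_⟩ <;> rw [abs_mul]
      · calc _ ≤ μ * r * (μ * r * κ) := by gcongr
          _ = _ := by ring
      · calc _ ≤ μ * r * (4 * μ ^ 2 * r * κ) := by gcongr
          _ = _ := by ring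
      · calc _ ≤ 3 * μ ^ 2 * r * (μ * r * κ) := by gcongr
          _ = _ := by ring
      · calc _ ≤ 3 * μ ^ 2 * r * (4 * μ ^ 2 * r * κ) := by gcongr
          _ = _ := by ring
      · calc _ ≤ μ * r * (40 * μ ^ 3 * r * κ) := by gcongr
          _ = _ := by ring
  have bi : ∀ {f : Plane → ℝ} {Ψ : Plane → ℂ} {B : ℝ}, Continuous f → (∀ x, |f x| ≤ B) →
      Integrable Ψ → Integrable fun x => (f x : ℂ) * Ψ x := by
    intro f Ψ B hf hB hΨ
    exact hΨ.bdd_mul (c := B) (Continuous.aestronglyMeasurable (by fun_prop))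
      (ae_of_all _ fun x => by simpa using hB x)
  set Z1 : Plane → ℂ := fun x => (c' x : ℂ) * Φ x + (c x : ℂ) * Φ' x with hZ1
  have dZ1 : LD e (fun x => (m x : ℂ) * ((X x : ℂ) * Φ x)) Z1 := by
    have := dc.ofReal.mul hΦ
    simp only [hc] at this
    have e1 : (fun x => (m x : ℂ) * ((X x : ℂ) * Φ x)) =
        fun x => ((m x * X x : ℝ) : ℂ) * Φ x := by
      ext x; push_cast; ring
    rw [e1]; exact this
  have iZ1 : Integrable Z1 :=
    (bi cc' (fun x => (key x).2.1) i0).add (bi cc (fun x => (key x).1) i1)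
  have s1 := oscillatory_step ht hP hPc h.mul_eq dZ1 iZ1 (bi h.cX h.bX i0) (by
    have := bi cc (fun x => (key x).1) i0
    refine this.congr (ae_of_all _ fun x => ?_)
    simp only [hc]; push_cast; ring)
  set Z2 : Plane → ℂ := fun x => ((m' x * c' x + m x * c'' x : ℝ) : ℂ) * Φ x +
    ((m x * c' x : ℝ) : ℂ) * Φ' x + (((m' x * c x + m x * c' x : ℝ) : ℂ) * Φ' x +
      ((m x * c x : ℝ) : ℂ) * Φ'' x) with hZ2
  have dZ2 : LD e (fun x => (m x : ℂ) * Z1 x) Z2 := by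
    have := ((h.dm.mul dc').ofReal.mul hΦ).add ((h.dm.mul dc).ofReal.mul hΦ')
    have e1 : (fun x => (m x : ℂ) * Z1 x) =
        fun x => ((m x * c' x : ℝ) : ℂ) * Φ x + ((m x * c x : ℝ) : ℂ) * Φ' x := by
      ext x; simp only [hZ1]; push_cast; ring
    rw [e1]; exact this
  -- This coefficient fixes the final constant: 52 = 12 + 40. Those of Φ' and Φ'' are smaller
  -- because μ ≥ 1.
  have bA0 : ∀ x, |m' x * c' x + m x * c'' x| ≤ 52 * μ ^ 4 * r ^ 2 * κ := fun x => by
    have := key x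
    refine (abs_add_le _ _).trans ?_
    linarith [this.2.2.2.2.2.1, this.2.2.2.2.2.2]
  have bA1 : ∀ x, |m' x * c x + m x * c' x| ≤ 7 * μ ^ 3 * r ^ 2 * κ := fun x => by
    have := key x
    refine (abs_add_le _ _).trans ?_
    linarith [this.2.2.2.2.1, this.2.2.2.1]
  have iZ2 : Integrable Z2 := by
    refine ((bi ?_ bA0 i0).add (bi ?_ (fun x => (key x).2.2.2.1) i1)).add
      ((bi ?_ bA1 i1).add (bi ?_ (fun x => (key x).2.2.1) i2))
    · exact (h.cm'.mul cc').add (h.cm.mul cc'')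
    · exact h.cm.mul cc'
    · exact (h.cm'.mul cc).add (h.cm.mul cc')
    · exact h.cm.mul cc
  have s2 := oscillatory_step ht hP hPc h.mul_eq dZ2 iZ2 iZ1 (by
    have := (bi (h.cm.mul cc') (fun x => (key x).2.2.2.1) i0).add
      (bi (h.cm.mul cc) (fun x => (key x).2.2.1) i1)
    refine this.congr (ae_of_all _ fun x => ?_)
    simp only [hZ1, Pi.add_apply, Pi.mul_apply]; push_cast; ring)
  rw [pow_two, mul_assoc, s1, s2]
  refine (norm_integral_le_integral_norm _).trans ?_
  have hs : (∫ x, ‖Φ x‖) + (∫ x, ‖Φ' x‖) + ∫ x, ‖Φ'' x‖ =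
      ∫ x, (‖Φ x‖ + ‖Φ' x‖ + ‖Φ'' x‖) := by
    rw [← integral_add i0.norm i1.norm]
    exact (integral_add (i0.norm.add i1.norm) i2.norm).symm
  rw [hs, ← integral_const_mul]
  refine integral_mono_of_nonneg (ae_of_all _ fun x => norm_nonneg _)
    (((i0.norm.add i1.norm).add i2.norm).const_mul _) (ae_of_all _ fun x => ?_)
  simp only
  have hE : ‖Complex.exp (-(Complex.I * t * P x))‖ = 1 := by
    rw [show -(Complex.I * t * P x) = Complex.I * ((-(t * P x) : ℝ) : ℂ) by push_cast; ring]
    exact norm_cexp_I_mul _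
  rw [norm_mul, hE, one_mul]
  have hn : ‖Z2 x‖ ≤ |m' x * c' x + m x * c'' x| * ‖Φ x‖ + |m x * c' x| * ‖Φ' x‖ +
      (|m' x * c x + m x * c' x| * ‖Φ' x‖ + |m x * c x| * ‖Φ'' x‖) := by
    simp only [hZ2]
    refine (norm_add_le _ _).trans (add_le_add ((norm_add_le _ _).trans ?_)
      ((norm_add_le _ _).trans ?_)) <;>
    · rw [norm_mul, norm_mul, Complex.norm_real, Complex.norm_real, Real.norm_eq_abs,
        Real.norm_eq_abs]
  refine hn.trans ?_
  have k := key x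
  have hrk : 0 ≤ r ^ 2 * κ := by positivity
  have q0 := bA0 x
  have q1 : |m x * c' x| + |m' x * c x + m x * c' x| ≤ 52 * μ ^ 4 * r ^ 2 * κ := by
    have := bA1 x
    have h3 := k.2.2.2.1
    have : μ ^ 3 * (r ^ 2 * κ) ≤ μ ^ 4 * (r ^ 2 * κ) := by gcongr
    nlinarith [mul_nonneg (pow_nonneg hμ 4) hrk]
  have q2 : |m x * c x| ≤ 52 * μ ^ 4 * r ^ 2 * κ := by
    have h3 := k.2.2.1
    have : μ ^ 2 * (r ^ 2 * κ) ≤ μ ^ 4 * (r ^ 2 * κ) := by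
      apply mul_le_mul_of_nonneg_right _ hrk; linarith
    nlinarith [mul_nonneg (pow_nonneg hμ 4) hrk]
  have n0 := norm_nonneg (Φ x)
  have n1 := norm_nonneg (Φ' x)
  have n2 := norm_nonneg (Φ'' x)
  have := mul_le_mul_of_nonneg_right q0 n0
  have := mul_le_mul_of_nonneg_right q1 n1
  have := mul_le_mul_of_nonneg_right q2 n2
  linarith

/-! ### Directional derivatives of the bracket -/

/-- First derivative of the bracket in the direction `e`. -/
noncomputable def jb1 (e x : Plane) : ℝ := inner ℝ e x / jb x

/-- Second derivative of the bracket in the direction `e`. -/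
noncomputable def jb2 (e x : Plane) : ℝ := (1 - jb1 e x ^ 2) / jb x

/-- Third derivative of the bracket in the direction `e`. -/
noncomputable def jb3 (e x : Plane) : ℝ := -3 * jb1 e x * jb2 e x / jb x

/-- Fourth derivative of the bracket in the direction `e`. -/
noncomputable def jb4 (e x : Plane) : ℝ :=
  -3 * (jb2 e x ^ 2 + jb1 e x * jb3 e x - jb1 e x ^ 2 * jb2 e x / jb x) / jb x

section

variable {e : Plane}

lemma hasFDerivAt_jb (x : Plane) : HasFDerivAt jb ((jb x)⁻¹ • innerSL ℝ x) x := by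
  have h1 : HasFDerivAt (fun x : Plane => 1 + ‖x‖ ^ 2) (2 • innerSL ℝ x) x :=
    (hasStrictFDerivAt_norm_sq x).hasFDerivAt.const_add 1
  have h2 := h1.sqrt (by positivity)
  have e1 : (fun x : Plane => √(1 + ‖x‖ ^ 2)) = jb := rfl
  rw [e1] at h2
  refine h2.congr_fderiv ?_
  have hs : √(1 + ‖x‖ ^ 2) = jb x := rfl
  have := jb_ne x
  rw [hs]
  ext v
  simp
  field_simp

lemma ld_jb : LD e jb (jb1 e) := by
  refine LD.of_hasLineDerivAt fun x => ?_
  have := (hasFDerivAt_jb x).hasLineDerivAt e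
  have e1 : ((jb x)⁻¹ • innerSL ℝ x) e = jb1 e x := by
    rw [jb1, real_inner_comm, div_eq_inv_mul]
    rfl
  rwa [e1] at this

lemma ld_inner (he : ‖e‖ = 1) : LD e (fun x => inner ℝ e x) (fun _ => 1) := by
  refine LD.of_hasLineDerivAt fun x => ?_
  have := ((innerSL ℝ e).hasFDerivAt (x := x)).hasLineDerivAt e
  simpa [he] using this

lemma ld_jb1 (he : ‖e‖ = 1) : LD e (jb1 e) (jb2 e) := by
  refine ((ld_inner he).div ld_jb jb_ne).congr_right fun x => ?_
  have := jb_ne x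
  simp only [jb2, jb1]
  field_simp

lemma ld_jb2 (he : ‖e‖ = 1) : LD e (jb2 e) (jb3 e) := by
  have h1 : LD e (fun _ : Plane => (1 : ℝ)) (fun _ => 0) := fun σ s => hasDerivAt_const _ _
  have h := (h1.sub ((ld_jb1 he).mul (ld_jb1 he))).div ld_jb jb_ne
  have e1 : (fun x => (1 - jb1 e x * jb1 e x) / jb x) = jb2 e := by
    ext x; rw [jb2, pow_two]
  rw [e1] at h
  refine h.congr_right fun x => ?_
  have := jb_ne x
  simp only [jb3, jb2]
  field_simp
  ring

lemma ld_jb3 (he : ‖e‖ = 1) : LD e (jb3 e) (jb4 e) := by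
  have h := (((ld_jb1 he).const_mul (-3)).mul (ld_jb2 he)).div ld_jb jb_ne
  refine h.congr_right fun x => ?_
  have := jb_ne x
  simp only [jb4]
  field_simp
  ring

lemma continuous_jb1 : Continuous (jb1 e) := by
  unfold jb1; exact (by fun_prop : Continuous fun x : Plane => inner ℝ e x).div continuous_jb jb_ne

lemma continuous_jb2 : Continuous (jb2 e) := by
  unfold jb2; exact (continuous_const.sub (continuous_jb1.pow 2)).div continuous_jb jb_ne

lemma continuous_jb3 : Continuous (jb3 e) := by
  unfold jb3
  exact ((continuous_const.mul continuous_jb1).mul continuous_jb2).div continuous_jb jb_ne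

lemma inner_sq_le (he : ‖e‖ = 1) (x : Plane) : (inner ℝ e x) ^ 2 ≤ ‖x‖ ^ 2 := by
  have := abs_real_inner_le_norm e x
  rw [he, one_mul] at this
  exact sq_le_sq' (by linarith [neg_abs_le (inner ℝ e x)]) ((le_abs_self _).trans this)

lemma jb1_sq_le (he : ‖e‖ = 1) (x : Plane) : jb1 e x ^ 2 ≤ 1 - (jb x ^ 2)⁻¹ := by
  have h := inner_sq_le he x
  have h2 := jb_sq x
  have h3 : 0 < jb x ^ 2 := pow_pos (jb_pos x) 2
  rw [jb1, div_pow, div_le_iff₀ h3, sub_mul, inv_mul_cancel₀ h3.ne']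
  linarith

lemma abs_jb1_le (he : ‖e‖ = 1) (x : Plane) : |jb1 e x| ≤ 1 := by
  have h := jb1_sq_le he x
  have : 0 < (jb x ^ 2)⁻¹ := inv_pos.2 (pow_pos (jb_pos x) 2)
  rw [← sq_le_one_iff_abs_le_one]; linarith

/-- Strict convexity of the bracket: the least eigenvalue of its Hessian is ⟨x⟩^{-3}, attained
radially. Both the non-stationary phase bounds and the separation of velocities rest on it. -/
lemma le_jb2 (he : ‖e‖ = 1) (x : Plane) : (jb x ^ 3)⁻¹ ≤ jb2 e x := by
  have h := jb1_sq_le he x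
  rw [jb2, le_div_iff₀ (jb_pos x)]
  have : (jb x ^ 3)⁻¹ * jb x = (jb x ^ 2)⁻¹ := by have := jb_ne x; field_simp
  rw [this]; linarith

lemma jb2_pos (he : ‖e‖ = 1) (x : Plane) : 0 < jb2 e x :=
  lt_of_lt_of_le (inv_pos.2 (pow_pos (jb_pos x) 3)) (le_jb2 he x)

lemma jb2_le (x : Plane) : jb2 e x ≤ 1 := by
  rw [jb2, div_le_one (jb_pos x)]
  linarith [sq_nonneg (jb1 e x), one_le_jb x]

lemma abs_jb2_le (he : ‖e‖ = 1) (x : Plane) : |jb2 e x| ≤ 1 := by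
  rw [abs_of_pos (jb2_pos he x)]; exact jb2_le x

lemma abs_div_jb_le (a : ℝ) (x : Plane) : |a / jb x| ≤ |a| := by
  rw [abs_div, abs_of_pos (jb_pos x)]; exact div_le_self (abs_nonneg _) (one_le_jb x)

lemma abs_jb3_le (he : ‖e‖ = 1) (x : Plane) : |jb3 e x| ≤ 3 := by
  refine (abs_div_jb_le _ x).trans ?_
  rw [abs_mul, abs_mul]
  have := mul_le_one₀ (abs_jb1_le he x) (abs_nonneg _) (abs_jb2_le he x)
  norm_num
  linarith

lemma abs_jb4_le (he : ‖e‖ = 1) (x : Plane) : |jb4 e x| ≤ 15 := by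
  refine (abs_div_jb_le _ x).trans ?_
  have h1 := abs_jb1_le he x
  have h2 := abs_jb2_le he x
  have h3 := abs_jb3_le he x
  have a1 : |jb2 e x ^ 2| ≤ 1 := by rw [abs_pow]; exact pow_le_one₀ (abs_nonneg _) h2
  have a2 : |jb1 e x * jb3 e x| ≤ 3 := by
    rw [abs_mul]; nlinarith [abs_nonneg (jb1 e x), abs_nonneg (jb3 e x)]
  have a3 : |jb1 e x ^ 2 * jb2 e x / jb x| ≤ 1 := by
    refine (abs_div_jb_le _ x).trans ?_
    rw [abs_mul, abs_pow]
    exact mul_le_one₀ (pow_le_one₀ (abs_nonneg _) h1) (abs_nonneg _) h2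
  rw [abs_mul]
  have := abs_sub (jb2 e x ^ 2 + jb1 e x * jb3 e x) (jb1 e x ^ 2 * jb2 e x / jb x)
  have := abs_add_le (jb2 e x ^ 2) (jb1 e x * jb3 e x)
  norm_num
  linarith

lemma ld_abs_sub_le {f f' : Plane → ℝ} (hf : LD e f f') {B : ℝ} (hB : ∀ x, |f' x| ≤ B) {h : ℝ}
    (hh : 0 < h) (σ : Plane) : |f (σ + h • e) - f σ| ≤ B * h := by
  obtain ⟨s, -, hs⟩ := hf.mean_value σ hh
  rw [hs, abs_mul, abs_of_pos hh, mul_comm]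
  exact mul_le_mul_of_nonneg_right (hB _) hh.le

/-! ### Cutoffs -/

lemma exists_norm_le_of_hasCompactSupport {E : Type*} [NormedAddCommGroup E] {f : Plane → E}
    (hf : Continuous f) (hs : HasCompactSupport f) : ∃ k, ∀ x, ‖f x‖ ≤ k :=
  hf.bounded_above_of_compact_support hs

/-- Uniform bounds for a smooth bump and its first two derivatives. -/
lemma IsBump.exists_bound {ρ : Plane → ℝ} (hρ : IsBump ρ) : ∃ κ : ℝ, 1 ≤ κ ∧
    (∀ x, |ρ x| ≤ κ) ∧ (∀ x, ‖fderiv ℝ ρ x‖ ≤ κ) ∧ ∀ x, ‖fderiv ℝ (fderiv ℝ ρ) x‖ ≤ κ := by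
  have hc : HasCompactSupport ρ :=
    HasCompactSupport.intro' (isCompact_closedBall (0 : Plane) 2) Metric.isClosed_closedBall
      fun x hx => image_eq_zero_of_notMem_tsupport fun h =>
        hx (Metric.ball_subset_closedBall (hρ.support h))
  have h1 : ContDiff ℝ ∞ (fderiv ℝ ρ) := hρ.smooth.fderiv_right (by simp)
  have h2 : ContDiff ℝ ∞ (fderiv ℝ (fderiv ℝ ρ)) := h1.fderiv_right (by simp)
  have c1 : HasCompactSupport (fderiv ℝ ρ) := hc.fderiv ℝ
  have c2 : HasCompactSupport (fderiv ℝ (fderiv ℝ ρ)) := c1.fderiv ℝ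
  obtain ⟨k0, hk0⟩ := exists_norm_le_of_hasCompactSupport hρ.smooth.continuous hc
  obtain ⟨k1, hk1⟩ := exists_norm_le_of_hasCompactSupport h1.continuous c1
  obtain ⟨k2, hk2⟩ := exists_norm_le_of_hasCompactSupport h2.continuous c2
  have m1 : k0 ≤ max 1 (max k0 (max k1 k2)) := (le_max_left _ _).trans (le_max_right _ _)
  have m2 : k1 ≤ max 1 (max k0 (max k1 k2)) :=
    ((le_max_left _ _).trans (le_max_right _ _)).trans (le_max_right _ _)
  have m3 : k2 ≤ max 1 (max k0 (max k1 k2)) :=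
    ((le_max_right _ _).trans (le_max_right _ _)).trans (le_max_right _ _)
  exact ⟨max 1 (max k0 (max k1 k2)), le_max_left _ _, fun x => (hk0 x).trans m1,
    fun x => (hk1 x).trans m2, fun x => (hk2 x).trans m3⟩

/-- A dilated bump with its first two derivatives in a direction. -/
structure Cutoff (e : Plane) (M κ : ℝ) (χ χ' χ'' : Plane → ℝ) : Prop where
  d : LD e χ χ'
  d' : LD e χ' χ''
  c : Continuous χ
  c' : Continuous χ'
  c'' : Continuous χ''
  b : ∀ x, |χ x| ≤ κ
  b' : ∀ x, |χ' x| ≤ κ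
  b'' : ∀ x, |χ'' x| ≤ κ
  z : ∀ x, 2 * M ≤ ‖x‖ → χ x = 0 ∧ χ' x = 0 ∧ χ'' x = 0

/-- Dilating by M ≥ 1 only shrinks derivatives, so the bounds for `ρ` serve for all M at once. -/
lemma IsBump.cutoff {ρ : Plane → ℝ} (hρ : IsBump ρ) {κ : ℝ} (h0 : ∀ x, |ρ x| ≤ κ)
    (h1 : ∀ x, ‖fderiv ℝ ρ x‖ ≤ κ) (h2 : ∀ x, ‖fderiv ℝ (fderiv ℝ ρ) x‖ ≤ κ) (he : ‖e‖ = 1)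
    {M : ℝ} (hM : 1 ≤ M) :
    Cutoff e M κ (fun x => ρ (M⁻¹ • x)) (fun x => M⁻¹ * fderiv ℝ ρ (M⁻¹ • x) e)
      (fun x => M⁻¹ * (M⁻¹ * fderiv ℝ (fderiv ℝ ρ) (M⁻¹ • x) e e)) := by
  have hκ : 0 ≤ κ := (abs_nonneg _).trans (h0 0)
  have hM0 : 0 < M := one_pos.trans_le hM
  have hMi : M⁻¹ ≤ 1 := inv_le_one_of_one_le₀ hM
  have hMi0 : 0 ≤ M⁻¹ := inv_nonneg.2 hM0.le
  have s1 : ContDiff ℝ ∞ (fderiv ℝ ρ) := hρ.smooth.fderiv_right (by simp)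
  have s2 : ContDiff ℝ ∞ (fderiv ℝ (fderiv ℝ ρ)) := s1.fderiv_right (by simp)
  have dil : ∀ {f f' : Plane → ℝ}, LD e f f' →
      LD e (fun x => f (M⁻¹ • x)) (fun x => M⁻¹ * f' (M⁻¹ • x)) := by
    intro f f' hf σ s
    have k1 := hf (M⁻¹ • σ) (M⁻¹ * s)
    have k2 : HasDerivAt (fun r : ℝ => M⁻¹ * r) M⁻¹ s := by
      simpa using (hasDerivAt_id s).const_mul M⁻¹
    have k3 := HasDerivAt.scomp (g₁ := fun r : ℝ => f (M⁻¹ • σ + r • e)) s k1 k2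
    have e1 : ∀ r : ℝ, M⁻¹ • (σ + r • e) = M⁻¹ • σ + (M⁻¹ * r) • e := fun r => by module
    simp only [e1]
    exact k3
  have l1 : LD e ρ (fun x => fderiv ℝ ρ x e) := LD.of_fderiv (hρ.smooth.differentiable (by simp))
  have l2 : LD e (fun x => fderiv ℝ ρ x e) (fun x => fderiv ℝ (fderiv ℝ ρ) x e e) := by
    intro σ s
    have := LD.of_fderiv (e := e) (s1.differentiable (by simp)) σ s
    exact this.clm_apply (hasDerivAt_const s e) |>.congr_deriv (by simp)
  have ap : ∀ x, |fderiv ℝ ρ x e| ≤ κ := fun x =>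
    (((fderiv ℝ ρ x).le_opNorm e).trans (by rw [he, mul_one])).trans (h1 x)
  have ap2 : ∀ x, |fderiv ℝ (fderiv ℝ ρ) x e e| ≤ κ := fun x =>
    (((fderiv ℝ (fderiv ℝ ρ) x).le_opNorm₂ e e).trans (by rw [he, mul_one, mul_one])).trans (h2 x)
  have sm : ∀ {b : ℝ}, |b| ≤ κ → |M⁻¹ * b| ≤ κ := by
    intro b hb
    rw [abs_mul, abs_of_nonneg hMi0]
    exact (mul_le_of_le_one_left (abs_nonneg _) hMi).trans hb
  refine ⟨dil l1, (dil l2).const_mul _, ?_, ?_, ?_, fun x => h0 _, fun x => sm (ap _),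
    fun x => sm (sm (ap2 _)), fun x hx => ?_⟩
  · exact hρ.smooth.continuous.comp (continuous_const_smul _)
  · exact continuous_const.mul ((s1.continuous.comp (continuous_const_smul _)).clm_apply
      continuous_const)
  · exact continuous_const.mul (continuous_const.mul
      (((s2.continuous.comp (continuous_const_smul _)).clm_apply continuous_const).clm_apply
      continuous_const))
  · have hout : M⁻¹ • x ∉ tsupport ρ := fun h => by
      have := hρ.support h
      rw [mem_ball_zero_iff, norm_smul, Real.norm_of_nonneg hMi0, inv_mul_lt_iff₀ hM0] at this
      linarith
    have hout1 : M⁻¹ • x ∉ tsupport (fderiv ℝ ρ) := fun h => hout (tsupport_fderiv_subset ℝ h)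
    have hout2 : M⁻¹ • x ∉ tsupport (fderiv ℝ (fderiv ℝ ρ)) :=
      fun h => hout1 (tsupport_fderiv_subset ℝ h)
    refine ⟨image_eq_zero_of_notMem_tsupport hout, ?_, ?_⟩
    · simp [image_eq_zero_of_notMem_tsupport hout1]
    · simp [image_eq_zero_of_notMem_tsupport hout2]

/-- The amplitude for the phase `⟨σ + η⟩ - ⟨σ⟩`, localized to `|σ|, |σ + η| ≤ 2 M`. -/
lemma exists_amplitude (he : ‖e‖ = 1) {h M κ : ℝ} (hh : 0 < h) (hκ : 1 ≤ κ)
    {χ χ' χ'' : Plane → ℝ} (hχ : Cutoff e M κ χ χ' χ'') :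
    ∃ m m' m'' X' X'' : Plane → ℝ,
      Amplitude e (fun σ => jb1 e (σ + h • e) - jb1 e σ) m m' m''
        (fun σ => χ (σ + h • e) * χ σ) X' X'' (bracket (2 * M) ^ 3) h⁻¹ (4 * κ ^ 2) := by
  have hκ0 : 0 ≤ κ := zero_le_one.trans hκ
  set q : Plane → ℝ := fun σ => jb1 e (σ + h • e) - jb1 e σ with hq
  set q' : Plane → ℝ := fun σ => jb2 e (σ + h • e) - jb2 e σ with hq'
  set q'' : Plane → ℝ := fun σ => jb3 e (σ + h • e) - jb3 e σ with hq''
  have dq : LD e q q' := ((ld_jb1 he).translate _).sub (ld_jb1 he)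
  have dq' : LD e q' q'' := ((ld_jb2 he).translate _).sub (ld_jb2 he)
  have cq : Continuous q := (continuous_jb1.comp (by fun_prop)).sub continuous_jb1
  have cq' : Continuous q' := (continuous_jb2.comp (by fun_prop)).sub continuous_jb2
  have cq'' : Continuous q'' := (continuous_jb3.comp (by fun_prop)).sub continuous_jb3
  -- By convexity along `e` the phase derivative vanishes nowhere, even off the cutoff, so its
  -- reciprocal is defined on the whole plane.
  have qpos : ∀ σ, 0 < q σ := fun σ => by
    obtain ⟨s, -, hs⟩ := (ld_jb1 he).mean_value σ hh
    simp only [hq]; rw [hs]; exact mul_pos hh (jb2_pos he _)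
  have qne : ∀ σ, q σ ≠ 0 := fun σ => (qpos σ).ne'
  have bq' : ∀ σ, |q' σ| ≤ 3 * h := fun σ => ld_abs_sub_le (ld_jb2 he) (abs_jb3_le he) hh σ
  have bq'' : ∀ σ, |q'' σ| ≤ 15 * h := fun σ => ld_abs_sub_le (ld_jb3 he) (abs_jb4_le he) hh σ
  have dX := (hχ.d.translate (h • e)).mul hχ.d
  have dX' := ((hχ.d'.translate (h • e)).mul hχ.d).add ((hχ.d.translate (h • e)).mul hχ.d')
  have tr : Continuous fun σ : Plane => σ + h • e := by fun_prop
  set μ := bracket (2 * M) ^ 3 with hμ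
  have hμ1 : 1 ≤ μ := one_le_pow₀ (one_le_bracket _)
  have dm' : LD e (fun x => -q' x / q x ^ 2)
      (fun x => -q'' x / q x ^ 2 + 2 * q' x ^ 2 / q x ^ 3) := by
    have k := (dq'.const_mul (-1)).div (dq.mul dq) (fun x => mul_ne_zero (qne x) (qne x))
    have e1 : (fun x => -1 * q' x / (q x * q x)) = fun x => -q' x / q x ^ 2 := by
      ext x; rw [pow_two, neg_one_mul]
    rw [e1] at k
    refine k.congr_right fun x => ?_
    have := qne x
    field_simp
    ring
  refine ⟨fun x => (q x)⁻¹, fun x => -q' x / q x ^ 2,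
    fun x => -q'' x / q x ^ 2 + 2 * q' x ^ 2 / q x ^ 3, _, _,
    fun x => inv_mul_cancel₀ (qne x), dq.inv qne, dm', dX, dX', cq.inv₀ qne,
    cq'.neg.div (cq.pow 2) fun x => pow_ne_zero 2 (qne x),
    (cq''.neg.div (cq.pow 2) fun x => pow_ne_zero 2 (qne x)).add
      ((continuous_const.mul (cq'.pow 2)).div (cq.pow 3) fun x => pow_ne_zero 3 (qne x)),
    (hχ.c.comp tr).mul hχ.c, ((hχ.c'.comp tr).mul hχ.c).add ((hχ.c.comp tr).mul hχ.c'),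
    (((hχ.c''.comp tr).mul hχ.c).add ((hχ.c'.comp tr).mul hχ.c')).add
      (((hχ.c'.comp tr).mul hχ.c').add ((hχ.c.comp tr).mul hχ.c'')), ?_, ?_, ?_, ?_, hμ1,
    inv_nonneg.2 hh.le⟩
  · intro x
    rw [abs_mul]
    have := mul_le_mul (hχ.b (x + h • e)) (hχ.b x) (abs_nonneg _) hκ0
    nlinarith
  · intro x
    refine (abs_add_le _ _).trans ?_
    rw [abs_mul, abs_mul]
    have := mul_le_mul (hχ.b' (x + h • e)) (hχ.b x) (abs_nonneg _) hκ0
    have := mul_le_mul (hχ.b (x + h • e)) (hχ.b' x) (abs_nonneg _) hκ0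
    nlinarith
  · intro x
    refine (abs_add_le _ _).trans ((add_le_add (abs_add_le _ _) (abs_add_le _ _)).trans ?_)
    simp only [abs_mul]
    have := mul_le_mul (hχ.b'' (x + h • e)) (hχ.b x) (abs_nonneg _) hκ0
    have := mul_le_mul (hχ.b' (x + h • e)) (hχ.b' x) (abs_nonneg _) hκ0
    have := mul_le_mul (hχ.b (x + h • e)) (hχ.b'' x) (abs_nonneg _) hκ0
    nlinarith
  · intro x
    by_cases h1 : 2 * M ≤ ‖x‖
    · obtain ⟨z0, z1, z2⟩ := hχ.z x h1
      left; simp [z0, z1, z2]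
    by_cases h2 : 2 * M ≤ ‖x + h • e‖
    · obtain ⟨z0, z1, z2⟩ := hχ.z _ h2
      left; simp [z0, z1, z2]
    right
    push Not at h1 h2
    -- The intermediate point lies on a segment joining two points of the ball of radius 2M, hence
    -- in that ball, where the second derivative is at least μ⁻¹.
    have lower : h / μ ≤ q x := by
      obtain ⟨s, hs, hs2⟩ := (ld_jb1 he).mean_value x hh
      simp only [hq]
      rw [hs2, div_eq_mul_inv]
      refine mul_le_mul_of_nonneg_left (le_trans ?_ (le_jb2 he _)) hh.le
      refine inv_anti₀ (pow_pos (jb_pos _) 3) (pow_le_pow_left₀ (jb_pos _).le ?_ 3)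
      have hn : ‖x + s • e‖ ≤ 2 * M := by
        have hc : x + s • e ∈ Metric.closedBall (0 : Plane) (2 * M) := by
          refine (convex_closedBall (0 : Plane) (2 * M)).segment_subset (x := x) (y := x + h • e)
            (by simpa using h1.le) (by simpa using h2.le) ?_
          rw [segment_eq_image']
          refine ⟨s / h, ⟨div_nonneg hs.1.le hh.le, (div_le_one hh).2 hs.2.le⟩, ?_⟩
          simp only [add_sub_cancel_left, smul_smul]
          rw [div_mul_cancel₀ _ hh.ne']
        simpa using hc
      unfold jb bracket
      exact Real.sqrt_le_sqrt (by gcongr)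
    have hμ0 : 0 < μ := one_pos.trans_le hμ1
    have hinv : (q x)⁻¹ ≤ μ * h⁻¹ := by
      have := inv_anti₀ (div_pos hh hμ0) lower
      rwa [inv_div, div_eq_mul_inv] at this
    have hq0 := qpos x
    have hi0 : 0 ≤ (q x)⁻¹ := inv_nonneg.2 hq0.le
    have i2 : (q x ^ 2)⁻¹ ≤ (μ * h⁻¹) ^ 2 := by
      rw [← inv_pow]; exact pow_le_pow_left₀ hi0 hinv 2
    have i3 : (q x ^ 3)⁻¹ ≤ (μ * h⁻¹) ^ 3 := by
      rw [← inv_pow]; exact pow_le_pow_left₀ hi0 hinv 3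
    refine ⟨?_, ?_, ?_⟩
    · rw [abs_of_nonneg hi0]; exact hinv
    · rw [abs_div, abs_neg, abs_of_pos (pow_pos hq0 2), div_eq_mul_inv]
      calc |q' x| * (q x ^ 2)⁻¹ ≤ 3 * h * (μ * h⁻¹) ^ 2 :=
            mul_le_mul (bq' x) i2 (by positivity) (by positivity)
        _ = _ := by field_simp
    · refine (abs_add_le _ _).trans ?_
      rw [abs_div, abs_div, abs_neg, abs_of_pos (pow_pos hq0 2), abs_of_pos (pow_pos hq0 3),
        div_eq_mul_inv, div_eq_mul_inv, abs_mul, abs_pow, abs_two]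
      calc |q'' x| * (q x ^ 2)⁻¹ + 2 * |q' x| ^ 2 * (q x ^ 3)⁻¹
          ≤ 15 * h * (μ * h⁻¹) ^ 2 + 2 * (3 * h) ^ 2 * (μ * h⁻¹) ^ 3 := by
            gcongr
            · exact bq'' x
            · exact bq' x
        _ = (15 * μ ^ 2 + 18 * μ ^ 3) * h⁻¹ := by field_simp; ring
        -- Here 15 μ² is absorbed into 15 μ³, since μ ≥ 1; 33 = 15 + 18.
        _ ≤ 33 * μ ^ 3 * h⁻¹ := by
            gcongr
            nlinarith [pow_pos hμ0 2]

end

/-! ### Decay of the transform of the density -/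

lemma integral_mul_le_sqrt {A B : Plane → ℝ} (hA0 : ∀ x, 0 ≤ A x) (hB0 : ∀ x, 0 ≤ B x)
    (hA : MemLp A 2) (hB : MemLp B 2) :
    ∫ x, A x * B x ≤ √(∫ x, A x ^ 2) * √(∫ x, B x ^ 2) := by
  have h := integral_mul_le_Lp_mul_Lq_of_nonneg (μ := volume) (p := 2) (q := 2)
    Real.HolderConjugate.two_two (ae_of_all _ hA0) (ae_of_all _ hB0)
    (by simpa using hA) (by simpa using hB)
  simpa [Real.sqrt_eq_rpow] using h

lemma jb_rpow_sq (s : ℝ) (x : Plane) : (jb x ^ s) ^ 2 = jb x ^ (2 * s) := by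
  rw [mul_comm, Real.rpow_mul (jb_pos x).le, Real.rpow_two]

lemma memLp_translate {A : Plane → ℂ} (hA : MemLp A 2) (η : Plane) :
    MemLp (fun σ => A (σ + η)) 2 :=
  hA.comp_measurePreserving (measurePreserving_add_right volume η)

lemma integrable_translate_mul {A B : Plane → ℂ} (hA : MemLp A 2) (hB : MemLp B 2) (η : Plane) :
    Integrable fun σ => A (σ + η) * star (B σ) :=
  (memLp_translate hA η).integrable_mul hB.star

lemma integral_translate_mul_le {A B : Plane → ℂ} (hA : MemLp A 2) (hB : MemLp B 2) (η : Plane) :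
    ∫ σ, ‖A (σ + η) * star (B σ)‖ ≤ √(∫ x, ‖A x‖ ^ 2) * √(∫ x, ‖B x‖ ^ 2) := by
  have h := integral_mul_le_sqrt (fun x => norm_nonneg (A (x + η))) (fun x => norm_nonneg (B x))
    (memLp_translate hA η).norm hB.norm
  rw [integral_add_right_eq_self (fun x => ‖A x‖ ^ 2) η] at h
  simpa only [norm_mul, norm_star] using h

lemma schwartz_ld (f : 𝓢(Plane, ℂ)) (e : Plane) : LD e f (∂_{e} f : 𝓢(Plane, ℂ)) :=
  (LD.of_fderiv f.differentiable).congr_right fun x => by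
    rw [SchwartzMap.lineDerivOp_apply_eq_fderiv]

/-- The norm in `L²` of `f` and its first two derivatives in every direction is at most `N`. -/
structure SobolevTwo (N : ℝ) (f : 𝓢(Plane, ℂ)) : Prop where
  zero : ∫ x, ‖f x‖ ^ 2 ≤ N ^ 2
  one : ∀ e : Plane, ‖e‖ = 1 → ∫ x, ‖(∂_{e} f) x‖ ^ 2 ≤ N ^ 2
  two : ∀ e : Plane, ‖e‖ = 1 → ∫ x, ‖(∂_{e} (∂_{e} f)) x‖ ^ 2 ≤ N ^ 2

section

variable {e : Plane}

/-- The product f(σ+η) times the conjugate of f(σ) and its first two derivatives consist of 1, 2 and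
4 terms, each at most N² in L¹ by Cauchy–Schwarz; 364 = 52 · (1 + 2 + 4). -/
lemma schwartz_oscillatory {N : ℝ} (hN : 0 ≤ N) {f : 𝓢(Plane, ℂ)} (hf : SobolevTwo N f)
    (he : ‖e‖ = 1) {P q m m' m'' X X' X'' : Plane → ℝ} {μ r κ t : ℝ}
    (h : Amplitude e q m m' m'' X X' X'' μ r κ) (ht : 0 ≤ t)
    (hP : LD e P q) (hPc : Continuous P) (η : Plane) :
    t ^ 2 * ‖∫ x, Complex.exp (-(Complex.I * t * P x)) * ((X x : ℂ) * (f (x + η) * star (f x)))‖ ≤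
      364 * μ ^ 4 * r ^ 2 * κ * N ^ 2 := by
  set f1 := ∂_{e} f
  set f2 := ∂_{e} f1
  have d1 : LD e f f1 := schwartz_ld f e
  have d2 : LD e f1 f2 := schwartz_ld f1 e
  have m0 : MemLp f 2 := f.memLp 2
  have m1 : MemLp f1 2 := f1.memLp 2
  have m2 : MemLp f2 2 := f2.memLp 2
  have n0 : √(∫ x, ‖f x‖ ^ 2) ≤ N := Real.sqrt_le_iff.2 ⟨hN, hf.zero⟩
  have n1 : √(∫ x, ‖f1 x‖ ^ 2) ≤ N := Real.sqrt_le_iff.2 ⟨hN, hf.one e he⟩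
  have n2 : √(∫ x, ‖f2 x‖ ^ 2) ≤ N := Real.sqrt_le_iff.2 ⟨hN, hf.two e he⟩
  have pb : ∀ {A B : Plane → ℂ}, MemLp A 2 → MemLp B 2 → √(∫ x, ‖A x‖ ^ 2) ≤ N →
      √(∫ x, ‖B x‖ ^ 2) ≤ N → ∫ σ, ‖A (σ + η) * star (B σ)‖ ≤ N ^ 2 := by
    intro A B hA hB h1 h2
    refine (integral_translate_mul_le hA hB η).trans ?_
    rw [pow_two]
    exact mul_le_mul h1 h2 (Real.sqrt_nonneg _) hN
  have it : ∀ {A B : Plane → ℂ}, MemLp A 2 → MemLp B 2 →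
      Integrable fun σ => A (σ + η) * star (B σ) := fun hA hB => integrable_translate_mul hA hB η
  have dΦ := (d1.translate η).mul d1.star
  have dΦ' := ((d2.translate η).mul d1.star).add ((d1.translate η).mul d2.star)
  have i1 := (it m1 m0).add (it m0 m1)
  have i2 := ((it m2 m0).add (it m1 m1)).add ((it m1 m1).add (it m0 m2))
  refine (oscillatory_bound h ht hP hPc dΦ dΦ' (it m0 m0) i1 i2).trans ?_
  have b0 := pb m0 m0 n0 n0
  have b1 : ∫ x, ‖f1 (x + η) * star (f x) + f (x + η) * star (f1 x)‖ ≤ 2 * N ^ 2 := by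
    have : ∫ x, ‖f1 (x + η) * star (f x) + f (x + η) * star (f1 x)‖ ≤
        (∫ x, ‖f1 (x + η) * star (f x)‖) + ∫ x, ‖f (x + η) * star (f1 x)‖ := by
      rw [← integral_add (it m1 m0).norm (it m0 m1).norm]
      exact integral_mono_of_nonneg (ae_of_all _ fun x => norm_nonneg _)
        ((it m1 m0).norm.add (it m0 m1).norm) (ae_of_all _ fun x => norm_add_le _ _)
    linarith [pb m1 m0 n1 n0, pb m0 m1 n0 n1]
  have b2 : ∫ x, ‖f2 (x + η) * star (f x) + f1 (x + η) * star (f1 x) +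
      (f1 (x + η) * star (f1 x) + f (x + η) * star (f2 x))‖ ≤ 4 * N ^ 2 := by
    have : ∫ x, ‖f2 (x + η) * star (f x) + f1 (x + η) * star (f1 x) +
        (f1 (x + η) * star (f1 x) + f (x + η) * star (f2 x))‖ ≤
        ((∫ x, ‖f2 (x + η) * star (f x)‖) + ∫ x, ‖f1 (x + η) * star (f1 x)‖) +
        ((∫ x, ‖f1 (x + η) * star (f1 x)‖) + ∫ x, ‖f (x + η) * star (f2 x)‖) := by
      rw [← integral_add (it m2 m0).norm (it m1 m1).norm,
        ← integral_add (it m1 m1).norm (it m0 m2).norm]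
      have hi := ((it m2 m0).norm.add (it m1 m1).norm).add ((it m1 m1).norm.add (it m0 m2).norm)
      have := integral_add ((it m2 m0).norm.add (it m1 m1).norm)
        ((it m1 m1).norm.add (it m0 m2).norm)
      simp only [Pi.add_apply] at this
      rw [← this]
      exact integral_mono_of_nonneg (ae_of_all _ fun x => norm_nonneg _) hi
        (ae_of_all _ fun x => (norm_add_le _ _).trans
          (add_le_add (norm_add_le _ _) (norm_add_le _ _)))
    linarith [pb m2 m0 n2 n0, pb m1 m1 n1 n1, pb m0 m2 n0 n2]
  have hκ : 0 ≤ κ := (abs_nonneg _).trans (h.bX 0)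
  have hμ : 0 ≤ μ := zero_le_one.trans h.one_le
  calc _ ≤ 52 * μ ^ 4 * r ^ 2 * κ * (N ^ 2 + 2 * N ^ 2 + 4 * N ^ 2) := by
        refine mul_le_mul_of_nonneg_left ?_ (by positivity)
        exact add_le_add (add_le_add b0 b1) b2
    _ = _ := by ring

/-- The oscillatory bound for limits in `L²` of Schwartz functions. -/
lemma limit_oscillatory {N : ℝ} (hN : 0 ≤ N) {F : Plane → ℂ} (hF : MemLp F 2)
    {f : ℕ → 𝓢(Plane, ℂ)} (hf : ∀ j, SobolevTwo N (f j))
    (hlim : Tendsto (fun j => ∫ x, ‖F x - f j x‖ ^ 2) atTop (𝓝 0))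
    (he : ‖e‖ = 1) {P q m m' m'' X X' X'' : Plane → ℝ} {μ r κ t : ℝ}
    (h : Amplitude e q m m' m'' X X' X'' μ r κ) (ht : 0 ≤ t)
    (hP : LD e P q) (hPc : Continuous P) (η : Plane) :
    t ^ 2 * ‖∫ x, Complex.exp (-(Complex.I * t * P x)) * ((X x : ℂ) * (F (x + η) * star (F x)))‖ ≤
      364 * μ ^ 4 * r ^ 2 * κ * N ^ 2 := by
  set T : (Plane → ℂ) → ℂ := fun Ψ => ∫ x, Complex.exp (-(Complex.I * t * P x)) *
    ((X x : ℂ) * Ψ x) with hT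
  have hκ : 0 ≤ κ := (abs_nonneg _).trans (h.bX 0)
  have hE : ∀ x, ‖Complex.exp (-(Complex.I * t * P x))‖ = 1 := fun x => by
    rw [show -(Complex.I * t * P x) = Complex.I * ((-(t * P x) : ℝ) : ℂ) by push_cast; ring]
    exact norm_cexp_I_mul _
  have hXc := h.cX
  have hi : ∀ {Ψ : Plane → ℂ}, Integrable Ψ → Integrable fun x =>
      Complex.exp (-(Complex.I * t * P x)) * ((X x : ℂ) * Ψ x) := by
    intro Ψ hΨ
    simp_rw [← mul_assoc]
    refine hΨ.bdd_mul (c := κ) (Continuous.aestronglyMeasurable (by fun_prop))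
      (ae_of_all _ fun x => ?_)
    rw [norm_mul, hE, one_mul, Complex.norm_real]; exact h.bX x
  have hTb : ∀ {Ψ : Plane → ℂ}, Integrable Ψ → ‖T Ψ‖ ≤ κ * ∫ x, ‖Ψ x‖ := by
    intro Ψ hΨ
    rw [← integral_const_mul]
    refine norm_integral_le_of_norm_le (hΨ.norm.const_mul κ) (ae_of_all _ fun x => ?_)
    rw [norm_mul, hE, one_mul, norm_mul, Complex.norm_real]
    exact mul_le_mul_of_nonneg_right (h.bX x) (norm_nonneg _)
  have mj : ∀ j, MemLp (f j) 2 := fun j => (f j).memLp 2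
  have dj : ∀ j, MemLp (fun x => F x - f j x) 2 := fun j => hF.sub (mj j)
  set ε : ℕ → ℝ := fun j => √(∫ x, ‖F x - f j x‖ ^ 2) with hε
  have hε0 : Tendsto ε atTop (𝓝 0) := by
    have := (Real.continuous_sqrt.tendsto 0).comp hlim
    rwa [Real.sqrt_zero] at this
  set NF := √(∫ x, ‖F x‖ ^ 2)
  have hdiff : ∀ j, ‖T (fun x => F (x + η) * star (F x)) -
      T (fun x => f j (x + η) * star (f j x))‖ ≤ κ * (ε j * NF + N * ε j) := by
    intro j
    have a1 := integrable_translate_mul (dj j) hF η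
    have a2 := integrable_translate_mul (mj j) (dj j) η
    -- The form is sesquilinear in the two factors, so the difference splits into two terms, each
    -- containing a factor F - f_j that is small in L².
    have e1 : T (fun x => F (x + η) * star (F x)) - T (fun x => f j (x + η) * star (f j x)) =
        T (fun x => (F (x + η) - f j (x + η)) * star (F x)) +
          T (fun x => f j (x + η) * star (F x - f j x)) := by
      simp only [hT]
      rw [← integral_sub (hi (integrable_translate_mul hF hF η))
        (hi (integrable_translate_mul (mj j) (mj j) η)), ← integral_add (hi a1) (hi a2)]
      congr 1 with x
      rw [star_sub]; ring
    rw [e1]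
    refine (norm_add_le _ _).trans ?_
    rw [mul_add]
    refine add_le_add ((hTb a1).trans ?_) ((hTb a2).trans ?_)
    · exact mul_le_mul_of_nonneg_left (integral_translate_mul_le (dj j) hF η) hκ
    · refine mul_le_mul_of_nonneg_left ((integral_translate_mul_le (mj j) (dj j) η).trans ?_) hκ
      exact mul_le_mul_of_nonneg_right (Real.sqrt_le_iff.2 ⟨hN, (hf j).zero⟩) (Real.sqrt_nonneg _)
  have hz : Tendsto (fun j => κ * (ε j * NF + N * ε j)) atTop (𝓝 0) := by
    have := ((hε0.mul_const NF).add (hε0.const_mul N)).const_mul κ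
    simpa using this
  have hconv : Tendsto (fun j => T (fun x => f j (x + η) * star (f j x))) atTop
      (𝓝 (T (fun x => F (x + η) * star (F x)))) := by
    rw [tendsto_iff_norm_sub_tendsto_zero]
    refine squeeze_zero (fun j => norm_nonneg _) (fun j => ?_) hz
    rw [norm_sub_rev]; exact hdiff j
  refine le_of_tendsto (hconv.norm.const_mul (t ^ 2)) (Eventually.of_forall fun j => ?_)
  exact schwartz_oscillatory hN (hf j) he h ht hP hPc η

end

/-- Quantitative hypotheses on the transform `F` of the profile at time `t`. -/
structure Prof (n t a : ℝ) (F : Plane → ℂ) : Prop where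
  cont : Continuous F
  bd : ∀ ξ, ‖F ξ‖ ≤ a * jb ξ ^ (-(n / 100))
  sob_int : Integrable fun ξ => jb ξ ^ (2 * n) * ‖F ξ‖ ^ 2
  sob : ∫ ξ, jb ξ ^ (2 * n) * ‖F ξ‖ ^ 2 ≤ (a * bracket t ^ (1 / 100 : ℝ)) ^ 2
  hold : ∀ x y, ‖F x - F y‖ ≤ a * bracket t ^ (1 / 50 : ℝ) * ‖x - y‖ ^ (1 / 2 : ℝ)
  approx : ∃ f : ℕ → 𝓢(Plane, ℂ), (∀ j, SobolevTwo (a * bracket t ^ (1 / 50 : ℝ)) (f j)) ∧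
    Tendsto (fun j => ∫ x, ‖F x - f j x‖ ^ 2) atTop (𝓝 0)

/-- The transform of the solution in terms of the transform of its profile. -/
noncomputable def modul (t : ℝ) (F : Plane → ℂ) (ξ : Plane) : ℂ :=
  Complex.exp (-(Complex.I * t * jb ξ)) * F ξ

lemma norm_cexp_phase (t r : ℝ) : ‖Complex.exp (-(Complex.I * t * r))‖ = 1 := by
  rw [show -(Complex.I * t * r) = Complex.I * ((-(t * r) : ℝ) : ℂ) by push_cast; ring]
  exact norm_cexp_I_mul _

@[simp] lemma norm_modul (t : ℝ) (F : Plane → ℂ) (ξ : Plane) : ‖modul t F ξ‖ = ‖F ξ‖ := by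
  rw [modul, norm_mul, norm_cexp_phase, one_mul]

lemma continuous_modul {F : Plane → ℂ} (hF : Continuous F) (t : ℝ) : Continuous (modul t F) := by
  have := continuous_jb
  unfold modul; fun_prop

lemma corr_modul (t : ℝ) (F : Plane → ℂ) (η : Plane) :
    corr (modul t F) η = ((2 * Real.pi) ^ 2 : ℂ)⁻¹ *
      ∫ σ, Complex.exp (-(Complex.I * t * (jb (σ + η) - jb σ : ℝ))) * (F (σ + η) * star (F σ)) := by
  rw [corr]
  congr 2 with σ
  have : star (Complex.exp (-(Complex.I * t * jb σ))) = Complex.exp (Complex.I * t * jb σ) := by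
    change (starRingEnd ℂ) _ = _
    rw [← Complex.exp_conj]; simp
  rw [modul, modul, star_mul', this]
  have e2 : Complex.exp (-(Complex.I * t * (jb (σ + η) - jb σ : ℝ))) =
      Complex.exp (-(Complex.I * t * jb (σ + η))) * Complex.exp (Complex.I * t * jb σ) := by
    rw [← Complex.exp_add]; congr 1; push_cast; ring
  rw [e2]; ring

namespace Prof

variable {n t a : ℝ} {F : Plane → ℂ}

lemma nonneg (h : Prof n t a F) : 0 ≤ a := nonneg_of_bound h.bd

lemma bd10 (h : Prof n t a F) (hn : 1000 ≤ n) : ∀ ξ, ‖F ξ‖ ≤ a * jb ξ ^ (-10 : ℝ) :=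
  bound_mono h.bd (by linarith)

lemma mbd10 (h : Prof n t a F) (hn : 1000 ≤ n) : ∀ ξ, ‖modul t F ξ‖ ≤ a * jb ξ ^ (-10 : ℝ) :=
  fun ξ => by rw [norm_modul]; exact h.bd10 hn ξ

lemma memLp (h : Prof n t a F) (hn : 1000 ≤ n) : MemLp F 2 :=
  memLp_of_bound (s := -10) (by norm_num) h.cont.aestronglyMeasurable (h.bd10 hn)

lemma integrable (h : Prof n t a F) (hn : 1000 ≤ n) : Integrable F :=
  integrable_of_bound (s := -10) (by norm_num) h.cont.aestronglyMeasurable (h.bd10 hn)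

lemma weighted_memLp (h : Prof n t a F) : MemLp (fun ξ => ((jb ξ ^ n : ℝ) : ℂ) * F ξ) 2 := by
  refine (memLp_two_iff_integrable_sq_norm ?_).2 ?_
  · exact ((Complex.continuous_ofReal.comp (continuous_jb_rpow n)).mul h.cont).aestronglyMeasurable
  · refine h.sob_int.congr (ae_of_all _ fun ξ => ?_)
    simp only
    rw [norm_mul, Complex.norm_real, Real.norm_of_nonneg (jb_rpow_pos _ _).le, mul_pow,
      jb_rpow_sq]

lemma weighted_pair (h : Prof n t a F) (η : Plane) :
    Integrable (fun σ => jb (σ + η) ^ n * ‖F (σ + η)‖ * (jb σ ^ n * ‖F σ‖)) ∧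
    ∫ σ, jb (σ + η) ^ n * ‖F (σ + η)‖ * (jb σ ^ n * ‖F σ‖) ≤
      (a * bracket t ^ (1 / 100 : ℝ)) ^ 2 := by
  have hm := h.weighted_memLp
  have e1 : ∀ σ, jb (σ + η) ^ n * ‖F (σ + η)‖ * (jb σ ^ n * ‖F σ‖) =
      ‖((jb (σ + η) ^ n : ℝ) : ℂ) * F (σ + η) * star (((jb σ ^ n : ℝ) : ℂ) * F σ)‖ := by
    intro σ
    rw [norm_mul, norm_star, norm_mul, norm_mul, Complex.norm_real, Complex.norm_real,
      Real.norm_of_nonneg (jb_rpow_pos _ _).le, Real.norm_of_nonneg (jb_rpow_pos _ _).le]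
  simp_rw [e1]
  refine ⟨(integrable_translate_mul hm hm η).norm, (integral_translate_mul_le hm hm η).trans ?_⟩
  rw [Real.mul_self_sqrt (integral_nonneg fun x => by positivity)]
  refine le_trans (le_of_eq ?_) h.sob
  congr 1 with ξ
  rw [norm_mul, Complex.norm_real, Real.norm_of_nonneg (jb_rpow_pos _ _).le, mul_pow,
    jb_rpow_sq]

lemma inv_two_pi_sq_le : ‖((2 * Real.pi) ^ 2 : ℂ)⁻¹‖ ≤ 1 := by
  rw [norm_inv, norm_pow, norm_mul, Complex.norm_real, Complex.norm_ofNat,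
    Real.norm_of_nonneg Real.pi_pos.le]
  refine inv_le_one_of_one_le₀ ?_
  nlinarith [Real.pi_gt_three]

/-- Decay of the transform of the density from regularity. -/
lemma corr_le (h : Prof n t a F) {j : ℝ} (hj : 0 ≤ j) (hjn : j ≤ n) (η : Plane) :
    jb η ^ j * ‖corr (modul t F) η‖ ≤ 2 ^ j * (a * bracket t ^ (1 / 100 : ℝ)) ^ 2 := by
  obtain ⟨hi, hle⟩ := h.weighted_pair η
  calc jb η ^ j * ‖corr (modul t F) η‖
      ≤ jb η ^ j * ∫ σ : Plane, ‖modul t F (σ + η)‖ * ‖modul t F σ‖ :=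
        mul_le_mul_of_nonneg_left (norm_corr_le_integral η) (jb_rpow_pos _ _).le
    _ = ∫ σ : Plane, jb η ^ j * (‖F (σ + η)‖ * ‖F σ‖) := by
        rw [integral_const_mul]; simp only [norm_modul]
    _ ≤ ∫ σ, 2 ^ j * (jb (σ + η) ^ n * ‖F (σ + η)‖ * (jb σ ^ n * ‖F σ‖)) := by
        refine integral_mono_of_nonneg (ae_of_all _ fun σ => ?_) (hi.const_mul _)
          (ae_of_all _ fun σ => ?_)
        · exact mul_nonneg (jb_rpow_pos _ _).le (by positivity)
        · simp only
          calc jb η ^ j * (‖F (σ + η)‖ * ‖F σ‖)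
              ≤ 2 ^ j * jb (σ + η) ^ j * jb σ ^ j * (‖F (σ + η)‖ * ‖F σ‖) :=
                mul_le_mul_of_nonneg_right (jb_rpow_le' hj σ η) (by positivity)
            _ ≤ 2 ^ j * jb (σ + η) ^ n * jb σ ^ n * (‖F (σ + η)‖ * ‖F σ‖) := by
                have := jb_rpow_mono hjn (σ + η)
                have := jb_rpow_mono hjn σ
                have := jb_rpow_pos j σ
                have := jb_rpow_pos n (σ + η)
                gcongr
            _ = _ := by ring
    _ ≤ _ := by
        rw [integral_const_mul]
        exact mul_le_mul_of_nonneg_left hle (by positivity)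

end Prof

/-! ### Decay of the transform of the density from non-stationary phase -/

lemma bracket_le_two_mul {t : ℝ} (ht : 1 ≤ t) : bracket t ≤ 2 * t :=
  (bracket_le_one_add (by linarith)).trans (by linarith)

lemma bracket_rpow_le {t s : ℝ} (ht : 1 ≤ t) (hs : 0 ≤ s) (hs1 : s ≤ 1) :
    bracket t ^ s ≤ 2 * t ^ s := by
  calc bracket t ^ s ≤ (2 * t) ^ s :=
        Real.rpow_le_rpow (bracket_pos t).le (bracket_le_two_mul ht) hs
    _ = 2 ^ s * t ^ s := Real.mul_rpow (by norm_num) (by linarith)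
    _ ≤ 2 * t ^ s := by
        gcongr
        calc (2 : ℝ) ^ s ≤ 2 ^ (1 : ℝ) := Real.rpow_le_rpow_of_exponent_le (by norm_num) hs1
          _ = 2 := Real.rpow_one 2

lemma sq_mul_bracket_rpow (a t s : ℝ) :
    (a * bracket t ^ s) ^ 2 = a ^ 2 * bracket t ^ (2 * s) := by
  rw [mul_pow, mul_comm 2 s, Real.rpow_mul (bracket_pos t).le, Real.rpow_two]

namespace Prof

variable {n t a κ M : ℝ} {F : Plane → ℂ}

/-- The localized part of the transform of the density. -/
lemma oscillatory_main {ρ : Plane → ℝ} (hρ : IsBump ρ) (h0 : ∀ x, |ρ x| ≤ κ)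
    (h1 : ∀ x, ‖fderiv ℝ ρ x‖ ≤ κ) (h2 : ∀ x, ‖fderiv ℝ (fderiv ℝ ρ) x‖ ≤ κ) (hκ : 1 ≤ κ)
    (hn : 1000 ≤ n) (h : Prof n t a F) (ht : 0 ≤ t) (hM : 1 ≤ M) {η : Plane} (hη : η ≠ 0) :
    t ^ 2 * ‖∫ σ, Complex.exp (-(Complex.I * t * (jb (σ + η) - jb σ : ℝ))) *
      (((ρ (M⁻¹ • (σ + η)) * ρ (M⁻¹ • σ) : ℝ) : ℂ) * (F (σ + η) * star (F σ)))‖ ≤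
      364 * (bracket (2 * M) ^ 3) ^ 4 * ‖η‖⁻¹ ^ 2 * (4 * κ ^ 2) *
        (a * bracket t ^ (1 / 50 : ℝ)) ^ 2 := by
  obtain ⟨f, hf, hlim⟩ := h.approx
  have hh : 0 < ‖η‖ := norm_pos_iff.2 hη
  have he : ‖(‖η‖⁻¹ • η)‖ = 1 := by
    rw [norm_smul, norm_inv, norm_norm, inv_mul_cancel₀ hh.ne']
  have hχ := hρ.cutoff h0 h1 h2 he hM
  obtain ⟨m, m', m'', X', X'', hA⟩ := exists_amplitude he hh hκ hχ
  have e1 : ‖η‖ • ‖η‖⁻¹ • η = η := by rw [smul_smul, mul_inv_cancel₀ hh.ne', one_smul]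
  rw [e1] at hA
  have hP : LD (‖η‖⁻¹ • η) (fun σ => jb (σ + η) - jb σ)
      (fun σ => jb1 (‖η‖⁻¹ • η) (σ + η) - jb1 (‖η‖⁻¹ • η) σ) :=
    (ld_jb.translate η).sub ld_jb
  have hPc : Continuous fun σ : Plane => jb (σ + η) - jb σ :=
    (continuous_jb.comp (by fun_prop)).sub continuous_jb
  have hN : 0 ≤ a * bracket t ^ (1 / 50 : ℝ) :=
    mul_nonneg h.nonneg (Real.rpow_nonneg (bracket_pos t).le _)
  exact limit_oscillatory hN (h.memLp hn) hf hlim he hA ht hP hPc η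

lemma integrable_pair_mul {X : Plane → ℝ} (hX : Continuous X) (hb : ∀ x, |X x| ≤ κ)
    (hn : 1000 ≤ n) (h : Prof n t a F) (η : Plane) :
    Integrable fun σ => Complex.exp (-(Complex.I * t * (jb (σ + η) - jb σ : ℝ))) *
      ((X σ : ℂ) * (F (σ + η) * star (F σ))) := by
  simp_rw [← mul_assoc (Complex.exp _)]
  have := continuous_jb
  refine (integrable_translate_mul (h.memLp hn) (h.memLp hn) η).bdd_mul (c := κ)
    (Continuous.aestronglyMeasurable (by fun_prop)) (ae_of_all _ fun x => ?_)
  rw [norm_mul, norm_cexp_phase, one_mul, Complex.norm_real]; exact hb x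

/-- The part of the transform of the density carried by high frequencies. -/
lemma oscillatory_rem {X : Plane → ℝ} {j : ℝ} (hj : 0 ≤ j) (hjn : j ≤ n) (hM : 1 ≤ M)
    (h : Prof n t a F) (η : Plane)
    (hb : ∀ σ, |X σ| ≤ κ) (hz : ∀ σ, ‖σ‖ ≤ M → ‖σ + η‖ ≤ M → X σ = 0) :
    jb η ^ j * ‖∫ σ, Complex.exp (-(Complex.I * t * (jb (σ + η) - jb σ : ℝ))) *
      ((X σ : ℂ) * (F (σ + η) * star (F σ)))‖ ≤
      κ * 2 ^ j * M ^ (j - n) * (a * bracket t ^ (1 / 100 : ℝ)) ^ 2 := by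
  obtain ⟨hi, hle⟩ := h.weighted_pair η
  have hM0 : 0 < M := by linarith
  have hκ : 0 ≤ κ := (abs_nonneg _).trans (hb 0)
  have hgain : ∀ σ : Plane, M ≤ ‖σ‖ → jb σ ^ j ≤ M ^ (j - n) * jb σ ^ n := by
    intro σ hσ
    have e1 : jb σ ^ j = jb σ ^ (j - n) * jb σ ^ n := by
      rw [← Real.rpow_add (jb_pos σ)]; congr 1; ring
    rw [e1]
    exact mul_le_mul_of_nonneg_right (Real.rpow_le_rpow_of_nonpos hM0
      (hσ.trans (norm_le_jb σ)) (by linarith)) (jb_rpow_pos _ _).le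
  calc _ ≤ jb η ^ j * ∫ σ, |X σ| * (‖F (σ + η)‖ * ‖F σ‖) := by
        refine mul_le_mul_of_nonneg_left ((norm_integral_le_integral_norm _).trans (le_of_eq ?_))
          (jb_rpow_pos _ _).le
        congr 1 with σ
        rw [norm_mul, norm_cexp_phase, one_mul, norm_mul, Complex.norm_real, norm_mul, norm_star,
          Real.norm_eq_abs]
    _ = ∫ σ, jb η ^ j * (|X σ| * (‖F (σ + η)‖ * ‖F σ‖)) := by rw [integral_const_mul]
    _ ≤ ∫ σ, κ * 2 ^ j * M ^ (j - n) *
          (jb (σ + η) ^ n * ‖F (σ + η)‖ * (jb σ ^ n * ‖F σ‖)) := by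
        refine integral_mono_of_nonneg (ae_of_all _ fun σ => ?_) (hi.const_mul _)
          (ae_of_all _ fun σ => ?_)
        · exact mul_nonneg (jb_rpow_pos _ _).le (by positivity)
        · simp only
          have p1 := jb_rpow_pos n (σ + η)
          have p2 := jb_rpow_pos n σ
          have p3 := jb_rpow_pos j (σ + η)
          have p4 := jb_rpow_pos j σ
          have p5 : 0 < M ^ (j - n) := Real.rpow_pos_of_pos hM0 _
          have p6 : (0 : ℝ) < 2 ^ j := Real.rpow_pos_of_pos two_pos _
          by_cases hs : ‖σ‖ ≤ M ∧ ‖σ + η‖ ≤ M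
          · rw [hz σ hs.1 hs.2]
            simp only [abs_zero, zero_mul, mul_zero]
            positivity
          -- One of the two frequencies exceeds M. On that one the power j is raised to n at the
          -- gain M^{j-n}.
          have key : jb (σ + η) ^ j * jb σ ^ j ≤ M ^ (j - n) * (jb (σ + η) ^ n * jb σ ^ n) := by
            rw [not_and_or, not_le, not_le] at hs
            rcases hs with hs | hs
            · calc _ ≤ jb (σ + η) ^ n * (M ^ (j - n) * jb σ ^ n) :=
                    mul_le_mul (jb_rpow_mono hjn _) (hgain σ hs.le) p4.le p1.le
                _ = _ := by ring
            · calc _ ≤ (M ^ (j - n) * jb (σ + η) ^ n) * jb σ ^ n :=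
                    mul_le_mul (hgain _ hs.le) (jb_rpow_mono hjn _) p4.le (by positivity)
                _ = _ := by ring
          calc jb η ^ j * (|X σ| * (‖F (σ + η)‖ * ‖F σ‖))
              ≤ 2 ^ j * jb (σ + η) ^ j * jb σ ^ j * (κ * (‖F (σ + η)‖ * ‖F σ‖)) :=
                mul_le_mul (jb_rpow_le' hj σ η)
                  (mul_le_mul_of_nonneg_right (hb σ) (by positivity)) (by positivity)
                  (by positivity)
            _ = κ * 2 ^ j * (jb (σ + η) ^ j * jb σ ^ j) * (‖F (σ + η)‖ * ‖F σ‖) := by ring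
            _ ≤ κ * 2 ^ j * (M ^ (j - n) * (jb (σ + η) ^ n * jb σ ^ n)) *
                  (‖F (σ + η)‖ * ‖F σ‖) := by gcongr
            _ = _ := by ring
    _ ≤ _ := by
        rw [integral_const_mul]
        exact mul_le_mul_of_nonneg_left hle (by positivity)

lemma rpow_le_rpow_neg {w p q : ℝ} (hw : 1 ≤ w) (h : q ≤ p) : w ^ (-p) ≤ w ^ (-q) :=
  Real.rpow_le_rpow_of_exponent_le hw (neg_le_neg h)

/-- Frequencies are cut at M = t^{2/n}. Below M two integrations by parts give (t|η|)^{-2}; the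
losses M^{12} from weak convexity and M^k from the weight are small powers of t. Above M the H^n
bound gains almost t^{-2}. The exponent is lowered from 2 to 7/4 so that |η|^{-7/4} is locally
integrable in the plane. -/
lemma corr_decay (hn : 1000 ≤ n) {ρ : Plane → ℝ} (hρ : IsBump ρ) : ∃ C : ℝ, 0 ≤ C ∧
    ∀ t a F, 1 ≤ t → Prof n t a F → ∀ η : Plane, η ≠ 0 →
      jb η ^ (n / 100) * ‖corr (modul t F) η‖ ≤
        C * a ^ 2 * (t ^ (1 / 10 : ℝ) * (t * ‖η‖) ^ (-(7 / 4) : ℝ)) := by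
  obtain ⟨κ, hκ, h0, h1, h2⟩ := hρ.exists_bound
  set k := n / 100 with hk
  have hk0 : 0 ≤ k := by rw [hk]; linarith
  have hn0 : 0 < n := by linarith
  set C1 : ℝ := 2 ^ k * 2
  set C2 : ℝ := 5 ^ k * (364 * 3 ^ 12 * (4 * κ ^ 2) * 2)
  set C3 : ℝ := (1 + κ ^ 2) * 2 ^ (k + 2) * 2
  have p1 : 0 ≤ C1 := by positivity
  have p2 : 0 ≤ C2 := by positivity
  have p3 : 0 ≤ C3 := by positivity
  refine ⟨C1 + C2 + C3, by positivity, fun t a F ht h η hη => ?_⟩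
  have ht0 : 0 < t := by linarith
  have hh : 0 < ‖η‖ := norm_pos_iff.2 hη
  have hw : 0 < t * ‖η‖ := mul_pos ht0 hh
  set w := t * ‖η‖ with hwd
  have ha := h.nonneg
  have tpow : ∀ {r s : ℝ}, r ≤ s → t ^ r ≤ t ^ s := fun h =>
    Real.rpow_le_rpow_of_exponent_le ht h
  rcases le_total w 1 with hw1 | hw1
  -- For t|η| ≤ 1 no oscillation is needed: the right-hand factor is at least one.
  · have hw2 : 1 ≤ w ^ (-(7 / 4) : ℝ) := Real.one_le_rpow_of_pos_of_le_one_of_nonpos hw hw1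
      (by norm_num)
    calc _ ≤ 2 ^ k * (a * bracket t ^ (1 / 100 : ℝ)) ^ 2 :=
          h.corr_le hk0 (by rw [hk]; linarith) η
      _ = 2 ^ k * (a ^ 2 * bracket t ^ (1 / 50 : ℝ)) := by
          rw [sq_mul_bracket_rpow]; norm_num
      _ ≤ 2 ^ k * (a ^ 2 * (2 * t ^ (1 / 10 : ℝ))) := by
          have := (bracket_rpow_le ht (s := 1 / 50) (by norm_num) (by norm_num)).trans
            (mul_le_mul_of_nonneg_left (tpow (by norm_num : (1 / 50 : ℝ) ≤ 1 / 10)) zero_le_two)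
          gcongr
      _ = C1 * a ^ 2 * (t ^ (1 / 10 : ℝ) * 1) := by simp only [C1]; ring
      _ ≤ _ := by
          have : C1 ≤ C1 + C2 + C3 := by linarith
          gcongr
  set M := t ^ (2 / n) with hMd
  have hM : 1 ≤ M := Real.one_le_rpow ht (by positivity)
  have hM0 : 0 < M := by linarith
  have Mpow : ∀ s : ℝ, M ^ s = t ^ (2 / n * s) := fun s => by
    rw [hMd, ← Real.rpow_mul ht0.le]
  set X : Plane → ℝ := fun σ => ρ (M⁻¹ • (σ + η)) * ρ (M⁻¹ • σ) with hX
  have hcρ := hρ.smooth.continuous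
  have hXc : Continuous X := by simp only [hX]; fun_prop
  have hXb : ∀ σ, |X σ| ≤ κ ^ 2 := fun σ => by
    rw [hX, abs_mul, pow_two]
    exact mul_le_mul (h0 _) (h0 _) (abs_nonneg _) (by linarith)
  have hYb : ∀ σ, |1 - X σ| ≤ 1 + κ ^ 2 := fun σ => by
    refine (abs_sub _ _).trans ?_
    rw [abs_one]; linarith [hXb σ]
  set E : Plane → ℂ := fun σ => Complex.exp (-(Complex.I * t * (jb (σ + η) - jb σ : ℝ))) with hE
  have split : (∫ σ, E σ * (F (σ + η) * star (F σ))) =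
      (∫ σ, E σ * ((X σ : ℂ) * (F (σ + η) * star (F σ)))) +
      ∫ σ, E σ * (((1 - X σ : ℝ) : ℂ) * (F (σ + η) * star (F σ))) := by
    rw [← integral_add (integrable_pair_mul hXc hXb hn h η)
      (integrable_pair_mul (X := fun σ => 1 - X σ) (by fun_prop) hYb hn h η)]
    congr 1 with σ
    rw [Complex.ofReal_sub 1, Complex.ofReal_one]; ring
  have inner_le : ∀ σ : Plane, ‖σ‖ ≤ M → ρ (M⁻¹ • σ) = 1 := fun σ hσ => by
    refine hρ.eq_one _ ?_
    rw [norm_smul, norm_inv, Real.norm_of_nonneg hM0.le, inv_mul_le_iff₀ hM0]; linarith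
  have hmain : jb η ^ k * ‖∫ σ, E σ * ((X σ : ℂ) * (F (σ + η) * star (F σ)))‖ ≤
      C2 * a ^ 2 * (t ^ (1 / 10 : ℝ) * w ^ (-(7 / 4) : ℝ)) := by
    -- For |η| ≥ 4M the two cutoffs have disjoint supports and the integral vanishes; otherwise ⟨η⟩
    -- ≤ 5M, and M^k = t^{1/50}.
    by_cases hbig : 4 * M ≤ ‖η‖
    · have hX0 : ∀ σ, X σ = 0 := by
        intro σ
        have hout : ∀ y : Plane, 2 * M ≤ ‖y‖ → ρ (M⁻¹ • y) = 0 := by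
          intro y hy
          refine image_eq_zero_of_notMem_tsupport fun hm => ?_
          have := hρ.support hm
          rw [mem_ball_zero_iff, norm_smul, norm_inv, Real.norm_of_nonneg hM0.le,
            inv_mul_lt_iff₀ hM0] at this
          linarith
        by_cases hs : 2 * M ≤ ‖σ‖
        · simp only [hX, hout σ hs, mul_zero]
        · have : 2 * M ≤ ‖σ + η‖ := by
            have := norm_sub_le (σ + η) σ
            rw [add_sub_cancel_left] at this
            linarith
          simp only [hX, hout _ this, zero_mul]
      simp only [hX0, Complex.ofReal_zero, zero_mul, mul_zero, integral_zero, norm_zero]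
      positivity
    push Not at hbig
    have hm := oscillatory_main hρ h0 h1 h2 hκ hn h ht0.le hM hη
    set J := ‖∫ σ, E σ * ((X σ : ℂ) * (F (σ + η) * star (F σ)))‖ with hJ
    have hJ0 : 0 ≤ J := norm_nonneg _
    have b1 : jb η ^ k ≤ 5 ^ k * t ^ (1 / 50 : ℝ) := by
      have e1 : t ^ (1 / 50 : ℝ) = M ^ k := by
        rw [Mpow, hk]; congr 1; field_simp; norm_num
      rw [e1, ← Real.mul_rpow (by norm_num) hM0.le]
      refine Real.rpow_le_rpow (jb_pos η).le ((jb_le_one_add η).trans ?_) hk0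
      linarith
    have b2 : (bracket (2 * M) ^ 3) ^ 4 ≤ 3 ^ 12 * t ^ (24 / 1000 : ℝ) := by
      have e1 : M ^ (12 : ℕ) ≤ t ^ (24 / 1000 : ℝ) := by
        rw [← Real.rpow_natCast, Mpow]
        refine tpow ?_
        rw [div_mul_eq_mul_div, div_le_div_iff₀ hn0 (by norm_num)]
        push_cast; linarith
      have e2 : bracket (2 * M) ≤ 3 * M := (bracket_le_one_add (by linarith)).trans (by linarith)
      calc (bracket (2 * M) ^ 3) ^ 4 = bracket (2 * M) ^ 12 := by ring
        _ ≤ (3 * M) ^ 12 := pow_le_pow_left₀ (bracket_pos _).le e2 12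
        _ = 3 ^ 12 * M ^ 12 := by ring
        _ ≤ _ := by gcongr
    have b3 : (a * bracket t ^ (1 / 50 : ℝ)) ^ 2 ≤ a ^ 2 * (2 * t ^ (1 / 25 : ℝ)) := by
      rw [sq_mul_bracket_rpow]
      have := bracket_rpow_le ht (s := 1 / 25) (by norm_num) (by norm_num)
      have e1 : (2 * (1 / 50) : ℝ) = 1 / 25 := by norm_num
      rw [e1]; gcongr
    have b4 : J ≤ (364 * (bracket (2 * M) ^ 3) ^ 4 * (4 * κ ^ 2) *
        (a * bracket t ^ (1 / 50 : ℝ)) ^ 2) * (w ^ 2)⁻¹ := by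
      rw [← div_eq_mul_inv, le_div_iff₀ (pow_pos hw 2)]
      have e1 : J * w ^ 2 = (t ^ 2 * J) * ‖η‖ ^ 2 := by rw [hwd]; ring
      rw [e1]
      refine (mul_le_mul_of_nonneg_right hm (sq_nonneg _)).trans (le_of_eq ?_)
      field_simp
    have b5 : (w ^ 2)⁻¹ ≤ w ^ (-(7 / 4) : ℝ) := by
      rw [← Real.rpow_two, ← Real.rpow_neg hw.le]
      exact rpow_le_rpow_neg hw1 (by norm_num)
    calc jb η ^ k * J ≤ (5 ^ k * t ^ (1 / 50 : ℝ)) *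
          ((364 * (3 ^ 12 * t ^ (24 / 1000 : ℝ)) * (4 * κ ^ 2) * (a ^ 2 * (2 * t ^ (1 / 25 : ℝ)))) *
            w ^ (-(7 / 4) : ℝ)) := by
          refine mul_le_mul b1 (b4.trans ?_) hJ0 (by positivity)
          gcongr
      _ = C2 * a ^ 2 * ((t ^ (1 / 50 : ℝ) * t ^ (24 / 1000 : ℝ) * t ^ (1 / 25 : ℝ)) *
            w ^ (-(7 / 4) : ℝ)) := by simp only [C2]; ring
      _ ≤ _ := by
          -- The exponents add up to 84/1000, below 1/10.
          have : t ^ (1 / 50 : ℝ) * t ^ (24 / 1000 : ℝ) * t ^ (1 / 25 : ℝ) ≤ t ^ (1 / 10 : ℝ) := by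
            rw [← Real.rpow_add ht0, ← Real.rpow_add ht0]; exact tpow (by norm_num)
          gcongr
  have hrem : jb η ^ k * ‖∫ σ, E σ * (((1 - X σ : ℝ) : ℂ) * (F (σ + η) * star (F σ)))‖ ≤
      C3 * a ^ 2 * (t ^ (1 / 10 : ℝ) * w ^ (-(7 / 4) : ℝ)) := by
    -- Two extra powers of ⟨η⟩ are carried because ⟨η⟩^{-2} ≤ |η|^{-7/4}. The exponent of t coming
    -- from M is then (2/n)(k + 2 - n) = 1/50 - 2 + 4/n.
    have hr := oscillatory_rem (X := fun σ => 1 - X σ) (j := k + 2) (by linarith)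
      (by rw [hk]; linarith) hM h η hYb (fun σ a1 a2 => by
        simp only [hX, inner_le _ a1, inner_le _ a2]; norm_num)
    set J := ‖∫ σ, E σ * (((1 - X σ : ℝ) : ℂ) * (F (σ + η) * star (F σ)))‖ with hJ
    have hJ0 : 0 ≤ J := norm_nonneg _
    have b1 : M ^ (k + 2 - n) ≤ t ^ (-(1976 / 1000) : ℝ) := by
      rw [Mpow]
      refine tpow ?_
      have e1 : 2 / n * (k + 2 - n) = 1 / 50 - 2 + 4 / n := by rw [hk]; field_simp; ring
      have e2 : 4 / n ≤ 4 / 1000 := div_le_div_of_nonneg_left (by norm_num) (by norm_num) hn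
      rw [e1]; linarith
    have b2 : (a * bracket t ^ (1 / 100 : ℝ)) ^ 2 ≤ a ^ 2 * (2 * t ^ (1 / 50 : ℝ)) := by
      rw [sq_mul_bracket_rpow]
      have := bracket_rpow_le ht (s := 1 / 50) (by norm_num) (by norm_num)
      have e1 : (2 * (1 / 100) : ℝ) = 1 / 50 := by norm_num
      rw [e1]; gcongr
    have b3 : jb η ^ (-2 : ℝ) ≤ ‖η‖ ^ (-(7 / 4) : ℝ) :=
      (Real.rpow_le_rpow_of_exponent_le (one_le_jb η) (by norm_num)).trans
        (Real.rpow_le_rpow_of_nonpos hh (norm_le_jb η) (by norm_num))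
    have e1 : jb η ^ k = jb η ^ (-2 : ℝ) * jb η ^ (k + 2) := by
      rw [← Real.rpow_add (jb_pos η)]; congr 1; ring
    have e2 : ‖η‖ ^ (-(7 / 4) : ℝ) = t ^ (7 / 4 : ℝ) * w ^ (-(7 / 4) : ℝ) := by
      rw [hwd, Real.mul_rpow ht0.le hh.le, ← mul_assoc, ← Real.rpow_add ht0]; norm_num
    calc jb η ^ k * J = jb η ^ (-2 : ℝ) * (jb η ^ (k + 2) * J) := by rw [e1]; ring
      _ ≤ (t ^ (7 / 4 : ℝ) * w ^ (-(7 / 4) : ℝ)) * ((1 + κ ^ 2) * 2 ^ (k + 2) *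
            t ^ (-(1976 / 1000) : ℝ) * (a ^ 2 * (2 * t ^ (1 / 50 : ℝ)))) := by
          rw [← e2]
          refine mul_le_mul b3 (hr.trans ?_) (mul_nonneg (jb_rpow_pos _ _).le hJ0) (by positivity)
          gcongr
      _ = C3 * a ^ 2 * ((t ^ (7 / 4 : ℝ) * t ^ (-(1976 / 1000) : ℝ) * t ^ (1 / 50 : ℝ)) *
            w ^ (-(7 / 4) : ℝ)) := by simp only [C3]; ring
      _ ≤ _ := by
          have : t ^ (7 / 4 : ℝ) * t ^ (-(1976 / 1000) : ℝ) * t ^ (1 / 50 : ℝ) ≤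
              t ^ (1 / 10 : ℝ) := by
            rw [← Real.rpow_add ht0, ← Real.rpow_add ht0]; exact tpow (by norm_num)
          gcongr
  rw [corr_modul, split, norm_mul]
  have hfin := mul_le_mul_of_nonneg_right inv_two_pi_sq_le
    (norm_nonneg ((∫ σ, E σ * ((X σ : ℂ) * (F (σ + η) * star (F σ)))) +
      ∫ σ, E σ * (((1 - X σ : ℝ) : ℂ) * (F (σ + η) * star (F σ)))))
  rw [one_mul] at hfin
  calc _ ≤ jb η ^ k * (‖∫ σ, E σ * ((X σ : ℂ) * (F (σ + η) * star (F σ)))‖ +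
        ‖∫ σ, E σ * (((1 - X σ : ℝ) : ℂ) * (F (σ + η) * star (F σ)))‖) :=
        mul_le_mul_of_nonneg_left (hfin.trans (norm_add_le _ _)) (jb_rpow_pos _ _).le
    _ ≤ C2 * a ^ 2 * (t ^ (1 / 10 : ℝ) * w ^ (-(7 / 4) : ℝ)) +
        C3 * a ^ 2 * (t ^ (1 / 10 : ℝ) * w ^ (-(7 / 4) : ℝ)) := by
        rw [mul_add]; exact add_le_add hmain hrem
    _ ≤ _ := by
        have : 0 ≤ C1 * a ^ 2 * (t ^ (1 / 10 : ℝ) * w ^ (-(7 / 4) : ℝ)) := by positivity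
        linarith

end Prof

/-! ### Pointwise decay from regularity -/

namespace Prof

variable {n t a : ℝ} {F : Plane → ℂ}

lemma a_mul_mono (h : Prof n t a F) :
    a * bracket t ^ (1 / 100 : ℝ) ≤ a * bracket t ^ (1 / 50 : ℝ) :=
  mul_le_mul_of_nonneg_left (Real.rpow_le_rpow_of_exponent_le (one_le_bracket t) (by norm_num))
    h.nonneg

/-- Interpolation between Hölder continuity and H^n. If |F(ξ)| = y, then |F| ≥ y/2 on a disc of
radius (y/2H)², of area comparable to (y/H)⁴. The weighted L² bound on this disc gives ⟨ξ⟩^{2n} y⁶ ≲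
H⁶, and a sixth root is taken. -/
lemma pointwise (hn : 1000 ≤ n) (h : Prof n t a F) (ξ : Plane) :
    ‖F ξ‖ ≤ 2 * 4 ^ n * (a * bracket t ^ (1 / 50 : ℝ)) * jb ξ ^ (-(n / 3)) := by
  set H := a * bracket t ^ (1 / 50 : ℝ) with hH
  set y := ‖F ξ‖ with hy
  have ha := h.nonneg
  have hH0 : 0 ≤ H := mul_nonneg ha (Real.rpow_nonneg (bracket_pos t).le _)
  have h4 : (1 : ℝ) ≤ 4 ^ n := Real.one_le_rpow (by norm_num) (by linarith)
  rcases (norm_nonneg (F ξ)).eq_or_lt with h0 | hy0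
  · rw [hy, ← h0]; have := jb_rpow_pos (-(n / 3)) ξ; positivity
  have haH : a ≤ H := le_mul_of_one_le_right ha
    (Real.one_le_rpow (one_le_bracket t) (by norm_num))
  have hya : y ≤ a := (h.bd ξ).trans (mul_le_of_le_one_right ha
    (jb_rpow_le_one (by linarith) ξ))
  have hHpos : 0 < H := by linarith
  set r := (y / (2 * H)) ^ 2 with hr
  have hyH : y / (2 * H) ≤ 1 := by rw [div_le_one (by positivity)]; linarith
  have hr0 : 0 < r := by positivity
  have hr1 : r ≤ 1 := pow_le_one₀ (by positivity) hyH
  have hball : ∀ x ∈ Metric.closedBall ξ r,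
      (jb ξ / 4) ^ (2 * n) * (y / 2) ^ 2 ≤ jb x ^ (2 * n) * ‖F x‖ ^ 2 := by
    intro x hx
    rw [Metric.mem_closedBall, dist_eq_norm] at hx
    have h1 := h.hold ξ x
    have h2 : ‖ξ - x‖ ^ (1 / 2 : ℝ) ≤ y / (2 * H) := by
      rw [norm_sub_rev]
      calc _ ≤ r ^ (1 / 2 : ℝ) := Real.rpow_le_rpow (norm_nonneg _) hx (by norm_num)
        _ = _ := by
          rw [hr, ← Real.sqrt_eq_rpow, Real.sqrt_sq (by positivity)]
    have h3 : ‖F ξ - F x‖ ≤ y / 2 := by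
      refine h1.trans ?_
      calc H * ‖ξ - x‖ ^ (1 / 2 : ℝ) ≤ H * (y / (2 * H)) := by gcongr
        _ = y / 2 := by field_simp
    have h4 : y / 2 ≤ ‖F x‖ := by
      have := norm_sub_norm_le (F ξ) (F x)
      linarith
    have h5 : jb ξ / 4 ≤ jb x := by
      have := jb_le_mul_sub ξ x
      have h6 := jb_le_one_add (ξ - x)
      rw [norm_sub_rev] at h6
      have : jb (ξ - x) ≤ 2 := by linarith
      nlinarith [jb_pos x]
    have := (jb_pos ξ).le
    exact mul_le_mul (Real.rpow_le_rpow (by positivity) h5 (by linarith))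
      (pow_le_pow_left₀ (by positivity) h4 2) (sq_nonneg _) (jb_rpow_pos _ _).le
  have hvol : (volume : Measure Plane).real (Metric.closedBall ξ r) = r ^ 2 * Real.pi := by
    rw [Measure.real, EuclideanSpace.volume_closedBall_fin_two, ENNReal.toReal_mul,
      ← ENNReal.ofReal_pow hr0.le, ENNReal.toReal_ofReal (by positivity)]
    simp [Real.pi_pos.le]
  have hint : (jb ξ / 4) ^ (2 * n) * (y / 2) ^ 2 * (r ^ 2 * Real.pi) ≤ H ^ 2 := by
    calc _ = ∫ _ in Metric.closedBall ξ r, (jb ξ / 4) ^ (2 * n) * (y / 2) ^ 2 := by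
          rw [setIntegral_const, hvol, smul_eq_mul, mul_comm]
      _ ≤ ∫ x in Metric.closedBall ξ r, jb x ^ (2 * n) * ‖F x‖ ^ 2 :=
          setIntegral_mono_on (integrableOn_const measure_closedBall_lt_top.ne) h.sob_int.integrableOn
            measurableSet_closedBall hball
      _ ≤ ∫ x, jb x ^ (2 * n) * ‖F x‖ ^ 2 :=
          setIntegral_le_integral h.sob_int (ae_of_all _ fun x =>
            mul_nonneg (jb_rpow_pos _ _).le (sq_nonneg _))
      _ ≤ (a * bracket t ^ (1 / 100 : ℝ)) ^ 2 := h.sob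
      _ ≤ H ^ 2 := pow_le_pow_left₀
          (mul_nonneg ha (Real.rpow_nonneg (bracket_pos t).le _)) h.a_mul_mono 2
  have e4 : ((4 : ℝ) ^ n) ^ 2 = 4 ^ (2 * n) := by
    rw [← Real.rpow_natCast, ← Real.rpow_mul (by norm_num)]; push_cast; ring_nf
  have eJ : (jb ξ ^ (-(n / 3))) ^ 6 = (jb ξ ^ (2 * n))⁻¹ := by
    rw [← Real.rpow_natCast, ← Real.rpow_mul (jb_pos ξ).le, ← Real.rpow_neg (jb_pos ξ).le]
    congr 1; push_cast; ring
  have hJ := jb_rpow_pos (2 * n) ξ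
  have h6 : y ^ 6 ≤ 64 * 4 ^ (2 * n) * H ^ 6 * (jb ξ ^ (2 * n))⁻¹ := by
    rw [Real.div_rpow (jb_pos ξ).le (by norm_num)] at hint
    have e1 : jb ξ ^ (2 * n) / 4 ^ (2 * n) * (y / 2) ^ 2 * (r ^ 2 * Real.pi) =
        (jb ξ ^ (2 * n) * y ^ 6) * (Real.pi / (64 * 4 ^ (2 * n) * H ^ 4)) := by
      rw [hr]; field_simp; ring
    rw [e1] at hint
    have h7 : (1 : ℝ) / (64 * 4 ^ (2 * n) * H ^ 4) ≤ Real.pi / (64 * 4 ^ (2 * n) * H ^ 4) := by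
      have := Real.pi_gt_three
      gcongr; linarith
    have h8 := (mul_le_mul_of_nonneg_left h7 (by positivity :
      0 ≤ jb ξ ^ (2 * n) * y ^ 6)).trans hint
    rw [mul_one_div, div_le_iff₀ (by positivity)] at h8
    rw [← div_eq_mul_inv, le_div_iff₀ hJ]
    linarith
  refine le_of_pow_le_pow_left₀ (n := 6) (by norm_num)
    (by have := jb_rpow_pos (-(n / 3)) ξ; positivity) (h6.trans ?_)
  have e2 : (2 * 4 ^ n * H * jb ξ ^ (-(n / 3))) ^ 6 =
      64 * ((4 ^ n) ^ 2 * ((4 : ℝ) ^ n) ^ 4) * H ^ 6 * (jb ξ ^ (-(n / 3))) ^ 6 := by ring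
  rw [e2, eJ, e4]
  have : (1 : ℝ) ≤ (4 ^ n) ^ 4 := one_le_pow₀ h4
  gcongr
  exact le_mul_of_one_le_right (by positivity) this

end Prof

/-! ### Velocities -/

/-- The group velocity of the frequency `ξ`. -/
noncomputable def vel (ξ : Plane) : Plane := (jb ξ)⁻¹ • ξ

lemma continuous_vel : Continuous vel := by
  unfold vel; exact (continuous_jb.inv₀ jb_ne).smul continuous_id

lemma inner_vel (e x : Plane) : inner ℝ e (vel x) = jb1 e x := by
  rw [vel, inner_smul_right, jb1, div_eq_inv_mul]

lemma unit_smul {η : Plane} (hη : η ≠ 0) : ‖(‖η‖⁻¹ • η)‖ = 1 ∧ ‖η‖ • ‖η‖⁻¹ • η = η := by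
  have hh : 0 < ‖η‖ := norm_pos_iff.2 hη
  exact ⟨by rw [norm_smul, norm_inv, norm_norm, inv_mul_cancel₀ hh.ne'],
    by rw [smul_smul, mul_inv_cancel₀ hh.ne', one_smul]⟩

/-- The velocity is the gradient of a convex function, so its component along x - y is monotone and
only the first unit of length from `y` need be examined. There the bracket is at most 4⟨y⟩, whose
cube is 64⟨y⟩³. -/
lemma le_norm_vel_sub (x y : Plane) : min 1 ‖x - y‖ * (64 * jb y ^ 3)⁻¹ ≤ ‖vel x - vel y‖ := by
  rcases eq_or_ne x y with rfl | hxy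
  · simp
  have hη : x - y ≠ 0 := sub_ne_zero.2 hxy
  obtain ⟨he, hs⟩ := unit_smul hη
  set e := ‖x - y‖⁻¹ • (x - y)
  have hh : 0 < ‖x - y‖ := norm_pos_iff.2 hη
  set h := ‖x - y‖
  set h' := min 1 h with hh'
  have h'0 : 0 < h' := lt_min one_pos hh
  have ex : x = y + h • e := by rw [hs]; abel
  have mono : jb1 e (y + h' • e) ≤ jb1 e (y + h • e) := by
    have hm : Monotone fun s : ℝ => jb1 e (y + s • e) :=
      monotone_of_deriv_nonneg (fun s => (ld_jb1 he y s).differentiableAt)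
        fun s => by rw [(ld_jb1 he y s).deriv]; exact (jb2_pos he _).le
    exact hm (min_le_right _ _)
  obtain ⟨s, hs1, hs2⟩ := (ld_jb1 he).mean_value y h'0
  have hsm : s ≤ 1 := hs1.2.le.trans (min_le_left _ _)
  have hj : jb (y + s • e) ≤ 4 * jb y := by
    have h1 := jb_add_le y (s • e)
    have h2 := jb_le_one_add (s • e)
    rw [norm_smul, he, mul_one, Real.norm_of_nonneg hs1.1.le] at h2
    nlinarith [jb_pos y]
  have lower : (64 * jb y ^ 3)⁻¹ ≤ jb2 e (y + s • e) := by
    refine le_trans ?_ (le_jb2 he _)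
    refine inv_anti₀ (pow_pos (jb_pos _) 3) ?_
    calc jb (y + s • e) ^ 3 ≤ (4 * jb y) ^ 3 := pow_le_pow_left₀ (jb_pos _).le hj 3
      _ = _ := by ring
  calc h' * (64 * jb y ^ 3)⁻¹ ≤ h' * jb2 e (y + s • e) := by gcongr
    _ = jb1 e (y + h' • e) - jb1 e y := hs2.symm
    _ ≤ jb1 e (y + h • e) - jb1 e y := by linarith
    _ = inner ℝ e (vel x - vel y) := by rw [inner_sub_right, inner_vel, inner_vel, ← ex]
    _ ≤ ‖e‖ * ‖vel x - vel y‖ := real_inner_le_norm _ _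
    _ = _ := by rw [he, one_mul]

lemma norm_vel_sub_pos {x y : Plane} (h : x ≠ y) : 0 < ‖vel x - vel y‖ :=
  lt_of_lt_of_le (mul_pos (lt_min one_pos (norm_pos_iff.2 (sub_ne_zero.2 h)))
    (inv_pos.2 (mul_pos (by norm_num) (pow_pos (jb_pos y) 3)))) (le_norm_vel_sub x y)

/-- Linearization of the bracket. -/
lemma abs_jb_sub_le (x η : Plane) : |jb x - jb (x - η) - inner ℝ η (vel x)| ≤ ‖η‖ ^ 2 := by
  rcases eq_or_ne η 0 with rfl | hη
  · simp
  obtain ⟨he, hs⟩ := unit_smul hη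
  set e := ‖η‖⁻¹ • η
  have hh : 0 < ‖η‖ := norm_pos_iff.2 hη
  set h := ‖η‖
  obtain ⟨s, hs1, hs2⟩ := (ld_jb (e := e)).mean_value (x - η) hh
  rw [hs, sub_add_cancel] at hs2
  have hr : 0 < h - s := sub_pos.2 hs1.2
  have h1 := ld_abs_sub_le (ld_jb1 he) (abs_jb2_le he) hr (x - η + s • e)
  have e1 : x - η + s • e + (h - s) • e = x := by
    rw [add_assoc, ← add_smul, add_sub_cancel, hs, sub_add_cancel]
  rw [e1] at h1
  have e2 : inner ℝ η (vel x) = h * jb1 e x := by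
    rw [← inner_vel, ← real_inner_smul_left, hs]
  rw [hs2, e2, ← mul_sub, abs_mul, abs_of_pos hh, abs_sub_comm, pow_two]
  refine mul_le_mul_of_nonneg_left (h1.trans ?_) hh.le
  linarith [hs1.1]

/-- The singular part carries a Gaussian factor so that its integrals are the moments `gamMoment`.
For r ≤ 1 that factor is at least 1/2, which explains the 2. -/
lemma rpow_min_le {p r : ℝ} (hr : 0 < r) :
    min 1 r ^ (-p) ≤ 1 + Real.exp (-r ^ 2 / 4) * (2 * r ^ (-p)) := by
  rcases le_total 1 r with h | h
  · rw [min_eq_left h, Real.one_rpow]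
    have : 0 ≤ Real.exp (-r ^ 2 / 4) * (2 * r ^ (-p)) := by positivity
    linarith
  · rw [min_eq_right h]
    have h1 : 1 ≤ Real.exp (-r ^ 2 / 4) * 2 := by
      have : (1 : ℝ) / 2 ≤ Real.exp (-r ^ 2 / 4) := by
        have := Real.add_one_le_exp (-r ^ 2 / 4)
        nlinarith
      linarith
    have h2 : 0 ≤ r ^ (-p) := by positivity
    nlinarith

/-- Majorant of negative powers of the relative velocity. -/
lemma rpow_vel_le {p : ℝ} (hp : 0 ≤ p) (hp2 : p ≤ 2) {x y : Plane} (h : x ≠ y) :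
    ‖vel x - vel y‖ ^ (-p) ≤
      64 ^ 2 * (1 + 8 * Real.pi * (gam 1 (x - y) * ‖x - y‖ ^ (-p))) * jb y ^ (6 : ℝ) := by
  have hr : 0 < ‖x - y‖ := norm_pos_iff.2 (sub_ne_zero.2 h)
  have hm : 0 < min 1 ‖x - y‖ := lt_min one_pos hr
  have hj := jb_pos y
  have hA : 1 ≤ 64 * jb y ^ 3 := by nlinarith [one_le_pow₀ (n := 3) (one_le_jb y)]
  calc ‖vel x - vel y‖ ^ (-p) ≤ (min 1 ‖x - y‖ * (64 * jb y ^ 3)⁻¹) ^ (-p) :=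
        Real.rpow_le_rpow_of_nonpos (by positivity) (le_norm_vel_sub x y) (by linarith)
    _ = min 1 ‖x - y‖ ^ (-p) * (64 * jb y ^ 3) ^ p := by
        rw [Real.mul_rpow hm.le (by positivity), Real.inv_rpow (by positivity),
          Real.rpow_neg (by positivity : 0 ≤ 64 * jb y ^ 3), inv_inv]
    _ ≤ (1 + Real.exp (-‖x - y‖ ^ 2 / 4) * (2 * ‖x - y‖ ^ (-p))) * (64 * jb y ^ 3) ^ (2 : ℝ) :=
        mul_le_mul (rpow_min_le hr) (Real.rpow_le_rpow_of_exponent_le hA hp2)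
          (by positivity) (by positivity)
    _ = _ := by
        have e1 : jb y ^ (6 : ℝ) = jb y ^ 6 := by exact_mod_cast Real.rpow_natCast (jb y) 6
        have e2 : Real.exp (-‖x - y‖ ^ 2 / 4) = 4 * Real.pi * gam 1 (x - y) := by
          have := Real.pi_pos
          rw [gam, mul_one, mul_inv_cancel_left₀ (by positivity)]
          congr 1; ring
        rw [e1, e2, Real.rpow_two]; ring

/-- The constant in the velocity integrals. -/
noncomputable def velConst (p : ℝ) : ℝ := 64 ^ 2 * (jbMass + 8 * Real.pi * gamMoment (-p))

lemma velConst_nonneg (p : ℝ) : 0 ≤ velConst p := by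
  have := jbMass_nonneg
  have := gamMoment_nonneg (-p)
  have := Real.pi_pos
  unfold velConst; positivity

lemma measurable_vel_sub (p : ℝ) (x : Plane) : Measurable fun y => ‖vel x - vel y‖ ^ (-p) :=
  ((continuous_const.sub continuous_vel).norm.measurable).pow_const _

section

variable {F : Plane → ℂ} {a : ℝ}

lemma vel_majorant {p : ℝ} (hp2 : p < 2) (x : Plane) :
    Integrable (fun y : Plane => 64 ^ 2 * (jb y ^ (-3 : ℝ) +
      8 * Real.pi * (gam 1 (x - y) * ‖x - y‖ ^ (-p)))) ∧
    ∫ y : Plane, 64 ^ 2 * (jb y ^ (-3 : ℝ) +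
      8 * Real.pi * (gam 1 (x - y) * ‖x - y‖ ^ (-p))) = velConst p := by
  have h1 : Integrable fun y : Plane => gam 1 (x - y) * ‖x - y‖ ^ (-p) :=
    (integrable_gam_rpow one_pos (by linarith)).comp_sub_left x
  refine ⟨(integrable_jb3.add (h1.const_mul _)).const_mul _, ?_⟩
  rw [integral_const_mul, integral_add integrable_jb3 (h1.const_mul _), integral_const_mul,
    integral_sub_left_eq_self (fun y : Plane => gam 1 y * ‖y‖ ^ (-p)), velConst, gamMoment, jbMass]

/-- The velocity integral with a bounded density. -/
lemma vel_integral (hF : Continuous F) (hb : ∀ ξ, ‖F ξ‖ ≤ a * jb ξ ^ (-10 : ℝ)) {p : ℝ}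
    (hp : 0 ≤ p) (hp2 : p < 2) (x : Plane) :
    Integrable (fun y => ‖vel x - vel y‖ ^ (-p) * ‖F y‖ ^ 2) ∧
    ∫ y, ‖vel x - vel y‖ ^ (-p) * ‖F y‖ ^ 2 ≤ velConst p * a ^ 2 := by
  obtain ⟨hi, hv⟩ := vel_majorant hp2 x
  have key : ∀ᵐ y : Plane, ‖vel x - vel y‖ ^ (-p) * ‖F y‖ ^ 2 ≤ a ^ 2 * (64 ^ 2 *
      (jb y ^ (-3 : ℝ) + 8 * Real.pi * (gam 1 (x - y) * ‖x - y‖ ^ (-p)))) := by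
    have hne : ∀ᵐ y : Plane, y ≠ x := by simp [ae_iff, measure_singleton]
    filter_upwards [hne] with y hy
    have h1 := rpow_vel_le hp hp2.le hy.symm
    have h2 : ‖F y‖ ^ 2 ≤ a ^ 2 * jb y ^ (-9 : ℝ) := by
      calc ‖F y‖ ^ 2 ≤ (a * jb y ^ (-10 : ℝ)) ^ 2 := pow_le_pow_left₀ (norm_nonneg _) (hb y) 2
        _ = a ^ 2 * jb y ^ (2 * (-10) : ℝ) := by rw [mul_pow, jb_rpow_sq]
        _ ≤ _ := mul_le_mul_of_nonneg_left (jb_rpow_mono (by norm_num) y) (sq_nonneg a)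
    have hg : 0 ≤ gam 1 (x - y) * ‖x - y‖ ^ (-p) :=
      mul_nonneg (gam_nonneg one_pos _) (by positivity)
    have hj6 := jb_rpow_pos 6 y
    have hpi := Real.pi_pos
    calc _ ≤ (64 ^ 2 * (1 + 8 * Real.pi * (gam 1 (x - y) * ‖x - y‖ ^ (-p))) * jb y ^ (6 : ℝ)) *
          (a ^ 2 * jb y ^ (-9 : ℝ)) := mul_le_mul h1 h2 (by positivity) (by positivity)
      _ = a ^ 2 * (64 ^ 2 * (jb y ^ (-3 : ℝ) +
          8 * Real.pi * (gam 1 (x - y) * ‖x - y‖ ^ (-p)) * jb y ^ (-3 : ℝ))) := by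
          have : jb y ^ (-3 : ℝ) = jb y ^ (6 : ℝ) * jb y ^ (-9 : ℝ) := by
            rw [← Real.rpow_add (jb_pos y)]; norm_num
          rw [this]; ring
      _ ≤ _ := by
          refine mul_le_mul_of_nonneg_left (mul_le_mul_of_nonneg_left (add_le_add le_rfl ?_)
            (by positivity)) (sq_nonneg a)
          exact mul_le_of_le_one_right (by positivity) (jb_rpow_le_one (by norm_num) y)
  have hint : Integrable (fun y => ‖vel x - vel y‖ ^ (-p) * ‖F y‖ ^ 2) := by
    refine Integrable.mono' (hi.const_mul (a ^ 2)) ?_ ?_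
    · exact ((measurable_vel_sub p x).mul (hF.norm.pow 2).measurable).aestronglyMeasurable
    · filter_upwards [key] with y hy
      rwa [Real.norm_of_nonneg (by positivity)]
  refine ⟨hint, (integral_mono_ae hint (hi.const_mul _) key).trans (le_of_eq ?_)⟩
  rw [integral_const_mul, hv, mul_comm]

end

/-! ### The leading term of the nonlinearity -/

/-- The Gaussian piece of the leading coefficient. -/
noncomputable def quad (t : ℝ) (F : Plane → ℂ) (τ : ℝ) (ξ : Plane) : ℝ :=
  ((2 * Real.pi) ^ 2)⁻¹ * ∫ σ, Real.exp (-τ * (t * ‖vel ξ - vel σ‖) ^ 2) * ‖F σ‖ ^ 2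

/-- The leading coefficient. -/
noncomputable def coul (F : Plane → ℂ) (ξ : Plane) : ℝ :=
  ((2 * Real.pi) ^ 2)⁻¹ * ∫ σ, ‖vel ξ - vel σ‖⁻¹ * ‖F σ‖ ^ 2

/-- The transform of the density with linearized phase. -/
noncomputable def lin (t : ℝ) (F : Plane → ℂ) (η : Plane) : ℂ :=
  (((2 * Real.pi) ^ 2 : ℝ) : ℂ)⁻¹ *
    ∫ σ, Complex.exp (-(Complex.I * t * (inner ℝ η (vel σ) : ℝ))) * ((‖F σ‖ ^ 2 : ℝ) : ℂ)

lemma two_pi_sq_inv_le : ((2 * Real.pi) ^ 2)⁻¹ ≤ 1 :=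
  inv_le_one_of_one_le₀ (by nlinarith [Real.pi_gt_three])

lemma two_pi_sq_inv_nonneg : 0 ≤ ((2 * Real.pi) ^ 2)⁻¹ := by positivity

lemma norm_cexp_sub_le (x y : ℝ) :
    ‖Complex.exp (Complex.I * x) - Complex.exp (Complex.I * y)‖ ≤ |x - y| := by
  have e1 : Complex.exp (Complex.I * x) - Complex.exp (Complex.I * y) =
      Complex.exp (Complex.I * y) * (Complex.exp (Complex.I * ((x - y : ℝ) : ℂ)) - 1) := by
    rw [mul_sub, ← Complex.exp_add, mul_one]; congr 2; push_cast; ring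
  rw [e1, norm_mul, norm_cexp_I_mul, one_mul]
  exact Real.norm_exp_I_mul_ofReal_sub_one_le

lemma exp_neg_le_rpow {z s : ℝ} (hz : 0 < z) (hs : 0 ≤ s) (hs1 : s ≤ 1) :
    Real.exp (-z) ≤ z ^ (-s) := by
  rw [Real.exp_neg, Real.rpow_neg hz.le]
  refine inv_anti₀ (by positivity) ?_
  rcases le_total z 1 with h | h
  · exact (Real.rpow_le_one hz.le h hs).trans (Real.one_le_exp hz.le)
  · calc z ^ s ≤ z ^ (1 : ℝ) := Real.rpow_le_rpow_of_exponent_le h hs1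
      _ = z := Real.rpow_one z
      _ ≤ _ := by linarith [Real.add_one_le_exp z]

section

variable {F : Plane → ℂ} {a : ℝ}

lemma sq_le_jb3 (hb : ∀ ξ, ‖F ξ‖ ≤ a * jb ξ ^ (-10 : ℝ)) (σ : Plane) :
    ‖F σ‖ ^ 2 ≤ a ^ 2 * jb σ ^ (-3 : ℝ) := by
  calc ‖F σ‖ ^ 2 ≤ (a * jb σ ^ (-10 : ℝ)) ^ 2 := pow_le_pow_left₀ (norm_nonneg _) (hb σ) 2
    _ = a ^ 2 * jb σ ^ (2 * (-10) : ℝ) := by rw [mul_pow, jb_rpow_sq]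
    _ ≤ _ := mul_le_mul_of_nonneg_left (jb_rpow_mono (by norm_num) σ) (sq_nonneg a)

lemma integrable_sq (hF : Continuous F) (hb : ∀ ξ, ‖F ξ‖ ≤ a * jb ξ ^ (-10 : ℝ)) :
    Integrable (fun σ => ‖F σ‖ ^ 2) ∧ ∫ σ, ‖F σ‖ ^ 2 ≤ a ^ 2 * jbMass := by
  have hi : Integrable (fun σ => ‖F σ‖ ^ 2) := by
    refine (integrable_jb3.const_mul (a ^ 2)).mono' (hF.norm.pow 2).aestronglyMeasurable
      (ae_of_all _ fun σ => ?_)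
    rw [Real.norm_of_nonneg (by positivity)]; exact sq_le_jb3 hb σ
  refine ⟨hi, ?_⟩
  rw [jbMass, ← integral_const_mul]
  exact integral_mono hi (integrable_jb3.const_mul _) (sq_le_jb3 hb)

lemma integral_norm_le (hb : ∀ ξ, ‖F ξ‖ ≤ a * jb ξ ^ (-10 : ℝ)) :
    ∫ σ, ‖F σ‖ ≤ a * jbMass := by
  have ha := nonneg_of_bound hb
  rw [jbMass, ← integral_const_mul]
  exact integral_mono_of_nonneg (ae_of_all _ fun _ => norm_nonneg _) (integrable_jb3.const_mul _)
    (ae_of_all _ fun σ => (hb σ).trans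
      (mul_le_mul_of_nonneg_left (jb_rpow_mono (by norm_num) σ) ha))

lemma coul_nonneg (ξ : Plane) : 0 ≤ coul F ξ :=
  mul_nonneg two_pi_sq_inv_nonneg (integral_nonneg fun _ => by positivity)

lemma integrable_coul (hF : Continuous F) (hb : ∀ ξ, ‖F ξ‖ ≤ a * jb ξ ^ (-10 : ℝ)) (ξ : Plane) :
    Integrable (fun σ => ‖vel ξ - vel σ‖⁻¹ * ‖F σ‖ ^ 2) := by
  have := (vel_integral hF hb (p := 1) (by norm_num) (by norm_num) ξ).1
  simpa only [Real.rpow_neg_one] using this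

lemma coul_le (hF : Continuous F) (hb : ∀ ξ, ‖F ξ‖ ≤ a * jb ξ ^ (-10 : ℝ)) (ξ : Plane) :
    coul F ξ ≤ velConst 1 * a ^ 2 := by
  have := (vel_integral hF hb (p := 1) (by norm_num) (by norm_num) ξ).2
  simp only [Real.rpow_neg_one] at this
  exact (mul_le_of_le_one_left (integral_nonneg fun _ => by positivity) two_pi_sq_inv_le).trans this

lemma quad_nonneg (t τ : ℝ) (ξ : Plane) : 0 ≤ quad t F τ ξ :=
  mul_nonneg two_pi_sq_inv_nonneg (integral_nonneg fun _ => by positivity)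

lemma continuous_gauss_vel (t τ : ℝ) (ξ : Plane) :
    Continuous fun σ => Real.exp (-τ * (t * ‖vel ξ - vel σ‖) ^ 2) := by
  have := continuous_vel; fun_prop

lemma integrable_quad (hF : Continuous F) (hb : ∀ ξ, ‖F ξ‖ ≤ a * jb ξ ^ (-10 : ℝ)) {τ : ℝ}
    (hτ : 0 < τ) (t : ℝ) (ξ : Plane) :
    Integrable (fun σ => Real.exp (-τ * (t * ‖vel ξ - vel σ‖) ^ 2) * ‖F σ‖ ^ 2) := by
  refine (integrable_sq hF hb).1.mono' ((continuous_gauss_vel t τ ξ).mul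
    (hF.norm.pow 2)).aestronglyMeasurable (ae_of_all _ fun σ => ?_)
  rw [Real.norm_of_nonneg (by positivity)]
  refine mul_le_of_le_one_left (sq_nonneg _) (Real.exp_le_one_iff.2 ?_)
  rw [neg_mul]; exact neg_nonpos.2 (by positivity)

lemma quad_le (hF : Continuous F) (hb : ∀ ξ, ‖F ξ‖ ≤ a * jb ξ ^ (-10 : ℝ)) {τ : ℝ}
    (hτ : 0 < τ) (t : ℝ) (ξ : Plane) : quad t F τ ξ ≤ a ^ 2 * jbMass := by
  refine (mul_le_of_le_one_left (integral_nonneg fun _ => by positivity) two_pi_sq_inv_le).trans ?_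
  refine le_trans ?_ (integrable_sq hF hb).2
  refine integral_mono (integrable_quad hF hb hτ t ξ) (integrable_sq hF hb).1 fun σ => ?_
  refine mul_le_of_le_one_left (sq_nonneg _) (Real.exp_le_one_iff.2 ?_)
  rw [neg_mul]; exact neg_nonpos.2 (by positivity)

/-- Uses e^{-z} ≤ z^{-7/8} at z = τt²|v(ξ)-v(σ)|². The resulting power 7/4 of the inverse relative
velocity is below 2, hence locally integrable. The τ-decay is the same as that available for the
nonlinearity. -/
lemma quad_le_rpow (hF : Continuous F) (hb : ∀ ξ, ‖F ξ‖ ≤ a * jb ξ ^ (-10 : ℝ)) {τ t : ℝ}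
    (hτ : 0 < τ) (ht : 0 < t) (ξ : Plane) :
    quad t F τ ξ ≤ velConst (7 / 4) * a ^ 2 * t ^ (-(7 / 4) : ℝ) * τ ^ (-(7 / 8) : ℝ) := by
  refine (mul_le_of_le_one_left (integral_nonneg fun _ => by positivity) two_pi_sq_inv_le).trans ?_
  obtain ⟨hi, hle⟩ := vel_integral hF hb (p := 7 / 4) (by norm_num) (by norm_num) ξ
  have hne : ∀ᵐ y : Plane, y ≠ ξ := by simp [ae_iff, measure_singleton]
  calc _ ≤ ∫ σ, (t ^ (-(7 / 4) : ℝ) * τ ^ (-(7 / 8) : ℝ)) *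
        (‖vel ξ - vel σ‖ ^ (-(7 / 4) : ℝ) * ‖F σ‖ ^ 2) := by
        refine integral_mono_ae (integrable_quad hF hb hτ t ξ) (hi.const_mul _) ?_
        filter_upwards [hne] with σ hσ
        have hv := norm_vel_sub_pos hσ.symm
        rw [← mul_assoc]
        refine mul_le_mul_of_nonneg_right ?_ (sq_nonneg _)
        have hz : 0 < τ * (t * ‖vel ξ - vel σ‖) ^ 2 := by positivity
        rw [neg_mul]
        refine (exp_neg_le_rpow hz (s := 7 / 8) (by norm_num) (by norm_num)).trans (le_of_eq ?_)
        rw [Real.mul_rpow hτ.le (by positivity), ← Real.rpow_two, ← Real.rpow_mul (by positivity),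
          Real.mul_rpow ht.le hv.le]
        norm_num; ring
    _ ≤ _ := by
        rw [integral_const_mul]
        calc _ ≤ t ^ (-(7 / 4) : ℝ) * τ ^ (-(7 / 8) : ℝ) * (velConst (7 / 4) * a ^ 2) :=
              mul_le_mul_of_nonneg_left hle (by positivity)
          _ = _ := by ring

/-- The Gaussian average of the linearized transform. -/
lemma quad_eq (hF : Continuous F) (hb : ∀ ξ, ‖F ξ‖ ≤ a * jb ξ ^ (-10 : ℝ)) {τ : ℝ}
    (hτ : 0 < τ) (t : ℝ) (ξ : Plane) :
    ∫ η : Plane, (gam τ η : ℂ) *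
      (Complex.exp (Complex.I * ((t * inner ℝ η (vel ξ) : ℝ) : ℂ)) * lin t F η) =
      (quad t F τ ξ : ℂ) := by
  have e1 : ∀ η : Plane, (gam τ η : ℂ) *
      (Complex.exp (Complex.I * ((t * inner ℝ η (vel ξ) : ℝ) : ℂ)) * lin t F η) =
      (((2 * Real.pi) ^ 2 : ℝ) : ℂ)⁻¹ * ∫ σ : Plane, (gam τ η : ℂ) *
        Complex.exp (Complex.I * (inner ℝ η (t • (vel ξ - vel σ)) : ℝ)) *
          ((‖F σ‖ ^ 2 : ℝ) : ℂ) := by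
    intro η
    rw [lin, mul_left_comm (Complex.exp _), mul_left_comm (gam τ η : ℂ), ← mul_assoc (gam τ η : ℂ),
      ← integral_const_mul]
    congr 2 with σ
    have : Complex.exp (Complex.I * (inner ℝ η (t • (vel ξ - vel σ)) : ℝ)) =
        Complex.exp (Complex.I * ((t * inner ℝ η (vel ξ) : ℝ) : ℂ)) *
          Complex.exp (-(Complex.I * t * (inner ℝ η (vel σ) : ℝ))) := by
      rw [← Complex.exp_add, real_inner_smul_right, inner_sub_right]
      congr 1; push_cast; ring
    rw [this]; ring
  simp_rw [e1]
  rw [integral_const_mul, integral_integral_swap, quad, Complex.ofReal_mul, Complex.ofReal_inv]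
  · congr 1
    rw [← integral_complex_ofReal]
    refine integral_congr_ae (ae_of_all _ fun σ => ?_)
    beta_reduce
    rw [integral_mul_const, integral_gam_cexp hτ, norm_smul, Complex.ofReal_mul]
    congr 3
    rw [Real.norm_eq_abs, mul_pow, mul_pow, sq_abs]
  · have hp := (integrable_gam hτ).mul_prod (integrable_sq hF hb).1
    refine hp.mono ?_ (ae_of_all _ fun p => ?_)
    · have h1 := continuous_gam τ
      have h2 := continuous_vel
      refine Continuous.aestronglyMeasurable ?_
      simp only [Function.uncurry_def]
      fun_prop
    · simp only [Function.uncurry, norm_mul, norm_cexp_I_mul, Complex.norm_real, mul_one, le_refl]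

lemma integrable_lin_aux (hF : Continuous F) (hb : ∀ ξ, ‖F ξ‖ ≤ a * jb ξ ^ (-10 : ℝ)) (t : ℝ)
    (η : Plane) : Integrable (fun σ =>
      Complex.exp (-(Complex.I * t * (inner ℝ η (vel σ) : ℝ))) * ((‖F σ‖ ^ 2 : ℝ) : ℂ)) := by
  have := continuous_vel
  refine (integrable_sq hF hb).1.mono' (Continuous.aestronglyMeasurable (by fun_prop))
    (ae_of_all _ fun σ => ?_)
  rw [norm_mul, norm_cexp_phase, one_mul, Complex.norm_real, Real.norm_of_nonneg (sq_nonneg _)]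

lemma continuous_lin (hF : Continuous F) (hb : ∀ ξ, ‖F ξ‖ ≤ a * jb ξ ^ (-10 : ℝ)) (t : ℝ) :
    Continuous (lin t F) := by
  have := continuous_vel
  refine continuous_const.mul (continuous_of_dominated (bound := fun σ => ‖F σ‖ ^ 2)
    (fun η => (integrable_lin_aux hF hb t η).aestronglyMeasurable)
    (fun η => ae_of_all _ fun σ => ?_) (integrable_sq hF hb).1
    (ae_of_all _ fun σ => by fun_prop))
  rw [norm_mul, norm_cexp_phase, one_mul, Complex.norm_real, Real.norm_of_nonneg (sq_nonneg _)]

/-- Subordination for the leading coefficient. -/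
lemma coul_subordination (hF : Continuous F) (hb : ∀ ξ, ‖F ξ‖ ≤ a * jb ξ ^ (-10 : ℝ)) {t : ℝ}
    (ht : 0 < t) (ξ : Plane) :
    IntegrableOn (fun τ : ℝ => τ ^ (-(1 / 2) : ℝ) * quad t F τ ξ) (Set.Ioi 0) ∧
    (√Real.pi)⁻¹ * ∫ τ in Set.Ioi (0 : ℝ), τ ^ (-(1 / 2) : ℝ) * quad t F τ ξ = coul F ξ / t := by
  have hne : ∀ᵐ y : Plane, y ≠ ξ := by simp [ae_iff, measure_singleton]
  have hV : ∀ {σ : Plane}, σ ≠ ξ → 0 < t * ‖vel ξ - vel σ‖ := fun h =>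
    mul_pos ht (norm_vel_sub_pos h.symm)
  set f : ℝ → Plane → ℝ := fun τ σ =>
    τ ^ (-(1 / 2) : ℝ) * (Real.exp (-τ * (t * ‖vel ξ - vel σ‖) ^ 2) * ‖F σ‖ ^ 2) with hf
  -- The Gaussian in τ is governed by t|v(ξ)-v(σ)|, so the subordination identity produces the
  -- factor t⁻¹.
  have inner_eq : ∀ σ, σ ≠ ξ → ∫ τ in Set.Ioi (0 : ℝ), f τ σ =
      √Real.pi * t⁻¹ * (‖vel ξ - vel σ‖⁻¹ * ‖F σ‖ ^ 2) := by
    intro σ hσ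
    simp only [hf]
    simp_rw [← mul_assoc]
    rw [integral_mul_const, integral_rpow_exp (hV hσ), mul_inv]
    ring
  have hmeas : Measurable (Function.uncurry f) := by
    have h2 := continuous_vel.measurable
    have h3 := hF.measurable
    simp only [hf, Function.uncurry_def]
    fun_prop
  have hprod : Integrable (Function.uncurry f)
      ((volume.restrict (Set.Ioi (0 : ℝ))).prod (volume : Measure Plane)) := by
    rw [integrable_prod_iff' hmeas.aestronglyMeasurable]
    refine ⟨?_, ?_⟩
    · filter_upwards [hne] with σ hσ
      simp only [Function.uncurry, hf]
      simp_rw [← mul_assoc]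
      exact (integrableOn_rpow_exp (hV hσ)).mul_const _
    · refine ((integrable_coul hF hb ξ).const_mul (√Real.pi * t⁻¹)).congr ?_
      filter_upwards [hne] with σ hσ
      rw [← inner_eq σ hσ]
      refine setIntegral_congr_fun measurableSet_Ioi fun τ hτ => ?_
      have hτ : (0 : ℝ) < τ := hτ
      simp only [Function.uncurry]
      rw [Real.norm_of_nonneg]
      simp only [hf]; positivity
  have e1 : ∀ τ : ℝ, τ ^ (-(1 / 2) : ℝ) * quad t F τ ξ =
      ((2 * Real.pi) ^ 2)⁻¹ * ∫ σ, f τ σ := by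
    intro τ
    simp only [hf]
    rw [quad, integral_const_mul]; ring
  simp_rw [e1]
  refine ⟨hprod.integral_prod_left.const_mul _, ?_⟩
  rw [integral_const_mul, integral_integral_swap hprod, coul]
  have e2 : ∫ σ, ∫ τ in Set.Ioi (0 : ℝ), f τ σ =
      √Real.pi * t⁻¹ * ∫ σ, ‖vel ξ - vel σ‖⁻¹ * ‖F σ‖ ^ 2 := by
    rw [← integral_const_mul]
    refine integral_congr_ae ?_
    filter_upwards [hne] with σ hσ using inner_eq σ hσ
  rw [e2]
  have : √Real.pi ≠ 0 := (Real.sqrt_pos.2 Real.pi_pos).ne'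
  field_simp

end

/-! ### Freezing phases and profiles at small momentum transfer. -/

namespace Prof

variable {n t a : ℝ} {F : Plane → ℂ}

/-- Replacing F(σ+η) by F(σ) costs the Hölder factor |η|^{1/2}; replacing ⟨σ+η⟩-⟨σ⟩ by η·v(σ) costs
t|η|², by Taylor's formula. The remaining factor is bounded in L¹. -/
lemma corr_sub_lin (hn : 1000 ≤ n) (h : Prof n t a F) (ht : 0 ≤ t) (η : Plane) :
    ‖corr (modul t F) η - lin t F η‖ ≤
      (a * bracket t ^ (1 / 50 : ℝ) * ‖η‖ ^ (1 / 2 : ℝ) + a * t * ‖η‖ ^ 2) * (a * jbMass) := by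
  have hb := h.bd10 hn
  have ha := h.nonneg
  have hi : Integrable (fun σ => Complex.exp (-(Complex.I * t * (jb (σ + η) - jb σ : ℝ))) *
      (F (σ + η) * star (F σ))) := by
    have := integrable_pair_mul (X := fun _ => 1) (κ := 1) (t := t) continuous_const
      (by simp) hn h η
    simpa using this
  have e0 : ((2 * Real.pi) ^ 2 : ℂ)⁻¹ = (((2 * Real.pi) ^ 2 : ℝ) : ℂ)⁻¹ := by push_cast; rfl
  rw [corr_modul, lin, e0, ← mul_sub, ← integral_sub hi (integrable_lin_aux h.cont hb t η),
    norm_mul]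
  have h1 : ‖(((2 * Real.pi) ^ 2 : ℝ) : ℂ)⁻¹‖ ≤ 1 := by rw [← e0]; exact inv_two_pi_sq_le
  refine (mul_le_of_le_one_left (norm_nonneg _) h1).trans ?_
  set K := a * bracket t ^ (1 / 50 : ℝ) * ‖η‖ ^ (1 / 2 : ℝ) + a * t * ‖η‖ ^ 2 with hK
  have hK0 : 0 ≤ K := by
    have := Real.rpow_nonneg (bracket_pos t).le (1 / 50); positivity
  calc _ ≤ ∫ σ, K * ‖F σ‖ := by
        refine norm_integral_le_of_norm_le ((h.integrable hn).norm.const_mul K)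
          (ae_of_all _ fun σ => ?_)
        have e1 : ((‖F σ‖ ^ 2 : ℝ) : ℂ) = F σ * star (F σ) := by
          have := Complex.mul_conj (F σ)
          rw [Complex.normSq_eq_norm_sq] at this
          exact this.symm
        have e2 : Complex.exp (-(Complex.I * t * (jb (σ + η) - jb σ : ℝ))) * (F (σ + η) * star (F σ))
            - Complex.exp (-(Complex.I * t * (inner ℝ η (vel σ) : ℝ))) * ((‖F σ‖ ^ 2 : ℝ) : ℂ) =
            (Complex.exp (-(Complex.I * t * (jb (σ + η) - jb σ : ℝ))) * (F (σ + η) - F σ) +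
            (Complex.exp (-(Complex.I * t * (jb (σ + η) - jb σ : ℝ))) -
              Complex.exp (-(Complex.I * t * (inner ℝ η (vel σ) : ℝ)))) * F σ) * star (F σ) := by
          rw [e1]; ring
        rw [e2, norm_mul, norm_star]
        refine mul_le_mul_of_nonneg_right ((norm_add_le _ _).trans ?_) (norm_nonneg _)
        rw [norm_mul, norm_cexp_phase, one_mul, norm_mul]
        refine add_le_add ?_ ?_
        · have := h.hold (σ + η) σ
          rwa [add_sub_cancel_left] at this
        · have p1 : ∀ r : ℝ, -(Complex.I * t * r) = Complex.I * ((-(t * r) : ℝ) : ℂ) := fun r => by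
            push_cast; ring
          have b1 := abs_jb_sub_le σ (-η)
          rw [sub_neg_eq_add, norm_neg, inner_neg_left] at b1
          have b2 : ‖Complex.exp (-(Complex.I * t * (jb (σ + η) - jb σ : ℝ))) -
              Complex.exp (-(Complex.I * t * (inner ℝ η (vel σ) : ℝ)))‖ ≤ t * ‖η‖ ^ 2 := by
            rw [p1, p1]
            refine (norm_cexp_sub_le _ _).trans ?_
            have : -(t * (jb (σ + η) - jb σ)) - -(t * inner ℝ η (vel σ)) =
                t * (jb σ - jb (σ + η) - -inner ℝ η (vel σ)) := by ring
            rw [this, abs_mul, abs_of_nonneg ht]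
            exact mul_le_mul_of_nonneg_left b1 ht
          have b3 : ‖F σ‖ ≤ a := (hb σ).trans (mul_le_of_le_one_right ha
            (jb_rpow_le_one (by norm_num) σ))
          calc _ ≤ t * ‖η‖ ^ 2 * a := mul_le_mul b2 b3 (norm_nonneg _) (by positivity)
            _ = _ := by ring
    _ ≤ _ := by
        rw [integral_const_mul]
        exact mul_le_mul_of_nonneg_left (integral_norm_le hb) hK0

/-- The difference between a Gaussian piece of the nonlinearity and its leading term. -/
noncomputable def defect (t : ℝ) (F : Plane → ℂ) (τ : ℝ) (ξ : Plane) : ℂ :=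
  Complex.exp (Complex.I * t * jb ξ) * tri (modul t F) τ ξ - quad t F τ ξ * F ξ

/-- Three replacements are made: of F(ξ-η) by F(ξ), of the phase t(⟨ξ⟩-⟨ξ-η⟩) by tη·v(ξ), and of
`corr` by `lin`. Each costs |η|^{1/2} or t|η|² (the last one both), and these average under `gam τ`
to multiples of τ^{1/4} and tτ. After them the η-integral is exactly `quad`. -/
lemma freeze (hn : 1000 ≤ n) (h : Prof n t a F) (ht : 0 ≤ t) {τ : ℝ} (hτ : 0 < τ) (ξ : Plane) :
    ‖defect t F τ ξ‖ ≤ 129 * jbMass * a ^ 2 *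
      (a * bracket t ^ (1 / 50 : ℝ) * (gamMoment (1 / 2) * τ ^ (1 / 4 : ℝ)) +
        a * t * (gamMoment 2 * τ)) := by
  have hb := h.bd10 hn
  have hmb := h.mbd10 hn
  have ha := h.nonneg
  have hm := jbMass_nonneg
  have hmc := continuous_modul h.cont t
  set G := corr (modul t F) with hG
  have hGc : Continuous G := continuous_corr hmc hmb
  have hLc := continuous_lin h.cont hb t
  have hFb : ∀ σ, ‖F σ‖ ≤ a := fun σ => (hb σ).trans (mul_le_of_le_one_right ha
            (jb_rpow_le_one (by norm_num) σ))
  have hGb : ∀ η, ‖G η‖ ≤ 128 * a ^ 2 * jbMass := fun η => by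
    refine (norm_corr_le hmb η).trans ?_
    have := jb_rpow_le_one (s := -7) (by norm_num) η
    calc _ ≤ 2 ^ 7 * a ^ 2 * jbMass * 1 := mul_le_mul_of_nonneg_left this (by positivity)
      _ = _ := by norm_num
  have hLb : ∀ η, ‖lin t F η‖ ≤ a ^ 2 * jbMass := fun η => by
    rw [lin, norm_mul]
    have h1 : ‖(((2 * Real.pi) ^ 2 : ℝ) : ℂ)⁻¹‖ ≤ 1 := by
      rw [norm_inv, Complex.norm_real, Real.norm_of_nonneg (by positivity)]
      exact two_pi_sq_inv_le
    refine (mul_le_of_le_one_left (norm_nonneg _) h1).trans (le_trans ?_ (integrable_sq h.cont hb).2)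
    refine norm_integral_le_of_norm_le (integrable_sq h.cont hb).1 (ae_of_all _ fun σ => ?_)
    rw [norm_mul, norm_cexp_phase, one_mul, Complex.norm_real, Real.norm_of_nonneg (sq_nonneg _)]
  set A : Plane → ℂ := fun η => Complex.exp (Complex.I * ((t * (jb ξ - jb (ξ - η)) : ℝ) : ℂ)) with hA
  set B : Plane → ℂ := fun η => Complex.exp (Complex.I * ((t * inner ℝ η (vel ξ) : ℝ) : ℂ)) with hB
  have hAn : ∀ η, ‖A η‖ = 1 := fun η => norm_cexp_I_mul _
  have hBn : ∀ η, ‖B η‖ = 1 := fun η => norm_cexp_I_mul _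
  have hFc := h.cont
  have hAc : Continuous A := by have := continuous_jb; simp only [hA]; fun_prop
  have hBc : Continuous B := by simp only [hB]; fun_prop
  have hgi := integrable_gam hτ
  have hgc := continuous_gam τ
  have gint : ∀ {w : Plane → ℂ} {c : ℝ}, Continuous w → (∀ η, ‖w η‖ ≤ c) →
      Integrable fun η => (gam τ η : ℂ) * w η := fun hw hc =>
    hgi.ofReal.mul_bdd hw.aestronglyMeasurable (ae_of_all _ hc)
  have e1 : Complex.exp (Complex.I * t * jb ξ) * tri (modul t F) τ ξ =
      ∫ η : Plane, (gam τ η : ℂ) * (A η * G η * F (ξ - η)) := by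
    rw [tri, ← integral_const_mul]
    congr 1 with η
    have : A η = Complex.exp (Complex.I * t * jb ξ) *
        Complex.exp (-(Complex.I * t * jb (ξ - η))) := by
      rw [← Complex.exp_add]; simp only [hA]; congr 1; push_cast; ring
    rw [this, modul]; ring
  have i1 : Integrable fun η : Plane => (gam τ η : ℂ) * (A η * G η * F (ξ - η)) := by
    refine gint (c := 1 * (128 * a ^ 2 * jbMass) * a) (by fun_prop) fun η => ?_
    rw [norm_mul, norm_mul, hAn]
    exact mul_le_mul (mul_le_mul_of_nonneg_left (hGb η) zero_le_one) (hFb _) (norm_nonneg _)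
      (by positivity)
  have i2 : Integrable fun η : Plane => (gam τ η : ℂ) * (B η * lin t F η) := by
    refine gint (c := 1 * (a ^ 2 * jbMass)) (by fun_prop) fun η => ?_
    rw [norm_mul, hBn]
    exact mul_le_mul_of_nonneg_left (hLb η) zero_le_one
  rw [defect, e1, ← quad_eq h.cont hb hτ t ξ, ← integral_mul_const, ← integral_sub i1
    (i2.mul_const _)]
  set H := a * bracket t ^ (1 / 50 : ℝ) with hH
  have hH0 : 0 ≤ H := mul_nonneg ha (Real.rpow_nonneg (bracket_pos t).le _)
  have g1 := integrable_gam_rpow (p := 1 / 2) hτ (by norm_num)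
  have g2 := integrable_gam_rpow (p := 2) hτ (by norm_num)
  calc _ ≤ ∫ η : Plane, 129 * jbMass * a ^ 2 * (H * (gam τ η * ‖η‖ ^ (1 / 2 : ℝ)) +
        a * t * (gam τ η * ‖η‖ ^ (2 : ℝ))) := by
        refine norm_integral_le_of_norm_le (((g1.const_mul _).add (g2.const_mul _)).const_mul _)
          (ae_of_all _ fun η => ?_)
        have e2 : (gam τ η : ℂ) * (A η * G η * F (ξ - η)) - (gam τ η : ℂ) * (B η * lin t F η) * F ξ =
            (gam τ η : ℂ) * (A η * G η * (F (ξ - η) - F ξ) + (A η - B η) * G η * F ξ +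
              B η * (G η - lin t F η) * F ξ) := by ring
        beta_reduce
        rw [e2, norm_mul, Complex.norm_real, Real.norm_of_nonneg (gam_nonneg hτ η)]
        have t1 : ‖A η * G η * (F (ξ - η) - F ξ)‖ ≤
            128 * a ^ 2 * jbMass * (H * ‖η‖ ^ (1 / 2 : ℝ)) := by
          rw [norm_mul, norm_mul, hAn, one_mul]
          have := h.hold (ξ - η) ξ
          rw [sub_sub_cancel_left, norm_neg] at this
          exact mul_le_mul (hGb η) this (norm_nonneg _) (by positivity)
        have t2 : ‖(A η - B η) * G η * F ξ‖ ≤ t * ‖η‖ ^ 2 * (128 * a ^ 2 * jbMass) * a := by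
          rw [norm_mul, norm_mul]
          have hd : ‖A η - B η‖ ≤ t * ‖η‖ ^ 2 := by
            refine (norm_cexp_sub_le _ _).trans ?_
            rw [← mul_sub, abs_mul, abs_of_nonneg ht]
            exact mul_le_mul_of_nonneg_left (abs_jb_sub_le ξ η) ht
          exact mul_le_mul (mul_le_mul hd (hGb η) (norm_nonneg _) (by positivity)) (hFb _)
            (norm_nonneg _) (by positivity)
        have t3 : ‖B η * (G η - lin t F η) * F ξ‖ ≤
            (H * ‖η‖ ^ (1 / 2 : ℝ) + a * t * ‖η‖ ^ 2) * (a * jbMass) * a := by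
          rw [norm_mul, norm_mul, hBn, one_mul]
          exact mul_le_mul (h.corr_sub_lin hn ht η) (hFb _) (norm_nonneg _) (by positivity)
        -- 129 = 128 + 1: the Hölder and the Taylor error each occur once against the bound 128 of
        -- `G` and once in the passage from `G` to `lin`.
        have t4 := (norm_add₃_le (a := A η * G η * (F (ξ - η) - F ξ))
          (b := (A η - B η) * G η * F ξ) (c := B η * (G η - lin t F η) * F ξ)).trans
          (add_le_add_three t1 t2 t3)
        refine (mul_le_mul_of_nonneg_left t4 (gam_nonneg hτ η)).trans (le_of_eq ?_)
        rw [Real.rpow_two]; ring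
    _ = _ := by
        rw [integral_const_mul, integral_add (g1.const_mul _) (g2.const_mul _), integral_const_mul,
          integral_const_mul, integral_gam_rpow hτ, integral_gam_rpow hτ]
        norm_num

end Prof

/-! ### Bounds at small and large Gaussian scales, and the leading term. -/

namespace Prof

variable {n t a : ℝ} {F : Plane → ℂ}

lemma rpow_jb_mul_le (h : Prof n t a F) (ξ : Plane) : jb ξ ^ (n / 100) * ‖F ξ‖ ≤ a := by
  have h1 := h.bd ξ
  rw [Real.rpow_neg (jb_pos ξ).le, ← div_eq_mul_inv, le_div_iff₀ (jb_rpow_pos _ _)] at h1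
  linarith

/-- Above t^{2/n} the decay ⟨ξ⟩^{-n/3} beats the weight ⟨ξ⟩^{n/100} by t^{1/50-2/3}, which is below
t^{-6/10}. This makes truncation at t^{2/n} harmless. -/
lemma tail_weight (hn : 1000 ≤ n) (ht : 1 ≤ t) {ξ : Plane} (hξ : t ^ (2 / n) ≤ jb ξ) :
    jb ξ ^ (n / 100 - n / 3) ≤ t ^ (-(6 / 10) : ℝ) := by
  have ht0 : 0 < t := by linarith
  have hM : 0 < t ^ (2 / n) := by positivity
  calc _ ≤ (t ^ (2 / n)) ^ (n / 100 - n / 3) :=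
        Real.rpow_le_rpow_of_nonpos hM hξ (by linarith)
    _ = t ^ (1 / 50 - 2 / 3 : ℝ) := by
        rw [← Real.rpow_mul ht0.le]; congr 1; field_simp; norm_num
    _ ≤ _ := Real.rpow_le_rpow_of_exponent_le ht (by norm_num)

lemma tail_le (hn : 1000 ≤ n) (ht : 1 ≤ t) (h : Prof n t a F) {ξ : Plane}
    (hξ : t ^ (2 / n) ≤ jb ξ) :
    jb ξ ^ (n / 100) * ‖F ξ‖ ≤ 4 * 4 ^ n * a * t ^ (-(1 / 2) : ℝ) := by
  have ht0 : 0 < t := by linarith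
  have ha := h.nonneg
  have hp := h.pointwise hn ξ
  have hbr := bracket_rpow_le ht (s := 1 / 50) (by norm_num) (by norm_num)
  have hw := tail_weight hn ht hξ
  calc _ ≤ jb ξ ^ (n / 100) * (2 * 4 ^ n * (a * bracket t ^ (1 / 50 : ℝ)) * jb ξ ^ (-(n / 3))) :=
        mul_le_mul_of_nonneg_left hp (jb_rpow_pos _ _).le
    _ = 2 * 4 ^ n * a * (bracket t ^ (1 / 50 : ℝ) * jb ξ ^ (n / 100 - n / 3)) := by
        rw [sub_eq_add_neg, Real.rpow_add (jb_pos ξ)]; ring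
    _ ≤ 2 * 4 ^ n * a * (2 * t ^ (1 / 50 : ℝ) * t ^ (-(6 / 10) : ℝ)) := by
        refine mul_le_mul_of_nonneg_left ?_ (by positivity)
        exact mul_le_mul hbr hw (jb_rpow_pos _ _).le (by positivity)
    _ = 4 * 4 ^ n * a * t ^ (1 / 50 + -(6 / 10) : ℝ) := by rw [Real.rpow_add ht0]; ring
    _ ≤ _ := mul_le_mul_of_nonneg_left
        (Real.rpow_le_rpow_of_exponent_le ht (by norm_num)) (by positivity)

/-- `norm_tri_le` with exponent n/3, at which both F and `corr` decay with only small losses in t.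
No gain in τ is sought, as the bound serves small scales only. -/
lemma tri_tail_le (hn : 1000 ≤ n) (ht : 1 ≤ t) (h : Prof n t a F) {τ : ℝ} (hτ : 0 < τ) {ξ : Plane}
    (hξ : t ^ (2 / n) ≤ jb ξ) :
    jb ξ ^ (n / 100) * ‖tri (modul t F) τ ξ‖ ≤
      8 * 4 ^ n * (2 ^ (n / 3)) ^ 2 * a ^ 3 * t ^ (-(1 / 2) : ℝ) := by
  have ht0 : 0 < t := by linarith
  have ha := h.nonneg
  have hbr := bracket_rpow_le ht (s := 1 / 50) (by norm_num) (by norm_num)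
  have hb2 : (a * bracket t ^ (1 / 100 : ℝ)) ^ 2 ≤ a ^ 2 * (2 * t ^ (1 / 50 : ℝ)) := by
    rw [sq_mul_bracket_rpow]
    have e1 : (2 * (1 / 100) : ℝ) = 1 / 50 := by norm_num
    rw [e1]; gcongr
  have hU : ∀ x, ‖modul t F x‖ ≤
      (2 * 4 ^ n * (a * bracket t ^ (1 / 50 : ℝ))) * jb x ^ (-(n / 3)) := fun x => by
    rw [norm_modul]; exact h.pointwise hn x
  have hg : ∀ c : ℝ, ∫ η : Plane, gam τ η * c = c := fun c => by
    rw [integral_mul_const, integral_gam hτ, one_mul]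
  have h1 := norm_tri_le (s := n / 3) (w := fun _ => 2 ^ (n / 3) *
    (a * bracket t ^ (1 / 100 : ℝ)) ^ 2) hτ (by linarith) hU
    (fun η => h.corr_le (by linarith) (by linarith) η) ((integrable_gam hτ).mul_const _) ξ
  rw [hg] at h1
  have e1 : jb ξ ^ (n / 100) = jb ξ ^ (n / 100 - n / 3) * jb ξ ^ (n / 3) := by
    rw [← Real.rpow_add (jb_pos ξ)]; congr 1; ring
  have hw := tail_weight hn ht hξ
  calc _ = jb ξ ^ (n / 100 - n / 3) * (jb ξ ^ (n / 3) * ‖tri (modul t F) τ ξ‖) := by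
        rw [e1, mul_assoc]
    _ ≤ t ^ (-(6 / 10) : ℝ) * (2 ^ (n / 3) * (2 * 4 ^ n * (a * (2 * t ^ (1 / 50 : ℝ)))) *
          (2 ^ (n / 3) * (a ^ 2 * (2 * t ^ (1 / 50 : ℝ))))) := by
        refine mul_le_mul hw (h1.trans ?_) (mul_nonneg (jb_rpow_pos _ _).le (norm_nonneg _))
          (by positivity)
        gcongr
    _ = 8 * 4 ^ n * (2 ^ (n / 3)) ^ 2 * a ^ 3 * t ^ (-(6 / 10) + 1 / 50 + 1 / 50 : ℝ) := by
        rw [Real.rpow_add ht0, Real.rpow_add ht0]; ring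
    _ ≤ _ := mul_le_mul_of_nonneg_left
        (Real.rpow_le_rpow_of_exponent_le ht (by norm_num)) (by positivity)

lemma norm_defect_le (ξ : Plane) (τ : ℝ) :
    jb ξ ^ (n / 100) * ‖defect t F τ ξ‖ ≤ jb ξ ^ (n / 100) * ‖tri (modul t F) τ ξ‖ +
      quad t F τ ξ * (jb ξ ^ (n / 100) * ‖F ξ‖) := by
  have h1 : ‖defect t F τ ξ‖ ≤ ‖tri (modul t F) τ ξ‖ + quad t F τ ξ * ‖F ξ‖ := by
    refine (norm_sub_le _ _).trans (le_of_eq ?_)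
    have e1 : Complex.I * t * jb ξ = Complex.I * ((t * jb ξ : ℝ) : ℂ) := by push_cast; ring
    rw [norm_mul, norm_mul, e1, norm_cexp_I_mul, one_mul, Complex.norm_real,
      Real.norm_of_nonneg (quad_nonneg t τ ξ)]
  calc _ ≤ jb ξ ^ (n / 100) * (‖tri (modul t F) τ ξ‖ + quad t F τ ξ * ‖F ξ‖) :=
        mul_le_mul_of_nonneg_left h1 (jb_rpow_pos _ _).le
    _ = _ := by ring

/-- Bound for small scales. -/
lemma defect_small (hn : 1000 ≤ n) : ∃ C : ℝ, 0 ≤ C ∧ ∀ t a F, 1 ≤ t → Prof n t a F →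
    ∀ τ, 0 < τ → ∀ ξ, jb ξ ^ (n / 100) * ‖defect t F τ ξ‖ ≤
      C * a ^ 3 * (t ^ (1 / 25 : ℝ) * τ ^ (1 / 4 : ℝ) + t ^ (26 / 25 : ℝ) * τ +
        t ^ (-(1 / 2) : ℝ)) := by
  have hm := jbMass_nonneg
  have g1 := gamMoment_nonneg (1 / 2)
  have g2 := gamMoment_nonneg 2
  set C1 := 129 * jbMass * (2 * gamMoment (1 / 2) + gamMoment 2)
  set C2 : ℝ := 8 * 4 ^ n * (2 ^ (n / 3)) ^ 2 + jbMass * (4 * 4 ^ n)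
  have p1 : 0 ≤ C1 := by positivity
  have p2 : 0 ≤ C2 := by positivity
  refine ⟨C1 + C2, by positivity, fun t a F ht h τ hτ ξ => ?_⟩
  have ht0 : 0 < t := by linarith
  have ha := h.nonneg
  have q1 : 0 ≤ t ^ (1 / 25 : ℝ) * τ ^ (1 / 4 : ℝ) := by positivity
  have q2 : 0 ≤ t ^ (26 / 25 : ℝ) * τ := by positivity
  have q3 : 0 ≤ t ^ (-(1 / 2) : ℝ) := by positivity
  -- Below t^{2/n} the weight costs only t^{1/50} and `freeze` applies; above it the nonlinearity
  -- and its model are each O(t^{-1/2}).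
  rcases le_total (jb ξ) (t ^ (2 / n)) with hξ | hξ
  · have hw : jb ξ ^ (n / 100) ≤ t ^ (1 / 50 : ℝ) := by
      calc _ ≤ (t ^ (2 / n)) ^ (n / 100) :=
            Real.rpow_le_rpow (jb_pos ξ).le hξ (by linarith)
        _ = _ := by rw [← Real.rpow_mul ht0.le]; congr 1; field_simp; norm_num
    have hbr := bracket_rpow_le ht (s := 1 / 50) (by norm_num) (by norm_num)
    have hf := h.freeze hn ht0.le hτ ξ
    calc _ ≤ t ^ (1 / 50 : ℝ) * (129 * jbMass * a ^ 2 *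
          (a * (2 * t ^ (1 / 50 : ℝ)) * (gamMoment (1 / 2) * τ ^ (1 / 4 : ℝ)) +
            a * t * (gamMoment 2 * τ))) := by
          refine mul_le_mul hw (hf.trans ?_) (norm_nonneg _) (by positivity)
          gcongr
      _ = 129 * jbMass * a ^ 3 * (2 * gamMoment (1 / 2) * (t ^ (1 / 50 + 1 / 50 : ℝ) *
            τ ^ (1 / 4 : ℝ)) + gamMoment 2 * (t ^ (1 / 50 + 1 : ℝ) * τ)) := by
          rw [Real.rpow_add ht0, Real.rpow_add ht0, Real.rpow_one]; ring
      _ ≤ 129 * jbMass * a ^ 3 * (2 * gamMoment (1 / 2) * (t ^ (1 / 25 : ℝ) *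
            τ ^ (1 / 4 : ℝ)) + gamMoment 2 * (t ^ (26 / 25 : ℝ) * τ)) := by
          have r1 : t ^ (1 / 50 + 1 / 50 : ℝ) ≤ t ^ (1 / 25 : ℝ) :=
            Real.rpow_le_rpow_of_exponent_le ht (by norm_num)
          have r2 : t ^ (1 / 50 + 1 : ℝ) ≤ t ^ (26 / 25 : ℝ) :=
            Real.rpow_le_rpow_of_exponent_le ht (by norm_num)
          gcongr
      _ ≤ C1 * a ^ 3 * (t ^ (1 / 25 : ℝ) * τ ^ (1 / 4 : ℝ) + t ^ (26 / 25 : ℝ) * τ) := by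
          have e1 : C1 * a ^ 3 * (t ^ (1 / 25 : ℝ) * τ ^ (1 / 4 : ℝ) + t ^ (26 / 25 : ℝ) * τ) =
              129 * jbMass * a ^ 3 * ((2 * gamMoment (1 / 2) + gamMoment 2) *
                (t ^ (1 / 25 : ℝ) * τ ^ (1 / 4 : ℝ) + t ^ (26 / 25 : ℝ) * τ)) := by
            simp only [C1]; ring
          rw [e1]
          refine mul_le_mul_of_nonneg_left ?_ (by positivity)
          nlinarith [mul_nonneg g1 q2, mul_nonneg g2 q1]
      _ ≤ _ := by
          refine mul_le_mul (by gcongr; linarith) (by linarith) (by positivity) (by positivity)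
  · have hq := quad_le h.cont (h.bd10 hn) hτ t ξ
    calc _ ≤ 8 * 4 ^ n * (2 ^ (n / 3)) ^ 2 * a ^ 3 * t ^ (-(1 / 2) : ℝ) +
          a ^ 2 * jbMass * (4 * 4 ^ n * a * t ^ (-(1 / 2) : ℝ)) :=
          (norm_defect_le ξ τ).trans (add_le_add (h.tri_tail_le hn ht hτ hξ)
            (mul_le_mul hq (h.tail_le hn ht hξ)
              (mul_nonneg (jb_rpow_pos _ _).le (norm_nonneg _)) (by positivity)))
      _ = C2 * a ^ 3 * t ^ (-(1 / 2) : ℝ) := by simp only [C2]; ring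
      _ ≤ _ := by
          refine mul_le_mul (by gcongr; linarith) (by linarith) (by positivity) (by positivity)

/-- Bound for large scales. -/
lemma defect_large (hn : 1000 ≤ n) {ρ : Plane → ℝ} (hρ : IsBump ρ) : ∃ C : ℝ, 0 ≤ C ∧
    ∀ t a F, 1 ≤ t → Prof n t a F → ∀ τ, 0 < τ → ∀ ξ,
      jb ξ ^ (n / 100) * ‖defect t F τ ξ‖ ≤
        C * a ^ 3 * (t ^ (-(165 / 100) : ℝ) * τ ^ (-(7 / 8) : ℝ)) := by
  obtain ⟨C, hC, hdec⟩ := corr_decay hn hρ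
  have g1 := gamMoment_nonneg (-(7 / 4))
  have v1 := velConst_nonneg (7 / 4)
  refine ⟨2 ^ (n / 100) * C * gamMoment (-(7 / 4)) + velConst (7 / 4), by positivity,
    fun t a F ht h τ hτ ξ => ?_⟩
  have ht0 : 0 < t := by linarith
  have ha := h.nonneg
  set c := C * a ^ 2 * t ^ (1 / 10 : ℝ) * t ^ (-(7 / 4) : ℝ) with hc
  -- The value at η = 0 is set by hand: a real negative power of 0 is 0 by convention, so the
  -- formula would not dominate `corr` there. One point does not affect the integral.
  set w : Plane → ℝ := fun η => if η = 0 then ‖corr (modul t F) 0‖ else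
    c * ‖η‖ ^ (-(7 / 4) : ℝ) with hw
  have hwae : (fun η => gam τ η * w η) =ᵐ[volume]
      fun η => c * (gam τ η * ‖η‖ ^ (-(7 / 4) : ℝ)) := by
    have hne : ∀ᵐ y : Plane, y ≠ 0 := by simp [ae_iff, measure_singleton]
    filter_upwards [hne] with η hη
    simp only [hw, if_neg hη]; ring
  have hgi := integrable_gam_rpow (p := -(7 / 4)) hτ (by norm_num)
  have hwb : ∀ η, jb η ^ (n / 100) * ‖corr (modul t F) η‖ ≤ w η := by
    intro η
    by_cases hη : η = 0
    · have : jb (0 : Plane) = 1 := by simp [jb, bracket]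
      simp [hw, hη, this]
    · simp only [hw, if_neg hη]
      refine (hdec t a F ht h η hη).trans (le_of_eq ?_)
      rw [Real.mul_rpow ht0.le (norm_nonneg _), hc]; ring
  have h1 := norm_tri_le (s := n / 100) hτ (by linarith)
    (fun x => by rw [norm_modul]; exact h.bd x) hwb ((hgi.const_mul c).congr hwae.symm) ξ
  rw [integral_congr_ae hwae, integral_const_mul, integral_gam_rpow hτ] at h1
  have e8 : (-(7 / 4) / 2 : ℝ) = -(7 / 8) := by norm_num
  rw [e8] at h1
  have h2 := quad_le_rpow h.cont (h.bd10 hn) hτ ht0 ξ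
  have r1 : t ^ (1 / 10 : ℝ) * t ^ (-(7 / 4) : ℝ) = t ^ (-(165 / 100) : ℝ) := by
    rw [← Real.rpow_add ht0]; norm_num
  have r2 : t ^ (-(7 / 4) : ℝ) ≤ t ^ (-(165 / 100) : ℝ) :=
    Real.rpow_le_rpow_of_exponent_le ht (by norm_num)
  have hq0 := quad_nonneg (F := F) t τ ξ
  calc _ ≤ 2 ^ (n / 100) * a * (c * (gamMoment (-(7 / 4)) * τ ^ (-(7 / 8) : ℝ))) +
        (velConst (7 / 4) * a ^ 2 * t ^ (-(165 / 100) : ℝ) * τ ^ (-(7 / 8) : ℝ)) * a := by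
        refine (norm_defect_le ξ τ).trans (add_le_add h1 ?_)
        refine mul_le_mul (h2.trans ?_) (h.rpow_jb_mul_le ξ)
          (mul_nonneg (jb_rpow_pos _ _).le (norm_nonneg _)) (by positivity)
        gcongr
    _ = _ := by rw [hc, mul_assoc (C * a ^ 2), r1]; ring

/-- Splitting at τ = t^{-8/5}, the three terms integrate to the powers -1.16, -1.36 and -1.3 of t,
while the large scales give exactly -1.05 in `integral_large`. All are below -1. -/
lemma integral_small {t : ℝ} (ht : 1 ≤ t) :
    IntegrableOn (fun τ : ℝ => t ^ (1 / 25 : ℝ) * τ ^ (-(1 / 4) : ℝ) +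
      t ^ (26 / 25 : ℝ) * τ ^ (1 / 2 : ℝ) + t ^ (-(1 / 2) : ℝ) * τ ^ (-(1 / 2) : ℝ))
      (Set.Ioc 0 (t ^ (-(8 / 5) : ℝ))) ∧
    ∫ τ in Set.Ioc 0 (t ^ (-(8 / 5) : ℝ)), (t ^ (1 / 25 : ℝ) * τ ^ (-(1 / 4) : ℝ) +
      t ^ (26 / 25 : ℝ) * τ ^ (1 / 2 : ℝ) + t ^ (-(1 / 2) : ℝ) * τ ^ (-(1 / 2) : ℝ)) ≤
      4 * t ^ (-(105 / 100) : ℝ) := by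
  have ht0 : 0 < t := by linarith
  set b := t ^ (-(8 / 5) : ℝ) with hb
  have hb0 : 0 < b := by positivity
  have hi : ∀ {r : ℝ}, -1 < r → IntegrableOn (fun τ : ℝ => τ ^ r) (Set.Ioc 0 b) := fun hr =>
    (intervalIntegrable_iff_integrableOn_Ioc_of_le hb0.le).1
      (intervalIntegral.intervalIntegrable_rpow' hr)
  have hv : ∀ {r : ℝ}, -1 < r → ∫ τ in Set.Ioc 0 b, τ ^ r = b ^ (r + 1) / (r + 1) := fun hr => by
    rw [← intervalIntegral.integral_of_le hb0.le, integral_rpow (Or.inl hr),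
      Real.zero_rpow (by linarith), sub_zero]
  have i1 := (hi (r := -(1 / 4)) (by norm_num)).const_mul (t ^ (1 / 25 : ℝ))
  have i2 := (hi (r := 1 / 2) (by norm_num)).const_mul (t ^ (26 / 25 : ℝ))
  have i3 := (hi (r := -(1 / 2)) (by norm_num)).const_mul (t ^ (-(1 / 2) : ℝ))
  refine ⟨(i1.add i2).add i3, ?_⟩
  have i12 : IntegrableOn (fun τ : ℝ => t ^ (1 / 25 : ℝ) * τ ^ (-(1 / 4) : ℝ) +
      t ^ (26 / 25 : ℝ) * τ ^ (1 / 2 : ℝ)) (Set.Ioc 0 b) := i1.add i2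
  rw [integral_add i12 i3, integral_add i1 i2, integral_const_mul, integral_const_mul,
    integral_const_mul, hv (by norm_num), hv (by norm_num), hv (by norm_num)]
  have e : ∀ p q : ℝ, p - 8 / 5 * q ≤ -(105 / 100) → t ^ p * b ^ q ≤ t ^ (-(105 / 100) : ℝ) := by
    intro p q hpq
    rw [hb, ← Real.rpow_mul ht0.le, ← Real.rpow_add ht0]
    exact Real.rpow_le_rpow_of_exponent_le ht (by linarith)
  have h1 := e (1 / 25) (-(1 / 4) + 1) (by norm_num)
  have h2 := e (26 / 25) (1 / 2 + 1) (by norm_num)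
  have h3 := e (-(1 / 2)) (-(1 / 2) + 1) (by norm_num)
  have e1 : t ^ (1 / 25 : ℝ) * (b ^ (-(1 / 4) + 1 : ℝ) / (-(1 / 4) + 1)) =
      4 / 3 * (t ^ (1 / 25 : ℝ) * b ^ (-(1 / 4) + 1 : ℝ)) := by ring
  have e2 : t ^ (26 / 25 : ℝ) * (b ^ (1 / 2 + 1 : ℝ) / (1 / 2 + 1)) =
      2 / 3 * (t ^ (26 / 25 : ℝ) * b ^ (1 / 2 + 1 : ℝ)) := by ring
  have e3 : t ^ (-(1 / 2) : ℝ) * (b ^ (-(1 / 2) + 1 : ℝ) / (-(1 / 2) + 1)) =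
      2 * (t ^ (-(1 / 2) : ℝ) * b ^ (-(1 / 2) + 1 : ℝ)) := by ring
  rw [e1, e2, e3]
  linarith

lemma integral_large {t : ℝ} (ht : 1 ≤ t) :
    IntegrableOn (fun τ : ℝ => t ^ (-(165 / 100) : ℝ) * τ ^ (-(11 / 8) : ℝ))
      (Set.Ioi (t ^ (-(8 / 5) : ℝ))) ∧
    ∫ τ in Set.Ioi (t ^ (-(8 / 5) : ℝ)), t ^ (-(165 / 100) : ℝ) * τ ^ (-(11 / 8) : ℝ) ≤
      3 * t ^ (-(105 / 100) : ℝ) := by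
  have ht0 : 0 < t := by linarith
  set b := t ^ (-(8 / 5) : ℝ) with hb
  have hb0 : 0 < b := by positivity
  refine ⟨(integrableOn_Ioi_rpow_of_lt (by norm_num) hb0).const_mul _, ?_⟩
  rw [integral_const_mul, integral_Ioi_rpow_of_lt (by norm_num) hb0]
  have e : t ^ (-(165 / 100) : ℝ) * b ^ (-(11 / 8) + 1 : ℝ) = t ^ (-(105 / 100) : ℝ) := by
    rw [hb, ← Real.rpow_mul ht0.le, ← Real.rpow_add ht0]; norm_num
  have e1 : t ^ (-(165 / 100) : ℝ) * (-b ^ (-(11 / 8) + 1 : ℝ) / (-(11 / 8) + 1)) =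
      8 / 3 * (t ^ (-(165 / 100) : ℝ) * b ^ (-(11 / 8) + 1 : ℝ)) := by ring
  rw [e1, e]
  have : 0 ≤ t ^ (-(105 / 100) : ℝ) := by positivity
  linarith

/-- The leading term of the nonlinearity, for large times. -/
lemma leading (hn : 1000 ≤ n) {ρ : Plane → ℝ} (hρ : IsBump ρ) : ∃ C : ℝ, 0 ≤ C ∧
    ∀ t a F, 1 ≤ t → Prof n t a F → ∀ ξ,
      jb ξ ^ (n / 100) * ‖Complex.exp (Complex.I * t * jb ξ) * hsym (modul t F) ξ -
        ((coul F ξ / t : ℝ) : ℂ) * F ξ‖ ≤ C * a ^ 3 * t ^ (-(105 / 100) : ℝ) := by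
  obtain ⟨C1, hC1, hsm⟩ := defect_small hn
  obtain ⟨C2, hC2, hla⟩ := defect_large hn hρ
  refine ⟨4 * C1 + 3 * C2, by positivity, fun t a F ht h ξ => ?_⟩
  have ht0 : 0 < t := by linarith
  have ha := h.nonneg
  have hb := h.bd10 hn
  obtain ⟨qi, qv⟩ := coul_subordination h.cont hb ht0 ξ
  have ti := integrable_tri_tau (continuous_modul h.cont t) (h.mbd10 hn) ξ
  set f : ℝ → ℂ := fun τ => ((τ ^ (-(1 / 2) : ℝ) : ℝ) : ℂ) * defect t F τ ξ with hf
  have e1 : ∀ τ, f τ = Complex.exp (Complex.I * t * jb ξ) *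
      (((τ ^ (-(1 / 2) : ℝ) : ℝ) : ℂ) * tri (modul t F) τ ξ) -
      ((τ ^ (-(1 / 2) : ℝ) * quad t F τ ξ : ℝ) : ℂ) * F ξ := by
    intro τ; simp only [hf, defect]; push_cast; ring
  have qi' : IntegrableOn (fun τ : ℝ => ((τ ^ (-(1 / 2) : ℝ) * quad t F τ ξ : ℝ) : ℂ) * F ξ)
      (Set.Ioi 0) := (Integrable.ofReal qi).mul_const _
  have fi : IntegrableOn f (Set.Ioi 0) := by
    have : f = fun τ => _ := funext e1
    rw [this]
    exact (ti.const_mul _).sub qi'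
  -- The same integral over τ represents both the nonlinearity and `coul / t`, so their difference
  -- is the integral of the defects.
  have key : Complex.exp (Complex.I * t * jb ξ) * hsym (modul t F) ξ -
      ((coul F ξ / t : ℝ) : ℂ) * F ξ = ((√Real.pi)⁻¹ : ℂ) * ∫ τ in Set.Ioi (0 : ℝ), f τ := by
    simp_rw [e1]
    rw [integral_sub (ti.const_mul _) qi', integral_const_mul, integral_mul_const, hsym, ← qv,
      integral_complex_ofReal]
    push_cast; ring
  set b := t ^ (-(8 / 5) : ℝ) with hbd
  have hb0 : 0 < b := by positivity
  obtain ⟨s1, s2⟩ := integral_small ht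
  obtain ⟨l1, l2⟩ := integral_large ht
  have hj := jb_rpow_pos (n / 100) ξ
  have fn : ∀ τ, 0 < τ → jb ξ ^ (n / 100) * ‖f τ‖ =
      τ ^ (-(1 / 2) : ℝ) * (jb ξ ^ (n / 100) * ‖defect t F τ ξ‖) := by
    intro τ hτ
    simp only [hf]
    rw [norm_mul, Complex.norm_real, Real.norm_of_nonneg (by positivity)]; ring
  have b1 : jb ξ ^ (n / 100) * ‖∫ τ in Set.Ioc 0 b, f τ‖ ≤
      C1 * a ^ 3 * (4 * t ^ (-(105 / 100) : ℝ)) := by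
    calc _ ≤ jb ξ ^ (n / 100) * ∫ τ in Set.Ioc 0 b, ‖f τ‖ :=
          mul_le_mul_of_nonneg_left (norm_integral_le_integral_norm _) hj.le
      _ = ∫ τ in Set.Ioc 0 b, jb ξ ^ (n / 100) * ‖f τ‖ := by rw [integral_const_mul]
      _ ≤ ∫ τ in Set.Ioc 0 b, C1 * a ^ 3 * (t ^ (1 / 25 : ℝ) * τ ^ (-(1 / 4) : ℝ) +
          t ^ (26 / 25 : ℝ) * τ ^ (1 / 2 : ℝ) + t ^ (-(1 / 2) : ℝ) * τ ^ (-(1 / 2) : ℝ)) := by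
          refine integral_mono_of_nonneg (ae_of_all _ fun τ => by positivity) (s1.const_mul _)
            ((ae_restrict_iff' measurableSet_Ioc).2 (ae_of_all _ fun τ hτ => ?_))
          have hτ0 := hτ.1
          beta_reduce
          rw [fn τ hτ0]
          refine (mul_le_mul_of_nonneg_left (hsm t a F ht h τ hτ0 ξ) (by positivity)).trans
            (le_of_eq ?_)
          have r1 : τ ^ (-(1 / 4) : ℝ) = τ ^ (-(1 / 2) : ℝ) * τ ^ (1 / 4 : ℝ) := by
            rw [← Real.rpow_add hτ0]; norm_num
          have r2 : τ ^ (1 / 2 : ℝ) = τ ^ (-(1 / 2) : ℝ) * τ := by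
            nth_rewrite 3 [← Real.rpow_one τ]
            rw [← Real.rpow_add hτ0]; norm_num
          rw [r1, r2]; ring
      _ ≤ _ := by
          rw [integral_const_mul]
          exact mul_le_mul_of_nonneg_left s2 (by positivity)
  have b2 : jb ξ ^ (n / 100) * ‖∫ τ in Set.Ioi b, f τ‖ ≤
      C2 * a ^ 3 * (3 * t ^ (-(105 / 100) : ℝ)) := by
    calc _ ≤ jb ξ ^ (n / 100) * ∫ τ in Set.Ioi b, ‖f τ‖ :=
          mul_le_mul_of_nonneg_left (norm_integral_le_integral_norm _) hj.le
      _ = ∫ τ in Set.Ioi b, jb ξ ^ (n / 100) * ‖f τ‖ := by rw [integral_const_mul]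
      _ ≤ ∫ τ in Set.Ioi b, C2 * a ^ 3 *
          (t ^ (-(165 / 100) : ℝ) * τ ^ (-(11 / 8) : ℝ)) := by
          refine integral_mono_of_nonneg (ae_of_all _ fun τ => by positivity) (l1.const_mul _)
            ((ae_restrict_iff' measurableSet_Ioi).2 (ae_of_all _ fun τ hτ => ?_))
          have hτ0 : 0 < τ := hb0.trans hτ
          beta_reduce
          rw [fn τ hτ0]
          refine (mul_le_mul_of_nonneg_left (hla t a F ht h τ hτ0 ξ) (by positivity)).trans
            (le_of_eq ?_)
          have r1 : τ ^ (-(11 / 8) : ℝ) = τ ^ (-(1 / 2) : ℝ) * τ ^ (-(7 / 8) : ℝ) := by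
            rw [← Real.rpow_add hτ0]; norm_num
          rw [r1]; ring
      _ ≤ _ := by
          rw [integral_const_mul]
          exact mul_le_mul_of_nonneg_left l2 (by positivity)
  have hsplit : ∫ τ in Set.Ioi (0 : ℝ), f τ =
      (∫ τ in Set.Ioc 0 b, f τ) + ∫ τ in Set.Ioi b, f τ := by
    rw [← setIntegral_union (Set.Ioc_disjoint_Ioi le_rfl) measurableSet_Ioi
      (fi.mono_set Set.Ioc_subset_Ioi_self) (fi.mono_set (Set.Ioi_subset_Ioi hb0.le)),
      Set.Ioc_union_Ioi_eq_Ioi hb0.le]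
  rw [key]
  calc _ ≤ jb ξ ^ (n / 100) * (‖∫ τ in Set.Ioc 0 b, f τ‖ + ‖∫ τ in Set.Ioi b, f τ‖) := by
        refine mul_le_mul_of_nonneg_left ((norm_inv_sqrt_pi_mul_le _).trans ?_) hj.le
        rw [hsplit]; exact norm_add_le _ _
    _ ≤ _ := by rw [mul_add]; linarith

end Prof

/-! ### Comparison with the truncated phase correction, for all positive times. -/

namespace Prof

variable {n t a : ℝ} {F : Plane → ℂ}

lemma bracket_rpow_le_two {s : ℝ} (ht : 0 ≤ t) (ht1 : t ≤ 1) (hs1 : s ≤ 1) :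
    bracket t ^ s ≤ 2 :=
  calc bracket t ^ s ≤ bracket t ^ (1 : ℝ) :=
        Real.rpow_le_rpow_of_exponent_le (one_le_bracket t) hs1
    _ ≤ 2 := by rw [Real.rpow_one]; linarith [bracket_le_one_add ht]

/-- Weighted bound for the nonlinearity at small times. -/
lemma hsym_le (hn : 1000 ≤ n) (ht : 0 ≤ t) (ht1 : t ≤ 1) (h : Prof n t a F) (ξ : Plane) :
    jb ξ ^ (n / 100) * ‖hsym (modul t F) ξ‖ ≤
      4 * 2 ^ (n / 100) * 2 ^ (n / 100 + 3) * (1 + gamMoment (-(7 / 4))) * betaMass * a ^ 3 := by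
  have ha := h.nonneg
  have g1 := gamMoment_nonneg (-(7 / 4))
  set c := 2 ^ (n / 100 + 3) * (a * bracket t ^ (1 / 100 : ℝ)) ^ 2 with hc
  have hc0 : 0 ≤ c := by positivity
  have hcle : c ≤ 2 ^ (n / 100 + 3) * (4 * a ^ 2) := by
    have := bracket_rpow_le_two ht ht1 (s := 1 / 100) (by norm_num)
    have h2 : (a * bracket t ^ (1 / 100 : ℝ)) ^ 2 ≤ 4 * a ^ 2 := by
      have h3 := Real.rpow_nonneg (bracket_pos t).le (1 / 100)
      calc _ ≤ (a * 2) ^ 2 := by gcongr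
        _ = _ := by ring
    exact mul_le_mul_of_nonneg_left h2 (by positivity)
  -- Three surplus powers of regularity yield the factor ⟨η⟩^{-3} needed by `gam_int_le_beta`.
  have hw : ∀ η, jb η ^ (n / 100) * ‖corr (modul t F) η‖ ≤ c * jb η ^ (-3 : ℝ) := by
    intro η
    have h1 := h.corr_le (j := n / 100 + 3) (by linarith) (by linarith) η
    have e1 : jb η ^ (n / 100) = jb η ^ (-3 : ℝ) * jb η ^ (n / 100 + 3) := by
      rw [← Real.rpow_add (jb_pos η)]; congr 1; ring
    rw [e1, mul_assoc, mul_comm c]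
    exact mul_le_mul_of_nonneg_left h1 (jb_rpow_pos _ _).le
  have htri : ∀ τ, 0 < τ → jb ξ ^ (n / 100) * ‖tri (modul t F) τ ξ‖ ≤
      2 ^ (n / 100) * a * (c * (1 + gamMoment (-(7 / 4))) * beta τ) := by
    intro τ hτ
    refine (norm_tri_le hτ (by linarith) (fun x => by rw [norm_modul]; exact h.bd x) hw ?_ ξ).trans
      (mul_le_mul_of_nonneg_left (gam_int_le_beta hτ hc0
        (fun η => mul_nonneg hc0 (jb_rpow_pos _ _).le) fun η => le_rfl) (by positivity))
    refine (integrable_gam hτ).mul_bdd (c := c)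
      ((continuous_const.mul (continuous_jb_rpow _)).aestronglyMeasurable)
      (ae_of_all _ fun η => ?_)
    rw [Real.norm_of_nonneg (mul_nonneg hc0 (jb_rpow_pos _ _).le)]
    exact mul_le_of_le_one_right hc0 (jb_rpow_le_one (by norm_num) η)
  have hj := jb_rpow_pos (n / 100) ξ
  have hbm : 0 ≤ betaMass := by
    refine setIntegral_nonneg measurableSet_Ioi fun τ hτ => ?_
    exact mul_nonneg (Real.rpow_nonneg (le_of_lt hτ) _) (beta_nonneg hτ)
  calc _ ≤ jb ξ ^ (n / 100) * ∫ τ in Set.Ioi (0 : ℝ),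
          ‖((τ ^ (-(1 / 2) : ℝ) : ℝ) : ℂ) * tri (modul t F) τ ξ‖ :=
        mul_le_mul_of_nonneg_left ((norm_inv_sqrt_pi_mul_le _).trans
          (norm_integral_le_integral_norm _)) hj.le
    _ = ∫ τ in Set.Ioi (0 : ℝ), jb ξ ^ (n / 100) *
          ‖((τ ^ (-(1 / 2) : ℝ) : ℝ) : ℂ) * tri (modul t F) τ ξ‖ := by rw [integral_const_mul]
    _ ≤ ∫ τ in Set.Ioi (0 : ℝ), (2 ^ (n / 100) * a * (c * (1 + gamMoment (-(7 / 4))))) *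
          (τ ^ (-(1 / 2) : ℝ) * beta τ) := by
        refine integral_mono_of_nonneg (ae_of_all _ fun τ => by positivity)
          (integrableOn_beta.const_mul _)
          ((ae_restrict_iff' measurableSet_Ioi).2 (ae_of_all _ fun τ hτ => ?_))
        have hτ0 : (0 : ℝ) < τ := hτ
        beta_reduce
        rw [norm_mul, Complex.norm_real, Real.norm_of_nonneg (by positivity), mul_left_comm]
        refine (mul_le_mul_of_nonneg_left (htri τ hτ0) (by positivity)).trans (le_of_eq ?_)
        ring
    _ = 2 ^ (n / 100) * a * (c * (1 + gamMoment (-(7 / 4)))) * betaMass := by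
        rw [integral_const_mul, betaMass]
    _ ≤ 2 ^ (n / 100) * a * (2 ^ (n / 100 + 3) * (4 * a ^ 2) * (1 + gamMoment (-(7 / 4)))) *
          betaMass := by gcongr
    _ = _ := by ring

/-- The nonlinearity is the resonant phase correction up to an integrable error. -/
lemma resonance (hn : 1000 ≤ n) {ρ : Plane → ℝ} (hρ : IsBump ρ) : ∃ C : ℝ, 0 ≤ C ∧
    ∀ t a F, 0 < t → Prof n t a F → ∀ ξ,
      jb ξ ^ (n / 100) * ‖Complex.exp (Complex.I * t * jb ξ) * hsym (modul t F) ξ -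
        ((coul F ξ * (ρ (t ^ (-(2 / n)) • ξ) / bracket t) : ℝ) : ℂ) * F ξ‖ ≤
      C * a ^ 3 * (1 + t) ^ (-(101 / 100) : ℝ) := by
  obtain ⟨κ, hκ, h0, -, -⟩ := hρ.exists_bound
  obtain ⟨C1, hC1, hl⟩ := leading hn hρ
  have v1 := velConst_nonneg 1
  have g1 := gamMoment_nonneg (-(7 / 4))
  have hbm : 0 ≤ betaMass := by
    refine setIntegral_nonneg measurableSet_Ioi fun τ hτ => ?_
    exact mul_nonneg (Real.rpow_nonneg (le_of_lt hτ) _) (beta_nonneg hτ)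
  set C2 := 4 * 2 ^ (n / 100) * 2 ^ (n / 100 + 3) * (1 + gamMoment (-(7 / 4))) * betaMass
  set C3 := velConst 1 * (1 + (1 + κ) * (4 * 4 ^ n))
  have p2 : 0 ≤ C2 := by positivity
  have p3 : 0 ≤ C3 := by positivity
  refine ⟨4 * (C1 + C3) + 4 * (C2 + velConst 1 * κ), by positivity, fun t a F ht h ξ => ?_⟩
  have ha := h.nonneg
  have hb := h.bd10 hn
  have hj := jb_rpow_pos (n / 100) ξ
  have hW0 := coul_nonneg (F := F) ξ
  have hW := coul_le h.cont hb ξ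
  have hF := h.rpow_jb_mul_le ξ
  have hF0 : 0 ≤ jb ξ ^ (n / 100) * ‖F ξ‖ := by positivity
  have hnE : ‖Complex.exp (Complex.I * t * jb ξ)‖ = 1 := by
    have e1 : Complex.I * t * jb ξ = Complex.I * ((t * jb ξ : ℝ) : ℂ) := by push_cast; ring
    rw [e1]; exact norm_cexp_I_mul _
  have hbr1 := one_le_bracket t
  have q0 : 0 ≤ (1 + t) ^ (-(101 / 100) : ℝ) := by positivity
  rcases le_total t 1 with ht1 | ht1
  -- For t ≤ 1 no cancellation is needed: both terms are bounded, and (1+t)^{-101/100} ≥ 1/4.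
  · have q1 : 1 ≤ 4 * (1 + t) ^ (-(101 / 100) : ℝ) := by
      have : (1 / 4 : ℝ) ≤ (1 + t) ^ (-(101 / 100) : ℝ) := by
        calc (1 / 4 : ℝ) = 2 ^ (-2 : ℝ) := by norm_num [Real.rpow_neg]
          _ ≤ 2 ^ (-(101 / 100) : ℝ) :=
              Real.rpow_le_rpow_of_exponent_le (by norm_num) (by norm_num)
          _ ≤ _ := Real.rpow_le_rpow_of_nonpos (by linarith) (by linarith) (by norm_num)
      linarith
    have h1 := h.hsym_le hn ht.le ht1 ξ
    have h2 : |coul F ξ * (ρ (t ^ (-(2 / n)) • ξ) / bracket t)| ≤ velConst 1 * a ^ 2 * κ := by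
      rw [abs_mul, abs_of_nonneg hW0, abs_div, abs_of_pos (bracket_pos t)]
      exact mul_le_mul hW ((div_le_self (abs_nonneg _) hbr1).trans (h0 _)) (by positivity)
        (by positivity)
    calc _ ≤ jb ξ ^ (n / 100) * (‖hsym (modul t F) ξ‖ + velConst 1 * a ^ 2 * κ * ‖F ξ‖) := by
          refine mul_le_mul_of_nonneg_left ((norm_sub_le _ _).trans ?_) hj.le
          rw [norm_mul, hnE, one_mul, norm_mul, Complex.norm_real, Real.norm_eq_abs]
          gcongr
      _ = jb ξ ^ (n / 100) * ‖hsym (modul t F) ξ‖ +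
            velConst 1 * a ^ 2 * κ * (jb ξ ^ (n / 100) * ‖F ξ‖) := by ring
      _ ≤ C2 * a ^ 3 + velConst 1 * a ^ 2 * κ * a := by
          refine add_le_add h1 (mul_le_mul_of_nonneg_left hF (by positivity))
      _ = (C2 + velConst 1 * κ) * a ^ 3 * 1 := by ring
      _ ≤ (C2 + velConst 1 * κ) * a ^ 3 * (4 * (1 + t) ^ (-(101 / 100) : ℝ)) := by gcongr
      _ = 4 * (C2 + velConst 1 * κ) * a ^ 3 * (1 + t) ^ (-(101 / 100) : ℝ) := by ring
      _ ≤ _ := by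
          have : 4 * (C2 + velConst 1 * κ) ≤ 4 * (C1 + C3) + 4 * (C2 + velConst 1 * κ) := by
            linarith
          gcongr
  · have q1 : t ^ (-(105 / 100) : ℝ) ≤ 4 * (1 + t) ^ (-(101 / 100) : ℝ) := by
      calc t ^ (-(105 / 100) : ℝ) ≤ t ^ (-(101 / 100) : ℝ) :=
            Real.rpow_le_rpow_of_exponent_le ht1 (by norm_num)
        _ = 4 * (2 ^ (-2 : ℝ) * t ^ (-(101 / 100) : ℝ)) := by
            have : (2 : ℝ) ^ (-2 : ℝ) = 1 / 4 := by norm_num [Real.rpow_neg]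
            rw [this]; ring
        _ ≤ 4 * (2 ^ (-(101 / 100) : ℝ) * t ^ (-(101 / 100) : ℝ)) := by
            have : (2 : ℝ) ^ (-2 : ℝ) ≤ 2 ^ (-(101 / 100) : ℝ) :=
              Real.rpow_le_rpow_of_exponent_le (by norm_num) (by norm_num)
            gcongr
        _ = 4 * (2 * t) ^ (-(101 / 100) : ℝ) := by
            rw [Real.mul_rpow (by norm_num) (by linarith)]
        _ ≤ _ := by
            refine mul_le_mul_of_nonneg_left ?_ (by norm_num)
            exact Real.rpow_le_rpow_of_nonpos (by linarith) (by linarith) (by norm_num)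
    set r := ρ (t ^ (-(2 / n)) • ξ) with hr
    -- If |ξ| ≤ t^{2/n} then ρ equals 1 and 1/t - 1/⟨t⟩ is O(t^{-2}). Otherwise both factors are
    -- O(1/t) and the high-frequency decay t^{-1/2} of F supplies the rest.
    have hkey : |1 / t - r / bracket t| * (jb ξ ^ (n / 100) * ‖F ξ‖) ≤
        (1 + (1 + κ) * (4 * 4 ^ n)) * a * t ^ (-(105 / 100) : ℝ) := by
      have hs : 0 ≤ a * t ^ (-(105 / 100) : ℝ) := by positivity
      have h4 : 0 ≤ (1 + κ) * (4 * 4 ^ n) := by positivity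
      rcases le_total ‖ξ‖ (t ^ (2 / n)) with hξ | hξ
      · have hr1 : r = 1 := by
          refine hρ.eq_one _ ?_
          rw [norm_smul, Real.norm_of_nonneg (by positivity), Real.rpow_neg ht.le,
            inv_mul_le_iff₀ (by positivity), mul_one]
          exact hξ
        have hd : |1 / t - r / bracket t| ≤ t ^ (-(105 / 100) : ℝ) := by
          rw [hr1, div_sub_div _ _ ht.ne' (bracket_pos t).ne', abs_div,
            abs_of_pos (mul_pos ht (bracket_pos t))]
          have h5 := le_bracket t
          have h6 := bracket_le_one_add ht.le
          have h7 : |1 * bracket t - t * 1| ≤ 1 := by rw [abs_le]; constructor <;> linarith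
          have h8 : t ^ (105 / 100 : ℝ) ≤ t * bracket t := by
            calc t ^ (105 / 100 : ℝ) ≤ t ^ (2 : ℝ) :=
                  Real.rpow_le_rpow_of_exponent_le ht1 (by norm_num)
              _ = t * t := by rw [Real.rpow_two, pow_two]
              _ ≤ _ := by gcongr
          calc _ ≤ 1 / (t * bracket t) := by
                have := mul_pos ht (bracket_pos t); gcongr
            _ ≤ 1 / t ^ (105 / 100 : ℝ) := by gcongr
            _ = _ := by rw [Real.rpow_neg ht.le, one_div]
        calc _ ≤ t ^ (-(105 / 100) : ℝ) * a := mul_le_mul hd hF hF0 (by positivity)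
          _ = 1 * (a * t ^ (-(105 / 100) : ℝ)) := by ring
          _ ≤ (1 + (1 + κ) * (4 * 4 ^ n)) * (a * t ^ (-(105 / 100) : ℝ)) := by
              gcongr; linarith
          _ = _ := by ring
      · have hd : |1 / t - r / bracket t| ≤ (1 + κ) * t ^ (-1 : ℝ) := by
          rw [Real.rpow_neg_one]
          refine (abs_sub _ _).trans ?_
          rw [abs_div, abs_div, abs_one, abs_of_pos ht, abs_of_pos (bracket_pos t), add_mul, one_mul,
            one_div]
          refine add_le_add le_rfl ?_
          rw [div_eq_mul_inv]
          exact mul_le_mul (h0 _) (inv_anti₀ ht (le_bracket t)) (inv_nonneg.2 (bracket_pos t).le)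
            (by linarith)
        have htail := h.tail_le hn ht1 (hξ.trans (norm_le_jb ξ))
        calc _ ≤ ((1 + κ) * t ^ (-1 : ℝ)) * (4 * 4 ^ n * a * t ^ (-(1 / 2) : ℝ)) :=
              mul_le_mul hd htail hF0 (by positivity)
          _ = (1 + κ) * (4 * 4 ^ n) * (a * t ^ (-1 + -(1 / 2) : ℝ)) := by
              rw [Real.rpow_add ht]; ring
          _ ≤ (1 + (1 + κ) * (4 * 4 ^ n)) * (a * t ^ (-(105 / 100) : ℝ)) := by
              have : t ^ (-1 + -(1 / 2) : ℝ) ≤ t ^ (-(105 / 100) : ℝ) :=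
                Real.rpow_le_rpow_of_exponent_le ht1 (by norm_num)
              gcongr; linarith
          _ = _ := by ring
    have split : Complex.exp (Complex.I * t * jb ξ) * hsym (modul t F) ξ -
        ((coul F ξ * (r / bracket t) : ℝ) : ℂ) * F ξ =
        (Complex.exp (Complex.I * t * jb ξ) * hsym (modul t F) ξ - ((coul F ξ / t : ℝ) : ℂ) * F ξ) +
        ((coul F ξ * (1 / t - r / bracket t) : ℝ) : ℂ) * F ξ := by
      push_cast; ring
    rw [split]
    calc _ ≤ C1 * a ^ 3 * t ^ (-(105 / 100) : ℝ) +
          coul F ξ * (|1 / t - r / bracket t| * (jb ξ ^ (n / 100) * ‖F ξ‖)) := by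
          refine (mul_le_mul_of_nonneg_left (norm_add_le _ _) hj.le).trans ?_
          rw [mul_add]
          refine add_le_add (hl t a F ht1 h ξ) (le_of_eq ?_)
          rw [norm_mul, Complex.norm_real, Real.norm_eq_abs, abs_mul, abs_of_nonneg hW0]; ring
      _ ≤ C1 * a ^ 3 * t ^ (-(105 / 100) : ℝ) + velConst 1 * a ^ 2 *
            ((1 + (1 + κ) * (4 * 4 ^ n)) * a * t ^ (-(105 / 100) : ℝ)) :=
          add_le_add le_rfl (mul_le_mul hW hkey (by positivity) (by positivity))
      _ = (C1 + C3) * a ^ 3 * t ^ (-(105 / 100) : ℝ) := by simp only [C3]; ring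
      _ ≤ (C1 + C3) * a ^ 3 * (4 * (1 + t) ^ (-(101 / 100) : ℝ)) := by gcongr
      _ = 4 * (C1 + C3) * a ^ 3 * (1 + t) ^ (-(101 / 100) : ℝ) := by ring
      _ ≤ _ := by
          have : 4 * (C1 + C3) ≤ 4 * (C1 + C3) + 4 * (C2 + velConst 1 * κ) := by
            have : 0 ≤ 4 * (C2 + velConst 1 * κ) := by positivity
            linarith
          gcongr

end Prof

/-! ### Plancherel's identity -/

lemma eLpNorm_two_eq {f : Plane → ℂ} (hf : MemLp f 2) :
    eLpNorm f 2 volume = ENNReal.ofReal √(∫ x, ‖f x‖ ^ 2) := by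
  rw [hf.eLpNorm_eq_integral_rpow_norm (by norm_num) (by norm_num), Real.sqrt_eq_rpow]
  norm_num

lemma integral_sq_le_of_eLpNorm {f : Plane → ℂ} {c : ℝ} (hc : 0 ≤ c)
    (hm : AEStronglyMeasurable f volume) (h : eLpNorm f 2 volume ≤ ENNReal.ofReal c) :
    MemLp f 2 ∧ ∫ x, ‖f x‖ ^ 2 ≤ c ^ 2 := by
  have hf : MemLp f 2 := ⟨hm, h.trans_lt ENNReal.ofReal_lt_top⟩
  refine ⟨hf, ?_⟩
  rw [eLpNorm_two_eq hf, ENNReal.ofReal_le_ofReal_iff hc] at h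
  exact (Real.sqrt_le_left hc).1 h

lemma norm_sq_eq_integral (g : L2) : ‖g‖ ^ 2 = ∫ x, ‖g x‖ ^ 2 := by
  rw [Lp.norm_def, eLpNorm_two_eq (Lp.memLp g), ENNReal.toReal_ofReal (Real.sqrt_nonneg _),
    Real.sq_sqrt (integral_nonneg fun _ => by positivity)]

lemma hat_two_pi (g : L2) (w : Plane) : hat g ((2 * Real.pi) • w) = (𝓕 g : L2) w := by
  rw [hat, inv_smul_smul₀ two_pi_ne]

lemma aestronglyMeasurable_hat (g : L2) : AEStronglyMeasurable (hat g) volume := by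
  have hq : Measure.QuasiMeasurePreserving (fun x : Plane => (2 * Real.pi)⁻¹ • x)
      volume volume := by
    refine ⟨measurable_const_smul _, ?_⟩
    rw [Measure.map_addHaar_smul volume (inv_ne_zero two_pi_ne)]
    exact Measure.smul_absolutelyContinuous
  exact (Lp.memLp (𝓕 g : L2)).1.comp_quasiMeasurePreserving hq

lemma integral_two_pi (f : Plane → ℝ) :
    ∫ x : Plane, f x = (2 * Real.pi) ^ 2 * ∫ x : Plane, f ((2 * Real.pi) • x) := by
  have h := Measure.integral_comp_smul (volume : Measure Plane) f (2 * Real.pi)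
  simp only [finrank_euclideanSpace, Fintype.card_fin] at h
  rw [abs_of_pos (by positivity), smul_eq_mul] at h
  rw [h, mul_inv_cancel_left₀ (by positivity)]

lemma integral_sq_hat (g : L2) : ∫ ξ, ‖hat g ξ‖ ^ 2 = (2 * Real.pi) ^ 2 * ∫ x, ‖g x‖ ^ 2 := by
  rw [integral_two_pi]
  simp_rw [hat_two_pi]
  rw [← norm_sq_eq_integral, Lp.norm_fourier_eq, norm_sq_eq_integral]

lemma memLp_hat (g : L2) : MemLp (hat g) 2 := by
  refine (memLp_two_iff_integrable_sq_norm (aestronglyMeasurable_hat g)).2 ?_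
  refine (integrable_comp_smul_iff volume (fun ξ => ‖hat g ξ‖ ^ 2) two_pi_ne).1 ?_
  simp_rw [hat_two_pi]
  exact (memLp_two_iff_integrable_sq_norm (Lp.memLp (𝓕 g : L2)).1).1 (Lp.memLp (𝓕 g : L2))

lemma hat_sub (g h : L2) : hat (g - h) =ᵐ[volume] fun ξ => hat g ξ - hat h ξ := by
  have e : (𝓕 (g - h) : L2) = 𝓕 g - 𝓕 h := by
    have h1 := FourierTransform.fourier_add (g - h) h
    rw [sub_add_cancel] at h1
    rw [h1, add_sub_cancel_right]
  filter_upwards [ae_comp_smul (inv_ne_zero two_pi_ne) (Lp.coeFn_sub (𝓕 g : L2) (𝓕 h))] with ξ hξ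
  rw [hat, e, hξ]; rfl

lemma hat_smul (c : ℂ) (g : L2) : hat (c • g) =ᵐ[volume] fun ξ => c * hat g ξ := by
  have e : (𝓕 (c • g) : L2) = c • 𝓕 g := FourierTransform.fourier_smul c g
  filter_upwards [ae_comp_smul (inv_ne_zero two_pi_ne) (Lp.coeFn_smul c (𝓕 g : L2))] with ξ hξ
  rw [hat, e, hξ]; rfl

lemma hat_fourierMul {m : Plane → ℂ} {g : L2} (h : MemLp (fun ξ => m ξ * hat g ξ) 2) :
    hat (fourierMul m g) =ᵐ[volume] fun ξ => m ξ * hat g ξ := by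
  have h1 := memLp_comp_two_pi h
  simp_rw [hat_two_pi] at h1
  have e : (𝓕 (fourierMul m g) : L2) = h1.toLp _ := by
    rw [fourierMul, dif_pos h1, FourierTransform.fourier_fourierInv_eq]
  filter_upwards [ae_comp_smul (inv_ne_zero two_pi_ne) h1.coeFn_toLp] with ξ hξ
  rw [hat, e, hξ, smul_inv_smul₀ two_pi_ne, hat]

lemma norm_cexp_I_mul_mul (t r : ℝ) : ‖Complex.exp (Complex.I * t * r)‖ = 1 := by
  have e1 : Complex.I * t * r = Complex.I * ((t * r : ℝ) : ℂ) := by push_cast; ring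
  rw [e1]; exact norm_cexp_I_mul _

lemma hat_propagator (t : ℝ) (g : L2) :
    hat (propagator t g) =ᵐ[volume] fun ξ => Complex.exp (Complex.I * t * jb ξ) * hat g ξ := by
  refine hat_fourierMul ?_
  have := continuous_jb
  refine (memLp_hat g).of_le (AEStronglyMeasurable.mul
    (Continuous.aestronglyMeasurable (by fun_prop)) (aestronglyMeasurable_hat g))
    (ae_of_all _ fun ξ => ?_)
  rw [norm_mul, norm_cexp_I_mul_mul, one_mul]

/-! ### The transform of a localized function -/

lemma continuous_ft {f : Plane → ℂ} (hf : Integrable f) : Continuous (ft f) := by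
  refine continuous_of_dominated (bound := fun x => ‖f x‖) (fun ξ => ?_)
    (fun ξ => ae_of_all _ fun x => ?_) hf.norm (ae_of_all _ fun x => by fun_prop)
  · exact (Continuous.aestronglyMeasurable (by fun_prop)).mul hf.aestronglyMeasurable
  · rw [norm_mul, show -(Complex.I * ((inner ℝ x ξ : ℝ) : ℂ)) =
      Complex.I * ((-inner ℝ x ξ : ℝ) : ℂ) by push_cast; ring, norm_cexp_I_mul, one_mul]

lemma norm_cexp_sub_le_sqrt (x y : ℝ) :
    ‖Complex.exp (Complex.I * x) - Complex.exp (Complex.I * y)‖ ≤ 2 * |x - y| ^ (1 / 2 : ℝ) := by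
  rcases le_total |x - y| 1 with h | h
  · refine (norm_cexp_sub_le x y).trans ?_
    have h1 : |x - y| ≤ |x - y| ^ (1 / 2 : ℝ) := by
      calc |x - y| = |x - y| ^ (1 : ℝ) := (Real.rpow_one _).symm
        _ ≤ _ := Real.rpow_le_rpow_of_exponent_ge' (abs_nonneg _) h (by norm_num) (by norm_num)
    linarith [abs_nonneg (x - y)]
  · refine (norm_sub_le _ _).trans ?_
    rw [norm_cexp_I_mul, norm_cexp_I_mul]
    have := Real.one_le_rpow h (by norm_num : (0 : ℝ) ≤ 1 / 2)
    linarith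

section

variable {f : Plane → ℂ}

lemma jb_sq_mul_cast (f : Plane → ℂ) (x : Plane) :
    ‖((jb x ^ 2 : ℝ) : ℂ) * f x‖ = jb x ^ 2 * ‖f x‖ := by
  rw [norm_mul, Complex.norm_real, Real.norm_of_nonneg (sq_nonneg _)]

lemma memLp_jb_rpow {s : ℝ} (hs : s < -1) : MemLp (fun x : Plane => jb x ^ s) 2 := by
  refine (memLp_two_iff_integrable_sq (continuous_jb_rpow s).aestronglyMeasurable).2 ?_
  simp_rw [jb_rpow_sq]
  exact integrable_jb_rpow (by linarith)

/-- Cauchy–Schwarz with ⟨x⟩^{-3/2}, which is square integrable in the plane. The surviving weight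
1/2 = 2 - 3/2 becomes the Hölder exponent of the transform. -/
lemma weight_integral
    (hh : MemLp (fun x => ((jb x ^ 2 : ℝ) : ℂ) * f x) 2) :
    Integrable (fun x => jb x ^ (1 / 2 : ℝ) * ‖f x‖) ∧
    ∫ x, jb x ^ (1 / 2 : ℝ) * ‖f x‖ ≤
      √jbMass * √(∫ x, ‖((jb x ^ 2 : ℝ) : ℂ) * f x‖ ^ 2) := by
  have e1 : ∀ x, jb x ^ (1 / 2 : ℝ) * ‖f x‖ =
      jb x ^ (-(3 / 2) : ℝ) * ‖((jb x ^ 2 : ℝ) : ℂ) * f x‖ := by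
    intro x
    rw [jb_sq_mul_cast, ← mul_assoc, ← Real.rpow_two, ← Real.rpow_add (jb_pos x)]; norm_num
  have hm := memLp_jb_rpow (s := -(3 / 2)) (by norm_num)
  simp_rw [e1]
  refine ⟨hm.integrable_mul hh.norm, ?_⟩
  have h1 := integral_mul_le_sqrt (fun x => (jb_rpow_pos (-(3 / 2)) x).le)
    (fun x => norm_nonneg (((jb x ^ 2 : ℝ) : ℂ) * f x)) hm hh.norm
  simp_rw [jb_rpow_sq] at h1
  have e2 : (2 * -(3 / 2) : ℝ) = -3 := by norm_num
  rw [e2] at h1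
  exact h1

lemma integrable_of_weight (hf : AEStronglyMeasurable f volume)
    (hh : MemLp (fun x => ((jb x ^ 2 : ℝ) : ℂ) * f x) 2) : Integrable f :=
  (weight_integral hh).1.mono' hf (ae_of_all _ fun x =>
    le_mul_of_one_le_left (norm_nonneg _) (one_le_jb_rpow (by norm_num) x))

/-- The difference of the two exponentials is at most 2(|x||ξ-η|)^{1/2}, and ⟨x⟩^{1/2} f is
integrable. -/
lemma ft_holder (hf : AEStronglyMeasurable f volume)
    (hh : MemLp (fun x => ((jb x ^ 2 : ℝ) : ℂ) * f x) 2) (ξ η : Plane) :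
    ‖ft f ξ - ft f η‖ ≤
      2 * √jbMass * √(∫ x, ‖((jb x ^ 2 : ℝ) : ℂ) * f x‖ ^ 2) * ‖ξ - η‖ ^ (1 / 2 : ℝ) := by
  have hi := integrable_of_weight hf hh
  obtain ⟨wi, wle⟩ := weight_integral hh
  have p1 : ∀ r : ℝ, -(Complex.I * r) = Complex.I * ((-r : ℝ) : ℂ) := fun r => by push_cast; ring
  have ei : ∀ ζ : Plane, Integrable fun x => Complex.exp (-(Complex.I * inner ℝ x ζ)) * f x := by
    intro ζ
    refine hi.bdd_mul (c := 1) (Continuous.aestronglyMeasurable (by fun_prop))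
      (ae_of_all _ fun x => ?_)
    rw [p1, norm_cexp_I_mul]
  rw [ft, ft, ← integral_sub (ei ξ) (ei η)]
  calc _ ≤ ∫ x, 2 * ‖ξ - η‖ ^ (1 / 2 : ℝ) * (jb x ^ (1 / 2 : ℝ) * ‖f x‖) := by
        refine norm_integral_le_of_norm_le (wi.const_mul _) (ae_of_all _ fun x => ?_)
        rw [← sub_mul, norm_mul, ← mul_assoc]
        refine mul_le_mul_of_nonneg_right ?_ (norm_nonneg _)
        rw [p1, p1]
        refine (norm_cexp_sub_le_sqrt _ _).trans ?_
        rw [mul_assoc, ← Real.mul_rpow (norm_nonneg _) (jb_pos x).le]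
        refine mul_le_mul_of_nonneg_left (Real.rpow_le_rpow (abs_nonneg _) ?_ (by norm_num))
          zero_le_two
        rw [← neg_sub_neg, neg_neg, neg_neg, ← inner_sub_right, mul_comm]
        refine (abs_real_inner_le_norm _ _).trans ?_
        rw [norm_sub_rev]
        exact mul_le_mul_of_nonneg_right (norm_le_jb x) (norm_nonneg _)
    _ ≤ 2 * ‖ξ - η‖ ^ (1 / 2 : ℝ) *
          (√jbMass * √(∫ x, ‖((jb x ^ 2 : ℝ) : ℂ) * f x‖ ^ 2)) := by
        rw [integral_const_mul]
        exact mul_le_mul_of_nonneg_left wle (by positivity)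
    _ = _ := by ring

/-- The rescaling which turns `ft` into Mathlib's transform. -/
lemma ft_eq_fourier (f : Plane → ℂ) (ξ : Plane) :
    ft f ξ = 𝓕 (fun y : Plane => ((2 * Real.pi) ^ 2 : ℂ) * f ((2 * Real.pi) • y)) ξ := by
  have h := Measure.integral_comp_smul (volume : Measure Plane)
    (fun x => Complex.exp (-(Complex.I * inner ℝ x ξ)) * f x) (2 * Real.pi)
  simp only [finrank_euclideanSpace, Fintype.card_fin] at h
  rw [abs_of_pos (by positivity)] at h
  rw [ft, Real.fourier_eq']
  have e1 : ∫ x : Plane, Complex.exp (-(Complex.I * inner ℝ x ξ)) * f x =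
      ((2 * Real.pi) ^ 2 : ℝ) • ∫ y : Plane, Complex.exp (-(Complex.I *
        inner ℝ ((2 * Real.pi) • y) ξ)) * f ((2 * Real.pi) • y) := by
    rw [h, smul_smul, mul_inv_cancel₀ (by positivity), one_smul]
  rw [e1, Complex.real_smul, ← integral_const_mul]
  congr 1 with y
  rw [real_inner_smul_left, smul_eq_mul]
  have e2 : -(Complex.I * ((2 * Real.pi * inner ℝ y ξ : ℝ) : ℂ)) =
      ((-2 * Real.pi * inner ℝ y ξ : ℝ) : ℂ) * Complex.I := by push_cast; ring
  rw [e2]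
  push_cast; ring

lemma integral_sq_le_of_norm_le {s q : Plane → ℂ} {c : ℝ} (hq : MemLp q 2)
    (h : ∀ x, ‖s x‖ ≤ c * ‖q x‖) : ∫ x, ‖s x‖ ^ 2 ≤ c ^ 2 * ∫ x, ‖q x‖ ^ 2 := by
  rw [← integral_const_mul]
  refine integral_mono_of_nonneg (ae_of_all _ fun x => by positivity)
    (((memLp_two_iff_integrable_sq_norm hq.1).1 hq).const_mul _) (ae_of_all _ fun x => ?_)
  beta_reduce
  rw [← mul_pow]
  exact pow_le_pow_left₀ (norm_nonneg _) (h x) 2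

/-- Division by `1 + |x|²` on Schwartz functions. -/
noncomputable def lower (q : 𝓢(Plane, ℂ)) : 𝓢(Plane, ℂ) :=
  SchwartzMap.smulLeftCLM ℂ (fun x : Plane => (1 + ‖x‖ ^ 2) ^ (-1 : ℝ)) q

lemma norm_lower (q : 𝓢(Plane, ℂ)) (x : Plane) : ‖lower q x‖ = (jb x ^ 2)⁻¹ * ‖q x‖ := by
  rw [lower, SchwartzMap.smulLeftCLM_apply_apply (by fun_prop), norm_smul, Real.rpow_neg_one,
    ← jb_sq, Real.norm_of_nonneg (inv_nonneg.2 (sq_nonneg _))]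

lemma one_le_two_pi : 1 ≤ 2 * Real.pi := by linarith [Real.pi_gt_three]

/-- A directional derivative of the transform is multiplication by -2πi x·e before it; two such
factors are absorbed by the division by ⟨x⟩². Each contributes one 2π. -/
lemma sobolevTwo_lower (q : 𝓢(Plane, ℂ)) {N : ℝ} (hN : ∫ x, ‖q x‖ ^ 2 ≤ N ^ 2) :
    SobolevTwo ((2 * Real.pi) ^ 2 * N) (𝓕 (lower q)) := by
  have hpi := one_le_two_pi
  have hpi2 : 2 * Real.pi ≤ (2 * Real.pi) ^ 2 := by nlinarith
  have key : ∀ s : 𝓢(Plane, ℂ), (∀ x, ‖s x‖ ≤ (2 * Real.pi) ^ 2 * ‖q x‖) →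
      ∫ x, ‖(𝓕 s : 𝓢(Plane, ℂ)) x‖ ^ 2 ≤ ((2 * Real.pi) ^ 2 * N) ^ 2 := by
    intro s hs
    rw [SchwartzMap.integral_norm_sq_fourier, mul_pow _ N]
    exact (integral_sq_le_of_norm_le (q.memLp 2) hs).trans
      (mul_le_mul_of_nonneg_left hN (by positivity))
  have hn : ‖-(2 * Real.pi * Complex.I)‖ = 2 * Real.pi := by
    rw [norm_neg, norm_mul, Complex.norm_I, mul_one, norm_mul, Complex.norm_ofNat,
      Complex.norm_real, Real.norm_of_nonneg Real.pi_pos.le]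
  have hin : ∀ e x : Plane, ‖e‖ = 1 → |inner ℝ x e| ≤ jb x := fun e x he => by
    have := abs_real_inner_le_norm x e
    rw [he, mul_one] at this
    exact this.trans (norm_le_jb x)
  have hd : ∀ (e x : Plane) (s : 𝓢(Plane, ℂ)), ‖e‖ = 1 →
      ‖(-(2 * Real.pi * Complex.I) • SchwartzMap.smulLeftCLM ℂ (inner ℝ · e) s) x‖ ≤
        2 * Real.pi * (jb x * ‖s x‖) := by
    intro e x s he
    rw [smul_apply, norm_smul, hn, SchwartzMap.smulLeftCLM_apply_apply (by fun_prop),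
      norm_smul, Real.norm_eq_abs]
    have := hin e x he
    gcongr
  have hl : ∀ x, jb x ^ 2 * ‖lower q x‖ = ‖q x‖ := fun x => by
    rw [norm_lower, mul_inv_cancel_left₀ (pow_pos (jb_pos x) 2).ne']
  have h1 : ∀ x, jb x * ‖lower q x‖ ≤ ‖q x‖ := fun x => by
    rw [← hl x]
    refine mul_le_mul_of_nonneg_right ?_ (norm_nonneg _)
    nlinarith [one_le_jb x]
  refine ⟨key _ fun x => ?_, fun e he => ?_, fun e he => ?_⟩
  · have h2 : ‖lower q x‖ ≤ jb x * ‖lower q x‖ :=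
      le_mul_of_one_le_left (norm_nonneg _) (one_le_jb x)
    exact (h2.trans (h1 x)).trans (le_mul_of_one_le_left (norm_nonneg _) (hpi.trans hpi2))
  · rw [SchwartzMap.lineDerivOp_fourier_eq]
    refine key _ fun x => (hd e x _ he).trans ?_
    exact mul_le_mul hpi2 (h1 x) (mul_nonneg (jb_pos x).le (norm_nonneg _)) (by positivity)
  · rw [SchwartzMap.lineDerivOp_fourier_eq, SchwartzMap.lineDerivOp_fourier_eq]
    refine key _ fun x => (hd e x _ he).trans ?_
    calc _ ≤ 2 * Real.pi * (jb x * (2 * Real.pi * (jb x * ‖lower q x‖))) := by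
          have := hd e x (lower q) he
          have := jb_pos x
          gcongr
      _ = (2 * Real.pi) ^ 2 * (jb x ^ 2 * ‖lower q x‖) := by ring
      _ = _ := by rw [hl]

lemma exists_schwartz_near (Q : L2) {ε : ℝ} (hε : 0 < ε) :
    ∃ q : 𝓢(Plane, ℂ), ‖Q - q.toLp 2 volume‖ < ε := by
  obtain ⟨q, hq⟩ := (SchwartzMap.denseRange_toLpCLM (E := Plane) (F := ℂ) (p := 2)
    (μ := volume) (by norm_num)).exists_dist_lt Q hε
  exact ⟨q, by rwa [dist_eq_norm] at hq⟩

/-- Approximation of the transform of a localized function by Schwartz functions. -/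
lemma exists_approx (hf : MemLp f 2)
    (hh : MemLp (fun x => ((jb x ^ 2 : ℝ) : ℂ) * f x) 2) {H : ℝ} (hH : 0 < H)
    (hle : ∫ x, ‖((jb x ^ 2 : ℝ) : ℂ) * f x‖ ^ 2 ≤ H ^ 2) :
    ∃ q : ℕ → 𝓢(Plane, ℂ), (∀ j, SobolevTwo ((2 * Real.pi) ^ 2 * (2 * Real.pi * H + H)) (q j)) ∧
      Tendsto (fun j => ∫ x, ‖ft f x - q j x‖ ^ 2) atTop (𝓝 0) := by
  have hpi := one_le_two_pi
  set p : Plane → ℂ := fun y => ((2 * Real.pi) ^ 2 : ℂ) * f ((2 * Real.pi) • y) with hp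
  set P : Plane → ℂ := fun y => ((jb y ^ 2 : ℝ) : ℂ) * p y with hP
  have hpm : MemLp p 2 := (memLp_comp_two_pi hf).const_mul _
  have hc : Continuous fun y : Plane => ((jb y ^ 2 : ℝ) : ℂ) := by
    have := continuous_jb; fun_prop
  have hPm' := memLp_comp_two_pi hh
  have hPb : ∀ y, ‖P y‖ ≤ (2 * Real.pi) ^ 2 *
      ‖((jb ((2 * Real.pi) • y) ^ 2 : ℝ) : ℂ) * f ((2 * Real.pi) • y)‖ := by
    intro y
    simp only [hP, hp]
    rw [jb_sq_mul_cast, norm_mul, norm_mul, Complex.norm_real,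
      Real.norm_of_nonneg (sq_nonneg (jb y))]
    have e1 : ‖((2 * Real.pi) ^ 2 : ℂ)‖ = (2 * Real.pi) ^ 2 := by
      rw [norm_pow, norm_mul, Complex.norm_ofNat, Complex.norm_real,
        Real.norm_of_nonneg Real.pi_pos.le]
    have e2 : jb y ^ 2 ≤ jb ((2 * Real.pi) • y) ^ 2 := by
      rw [jb_sq, jb_sq, norm_smul, Real.norm_of_nonneg (by positivity)]
      have : ‖y‖ ≤ 2 * Real.pi * ‖y‖ := le_mul_of_one_le_left (norm_nonneg _) hpi
      gcongr
    rw [e1]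
    calc _ ≤ jb ((2 * Real.pi) • y) ^ 2 * ((2 * Real.pi) ^ 2 * ‖f ((2 * Real.pi) • y)‖) := by gcongr
      _ = _ := by ring
  have hPm : MemLp P 2 := hPm'.of_le_mul (hc.aestronglyMeasurable.mul hpm.1) (ae_of_all _ hPb)
  -- The square of the prefactor gives (2π)⁴ and the dilation takes back (2π)².
  have hPle : ∫ x, ‖P x‖ ^ 2 ≤ (2 * Real.pi * H) ^ 2 := by
    refine (integral_sq_le_of_norm_le hPm' hPb).trans ?_
    have h3 := integral_two_pi fun x => ‖((jb x ^ 2 : ℝ) : ℂ) * f x‖ ^ 2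
    rw [pow_two ((2 * Real.pi) ^ 2), mul_assoc, ← h3, mul_pow _ H]
    exact mul_le_mul_of_nonneg_left hle (by positivity)
  set Q : L2 := hPm.toLp P with hQ
  have hQn : ‖Q‖ ≤ 2 * Real.pi * H := by
    refine le_of_sq_le_sq ?_ (by positivity)
    rw [norm_sq_eq_integral]
    refine le_trans (le_of_eq (integral_congr_ae ?_)) hPle
    filter_upwards [hPm.coeFn_toLp] with x hx
    rw [hx]
  -- The tolerance tends to 0, which gives convergence, and never exceeds H, which gives the uniform
  -- bound 2πH + H.
  choose q hq using fun j : ℕ => exists_schwartz_near Q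
    (ε := H / (j + 1)) (by positivity)
  refine ⟨fun j => 𝓕 (lower (q j)), fun j => sobolevTwo_lower (q j) ?_, ?_⟩
  · have e1 : ∫ x, ‖q j x‖ ^ 2 = ‖(q j).toLp 2 volume‖ ^ 2 := by
      rw [norm_sq_eq_integral]
      refine integral_congr_ae ?_
      filter_upwards [(q j).coeFn_toLp 2] with x hx
      rw [hx]
    rw [e1]
    refine pow_le_pow_left₀ (norm_nonneg _) ?_ 2
    have h1 : H / ((j : ℝ) + 1) ≤ H := div_le_self hH.le (by linarith [(Nat.cast_nonneg j : (0 : ℝ) ≤ j)])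
    have h2 := norm_sub_norm_le ((q j).toLp 2 volume : L2) Q
    rw [norm_sub_rev] at h2
    linarith [hq j]
  · have hpi1 : Integrable p := by
      have h0 := integrable_of_weight hf.1 hh
      exact (integrable_comp_two_pi h0).const_mul _
    set p2 : L2 := hpm.toLp p
    have hft : ft f =ᵐ[volume] (𝓕 p2 : L2) := by
      have h1 := fourier_ae_eq p2 (hpi1.congr hpm.coeFn_toLp.symm)
      filter_upwards [h1] with ξ hξ
      rw [hξ, ft_eq_fourier, Real.fourier_eq, Real.fourier_eq]
      refine integral_congr_ae ?_
      filter_upwards [hpm.coeFn_toLp] with y hy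
      rw [hy]
    have hz : Tendsto (fun j : ℕ => (H / ((j : ℝ) + 1)) ^ 2) atTop (𝓝 0) := by
      have h1 : Tendsto (fun j : ℕ => H / ((j : ℝ) + 1)) atTop (𝓝 0) := by
        have := (tendsto_one_div_add_atTop_nhds_zero_nat (𝕜 := ℝ)).const_mul H
        simpa only [mul_one_div, mul_zero] using this
      have := h1.pow 2
      rwa [zero_pow two_ne_zero] at this
    refine squeeze_zero (fun j => integral_nonneg fun _ => by positivity) (fun j => ?_) hz
    have e1 : ∫ x, ‖ft f x - (𝓕 (lower (q j)) : 𝓢(Plane, ℂ)) x‖ ^ 2 =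
        ‖p2 - (lower (q j)).toLp 2 volume‖ ^ 2 := by
      rw [← Lp.norm_fourier_eq, norm_sq_eq_integral]
      have e2 : (𝓕 (p2 - (lower (q j)).toLp 2 volume) : L2) = 𝓕 p2 - (𝓕 (lower (q j))).toLp 2 := by
        have h1 := FourierTransform.fourier_add (p2 - (lower (q j)).toLp 2 volume) ((lower (q j)).toLp 2 volume : L2)
        rw [sub_add_cancel] at h1
        rw [h1, ← SchwartzMap.toLp_fourier_eq, add_sub_cancel_right]
      rw [e2]
      refine integral_congr_ae ?_
      filter_upwards [hft, Lp.coeFn_sub (𝓕 p2 : L2) ((𝓕 (lower (q j))).toLp 2 volume),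
        (𝓕 (lower (q j)) : 𝓢(Plane, ℂ)).coeFn_toLp 2] with x h1 h2 h3
      rw [h2, Pi.sub_apply, h1, h3]
    rw [e1]
    refine le_trans ?_ (pow_le_pow_left₀ (norm_nonneg _) (hq j).le 2)
    rw [norm_sq_eq_integral, norm_sq_eq_integral]
    refine integral_mono_of_nonneg (ae_of_all _ fun x => by positivity)
      ((memLp_two_iff_integrable_sq_norm (Lp.memLp _).1).1 (Lp.memLp _)) ?_
    filter_upwards [Lp.coeFn_sub p2 ((lower (q j)).toLp 2 volume), (lower (q j)).coeFn_toLp 2,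
      Lp.coeFn_sub Q ((q j).toLp 2 volume), (q j).coeFn_toLp 2, hpm.coeFn_toLp, hPm.coeFn_toLp]
      with x h1 h2 h3 h4 h5 h6
    rw [h1, h3, Pi.sub_apply, Pi.sub_apply, h2, h4, h5, h6]
    refine pow_le_pow_left₀ (norm_nonneg _) ?_ 2
    -- Division by ⟨x⟩² does not increase moduli, so closeness of `P` to `q j` passes to `p` and
    -- `lower (q j)`.
    have e3 : P x - q j x = ((jb x ^ 2 : ℝ) : ℂ) * (p x - lower (q j) x) := by
      have : ((jb x ^ 2 : ℝ) : ℂ) * lower (q j) x = q j x := by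
        rw [lower, SchwartzMap.smulLeftCLM_apply_apply (by fun_prop), Real.rpow_neg_one, ← jb_sq,
          Complex.real_smul, ← mul_assoc, ← Complex.ofReal_mul,
          mul_inv_cancel₀ (pow_pos (jb_pos x) 2).ne', Complex.ofReal_one, one_mul]
      rw [mul_sub, this]
    rw [e3, norm_mul, Complex.norm_real, Real.norm_of_nonneg (sq_nonneg _)]
    exact le_mul_of_one_le_left (norm_nonneg _) (one_le_pow₀ (one_le_jb x))

end

/-! ### Profiles of solutions -/

/-- Universal constant in the extraction of profiles. -/
noncomputable def profConst : ℝ := 3 * ((2 * Real.pi) ^ 2 * (2 * Real.pi + 1)) + 6 * √jbMass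

lemma two_pi_le_profConst : 2 * Real.pi ≤ profConst := by
  have h := one_le_two_pi
  have h1 : 2 * Real.pi ≤ (2 * Real.pi) ^ 2 := by nlinarith
  have h2 : (2 * Real.pi) ^ 2 ≤ (2 * Real.pi) ^ 2 * (2 * Real.pi + 1) :=
    le_mul_of_one_le_right (by positivity) (by linarith)
  have := Real.sqrt_nonneg jbMass
  have : 0 ≤ (2 * Real.pi) ^ 2 * (2 * Real.pi + 1) := by positivity
  unfold profConst; linarith

lemma one_le_profConst : 1 ≤ profConst := one_le_two_pi.trans two_pi_le_profConst

section

variable {n t b : ℝ}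

/-- Localization of `f` becomes regularity of its transform: continuity, Hölder continuity, and
approximation by Schwartz functions bounded in H². By continuity the almost everywhere bound holds
everywhere, a null open set being empty. -/
lemma prof_ft (hb : 0 < b) (f : L2)
    (hh : MemLp (fun x => ((jb x ^ 2 : ℝ) : ℂ) * f x) 2)
    (hle : ∫ x, ‖((jb x ^ 2 : ℝ) : ℂ) * f x‖ ^ 2 ≤ (3 * b * bracket t ^ (1 / 50 : ℝ)) ^ 2)
    (hbd : ∀ᵐ ξ, ‖hat f ξ‖ ≤ b * jb ξ ^ (-(n / 100)))
    (hs : MemLp (fun ξ => ((jb ξ ^ n : ℝ) : ℂ) * hat f ξ) 2)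
    (hsl : ∫ ξ, ‖((jb ξ ^ n : ℝ) : ℂ) * hat f ξ‖ ^ 2 ≤
      (2 * Real.pi * (b * bracket t ^ (1 / 100 : ℝ))) ^ 2) :
    hat f =ᵐ[volume] ft f ∧ Prof n t (profConst * b) (ft f) := by
  have hfm := Lp.memLp f
  have hi := integrable_of_weight hfm.1 hh
  have hat_eq := hat_ae_eq_ft hi
  have hc := continuous_ft hi
  have hP := two_pi_le_profConst
  have hP1 := one_le_profConst
  set L := bracket t ^ (1 / 50 : ℝ) with hL
  have hL0 : 0 < L := Real.rpow_pos_of_pos (bracket_pos t) _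
  have e1 : ∀ ξ, jb ξ ^ (2 * n) * ‖ft f ξ‖ ^ 2 = ‖((jb ξ ^ n : ℝ) : ℂ) * ft f ξ‖ ^ 2 := by
    intro ξ
    rw [norm_mul, Complex.norm_real, Real.norm_of_nonneg (jb_rpow_pos _ _).le, mul_pow, jb_rpow_sq]
  have e2 : (fun ξ => ‖((jb ξ ^ n : ℝ) : ℂ) * hat f ξ‖ ^ 2) =ᵐ[volume]
      fun ξ => jb ξ ^ (2 * n) * ‖ft f ξ‖ ^ 2 := by
    filter_upwards [hat_eq] with ξ hξ
    rw [e1, hξ]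
  refine ⟨hat_eq, hc, fun ξ => ?_, ?_, ?_, fun x y => ?_, ?_⟩
  · have hopen : IsOpen {ξ | b * jb ξ ^ (-(n / 100)) < ‖ft f ξ‖} :=
      isOpen_lt (continuous_const.mul (continuous_jb_rpow _)) hc.norm
    have hnull : volume {ξ | b * jb ξ ^ (-(n / 100)) < ‖ft f ξ‖} = 0 := by
      have : ∀ᵐ ξ, ¬ b * jb ξ ^ (-(n / 100)) < ‖ft f ξ‖ := by
        filter_upwards [hat_eq, hbd] with ξ h1 h2
        rw [← h1]; exact not_lt.2 h2
      simpa [ae_iff] using this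
    have hemp := hopen.eq_empty_of_measure_zero hnull
    have h1 : ‖ft f ξ‖ ≤ b * jb ξ ^ (-(n / 100)) := by
      by_contra hcon
      have : ξ ∈ {ξ | b * jb ξ ^ (-(n / 100)) < ‖ft f ξ‖} := not_le.1 hcon
      rw [hemp] at this; exact this
    refine h1.trans (mul_le_mul_of_nonneg_right ?_ (jb_rpow_pos _ _).le)
    exact le_mul_of_one_le_left hb.le hP1
  · exact ((memLp_two_iff_integrable_sq_norm hs.1).1 hs).congr e2
  · rw [← integral_congr_ae e2]
    refine hsl.trans (pow_le_pow_left₀ ?_ ?_ 2)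
    · have := Real.rpow_nonneg (bracket_pos t).le (1 / 100); positivity
    · rw [← mul_assoc]
      exact mul_le_mul_of_nonneg_right (mul_le_mul_of_nonneg_right hP hb.le)
        (Real.rpow_nonneg (bracket_pos t).le _)
  · refine (ft_holder hfm.1 hh x y).trans ?_
    refine mul_le_mul_of_nonneg_right ?_ (by positivity)
    have h1 : √(∫ x, ‖((jb x ^ 2 : ℝ) : ℂ) * f x‖ ^ 2) ≤ 3 * b * L :=
      Real.sqrt_le_iff.2 ⟨by positivity, hle⟩
    calc _ ≤ 2 * √jbMass * (3 * b * L) := by gcongr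
      _ = (6 * √jbMass) * (b * L) := by ring
      _ ≤ profConst * (b * L) := by
          refine mul_le_mul_of_nonneg_right ?_ (by positivity)
          have : 0 ≤ (2 * Real.pi) ^ 2 * (2 * Real.pi + 1) := by positivity
          unfold profConst; linarith
      _ = _ := by ring
  · obtain ⟨q, hq, hlim⟩ := exists_approx hfm hh (H := 3 * b * L) (by positivity) hle
    have hN : (2 * Real.pi) ^ 2 * (2 * Real.pi * (3 * b * L) + 3 * b * L) ≤ profConst * b * L := by
      calc _ = 3 * ((2 * Real.pi) ^ 2 * (2 * Real.pi + 1)) * (b * L) := by ring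
        _ ≤ profConst * (b * L) := by
          refine mul_le_mul_of_nonneg_right ?_ (by positivity)
          have := Real.sqrt_nonneg jbMass
          unfold profConst; linarith
        _ = _ := by ring
    have hN2 := pow_le_pow_left₀ (by positivity) hN 2
    exact ⟨q, fun j => ⟨(hq j).zero.trans hN2, fun e he => ((hq j).one e he).trans hN2,
      fun e he => ((hq j).two e he).trans hN2⟩, hlim⟩

lemma le_ofReal_of_mul_le {c : ℝ} (hc : 0 < c) {x : ℝ≥0∞}
    (h : ENNReal.ofReal c⁻¹ * x ≤ ENNReal.ofReal b) : x ≤ ENNReal.ofReal (c * b) := by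
  have h1 : ENNReal.ofReal c * (ENNReal.ofReal c⁻¹ * x) = x := by
    rw [← mul_assoc, ← ENNReal.ofReal_mul hc.le, mul_inv_cancel₀ hc.ne', ENNReal.ofReal_one, one_mul]
  rw [ENNReal.ofReal_mul hc.le, ← h1]
  gcongr

lemma aestronglyMeasurable_weight_hat (s : ℝ) (g : L2) :
    AEStronglyMeasurable (fun ξ => ((jb ξ ^ s : ℝ) : ℂ) * hat g ξ) volume :=
  (Complex.continuous_ofReal.comp (continuous_jb_rpow s)).aestronglyMeasurable.mul
    (aestronglyMeasurable_hat g)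

lemma weight_hat_of_sobolev {s c : ℝ} (hc : 0 ≤ c) {g : L2}
    (h : sobolevNorm s g ≤ ENNReal.ofReal c) :
    MemLp (fun ξ => ((jb ξ ^ s : ℝ) : ℂ) * hat g ξ) 2 ∧
    ∫ ξ, ‖((jb ξ ^ s : ℝ) : ℂ) * hat g ξ‖ ^ 2 ≤ (2 * Real.pi * c) ^ 2 :=
  integral_sq_le_of_eLpNorm (by have := Real.pi_pos; positivity)
    (aestronglyMeasurable_weight_hat s g) (le_ofReal_of_mul_le (by positivity) h)

lemma norm_le_of_sobolev {s c : ℝ} (hs : 0 ≤ s) (hc : 0 ≤ c) {g : L2}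
    (h : sobolevNorm s g ≤ ENNReal.ofReal c) : ‖g‖ ≤ c := by
  obtain ⟨hm, hle⟩ := weight_hat_of_sobolev hc h
  refine le_of_sq_le_sq ?_ hc
  have h1 : ∫ ξ, ‖hat g ξ‖ ^ 2 ≤ 1 ^ 2 * ∫ ξ, ‖((jb ξ ^ s : ℝ) : ℂ) * hat g ξ‖ ^ 2 := by
    refine integral_sq_le_of_norm_le hm fun ξ => ?_
    rw [one_mul, norm_mul, Complex.norm_real, Real.norm_of_nonneg (jb_rpow_pos _ _).le]
    exact le_mul_of_one_le_left (norm_nonneg _) (one_le_jb_rpow hs ξ)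
  rw [integral_sq_hat, ← norm_sq_eq_integral, one_pow, one_mul] at h1
  have h2 := h1.trans hle
  rw [mul_pow _ c] at h2
  exact le_of_mul_le_mul_left h2 (by positivity)

lemma weighted_of_norm {w : Plane → ℝ} {c : ℝ} (hc : 0 ≤ c) {g : L2}
    (h : weightedSobolevNorm w 2 g ≤ ENNReal.ofReal c) :
    ∃ G : L2, (∀ᵐ x, G x = (w x : ℂ) * g x) ∧ ‖G‖ ≤ c := by
  unfold weightedSobolevNorm at h
  split_ifs at h with hm
  · exact ⟨hm.toLp _, hm.coeFn_toLp, norm_le_of_sobolev (by norm_num) hc h⟩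
  · exact absurd h (by simp)

lemma weighted_le_second (g : L2) (i j : Fin 2) :
    weightedSobolevNorm (fun x => x i * x j) 2 g ≤ secondMomentNorm 2 g := by
  unfold secondMomentNorm
  set W : Fin 2 → Fin 2 → ℝ≥0∞ := fun i j => weightedSobolevNorm (fun x => x i * x j) 2 g
  change W i j ≤ (∑ i, ∑ j, W i j ^ 2) ^ (1 / 2 : ℝ)
  have h1 : W i j ^ 2 ≤ ∑ i, ∑ j, W i j ^ 2 :=
    (Finset.single_le_sum (f := fun j => W i j ^ 2) (fun _ _ => zero_le) (Finset.mem_univ j)).trans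
      (Finset.single_le_sum (f := fun i => ∑ j, W i j ^ 2) (fun _ _ => zero_le)
        (Finset.mem_univ i))
  calc W i j = (W i j ^ 2) ^ (1 / 2 : ℝ) := by
        rw [← ENNReal.rpow_natCast, ← ENNReal.rpow_mul]; norm_num
    _ ≤ _ := ENNReal.rpow_le_rpow h1 (by norm_num)

lemma norm_propagator (t : ℝ) (g : L2) : ‖propagator t g‖ = ‖g‖ := by
  have h : ∫ ξ, ‖hat (propagator t g) ξ‖ ^ 2 = ∫ ξ, ‖hat g ξ‖ ^ 2 := by
    refine integral_congr_ae ?_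
    filter_upwards [hat_propagator t g] with ξ hξ
    rw [hξ, norm_mul, norm_cexp_I_mul_mul, one_mul]
  rw [integral_sq_hat, integral_sq_hat, ← norm_sq_eq_integral, ← norm_sq_eq_integral] at h
  have h2 := mul_left_cancel₀ (by positivity) h
  exact (sq_eq_sq₀ (norm_nonneg _) (norm_nonneg _)).1 h2

/-- The weighted bound for the profile at a fixed time. -/
lemma moment_bound {c d : ℝ} (hd : 0 ≤ d) {f : L2} (h0 : ‖f‖ ≤ c)
    (h2 : secondMomentNorm 2 f ≤ ENNReal.ofReal d) :
    MemLp (fun x => ((jb x ^ 2 : ℝ) : ℂ) * f x) 2 ∧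
    ∫ x, ‖((jb x ^ 2 : ℝ) : ℂ) * f x‖ ^ 2 ≤ (c + 2 * d) ^ 2 := by
  obtain ⟨G0, hG0, hn0⟩ := weighted_of_norm hd ((weighted_le_second f 0 0).trans h2)
  obtain ⟨G1, hG1, hn1⟩ := weighted_of_norm hd ((weighted_le_second f 1 1).trans h2)
  -- Since ⟨x⟩² = 1 + x₁² + x₂², the diagonal second moments suffice.
  have e : (fun x => ((jb x ^ 2 : ℝ) : ℂ) * f x) =ᵐ[volume] (f + G0 + G1 : L2) := by
    filter_upwards [hG0, hG1, Lp.coeFn_add (f + G0) G1, Lp.coeFn_add f G0] with x h1 h2 h3 h4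
    rw [h3, Pi.add_apply, h4, Pi.add_apply, h1, h2, jb_sq, EuclideanSpace.norm_sq_eq,
      Fin.sum_univ_two]
    simp only [Real.norm_eq_abs, sq_abs]
    push_cast; ring
  refine ⟨(memLp_congr_ae e).2 (Lp.memLp _), ?_⟩
  have e2 : ∫ x, ‖((jb x ^ 2 : ℝ) : ℂ) * f x‖ ^ 2 = ‖f + G0 + G1‖ ^ 2 := by
    rw [norm_sq_eq_integral]
    refine integral_congr_ae ?_
    filter_upwards [e] with x hx
    rw [hx]
  rw [e2]
  refine pow_le_pow_left₀ (norm_nonneg _) ?_ 2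
  have := norm_add₃_le (a := f) (b := G0) (c := G1)
  linarith

lemma ae_le_of_normS {k : ℝ} {g : L2} (hb : 0 ≤ b) (h : normS k g ≤ ENNReal.ofReal b) :
    ∀ᵐ ξ, ‖hat g ξ‖ ≤ b * jb ξ ^ (-k) := by
  unfold normS weightedSup at h
  rw [eLpNorm_exponent_top] at h
  filter_upwards [ae_le_eLpNormEssSup
    (f := fun ξ : Plane => ((jb ξ ^ k : ℝ) : ℂ) * hat g ξ) (μ := volume)] with ξ hξ
  have h1 := hξ.trans h
  rw [← ofReal_norm, ENNReal.ofReal_le_ofReal_iff hb, norm_mul, Complex.norm_real,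
    Real.norm_of_nonneg (jb_rpow_pos _ _).le] at h1
  rw [Real.rpow_neg (jb_pos ξ).le, ← div_eq_mul_inv, le_div_iff₀ (jb_rpow_pos _ _)]
  linarith

/-- The profile is f = e^{it⟨D⟩}u. Its L² norm and two second moments add up to 3b⟨t⟩^{1/50} for
⟨x⟩² f. The H^n and scattering bounds pass from u to f because the propagator multiplies the
transform by a unimodular factor. -/
lemma APriori.prof {lam A ε T : ℝ} {u : ℝ → L2} (hn : 1000 ≤ n) (hA : 0 < A * ε)
    (h : APriori n lam A ε T u) {t : ℝ} (ht : t ∈ Set.Icc 0 T) :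
    ∃ F, Prof n t (profConst * (A * ε)) F ∧ hat (u t) =ᵐ[volume] modul t F := by
  set b := A * ε with hbd
  have hsl : ENNReal.ofReal (bracket t ^ (-(1 / 100) : ℝ)) * normE1 n t (u t) +
      ENNReal.ofReal (bracket t ^ (-(2 * (1 / 100)) : ℝ)) * normE2 t (u t) +
      normS (n / 100) (u t) ≤ ENNReal.ofReal b :=
    (le_iSup₂ (f := fun t (_ : t ∈ Set.Icc (0 : ℝ) T) =>
      ENNReal.ofReal (bracket t ^ (-(1 / 100) : ℝ)) * normE1 n t (u t) +
      ENNReal.ofReal (bracket t ^ (-(2 * (1 / 100)) : ℝ)) * normE2 t (u t) +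
      normS (n / 100) (u t)) t ht).trans h.bound
  have hB := bracket_pos t
  set l := bracket t ^ (1 / 100 : ℝ) with hl
  set L := bracket t ^ (1 / 50 : ℝ) with hL
  have hl0 : 0 < l := Real.rpow_pos_of_pos hB _
  have hL0 : 0 < L := Real.rpow_pos_of_pos hB _
  have hlL : l ≤ L := Real.rpow_le_rpow_of_exponent_le (one_le_bracket t) (by norm_num)
  have e1 : bracket t ^ (-(1 / 100) : ℝ) = l⁻¹ := Real.rpow_neg hB.le _
  have e2 : bracket t ^ (-(2 * (1 / 100)) : ℝ) = L⁻¹ := by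
    rw [hL, ← Real.rpow_neg hB.le]; norm_num
  rw [e1, e2] at hsl
  have s1 : sobolevNorm n (u t) ≤ ENNReal.ofReal (l * b) := by
    refine le_ofReal_of_mul_le hl0 (le_trans ?_ hsl)
    calc _ ≤ ENNReal.ofReal l⁻¹ * normE1 n t (u t) := by
          gcongr; exact le_self_add
      _ ≤ _ := le_self_add.trans le_self_add
  have s2 : secondMomentNorm 2 (propagator t (u t)) ≤ ENNReal.ofReal (L * b) := by
    refine le_ofReal_of_mul_le hL0 (le_trans ?_ hsl)
    exact le_add_self.trans le_self_add
  have s3 : normS (n / 100) (u t) ≤ ENNReal.ofReal b := le_trans le_add_self hsl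
  set f := propagator t (u t) with hf
  have hfn : ‖f‖ ≤ l * b := by
    rw [hf, norm_propagator]; exact norm_le_of_sobolev (by linarith) (by positivity) s1
  obtain ⟨m1, m2⟩ := moment_bound (by positivity) hfn s2
  have hat_f := hat_propagator t (u t)
  obtain ⟨w1, w2⟩ := weight_hat_of_sobolev (by positivity) s1
  have hnorm : ∀ᵐ ξ, ‖((jb ξ ^ n : ℝ) : ℂ) * hat (u t) ξ‖ = ‖((jb ξ ^ n : ℝ) : ℂ) * hat f ξ‖ := by
    filter_upwards [hat_f] with ξ hξ
    rw [hξ, norm_mul, norm_mul, norm_mul, norm_cexp_I_mul_mul, one_mul]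
  obtain ⟨hat_eq, hP⟩ := prof_ft (n := n) (t := t) hA f m1
    (m2.trans (pow_le_pow_left₀ (by positivity) (by nlinarith) 2)) (by
      filter_upwards [hat_f, ae_le_of_normS hA.le s3] with ξ h1 h2
      rwa [h1, norm_mul, norm_cexp_I_mul_mul, one_mul])
    (w1.congr_norm (aestronglyMeasurable_weight_hat n f) hnorm) (by
      rw [mul_comm b]
      refine le_trans (le_of_eq (integral_congr_ae ?_)) w2
      filter_upwards [hnorm] with ξ hξ
      rw [hξ])
  refine ⟨ft f, hP, ?_⟩
  filter_upwards [hat_f, hat_eq] with ξ h1 h2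
  rw [modul, ← h2, h1, ← mul_assoc, ← Complex.exp_add, neg_add_cancel, Complex.exp_zero, one_mul]

end

/-! ### The phase correction -/

/-- A family of profiles for the curve `u` on `[0, T]`. -/
structure Profiles (n T a : ℝ) (u : ℝ → L2) (F : ℝ → Plane → ℂ) : Prop where
  prof : ∀ t ∈ Set.Icc 0 T, Prof n t a (F t)
  eq : ∀ t ∈ Set.Icc 0 T, hat (u t) =ᵐ[volume] modul t (F t)
  cont : ContinuousOn u (Set.Icc 0 T)

/-- Splits the velocity singularity into a stronger but still integrable one with small constant and
a bounded part, with a view to continuity of `coul` in time. -/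
lemma inv_le_eps {V ε : ℝ} (hV : 0 < V) (hε : 0 < ε) :
    V ^ (-1 : ℝ) ≤ ε * V ^ (-(3 / 2) : ℝ) + (ε ^ 2)⁻¹ := by
  have h0 : 0 ≤ V ^ (-(3 / 2) : ℝ) := by positivity
  rcases le_total (V ^ (1 / 2 : ℝ)) ε with h | h
  · have e1 : V ^ (-1 : ℝ) = V ^ (1 / 2 : ℝ) * V ^ (-(3 / 2) : ℝ) := by
      rw [← Real.rpow_add hV]; norm_num
    have : 0 ≤ (ε ^ 2)⁻¹ := by positivity
    rw [e1]
    nlinarith [mul_le_mul_of_nonneg_right h h0]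
  · have e1 : V = (V ^ (1 / 2 : ℝ)) ^ 2 := by
      rw [← Real.rpow_natCast, ← Real.rpow_mul hV.le]; norm_num
    have h2 : V ^ (-1 : ℝ) ≤ (ε ^ 2)⁻¹ := by
      rw [Real.rpow_neg_one]
      refine inv_anti₀ (by positivity) ?_
      rw [e1]; exact pow_le_pow_left₀ hε.le h 2
    have := mul_nonneg hε.le h0
    linarith

lemma measurable_coul {F : Plane → ℂ} (hF : Continuous F) : Measurable (coul F) := by
  have h : StronglyMeasurable (Function.uncurry fun ξ σ : Plane =>
      ‖vel ξ - vel σ‖⁻¹ * ‖F σ‖ ^ 2) := by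
    have h1 := continuous_vel.measurable
    have h2 := hF.measurable
    refine Measurable.stronglyMeasurable ?_
    simp only [Function.uncurry_def]
    fun_prop
  exact (h.integral_prod_right).measurable.const_mul _

namespace Profiles

variable {n T a : ℝ} {u : ℝ → L2} {F : ℝ → Plane → ℂ}

/-- The singular part is small uniformly in time. Against the bounded part only the L¹ distance of
the densities matters; as |F| = |û|, Cauchy–Schwarz bounds it by a multiple of ‖u(t)-u(s)‖, so no
comparison of the phases of the profiles is needed. -/
lemma coul_sub_le (hn : 1000 ≤ n) (h : Profiles n T a u F) {s t : ℝ} (hs : s ∈ Set.Icc 0 T)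
    (ht : t ∈ Set.Icc 0 T) (ξ : Plane) {ε : ℝ} (hε : 0 < ε) :
    |coul (F t) ξ - coul (F s) ξ| ≤ ε * (2 * (velConst (3 / 2) * a ^ 2)) +
      (ε ^ 2)⁻¹ * (4 * Real.pi * a * √jbMass * ‖u t - u s‖) := by
  have pt := h.prof t ht
  have ps := h.prof s hs
  have bt := pt.bd10 hn
  have bs := ps.bd10 hn
  have ha := pt.nonneg
  obtain ⟨vt, vt2⟩ := vel_integral pt.cont bt (p := 3 / 2) (by norm_num) (by norm_num) ξ
  obtain ⟨vs, vs2⟩ := vel_integral ps.cont bs (p := 3 / 2) (by norm_num) (by norm_num) ξ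
  obtain ⟨it, -⟩ := integrable_sq pt.cont bt
  obtain ⟨is, -⟩ := integrable_sq ps.cont bs
  have hne : ∀ᵐ y : Plane, y ≠ ξ := by simp [ae_iff, measure_singleton]
  have idiff : Integrable fun σ => |‖F t σ‖ ^ 2 - ‖F s σ‖ ^ 2| := (it.sub is).abs
  have hL1 : ∫ σ, |‖F t σ‖ ^ 2 - ‖F s σ‖ ^ 2| ≤ 4 * Real.pi * a * √jbMass * ‖u t - u s‖ := by
    have hm := memLp_jb_rpow (s := -(3 / 2)) (by norm_num)
    have hd := (memLp_hat (u t - u s)).norm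
    have hcs := integral_mul_le_sqrt (fun x => (jb_rpow_pos (-(3 / 2)) x).le)
      (fun x => norm_nonneg (hat (u t - u s) x)) hm hd
    simp_rw [jb_rpow_sq] at hcs
    have e2 : (2 * -(3 / 2) : ℝ) = -3 := by norm_num
    rw [e2, integral_sq_hat, ← norm_sq_eq_integral, ← mul_pow,
      Real.sqrt_sq (by have := Real.pi_pos; positivity)] at hcs
    calc _ ≤ ∫ σ, 2 * a * (jb σ ^ (-(3 / 2) : ℝ) * ‖hat (u t - u s) σ‖) := by
          refine integral_mono_ae idiff ((hm.integrable_mul hd).const_mul _) ?_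
          filter_upwards [h.eq t ht, h.eq s hs, hat_sub (u t) (u s)] with σ h1 h2 h3
          have e3 : ‖F t σ‖ = ‖hat (u t) σ‖ := by rw [h1, norm_modul]
          have e4 : ‖F s σ‖ = ‖hat (u s) σ‖ := by rw [h2, norm_modul]
          have b1 : ‖F t σ‖ + ‖F s σ‖ ≤ 2 * a * jb σ ^ (-(3 / 2) : ℝ) := by
            have := jb_rpow_mono (by norm_num : (-10 : ℝ) ≤ -(3 / 2)) σ
            have h5 := mul_le_mul_of_nonneg_left this ha
            linarith [bt σ, bs σ]
          have b2 : |‖F t σ‖ - ‖F s σ‖| ≤ ‖hat (u t - u s) σ‖ := by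
            rw [e3, e4, h3]; exact abs_norm_sub_norm_le _ _
          calc |‖F t σ‖ ^ 2 - ‖F s σ‖ ^ 2| = (‖F t σ‖ + ‖F s σ‖) * |‖F t σ‖ - ‖F s σ‖| := by
                rw [sq_sub_sq, abs_mul, abs_of_nonneg (by positivity)]
            _ ≤ (2 * a * jb σ ^ (-(3 / 2) : ℝ)) * ‖hat (u t - u s) σ‖ :=
                mul_le_mul b1 b2 (abs_nonneg _)
                  (by have := jb_rpow_pos (-(3 / 2)) σ; positivity)
            _ = _ := by ring
      _ ≤ 2 * a * (√jbMass * (2 * Real.pi * ‖u t - u s‖)) := by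
          rw [integral_const_mul]
          exact mul_le_mul_of_nonneg_left hcs (by positivity)
      _ = _ := by ring
  have i1 := integrable_coul pt.cont bt ξ
  have i2 := integrable_coul ps.cont bs ξ
  rw [coul, coul, ← mul_sub, abs_mul, abs_of_nonneg two_pi_sq_inv_nonneg, ← integral_sub i1 i2]
  refine (mul_le_of_le_one_left (abs_nonneg _) two_pi_sq_inv_le).trans ?_
  calc _ ≤ ∫ σ, (ε * (‖vel ξ - vel σ‖ ^ (-(3 / 2) : ℝ) * ‖F t σ‖ ^ 2 +
        ‖vel ξ - vel σ‖ ^ (-(3 / 2) : ℝ) * ‖F s σ‖ ^ 2) +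
        (ε ^ 2)⁻¹ * |‖F t σ‖ ^ 2 - ‖F s σ‖ ^ 2|) := by
        rw [← Real.norm_eq_abs]
        refine norm_integral_le_of_norm_le (((vt.add vs).const_mul ε).add (idiff.const_mul _)) ?_
        filter_upwards [hne] with σ hσ
        have hV := norm_vel_sub_pos hσ.symm
        rw [← mul_sub, norm_mul, norm_inv, norm_norm, Real.norm_eq_abs, ← Real.rpow_neg_one]
        have h1 := inv_le_eps hV hε
        have h2 : |‖F t σ‖ ^ 2 - ‖F s σ‖ ^ 2| ≤ ‖F t σ‖ ^ 2 + ‖F s σ‖ ^ 2 := by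
          rw [abs_le]; constructor <;> nlinarith [sq_nonneg ‖F t σ‖, sq_nonneg ‖F s σ‖]
        have h3 : 0 ≤ ε * ‖vel ξ - vel σ‖ ^ (-(3 / 2) : ℝ) := by positivity
        calc _ ≤ (ε * ‖vel ξ - vel σ‖ ^ (-(3 / 2) : ℝ) + (ε ^ 2)⁻¹) *
              |‖F t σ‖ ^ 2 - ‖F s σ‖ ^ 2| := mul_le_mul_of_nonneg_right h1 (abs_nonneg _)
          _ ≤ ε * ‖vel ξ - vel σ‖ ^ (-(3 / 2) : ℝ) * (‖F t σ‖ ^ 2 + ‖F s σ‖ ^ 2) +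
              (ε ^ 2)⁻¹ * |‖F t σ‖ ^ 2 - ‖F s σ‖ ^ 2| := by
              rw [add_mul]; exact add_le_add (mul_le_mul_of_nonneg_left h2 h3) le_rfl
          _ = _ := by ring
    _ ≤ _ := by
        have i12 : Integrable fun σ => ε * (‖vel ξ - vel σ‖ ^ (-(3 / 2) : ℝ) * ‖F t σ‖ ^ 2 +
            ‖vel ξ - vel σ‖ ^ (-(3 / 2) : ℝ) * ‖F s σ‖ ^ 2) := (vt.add vs).const_mul ε
        rw [integral_add i12 (idiff.const_mul _), integral_const_mul,
          integral_const_mul, integral_add vt vs]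
        refine add_le_add (mul_le_mul_of_nonneg_left (by linarith) hε.le)
          (mul_le_mul_of_nonneg_left hL1 (by positivity))

lemma continuousOn_coul (hn : 1000 ≤ n) (h : Profiles n T a u F) (ξ : Plane) :
    ContinuousOn (fun t => coul (F t) ξ) (Set.Icc 0 T) := by
  intro s hs
  rw [Metric.continuousWithinAt_iff']
  intro η hη
  have v := velConst_nonneg (3 / 2)
  have hA : 0 ≤ 2 * (velConst (3 / 2) * a ^ 2) := by positivity
  set A := 2 * (velConst (3 / 2) * a ^ 2)
  set ε := η / (2 * (A + 1)) with hε
  have hε0 : 0 < ε := by positivity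
  have hεA : ε * A < η / 2 := by
    rw [hε, div_mul_eq_mul_div, div_lt_div_iff₀ (by positivity) (by norm_num)]
    nlinarith
  have hcu : Tendsto (fun t => (ε ^ 2)⁻¹ * (4 * Real.pi * a * √jbMass * ‖u t - u s‖))
      (𝓝[Set.Icc 0 T] s) (𝓝 0) := by
    have h2 : Tendsto (fun t => ‖u t - u s‖) (𝓝[Set.Icc 0 T] s) (𝓝 0) := by
      simpa using ((h.cont s hs).tendsto.sub_const (u s)).norm
    simpa using (h2.const_mul (4 * Real.pi * a * √jbMass)).const_mul (ε ^ 2)⁻¹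
  filter_upwards [hcu.eventually (gt_mem_nhds (half_pos hη)), self_mem_nhdsWithin] with t h1 ht
  rw [Real.dist_eq]
  exact (h.coul_sub_le hn hs ht ξ hε0).trans_lt (by linarith)

/-- Projection to `[0, T]`. -/
noncomputable def clamp (T s : ℝ) : ℝ := max 0 (min s T)

lemma continuous_clamp (T : ℝ) : Continuous (clamp T) := by unfold clamp; fun_prop

lemma clamp_mem (hT : 0 ≤ T) (s : ℝ) : clamp T s ∈ Set.Icc 0 T :=
  ⟨le_max_left _ _, max_le hT (min_le_right _ _)⟩

lemma clamp_of_mem {s : ℝ} (hs : s ∈ Set.Icc 0 T) : clamp T s = s := by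
  rw [clamp, min_eq_left hs.2, max_eq_right hs.1]

/-- The derivative of the phase correction, up to the coupling constant. -/
noncomputable def amp (n T : ℝ) (ρ : Plane → ℝ) (F : ℝ → Plane → ℂ) (s : ℝ) (ξ : Plane) : ℝ :=
  coul (F (clamp T s)) ξ * (ρ (s ^ (-(2 / n)) • ξ) / bracket s)

lemma amp_of_mem {ρ : Plane → ℝ} {s : ℝ} (hs : s ∈ Set.Icc 0 T) (ξ : Plane) :
    amp n T ρ F s ξ = coul (F s) ξ * (ρ (s ^ (-(2 / n)) • ξ) / bracket s) := by
  rw [amp, clamp_of_mem hs]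

section

variable {ρ : Plane → ℝ} {κ lam : ℝ}

lemma abs_amp_le (hn : 1000 ≤ n) (hT : 0 ≤ T) (h : Profiles n T a u F) (hκ : ∀ x, |ρ x| ≤ κ)
    (s : ℝ) (ξ : Plane) : |amp n T ρ F s ξ| ≤ velConst 1 * a ^ 2 * κ := by
  have hp := h.prof _ (clamp_mem hT s)
  have v := velConst_nonneg 1
  rw [amp, abs_mul, abs_of_nonneg (coul_nonneg ξ), abs_div, abs_of_pos (bracket_pos s)]
  exact mul_le_mul (coul_le hp.cont (hp.bd10 hn) ξ)
    ((div_le_self (abs_nonneg _) (one_le_bracket s)).trans (hκ _))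
    (div_nonneg (abs_nonneg _) (bracket_pos s).le) (by positivity)

lemma continuous_coul_clamp (hn : 1000 ≤ n) (hT : 0 ≤ T) (h : Profiles n T a u F) (ξ : Plane) :
    Continuous fun s => coul (F (clamp T s)) ξ :=
  (h.continuousOn_coul hn ξ).comp_continuous (continuous_clamp T) (clamp_mem hT)

/-- Carathéodory measurability: the coefficient is continuous in time, on the whole line thanks to
`clamp`, and measurable in ξ. -/
lemma measurable_amp (hn : 1000 ≤ n) (hT : 0 ≤ T) (h : Profiles n T a u F) (hρ : Continuous ρ) :
    Measurable (Function.uncurry (amp n T ρ F)) := by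
  have h1 : Measurable (Function.uncurry fun (s : ℝ) (ξ : Plane) => coul (F (clamp T s)) ξ) :=
    (stronglyMeasurable_uncurry_of_continuous_of_stronglyMeasurable
      (fun ξ => h.continuous_coul_clamp hn hT ξ)
      fun s => (measurable_coul (h.prof _ (clamp_mem hT s)).cont).stronglyMeasurable).measurable
  have h2 : Measurable fun p : ℝ × Plane => ρ (p.1 ^ (-(2 / n)) • p.2) / bracket p.1 :=
    (hρ.measurable.comp ((measurable_fst.pow_const _).smul measurable_snd)).div
      (continuous_bracket.measurable.comp measurable_fst)
  exact h1.mul h2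

/-- The restriction to positive times comes from the negative power of s in the cutoff; it is why
the evolution is differentiated only for s > 0. -/
lemma continuousAt_amp (hn : 1000 ≤ n) (hT : 0 ≤ T) (h : Profiles n T a u F) (hρ : Continuous ρ)
    {s : ℝ} (hs : 0 < s) (ξ : Plane) : ContinuousAt (fun r => amp n T ρ F r ξ) s := by
  have h1 := (h.continuous_coul_clamp hn hT ξ).continuousAt (x := s)
  have h2 : ContinuousAt (fun r : ℝ => r ^ (-(2 / n)) • ξ) s :=
    (Real.continuousAt_rpow_const s _ (Or.inl hs.ne')).smul continuousAt_const
  exact h1.mul ((hρ.continuousAt.comp h2).div continuous_bracket.continuousAt (bracket_pos s).ne')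

lemma intervalIntegrable_amp (hn : 1000 ≤ n) (hT : 0 ≤ T) (h : Profiles n T a u F)
    (hρ : Continuous ρ) (hκ : ∀ x, |ρ x| ≤ κ) (ξ : Plane) (s t : ℝ) :
    IntervalIntegrable (fun r => amp n T ρ F r ξ) volume s t := by
  refine (intervalIntegrable_const (c := velConst 1 * a ^ 2 * κ)).mono_fun ?_ ?_
  · exact ((h.measurable_amp hn hT hρ).comp measurable_prodMk_right).aestronglyMeasurable
  · refine ae_of_all _ fun r => ?_
    have h1 := h.abs_amp_le hn hT hκ r ξ
    beta_reduce
    rw [Real.norm_eq_abs, Real.norm_eq_abs]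
    exact h1.trans (le_abs_self _)

/-- The phase correction expressed by the profiles. -/
noncomputable def corrPhase (n T lam : ℝ) (ρ : Plane → ℝ) (F : ℝ → Plane → ℂ) (t : ℝ) (ξ : Plane) :
    ℝ := lam * ∫ s in (0 : ℝ)..t, amp n T ρ F s ξ

lemma phase_eq (h : Profiles n T a u F) {t : ℝ} (ht : t ∈ Set.Icc 0 T) (ξ : Plane) :
    phase n lam ρ u t ξ = corrPhase n T lam ρ F t ξ := by
  rw [phase, corrPhase, div_mul_eq_mul_div, mul_div_assoc, ← intervalIntegral.integral_div]
  congr 1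
  refine intervalIntegral.integral_congr fun s hs => ?_
  rw [Set.uIcc_of_le ht.1] at hs
  have hs' : s ∈ Set.Icc 0 T := ⟨hs.1, hs.2.trans ht.2⟩
  beta_reduce
  rw [amp_of_mem hs', coul]
  have e : ∫ σ : Plane, ‖(jb ξ)⁻¹ • ξ - (jb σ)⁻¹ • σ‖⁻¹ * ‖hat (u s) σ‖ ^ 2 =
      ∫ σ, ‖vel ξ - vel σ‖⁻¹ * ‖F s σ‖ ^ 2 := by
    refine integral_congr_ae ?_
    filter_upwards [h.eq s hs'] with σ hσ
    rw [hσ, norm_modul]; rfl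
  rw [e]; ring

lemma hasDerivAt_corrPhase (hn : 1000 ≤ n) (hT : 0 ≤ T) (h : Profiles n T a u F)
    (hρ : Continuous ρ) (hκ : ∀ x, |ρ x| ≤ κ) {s : ℝ} (hs : 0 < s) (ξ : Plane) :
    HasDerivAt (fun r => corrPhase n T lam ρ F r ξ) (lam * amp n T ρ F s ξ) s := by
  refine HasDerivAt.const_mul lam ?_
  refine intervalIntegral.integral_hasDerivAt_right (h.intervalIntegrable_amp hn hT hρ hκ ξ 0 s)
    ?_ (h.continuousAt_amp hn hT hρ hs ξ)
  exact ((h.measurable_amp hn hT hρ).comp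
    measurable_prodMk_right).stronglyMeasurable.stronglyMeasurableAtFilter

lemma continuous_corrPhase (hn : 1000 ≤ n) (hT : 0 ≤ T) (h : Profiles n T a u F)
    (hρ : Continuous ρ) (hκ : ∀ x, |ρ x| ≤ κ) (ξ : Plane) :
    Continuous fun r => corrPhase n T lam ρ F r ξ :=
  continuous_const.mul (intervalIntegral.continuous_primitive
    (fun s t => h.intervalIntegrable_amp hn hT hρ hκ ξ s t) 0)

lemma measurable_corrPhase (hn : 1000 ≤ n) (hT : 0 ≤ T) (h : Profiles n T a u F)
    (hρ : Continuous ρ) (t : ℝ) : Measurable (corrPhase n T lam ρ F t) := by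
  have e (S : Set ℝ) : Measurable fun ξ => ∫ s in S, amp n T ρ F s ξ :=
    ((h.measurable_amp hn hT hρ).stronglyMeasurable.integral_prod_left
      (μ := volume.restrict S)).measurable
  exact ((e (Set.Ioc 0 t)).sub (e (Set.Ioc t 0))).const_mul _

end

end Profiles

/-! ### Weak formulation of the evolution -/

section

variable {E : Type*} [NormedAddCommGroup E] [NormedSpace ℝ E] {ℓ : ℝ → E →L[ℝ] ℂ} {K s : ℝ}
  {S : Set ℝ} {u : ℝ → E}

lemma continuousWithinAt_pairing (hK : ∀ r g, ‖ℓ r g‖ ≤ K * ‖g‖) (hu : ContinuousWithinAt u S s)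
    (hc : ContinuousWithinAt (fun r => ℓ r (u s)) S s) :
    ContinuousWithinAt (fun r => ℓ r (u r)) S s := by
  have h1 : Tendsto (fun r => ℓ r (u r - u s)) (𝓝[S] s) (𝓝 0) := by
    refine squeeze_zero_norm (a := fun r => K * ‖u r - u s‖) (fun r => hK r _) ?_
    have := ((hu.tendsto.sub_const (u s)).norm).const_mul K
    simpa using this
  have h2 := h1.add hc.tendsto
  simpa [ContinuousWithinAt] using h2

/-- Product rule for time-dependent functionals that are only strongly continuous and strongly
differentiable; the uniform bound K transfers the convergence of the difference quotients of u. -/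
lemma hasDerivWithinAt_pairing (hK : ∀ r g, ‖ℓ r g‖ ≤ K * ‖g‖) {u' : E} {d : ℂ}
    (hu : HasDerivWithinAt u u' S s) (hd : HasDerivWithinAt (fun r => ℓ r (u s)) d S s)
    (hc : ContinuousWithinAt (fun r => ℓ r u') S s) :
    HasDerivWithinAt (fun r => ℓ r (u r)) (d + ℓ s u') S s := by
  rw [hasDerivWithinAt_iff_tendsto_slope] at hu hd ⊢
  have h1 : Tendsto (fun r => ℓ r (slope u s r - u')) (𝓝[S \ {s}] s) (𝓝 0) := by
    refine squeeze_zero_norm (a := fun r => K * ‖slope u s r - u'‖) (fun r => hK r _) ?_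
    have := ((hu.sub_const u').norm).const_mul K
    simpa using this
  have h2 := (h1.add (hc.mono Set.sdiff_subset).tendsto)
  rw [zero_add] at h2
  refine (hd.add h2).congr fun r => ?_
  simp only [slope, vsub_eq_sub, map_sub, map_smul, smul_sub]
  ring

end

lemma hat_add (g h : L2) : hat (g + h) =ᵐ[volume] fun ξ => hat g ξ + hat h ξ := by
  have e : (𝓕 (g + h) : L2) = 𝓕 g + 𝓕 h := FourierTransform.fourier_add g h
  filter_upwards [ae_comp_smul (inv_ne_zero two_pi_ne) (Lp.coeFn_add (𝓕 g : L2) (𝓕 h))] with ξ hξ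
  rw [hat, e, hξ]; rfl

/-- Bounded test functions of bounded support. -/
structure IsTest (R : ℝ) (φ : Plane → ℂ) : Prop where
  meas : Measurable φ
  le_one : ∀ ξ, ‖φ ξ‖ ≤ 1
  supp : ∀ ξ, R < ‖ξ‖ → φ ξ = 0

section

variable {R : ℝ} {φ : Plane → ℂ} {θ : Plane → ℝ}

lemma IsTest.norm_le_indicator (h : IsTest R φ) (ξ : Plane) :
    ‖φ ξ‖ ≤ ‖(Metric.closedBall (0 : Plane) R).indicator (fun _ => (1 : ℂ)) ξ‖ := by
  by_cases hξ : ‖ξ‖ ≤ R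
  · rw [Set.indicator_of_mem (by simpa using hξ), norm_one]; exact h.le_one ξ
  · rw [h.supp ξ (not_le.1 hξ), norm_zero]; exact norm_nonneg _

lemma IsTest.memLp (h : IsTest R φ) (p : ℝ≥0∞) : MemLp φ p :=
  (memLp_indicator_const p measurableSet_closedBall 1
    (Or.inr measure_closedBall_lt_top.ne)).mono h.meas.aestronglyMeasurable
    (ae_of_all _ h.norm_le_indicator)

lemma IsTest.integrable (h : IsTest R φ) : Integrable φ := memLp_one_iff_integrable.1 (h.memLp 1)

lemma IsTest.osc (h : IsTest R φ) (hθ : Measurable θ) :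
    IsTest R fun ξ => Complex.exp (Complex.I * θ ξ) * φ ξ where
  meas := by have := h.meas; fun_prop
  le_one ξ := by rw [norm_mul, norm_cexp_I_mul, one_mul]; exact h.le_one ξ
  supp ξ hξ := by rw [h.supp ξ hξ, mul_zero]

lemma IsTest.integrable_mul_hat (h : IsTest R φ) (g : L2) : Integrable fun ξ => φ ξ * hat g ξ :=
  (h.memLp 2).integrable_mul (memLp_hat g)

lemma IsTest.norm_integral_mul_hat_le (h : IsTest R φ) (g : L2) :
    ‖∫ ξ, φ ξ * hat g ξ‖ ≤ √(∫ ξ, ‖φ ξ‖ ^ 2) * (2 * Real.pi) * ‖g‖ := by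
  have h1 := integral_mul_le_sqrt (fun x => norm_nonneg (φ x)) (fun x => norm_nonneg (hat g x))
    (h.memLp 2).norm (memLp_hat g).norm
  rw [integral_sq_hat, ← norm_sq_eq_integral, ← mul_pow,
    Real.sqrt_sq (by have := Real.pi_pos; positivity)] at h1
  refine (norm_integral_le_integral_norm _).trans ?_
  simp_rw [norm_mul]
  linarith

/-- The functional `g ↦ ∫ φ ĝ`. -/
noncomputable def IsTest.pair (h : IsTest R φ) : L2 →L[ℂ] ℂ :=
  LinearMap.mkContinuous
    { toFun := fun g => ∫ ξ, φ ξ * hat g ξ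
      map_add' := fun f g => by
        rw [← integral_add (h.integrable_mul_hat f) (h.integrable_mul_hat g)]
        refine integral_congr_ae ?_
        filter_upwards [hat_add f g] with ξ hξ
        rw [hξ, mul_add]
      map_smul' := fun c g => by
        rw [RingHom.id_apply, smul_eq_mul, ← integral_const_mul]
        refine integral_congr_ae ?_
        filter_upwards [hat_smul c g] with ξ hξ
        rw [hξ]; ring }
    (√(∫ ξ, ‖φ ξ‖ ^ 2) * (2 * Real.pi)) h.norm_integral_mul_hat_le

lemma IsTest.norm_osc_pair_le (h : IsTest R φ) (hθ : Measurable θ) (g : L2) :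
    ‖((h.osc hθ).pair.restrictScalars ℝ) g‖ ≤ √(∫ ξ, ‖φ ξ‖ ^ 2) * (2 * Real.pi) * ‖g‖ := by
  have h1 := (h.osc hθ).norm_integral_mul_hat_le g
  simp only [norm_mul (Complex.exp _), norm_cexp_I_mul, one_mul] at h1
  exact h1

/-- Differentiation under the integral. The bounded support of φ provides the domination, as the
phases in use have time derivatives growing like ⟨ξ⟩. -/
lemma hasDerivAt_osc_pair (h : IsTest R φ) {θ θ' : ℝ → Plane → ℝ} {s C : ℝ} (hs : 0 < s)
    (hθ : ∀ r, Measurable (θ r)) (hθ' : Measurable (θ' s))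
    (hd : ∀ r, 0 < r → ∀ ξ, HasDerivAt (fun r => θ r ξ) (θ' r ξ) r)
    (hC : ∀ r ξ, ‖ξ‖ ≤ R → |θ' r ξ| ≤ C) (g : L2) :
    HasDerivAt (fun r => ∫ ξ, Complex.exp (Complex.I * θ r ξ) * φ ξ * hat g ξ)
      (∫ ξ, Complex.I * θ' s ξ * (Complex.exp (Complex.I * θ s ξ) * φ ξ * hat g ξ)) s := by
  have hm : ∀ r, AEStronglyMeasurable
      (fun ξ => Complex.exp (Complex.I * θ r ξ) * φ ξ * hat g ξ) volume := fun r =>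
    ((h.osc (hθ r)).integrable_mul_hat g).1
  refine (hasDerivAt_integral_of_dominated_loc_of_deriv_le (s := Set.Ioi 0)
    (F' := fun r ξ => Complex.I * θ' r ξ * (Complex.exp (Complex.I * θ r ξ) * φ ξ * hat g ξ))
    (bound := fun ξ => C * ‖φ ξ * hat g ξ‖) (Ioi_mem_nhds hs) ?_
    ((h.osc (hθ s)).integrable_mul_hat g) ?_ (ae_of_all _ fun ξ r hr => ?_)
    ((h.integrable_mul_hat g).norm.const_mul C) (ae_of_all _ fun ξ r hr => ?_)).2
  · exact Eventually.of_forall hm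
  · exact AEStronglyMeasurable.mul (by fun_prop) (hm s)
  · rw [norm_mul, norm_mul, Complex.norm_I, one_mul, Complex.norm_real, Real.norm_eq_abs,
      mul_assoc (Complex.exp _), norm_mul (Complex.exp _), norm_cexp_I_mul, one_mul]
    by_cases hξ : ‖ξ‖ ≤ R
    · exact mul_le_mul_of_nonneg_right (hC r ξ hξ) (norm_nonneg _)
    · rw [h.supp ξ (not_le.1 hξ)]; simp
  · have h1 := ((((hd r hr ξ).ofReal_comp).const_mul Complex.I).cexp.mul_const
      (φ ξ)).mul_const (hat g ξ)
    refine h1.congr_deriv ?_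
    ring

lemma continuousWithinAt_osc_pair (h : IsTest R φ) {θ : ℝ → Plane → ℝ} {s : ℝ} {S : Set ℝ}
    (hθ : ∀ r, Measurable (θ r))
    (hc : ∀ ξ, Continuous fun r => θ r ξ) (g : L2) :
    ContinuousWithinAt (fun r => ∫ ξ, Complex.exp (Complex.I * θ r ξ) * φ ξ * hat g ξ) S s := by
  refine tendsto_integral_filter_of_dominated_convergence (fun ξ => ‖φ ξ * hat g ξ‖) ?_ ?_
    (h.integrable_mul_hat g).norm (ae_of_all _ fun ξ => ?_)
  · exact Eventually.of_forall fun r => ((h.osc (hθ r)).integrable_mul_hat g).1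
  · refine Eventually.of_forall fun r => ae_of_all _ fun ξ => ?_
    rw [mul_assoc, norm_mul (Complex.exp _), norm_cexp_I_mul, one_mul]
  · have h1 := hc ξ
    have : Continuous fun r => Complex.exp (Complex.I * θ r ξ) * φ ξ * hat g ξ := by fun_prop
    exact this.continuousWithinAt

end

/-- The transform of the time derivative of a solution. -/
lemma hat_deriv {n lam a : ℝ} {v v' : L2} {G : Plane → ℂ} (hn : 1 ≤ n)
    (hfin : sobolevNorm n v < ⊤)
    (heq : -(Complex.I • v') + japD v = (lam : ℂ) • hartree v)
    (hG : Continuous G) (hb : ∀ ξ, ‖G ξ‖ ≤ a * jb ξ ^ (-10 : ℝ)) (hv : hat v =ᵐ[volume] G) :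
    hat v' =ᵐ[volume] fun ξ => Complex.I * (lam * hsym G ξ - jb ξ * G ξ) := by
  have hJ : hat (japD v) =ᵐ[volume] fun ξ => (jb ξ : ℂ) * hat v ξ := by
    refine hat_fourierMul ?_
    obtain ⟨hm, -⟩ := weight_hat_of_sobolev ENNReal.toReal_nonneg
      (ENNReal.ofReal_toReal hfin.ne).ge
    refine hm.of_le ((Complex.continuous_ofReal.comp continuous_jb).aestronglyMeasurable.mul
      (aestronglyMeasurable_hat v)) (ae_of_all _ fun ξ => ?_)
    rw [norm_mul, norm_mul, Complex.norm_real, Complex.norm_real,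
      Real.norm_of_nonneg (jb_pos ξ).le, Real.norm_of_nonneg (jb_rpow_pos _ _).le]
    refine mul_le_mul_of_nonneg_right ?_ (norm_nonneg _)
    calc jb ξ = jb ξ ^ (1 : ℝ) := (Real.rpow_one _).symm
      _ ≤ _ := jb_rpow_mono hn ξ
  have e : v' = Complex.I • ((lam : ℂ) • hartree v - japD v) := by
    rw [← heq, add_sub_cancel_right, smul_neg, smul_smul, Complex.I_mul_I, neg_smul, one_smul,
      neg_neg]
  rw [e]
  filter_upwards [hat_smul Complex.I ((lam : ℂ) • hartree v - japD v),
    hat_sub ((lam : ℂ) • hartree v) (japD v), hat_smul lam (hartree v), hJ,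
    hat_hartree hG hb hv, hv] with ξ h1 h2 h3 h4 h5 h6
  rw [h1, h2, h3, h4, h5, h6]

/-! ### Evolution of the corrected profile -/

/-- The total phase carried by the corrected profile. -/
noncomputable def totalPhase (n T lam : ℝ) (ρ : Plane → ℝ) (F : ℝ → Plane → ℂ) (t : ℝ)
    (ξ : Plane) : ℝ := t * jb ξ - Profiles.corrPhase n T lam ρ F t ξ

namespace Profiles

variable {n T a lam κ R C : ℝ} {u : ℝ → L2} {F : ℝ → Plane → ℂ} {ρ : Plane → ℝ} {φ : Plane → ℂ}

lemma measurable_totalPhase (hn : 1000 ≤ n) (hT : 0 ≤ T) (h : Profiles n T a u F)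
    (hρ : Continuous ρ) (t : ℝ) : Measurable (totalPhase n T lam ρ F t) :=
  (continuous_jb.measurable.const_mul t).sub (h.measurable_corrPhase hn hT hρ t)

lemma continuous_totalPhase (hn : 1000 ≤ n) (hT : 0 ≤ T) (h : Profiles n T a u F)
    (hρ : Continuous ρ) (hκ : ∀ x, |ρ x| ≤ κ) (ξ : Plane) :
    Continuous fun r => totalPhase n T lam ρ F r ξ :=
  (continuous_id.mul continuous_const).sub (h.continuous_corrPhase hn hT hρ hκ ξ)

lemma hasDerivAt_totalPhase (hn : 1000 ≤ n) (hT : 0 ≤ T) (h : Profiles n T a u F)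
    (hρ : Continuous ρ) (hκ : ∀ x, |ρ x| ≤ κ) {s : ℝ} (hs : 0 < s) (ξ : Plane) :
    HasDerivAt (fun r => totalPhase n T lam ρ F r ξ) (jb ξ - lam * amp n T ρ F s ξ) s := by
  have h1 := (hasDerivAt_id s).mul_const (jb ξ)
  rw [one_mul] at h1
  exact h1.sub (h.hasDerivAt_corrPhase hn hT hρ hκ hs ξ)

lemma profile_eq (h : Profiles n T a u F) {t : ℝ} (ht : t ∈ Set.Icc 0 T) (ξ : Plane) :
    profile n lam ρ u t ξ =
      Complex.exp (Complex.I * totalPhase n T lam ρ F t ξ) * hat (u t) ξ := by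
  rw [profile, h.phase_eq ht, ← Complex.exp_add, totalPhase]
  congr 2
  push_cast; ring

/-- The pairing of the corrected profile with a test function. -/
noncomputable def weak (n T lam : ℝ) (ρ : Plane → ℝ) (F : ℝ → Plane → ℂ) (φ : Plane → ℂ)
    (r : ℝ) (g : L2) : ℂ :=
  ∫ ξ, Complex.exp (Complex.I * totalPhase n T lam ρ F r ξ) * φ ξ * hat g ξ

lemma integrable_test_weight (k : ℝ) (hk : k ≤ 0) (hφ : IsTest R φ) :
    Integrable fun ξ => ‖φ ξ‖ * jb ξ ^ k :=
  hφ.integrable.norm.mono (hφ.integrable.norm.1.mul (continuous_jb_rpow k).aestronglyMeasurable)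
    (ae_of_all _ fun ξ => by
      rw [norm_mul, Real.norm_of_nonneg (jb_rpow_pos k ξ).le]
      exact mul_le_of_le_one_right (norm_nonneg _)
        (Real.rpow_le_one_of_one_le_of_nonpos (one_le_jb ξ) hk))

lemma abs_phaseDeriv_le (hn : 1000 ≤ n) (hT : 0 ≤ T) (h : Profiles n T a u F)
    (hκ : ∀ x, |ρ x| ≤ κ) (r : ℝ) {ξ : Plane} (hξ : ‖ξ‖ ≤ R) :
    |jb ξ - lam * amp n T ρ F r ξ| ≤ 1 + R + |lam| * (velConst 1 * a ^ 2 * κ) := by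
  refine (abs_sub _ _).trans (add_le_add ?_ ?_)
  · rw [abs_of_pos (jb_pos ξ)]; exact (jb_le_one_add ξ).trans (by linarith)
  · rw [abs_mul]
    exact mul_le_mul_of_nonneg_left (h.abs_amp_le hn hT hκ r ξ) (abs_nonneg _)

lemma hasDerivWithinAt_weak (hn : 1000 ≤ n) (hT : 0 ≤ T) (h : Profiles n T a u F)
    (hρ : Continuous ρ) (hκ : ∀ x, |ρ x| ≤ κ) (hφ : IsTest R φ) {s : ℝ} (hs0 : 0 < s) {u' : L2}
    (hu : HasDerivWithinAt u u' (Set.Icc 0 T) s) :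
    HasDerivWithinAt (fun r => weak n T lam ρ F φ r (u r))
      ((∫ ξ, Complex.I * ((jb ξ - lam * amp n T ρ F s ξ : ℝ) : ℂ) *
        (Complex.exp (Complex.I * totalPhase n T lam ρ F s ξ) * φ ξ * hat (u s) ξ)) +
      ∫ ξ, Complex.exp (Complex.I * totalPhase n T lam ρ F s ξ) * φ ξ * hat u' ξ)
      (Set.Icc 0 T) s := by
  have hmeas := fun t => h.measurable_totalPhase (lam := lam) hn hT hρ t
  have hamp : Measurable fun ξ => amp n T ρ F s ξ :=
    (h.measurable_amp hn hT hρ).of_uncurry_left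
  have hd1 := hasDerivAt_osc_pair hφ (θ' := fun r ξ => jb ξ - lam * amp n T ρ F r ξ)
    hs0 hmeas (continuous_jb.measurable.sub (hamp.const_mul lam))
    (fun r hr ξ => h.hasDerivAt_totalPhase hn hT hρ hκ hr ξ)
    (fun r ξ hξ => h.abs_phaseDeriv_le hn hT hκ r hξ) (u s)
  have hc1 := continuousWithinAt_osc_pair hφ (s := s) (S := Set.Icc 0 T) hmeas
    (fun ξ => h.continuous_totalPhase hn hT hρ hκ ξ) u'
  exact hasDerivWithinAt_pairing (ℓ := fun r => (hφ.osc (hmeas r)).pair.restrictScalars ℝ)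
    (fun r g => hφ.norm_osc_pair_le (hmeas r) g) hu hd1.hasDerivWithinAt hc1

/-- The term ⟨ξ⟩û of the equation cancels against the derivative of e^{it⟨ξ⟩}, and the derivative of
e^{-iB} subtracts the resonant part. What remains is iλ times the error estimated by `hres`. -/
lemma exists_deriv_weak (hn : 1000 ≤ n) (hT : 0 ≤ T) (h : Profiles n T a u F)
    (hρ : Continuous ρ) (hκ : ∀ x, |ρ x| ≤ κ) (hφ : IsTest R φ)
    (hfin : ∀ t ∈ Set.Icc (0 : ℝ) T, sobolevNorm n (u t) < ⊤) (hsol : SolvesHartree lam T u)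
    (hres : ∀ t a F, 0 < t → Prof n t a F → ∀ ξ,
      jb ξ ^ (n / 100) * ‖Complex.exp (Complex.I * t * jb ξ) * hsym (modul t F) ξ -
        ((coul F ξ * (ρ (t ^ (-(2 / n)) • ξ) / bracket t) : ℝ) : ℂ) * F ξ‖ ≤
      C * a ^ 3 * (1 + t) ^ (-(101 / 100) : ℝ)) {s : ℝ} (hs0 : 0 < s) (hsT : s ≤ T) :
    ∃ d, HasDerivWithinAt (fun r => weak n T lam ρ F φ r (u r)) d (Set.Icc 0 T) s ∧
      ‖d‖ ≤ |lam| * C * a ^ 3 * (∫ ξ, ‖φ ξ‖ * jb ξ ^ (-(n / 100))) *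
        (1 + s) ^ (-(101 / 100) : ℝ) := by
  have hs : s ∈ Set.Icc 0 T := ⟨hs0.le, hsT⟩
  obtain ⟨u', hu, heq⟩ := hsol s hs
  have hmeas := h.measurable_totalPhase (lam := lam) hn hT hρ s
  have hP := h.prof s hs
  have hhat := hat_deriv (by linarith) (hfin s hs) heq (continuous_modul hP.cont s)
    (hP.mbd10 hn) (h.eq s hs)
  have hamp : Measurable fun ξ => amp n T ρ F s ξ :=
    (h.measurable_amp hn hT hρ).of_uncurry_left
  have hjm := continuous_jb.measurable
  refine ⟨_, h.hasDerivWithinAt_weak hn hT hρ hκ hφ hs0 hu, ?_⟩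
  set E : Plane → ℂ := fun ξ => Complex.exp (Complex.I * totalPhase n T lam ρ F s ξ) with hE
  have hEt : IsTest R fun ξ => E ξ * φ ξ := hφ.osc hmeas
  have e1 : (∫ ξ, Complex.I * ((jb ξ - lam * amp n T ρ F s ξ : ℝ) : ℂ) *
        (E ξ * φ ξ * hat (u s) ξ)) + ∫ ξ, E ξ * φ ξ * hat u' ξ =
      ∫ ξ, (Complex.I * ((jb ξ - lam * amp n T ρ F s ξ : ℝ) : ℂ) *
        (E ξ * φ ξ * hat (u s) ξ) + E ξ * φ ξ * hat u' ξ) := by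
    refine (integral_add ?_ (hEt.integrable_mul_hat u')).symm
    refine ((hEt.integrable_mul_hat (u s)).norm.const_mul
      (1 + R + |lam| * (velConst 1 * a ^ 2 * κ))).mono' ?_ (ae_of_all _ fun ξ => ?_)
    · exact AEStronglyMeasurable.mul (by fun_prop) (hEt.integrable_mul_hat (u s)).1
    · rw [norm_mul, norm_mul, Complex.norm_I, one_mul, Complex.norm_real, Real.norm_eq_abs]
      by_cases hξ : ‖ξ‖ ≤ R
      · refine mul_le_mul_of_nonneg_right ?_ (norm_nonneg _)
        exact h.abs_phaseDeriv_le hn hT hκ s hξ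
      · rw [hφ.supp ξ (not_le.1 hξ)]; simp
  rw [e1]
  have hwi := integrable_test_weight (-(n / 100)) (by linarith) hφ
  calc _ ≤ ∫ ξ, |lam| * C * a ^ 3 * (1 + s) ^ (-(101 / 100) : ℝ) *
        (‖φ ξ‖ * jb ξ ^ (-(n / 100))) := by
        refine norm_integral_le_of_norm_le (hwi.const_mul _) ?_
        filter_upwards [hhat, h.eq s hs] with ξ h1 h2
        have h3 := hres s a (F s) hs0 hP ξ
        rw [← amp_of_mem hs ξ] at h3
        rw [h1, h2]
        -- Factoring out e^{is⟨ξ⟩} turns the estimate for the profile into one for û itself.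
        have e2 : Complex.exp (Complex.I * s * jb ξ) * hsym (modul s (F s)) ξ -
            (amp n T ρ F s ξ : ℂ) * F s ξ = Complex.exp (Complex.I * s * jb ξ) *
              (hsym (modul s (F s)) ξ - (amp n T ρ F s ξ : ℂ) * modul s (F s) ξ) := by
          rw [modul, mul_sub, mul_left_comm (Complex.exp _) _ (_ * _), ← mul_assoc (Complex.exp _) _
            (F s ξ), ← Complex.exp_add, add_neg_cancel, Complex.exp_zero, one_mul]
        rw [e2, norm_mul, norm_cexp_I_mul_mul, one_mul] at h3
        have e3 : Complex.I * ((jb ξ - lam * amp n T ρ F s ξ : ℝ) : ℂ) *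
            (E ξ * φ ξ * modul s (F s) ξ) + E ξ * φ ξ *
              (Complex.I * (lam * hsym (modul s (F s)) ξ - jb ξ * modul s (F s) ξ)) =
            E ξ * (Complex.I * (lam * (φ ξ *
              (hsym (modul s (F s)) ξ - (amp n T ρ F s ξ : ℂ) * modul s (F s) ξ)))) := by
          push_cast; ring
        rw [e3, hE, norm_mul, norm_cexp_I_mul, one_mul, norm_mul, Complex.norm_I, one_mul, norm_mul,
          Complex.norm_real, Real.norm_eq_abs, norm_mul, Real.rpow_neg (jb_pos ξ).le]
        have hj := jb_rpow_pos (n / 100) ξ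
        have h4 : ‖hsym (modul s (F s)) ξ - (amp n T ρ F s ξ : ℂ) * modul s (F s) ξ‖ ≤
            (C * a ^ 3 * (1 + s) ^ (-(101 / 100) : ℝ)) * (jb ξ ^ (n / 100))⁻¹ := by
          rw [← div_eq_mul_inv, le_div_iff₀ hj]; linarith
        calc _ ≤ |lam| * (‖φ ξ‖ *
              ((C * a ^ 3 * (1 + s) ^ (-(101 / 100) : ℝ)) * (jb ξ ^ (n / 100))⁻¹)) := by
              gcongr
          _ = _ := by ring
    _ = _ := by rw [integral_const_mul]; ring

lemma continuousOn_weak (hn : 1000 ≤ n) (hT : 0 ≤ T) (h : Profiles n T a u F)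
    (hρ : Continuous ρ) (hκ : ∀ x, |ρ x| ≤ κ) (hφ : IsTest R φ) :
    ContinuousOn (fun r => weak n T lam ρ F φ r (u r)) (Set.Icc 0 T) := by
  intro s hs
  have hmeas := fun t => h.measurable_totalPhase (lam := lam) hn hT hρ t
  exact continuousWithinAt_pairing (fun r g => hφ.norm_osc_pair_le (hmeas r) g) (h.cont s hs)
    (continuousWithinAt_osc_pair hφ hmeas
      (fun ξ => h.continuous_totalPhase hn hT hρ hκ ξ) (u s))

end Profiles

/-- Comparison with an explicit primitive of M(1+s)^{-101/100}; the factor 100 is the reciprocal of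
the exponent 1/100 gained by integration. -/
lemma norm_sub_le_of_deriv_decay {f : ℝ → ℂ} {T M t₁ t₂ : ℝ}
    (hc : ContinuousOn f (Set.Icc 0 T)) (hM : 0 ≤ M)
    (hd : ∀ s, 0 < s → s ≤ T → ∃ d, HasDerivWithinAt f d (Set.Icc 0 T) s ∧
      ‖d‖ ≤ M * (1 + s) ^ (-(101 / 100) : ℝ)) (h0 : 0 ≤ t₁) (h12 : t₁ ≤ t₂) (h2 : t₂ ≤ T) :
    ‖f t₂ - f t₁‖ ≤ 100 * M * (1 + t₁) ^ (-(1 / 100) : ℝ) := by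
  have pos : ∀ t₁, 0 < t₁ → t₁ ≤ t₂ → ‖f t₂ - f t₁‖ ≤ 100 * M * (1 + t₁) ^ (-(1 / 100) : ℝ) := by
    intro t₁ h0 h12
    have hex : ∀ s : ℝ, ∃ d, 0 < s → s ≤ T → HasDerivWithinAt f d (Set.Icc 0 T) s ∧
        ‖d‖ ≤ M * (1 + s) ^ (-(101 / 100) : ℝ) := fun s => by
      by_cases hs : 0 < s ∧ s ≤ T
      · obtain ⟨d, hd⟩ := hd s hs.1 hs.2
        exact ⟨d, fun _ _ => hd⟩
      · exact ⟨0, fun h h' => absurd ⟨h, h'⟩ hs⟩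
    choose f' hf' using hex
    have hB : ∀ r : ℝ, 0 < r → HasDerivAt (fun r : ℝ => 100 * M * ((1 + t₁) ^ (-(1 / 100) : ℝ) -
        (1 + r) ^ (-(1 / 100) : ℝ))) (M * (1 + r) ^ (-(101 / 100) : ℝ)) r := fun r hr => by
      have h1 := (((hasDerivAt_id r).const_add 1).rpow_const (p := (-(1 / 100) : ℝ))
        (Or.inl (by simp only [id]; linarith))).const_sub ((1 + t₁) ^ (-(1 / 100) : ℝ))
      refine (h1.const_mul (100 * M)).congr_deriv ?_
      norm_num
      ring
    have hBc : ContinuousOn (fun r : ℝ => 100 * M * ((1 + t₁) ^ (-(1 / 100) : ℝ) -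
        (1 + r) ^ (-(1 / 100) : ℝ))) (Set.Icc t₁ t₂) := fun r hr =>
      (hB r (h0.trans_le hr.1)).continuousAt.continuousWithinAt
    have := image_norm_le_of_norm_deriv_right_le_deriv_boundary' (f := fun r => f r - f t₁)
      (f' := f') (a := t₁) (b := t₂)
      ((hc.mono (Set.Icc_subset_Icc h0.le h2)).sub continuousOn_const) (fun x hx => by
        have h1 := (hf' x (h0.trans_le hx.1) (hx.2.le.trans h2)).1
        exact (h1.mono_of_mem_nhdsWithin (Icc_mem_nhdsGE_of_mem
          ⟨h0.le.trans hx.1, hx.2.trans_le h2⟩)).sub_const _)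
      (by simp) hBc (fun x hx => (hB x (h0.trans_le hx.1)).hasDerivWithinAt)
      (fun x hx => (hf' x (h0.trans_le hx.1) (hx.2.le.trans h2)).2)
      (Set.right_mem_Icc.2 h12)
    refine this.trans (mul_le_mul_of_nonneg_left ?_ (by positivity))
    have : 0 ≤ (1 + t₂) ^ (-(1 / 100) : ℝ) := Real.rpow_nonneg (by linarith) _
    linarith
  -- To include t₁ = 0, where no derivative is available, the bound for positive times is passed to
  -- the limit from the right.
  rcases h12.eq_or_lt with rfl | hlt
  · rw [sub_self, norm_zero]
    have : 0 ≤ (1 + t₁) ^ (-(1 / 100) : ℝ) := Real.rpow_nonneg (by linarith) _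
    positivity
  have hcw : ContinuousWithinAt f (Set.Ioo t₁ t₂) t₁ :=
    (hc t₁ ⟨h0, h12.trans h2⟩).mono fun x hx => ⟨h0.trans hx.1.le, hx.2.le.trans h2⟩
  have : (𝓝[Set.Ioo t₁ t₂] t₁).NeBot := by
    rw [← mem_closure_iff_nhdsWithin_neBot, closure_Ioo hlt.ne]
    exact Set.left_mem_Icc.2 h12
  have hr : ContinuousAt (fun t : ℝ => 100 * M * (1 + t) ^ (-(1 / 100) : ℝ)) t₁ :=
    continuousAt_const.mul ((continuousAt_const.add continuousAt_id).rpow_const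
      (Or.inl (by change 1 + t₁ ≠ 0; linarith)))
  refine le_of_tendsto_of_tendsto (hcw.tendsto.const_sub (f t₂)).norm
    (hr.tendsto.mono_left nhdsWithin_le_nhds) ?_
  filter_upwards [self_mem_nhdsWithin] with x hx
  exact pos x (h0.trans_lt hx.1) hx.2.le

/-! ### Pointwise bounds by duality -/

/-- The test function is the conjugate sign of D on the part of a ball where the bound fails.
Duality then forces the integral of the strictly positive excess over that set to vanish, so the set
is null. -/
lemma ae_norm_le_of_dual {D : Plane → ℂ} {M k : ℝ} (hM : 0 ≤ M) (hk : k ≤ 0) (hD : MemLp D 2)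
    (hdual : ∀ R φ, IsTest R φ → ‖∫ ξ, φ ξ * D ξ‖ ≤ M * ∫ ξ, ‖φ ξ‖ * jb ξ ^ k) :
    ∀ᵐ ξ, ‖D ξ‖ ≤ M * jb ξ ^ k := by
  set G := hD.1.mk D with hG
  have hGD : D =ᵐ[volume] G := hD.1.ae_eq_mk
  have hGm : Measurable G := hD.1.stronglyMeasurable_mk.measurable
  have hjm : Measurable fun ξ : Plane => M * jb ξ ^ k :=
    (continuous_jb_rpow k).measurable.const_mul M
  have hnull : ∀ N : ℕ, ∀ᵐ ξ, ‖ξ‖ ≤ N → ‖G ξ‖ ≤ M * jb ξ ^ k := by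
    intro N
    set S : Set Plane := {ξ | M * jb ξ ^ k < ‖G ξ‖} ∩ Metric.closedBall 0 N with hS
    have hSm : MeasurableSet S :=
      (measurableSet_lt hjm hGm.norm).inter measurableSet_closedBall
    set φ : Plane → ℂ := S.indicator fun ξ => star (G ξ) * ((‖G ξ‖⁻¹ : ℝ) : ℂ) with hφd
    have hG0 : ∀ ξ ∈ S, 0 < ‖G ξ‖ := fun ξ hξ =>
      (mul_nonneg hM (jb_rpow_pos k ξ).le).trans_lt hξ.1
    have hφn : ∀ ξ, ‖φ ξ‖ ≤ S.indicator (fun _ => (1 : ℝ)) ξ := fun ξ => by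
      rw [hφd, norm_indicator_eq_indicator_norm]
      refine Set.indicator_le_indicator ?_
      rw [norm_mul, norm_star, Complex.norm_real, norm_inv, norm_norm]
      exact mul_inv_le_one
    have hφ : IsTest N φ := by
      refine ⟨Measurable.indicator ?_ hSm, fun ξ => (hφn ξ).trans ?_, fun ξ hξ => ?_⟩
      · exact (continuous_star.measurable.comp hGm).mul
          (Complex.measurable_ofReal.comp hGm.norm.inv)
      · exact Set.indicator_le_self' (fun _ _ => zero_le_one) ξ
      · exact Set.indicator_of_notMem (fun hm => by
          have := hm.2; rw [mem_closedBall_zero_iff] at this; linarith) _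
    have hφG : ∀ ξ, φ ξ * G ξ = ((S.indicator (fun ξ => ‖G ξ‖) ξ : ℝ) : ℂ) := fun ξ => by
      by_cases hξ : ξ ∈ S
      · rw [hφd, Set.indicator_of_mem hξ, Set.indicator_of_mem hξ, mul_right_comm,
          show star (G ξ) * G ξ = ((‖G ξ‖ ^ 2 : ℝ) : ℂ) from by
            push_cast; exact Complex.conj_mul' _, ← Complex.ofReal_mul]
        have h0 := (hG0 ξ hξ).ne'
        congr 1; field_simp
      · rw [hφd, Set.indicator_of_notMem hξ, Set.indicator_of_notMem hξ, zero_mul,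
          Complex.ofReal_zero]
    have hd := hdual N φ hφ
    have e1 : ∫ ξ, φ ξ * D ξ = ((∫ ξ, S.indicator (fun ξ => ‖G ξ‖) ξ : ℝ) : ℂ) := by
      rw [← integral_complex_ofReal]
      refine integral_congr_ae ?_
      filter_upwards [hGD] with ξ hξ
      rw [hξ]; exact hφG ξ
    have hfin : volume S ≠ ⊤ :=
      ((measure_mono Set.inter_subset_right).trans_lt measure_closedBall_lt_top).ne
    have i1 : Integrable (S.indicator fun ξ => ‖G ξ‖) := by
      have h1 : Integrable fun ξ => φ ξ * D ξ := (hφ.memLp 2).integrable_mul hD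
      refine h1.norm.congr ?_
      filter_upwards [hGD] with ξ hξ
      rw [hξ, hφG, Complex.norm_real, Real.norm_of_nonneg]
      exact Set.indicator_nonneg (fun _ _ => norm_nonneg _) _
    have i2 : Integrable fun ξ => ‖φ ξ‖ * jb ξ ^ k := Profiles.integrable_test_weight k hk hφ
    have hlt : ∀ ξ ∈ S, M * (‖φ ξ‖ * jb ξ ^ k) < S.indicator (fun ξ => ‖G ξ‖) ξ := by
      intro ξ hξ
      rw [hφd, Set.indicator_of_mem hξ, Set.indicator_of_mem hξ, norm_mul, norm_star,
        Complex.norm_real, norm_inv, norm_norm, mul_inv_cancel₀ (hG0 ξ hξ).ne', one_mul]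
      exact hξ.1
    have hle : ∀ ξ, 0 ≤ S.indicator (fun ξ => ‖G ξ‖) ξ - M * (‖φ ξ‖ * jb ξ ^ k) := by
      intro ξ
      by_cases hξ : ξ ∈ S
      · exact sub_nonneg.2 (hlt ξ hξ).le
      · rw [hφd, Set.indicator_of_notMem hξ, Set.indicator_of_notMem hξ]; simp
    rw [e1, Complex.norm_real, Real.norm_of_nonneg (integral_nonneg fun ξ =>
      Set.indicator_nonneg (fun _ _ => norm_nonneg _) _), ← integral_const_mul] at hd
    have i3 := i1.sub (i2.const_mul M)
    have h0 : ∫ ξ, (S.indicator (fun ξ => ‖G ξ‖) ξ - M * (‖φ ξ‖ * jb ξ ^ k)) = 0 := by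
      refine le_antisymm ?_ (integral_nonneg hle)
      rw [integral_sub i1 (i2.const_mul M)]; linarith
    have hz := (integral_eq_zero_iff_of_nonneg (hle) i3).1 h0
    filter_upwards [hz] with ξ hξ hN
    by_contra hcon
    have hS' : ξ ∈ S := ⟨not_le.1 hcon, by simpa using hN⟩
    have h1 := hlt ξ hS'
    simp only [Pi.zero_apply] at hξ
    linarith
  filter_upwards [hGD, ae_all_iff.2 hnull] with ξ h1 h2
  obtain ⟨N, hN⟩ := exists_nat_ge ‖ξ‖
  rw [h1]; exact h2 N hN

lemma memLp_osc_hat {θ : Plane → ℝ} (hθ : Measurable θ) (g : L2) :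
    MemLp (fun ξ => Complex.exp (Complex.I * θ ξ) * hat g ξ) 2 :=
  (memLp_hat g).of_le (AEStronglyMeasurable.mul (by fun_prop) (aestronglyMeasurable_hat g))
    (ae_of_all _ fun ξ => by rw [norm_mul, norm_cexp_I_mul, one_mul])

/-- The bound on the pairings is linear in the weighted L¹ norm of the test function, with constants
independent of its support radius, which is the form that duality converts into a weighted sup
bound. -/
lemma Profiles.profile_sub_le {n T a lam C t₁ t₂ : ℝ} {u : ℝ → L2} {F : ℝ → Plane → ℂ}
    {ρ : Plane → ℝ} (hn : 1000 ≤ n) (h : Profiles n T a u F) (hρ : IsBump ρ) (ha : 0 ≤ a)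
    (hC : 0 ≤ C)
    (hfin : ∀ t ∈ Set.Icc (0 : ℝ) T, sobolevNorm n (u t) < ⊤) (hsol : SolvesHartree lam T u)
    (hres : ∀ t a F, 0 < t → Prof n t a F → ∀ ξ,
      jb ξ ^ (n / 100) * ‖Complex.exp (Complex.I * t * jb ξ) * hsym (modul t F) ξ -
        ((coul F ξ * (ρ (t ^ (-(2 / n)) • ξ) / bracket t) : ℝ) : ℂ) * F ξ‖ ≤
      C * a ^ 3 * (1 + t) ^ (-(101 / 100) : ℝ))
    (h0 : 0 ≤ t₁) (h12 : t₁ ≤ t₂) (h2 : t₂ ≤ T) :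
    ∀ᵐ ξ, ‖profile n lam ρ u t₂ ξ - profile n lam ρ u t₁ ξ‖ ≤
      100 * (|lam| * C * a ^ 3) * (1 + t₁) ^ (-(1 / 100) : ℝ) * jb ξ ^ (-(n / 100)) := by
  obtain ⟨κ, -, hκ, -, -⟩ := hρ.exists_bound
  have hT : 0 ≤ T := h0.trans (h12.trans h2)
  have hρc := hρ.smooth.continuous
  have hmeas := fun t => h.measurable_totalPhase (lam := lam) hn hT hρc t
  have m1 : t₁ ∈ Set.Icc 0 T := ⟨h0, h12.trans h2⟩
  have m2 : t₂ ∈ Set.Icc 0 T := ⟨h0.trans h12, h2⟩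
  simp_rw [h.profile_eq m1, h.profile_eq m2]
  have p1 := memLp_osc_hat (hmeas t₁) (u t₁)
  have p2 := memLp_osc_hat (hmeas t₂) (u t₂)
  have hr : 0 ≤ (1 + t₁) ^ (-(1 / 100) : ℝ) := Real.rpow_nonneg (by linarith) _
  refine ae_norm_le_of_dual (by positivity) (by linarith) (p2.sub p1) fun R φ hφ => ?_
  have hw := norm_sub_le_of_deriv_decay (h.continuousOn_weak (lam := lam) hn hT hρc hκ hφ)
    (M := |lam| * C * a ^ 3 * (∫ ξ, ‖φ ξ‖ * jb ξ ^ (-(n / 100))))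
    (mul_nonneg (by positivity) (integral_nonneg fun ξ =>
      mul_nonneg (norm_nonneg _) (jb_rpow_pos _ ξ).le))
    (fun s hs hs' => h.exists_deriv_weak hn hT hρc hκ hφ hfin hsol hres hs hs') h0 h12 h2
  have e : ∫ ξ, φ ξ * (Complex.exp (Complex.I * totalPhase n T lam ρ F t₂ ξ) * hat (u t₂) ξ -
      Complex.exp (Complex.I * totalPhase n T lam ρ F t₁ ξ) * hat (u t₁) ξ) =
      Profiles.weak n T lam ρ F φ t₂ (u t₂) - Profiles.weak n T lam ρ F φ t₁ (u t₁) := by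
    rw [Profiles.weak, Profiles.weak, ← integral_sub ((hφ.osc (hmeas t₂)).integrable_mul_hat _)
      ((hφ.osc (hmeas t₁)).integrable_mul_hat _)]
    refine integral_congr_ae (ae_of_all _ fun ξ => ?_)
    beta_reduce; ring
  rw [e]
  exact hw.trans (le_of_eq (by ring))

/-! ### The rate of convergence and the conclusion. -/

lemma one_add_rpow_le {t : ℝ} (ht : 0 ≤ t) :
    (1 + t) ^ (-(1 / 100) : ℝ) ≤ bracket t ^ (-(1 / 100) : ℝ) :=
  Real.rpow_le_rpow_of_nonpos (bracket_pos t) (bracket_le_one_add ht) (by norm_num)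

lemma weightedSup_le {k c : ℝ} {f : Plane → ℂ} (h : ∀ᵐ ξ, ‖f ξ‖ ≤ c * jb ξ ^ (-k)) :
    weightedSup k f ≤ ENNReal.ofReal c := by
  rw [weightedSup, eLpNorm_exponent_top]
  refine eLpNormEssSup_le_of_ae_bound ?_
  filter_upwards [h] with ξ hξ
  have hj := jb_rpow_pos k ξ
  rw [norm_mul, Complex.norm_real, Real.norm_of_nonneg hj.le]
  rw [Real.rpow_neg (jb_pos ξ).le, ← div_eq_mul_inv, le_div_iff₀ hj] at hξ
  linarith

/-- Convergence rate of the corrected profile of a solution obeying the a priori bound. -/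
theorem exists_profile_rate {n : ℝ} (hn : 1000 ≤ n) {ρ : Plane → ℝ} (hρ : IsBump ρ) (lam : ℝ)
    {A : ℝ} (hA : 0 < A) :
    ∃ C : ℝ, 0 < C ∧ ∀ (T ε : ℝ) (u : ℝ → L2), 0 < ε → APriori n lam A ε T u →
      ∀ t₁ t₂ : ℝ, 0 ≤ t₁ → t₁ ≤ t₂ → t₂ ≤ T →
        weightedSup (n / 100) (fun ξ => profile n lam ρ u t₂ ξ - profile n lam ρ u t₁ ξ) ≤
          ENNReal.ofReal (C * ε ^ 3 * bracket t₁ ^ (-(1 / 100) : ℝ)) := by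
  obtain ⟨C, hC, hres⟩ := Prof.resonance hn hρ
  have hp : 0 < profConst := one_pos.trans_le one_le_profConst
  -- The profiles have size a = `profConst` · A ε, whose cube supplies ε³. The added 1 keeps the
  -- constant positive even if λ = 0.
  refine ⟨100 * (|lam| * C * (profConst * A) ^ 3) + 1, by positivity,
    fun T ε u hε hu t₁ t₂ h0 h12 h2 => ?_⟩
  have hex : ∀ t : ℝ, ∃ F, t ∈ Set.Icc 0 T → Prof n t (profConst * (A * ε)) F ∧
      hat (u t) =ᵐ[volume] modul t F := fun t => by
    by_cases ht : t ∈ Set.Icc 0 T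
    · obtain ⟨F, hF⟩ := hu.prof hn (mul_pos hA hε) ht
      exact ⟨F, fun _ => hF⟩
    · exact ⟨0, fun h => absurd h ht⟩
  choose F hF using hex
  have h : Profiles n T (profConst * (A * ε)) u F :=
    ⟨fun t ht => (hF t ht).1, fun t ht => (hF t ht).2, fun t ht =>
      (hu.solves t ht).choose_spec.1.continuousWithinAt⟩
  refine weightedSup_le ?_
  filter_upwards [h.profile_sub_le hn hρ (by positivity) hC hu.continuous.1 hu.solves hres h0 h12
    h2] with ξ hξ
  refine hξ.trans (mul_le_mul_of_nonneg_right ?_ (jb_rpow_pos _ ξ).le)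
  have hr : 0 ≤ (1 + t₁) ^ (-(1 / 100) : ℝ) := Real.rpow_nonneg (by linarith) _
  refine mul_le_mul ?_ (one_add_rpow_le h0) hr (by positivity)
  have : 0 ≤ ε ^ 3 := by positivity
  calc _ = 100 * (|lam| * C * (profConst * A) ^ 3) * ε ^ 3 := by ring
    _ ≤ _ := by nlinarith

/-- The phase B is real, so both exponentials have modulus one. This turns the rate for the
corrected profile into control of the scattering norm. -/
lemma weightedSup_profile (n lam : ℝ) (ρ : Plane → ℝ) (u : ℝ → L2) (t k : ℝ) :
    weightedSup k (profile n lam ρ u t) = normS k (u t) := by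
  refine eLpNorm_congr_norm_ae (ae_of_all _ fun ξ => ?_)
  rw [norm_mul, norm_mul, profile, norm_mul, norm_mul, norm_cexp_I_mul_mul, mul_one,
    show -(Complex.I * (phase n lam ρ u t ξ : ℂ)) =
      Complex.I * ((-phase n lam ρ u t ξ : ℝ) : ℂ) by push_cast; ring, norm_cexp_I_mul, one_mul]

lemma weightedSup_sub_comm (k : ℝ) (f g : Plane → ℂ) :
    weightedSup k (fun ξ => f ξ - g ξ) = weightedSup k (fun ξ => g ξ - f ξ) := by
  refine eLpNorm_congr_norm_ae (ae_of_all _ fun ξ => ?_)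
  rw [norm_mul, norm_mul, norm_sub_rev]

lemma weightedSup_le_add (k : ℝ) (f g : Plane → ℂ) :
    weightedSup k f ≤ weightedSup k g + weightedSup k (fun ξ => f ξ - g ξ) := by
  simp only [weightedSup, eLpNorm_exponent_top]
  refine le_trans (le_of_eq ?_) eLpNormEssSup_add_le
  congr 1
  ext ξ
  simp only [Pi.add_apply]
  ring

end SemiRelHartree

theorem proposition4p1 (n : ℝ) (hn : 1000 ≤ n) :
    ∃ δ : ℝ, 0 < δ ∧ δ ≤ 1 / 100 ∧
      ∀ (ρ : SemiRelHartree.Plane → ℝ), SemiRelHartree.IsBump ρ → ∀ (lam A : ℝ), 0 < A →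
        ∃ C : ℝ, 0 < C ∧
          (∀ (T ε₁ : ℝ) (u : ℝ → SemiRelHartree.L2), 0 < T → 0 < ε₁ →
            SemiRelHartree.APriori n lam A ε₁ T u →
              (∀ t₁ t₂ : ℝ, 0 ≤ t₁ → t₁ ≤ t₂ → t₂ ≤ T →
                SemiRelHartree.weightedSup (n / 100)
                    (fun ξ => SemiRelHartree.profile n lam ρ u t₂ ξ -
                      SemiRelHartree.profile n lam ρ u t₁ ξ) ≤
                  ENNReal.ofReal (C * ε₁ ^ 3 * SemiRelHartree.bracket t₁ ^ (-δ))) ∧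
              (∀ t ∈ Set.Icc (0 : ℝ) T,
                SemiRelHartree.normS (n / 100) (u t) ≤
                  SemiRelHartree.normS (n / 100) (u 0) + ENNReal.ofReal (C * ε₁ ^ 3))) ∧
          (∀ (ε₁ : ℝ) (u : ℝ → SemiRelHartree.L2), 0 < ε₁ →
            (∀ T : ℝ, 0 < T → SemiRelHartree.APriori n lam A ε₁ T u) →
              ∀ η : ℝ, 0 < η → ∃ t₀ : ℝ, 0 ≤ t₀ ∧ ∀ t₁ t₂ : ℝ, t₀ ≤ t₁ → t₀ ≤ t₂ →
                SemiRelHartree.weightedSup (n / 100)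
                    (fun ξ => SemiRelHartree.profile n lam ρ u t₂ ξ -
                      SemiRelHartree.profile n lam ρ u t₁ ξ) ≤ ENNReal.ofReal η) := by
  refine ⟨1 / 100, by norm_num, le_rfl, fun ρ hρ lam A hA => ?_⟩
  obtain ⟨C, hC, hrate⟩ := SemiRelHartree.exists_profile_rate hn hρ lam hA
  refine ⟨C, hC, fun T ε u hT hε hu => ⟨fun t₁ t₂ => hrate T ε u hε hu t₁ t₂, fun t ht => ?_⟩,
    fun ε u hε hu η hη => ?_⟩
  -- The rate is used from time 0, where ⟨0⟩ = 1.
  · have h1 := hrate T ε u hε hu 0 t le_rfl ht.1 ht.2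
    rw [show SemiRelHartree.bracket 0 = 1 by simp [SemiRelHartree.bracket], Real.one_rpow,
      mul_one] at h1
    rw [← SemiRelHartree.weightedSup_profile n lam ρ u t,
      ← SemiRelHartree.weightedSup_profile n lam ρ u 0]
    exact (SemiRelHartree.weightedSup_le_add _ _ _).trans (by gcongr)
  · have hlim : Tendsto (fun t => C * ε ^ 3 * SemiRelHartree.bracket t ^ (-(1 / 100) : ℝ)) atTop
        (𝓝 0) := by
      have hb : Tendsto SemiRelHartree.bracket atTop atTop :=
        tendsto_atTop_mono SemiRelHartree.le_bracket tendsto_id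
      simpa using ((tendsto_rpow_neg_atTop (by norm_num : (0 : ℝ) < 1 / 100)).comp hb).const_mul
        (C * ε ^ 3)
    obtain ⟨t₀, ht₀⟩ := eventually_atTop.1
      ((hlim.eventually (gt_mem_nhds hη)).and (eventually_ge_atTop 0))
    have key : ∀ t₁ t₂ : ℝ, t₀ ≤ t₁ → t₁ ≤ t₂ → SemiRelHartree.weightedSup (n / 100)
        (fun ξ => SemiRelHartree.profile n lam ρ u t₂ ξ -
          SemiRelHartree.profile n lam ρ u t₁ ξ) ≤ ENNReal.ofReal η := fun t₁ t₂ h1 h12 => by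
      obtain ⟨hlt, h0⟩ := ht₀ t₁ h1
      -- The interval [0, t₂ + 1] is taken so that its length is positive even when t₂ = 0.
      exact (hrate (t₂ + 1) ε u hε (hu _ (by linarith)) t₁ t₂ h0 h12 (by linarith)).trans
        (ENNReal.ofReal_le_ofReal hlt.le)
    refine ⟨t₀, (ht₀ t₀ le_rfl).2, fun t₁ t₂ h1 h2 => ?_⟩
    rcases le_total t₁ t₂ with h12 | h12
    · exact key t₁ t₂ h1 h12
    · rw [SemiRelHartree.weightedSup_sub_comm]
      exact key t₂ t₁ h2 h12
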